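/- **Conventions.** For a relation $U\subseteq X\times X$ containing the diagonal let $X^U$ be the simplicial set whose $n$-simplices are the tuples $(x_0,\dots,x_n)$ with $(x_i,x_j)\in U$ for all $i<j$, with the usual faces and degeneracies. For a metric space $X$ and a real number $r>0$ let $\mathcal U_r=\mathcal U_r^X$ be the semi-uniform structure on $X$ (a filter on $X\times X$) generated by the relations $U_{r+\varepsilon}=\{(x,y): d(x,y)<r+\varepsilon\}$, $\varepsilon>0$. For a module $G$ over a commutative ring $R$ put $H^n_{VR}(X,\mathcal U_r;G)=\varinjlim_{U\in\mathcal U_r}H^n(X^U;G)$ for $n\in\mathbb Z$ (zero for $n<0$), where $\mathcal U_r$ is ordered by reverse inclusion. We say that $\mathcal U_r^X$ has a base of finite type over $R$ if every $U\in\mathcal U_r^X$ contains some $V\in\mathcal U_r^X$ such that $H_n(X^{V};R)$ is a finitely generated $R$-module for every $n$. **Corollary (Künneth for metric spaces with the maximum metric).** Let $r>0$. Let $X$ and $Y$ be metric spaces, let $X\times Y$ carry the maximum metric, and let $G,G'$ be modules over a principal ideal domain $R$ with $\operatorname{Tor}_1^R(G,G')=0$. Suppose that $\mathcal U_r^X$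 and $\mathcal U_r^Y$ both have bases of finite type over $R$, or that $\mathcal U_r^Y$ has a base of finite type over $R$ and $G'$ is finitely generated. Then for every $q\in\mathbb Z$ there is a short exact sequence of $R$-modules $$0\to\bigoplus_{i+j=q}H^i_{VR}(X,\mathcal U_r;G)\otimes_R H^j_{VR}(Y,\mathcal U_r;G')\to H^q_{VR}(X\times Y,\mathcal U_r;G\otimes_R G')\to\bigoplus_{i+j=q+1}\operatorname{Tor}_1^R\bigl(H^i_{VR}(X,\mathcal U_r;G),H^j_{VR}(Y,\mathcal U_r;G')\bigr)\to0$$ whose first map is the cross product, induced by $(f\times g)\bigl((x_0,y_0),\dots,(x_n,y_n)\bigr)=f(x_0,\dots,x_i)\otimes g(y_i,\dots,y_n)$ for $n=i+j$, and this sequence splits. The splitting is not canonical: for $R=G=G'=\mathbb Z$ and every $r>0$ it is impossible to choose, for all metric spaces $X,Y$ whose structures $\mathcal U_r$ have bases of finite type over $\mathbb Z$ and all $q$, left inverses of the cross product maps that are natural with respect to non-expansive maps $X'\to X$ and $Y'\to Y$. -/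

import Mathlib

open scoped TensorProduct DirectSum

universe u

/-! ## Semi-uniform spaces -/

/-- A semi-uniform structure on a set `X`: a filter on `X × X` each of whose members contains the
diagonal, and which contains `U⁻¹` together with `U`. -/
structure SemiUniformity (X : Type*) where
  filter : Filter (X × X)
  diag : ∀ U ∈ filter, ∀ x : X, (x, x) ∈ U
  inv : ∀ U ∈ filter, {p : X × X | (p.2, p.1) ∈ U} ∈ filter

/-- The relation `U_q = {(x, y) | d(x, y) < q}` of a metric space. -/
def metricRel (X : Type*) [MetricSpace X] (q : ℝ) : Set (X × X) := {p | dist p.1 p.2 < q}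

/-- For `r > 0`, the semi-uniform structure `𝒰_r` of a metric space generated by the sets
`U_{r+ε}`, `ε > 0`. These sets are nested, so the sets of `𝒰_r` are those that contain one of
them. -/
def metricSemiUniformity (X : Type*) [MetricSpace X] (r : ℝ) (hr : 0 < r) : SemiUniformity X where
  filter :=
    { sets := {U | ∃ ε : ℝ, 0 < ε ∧ metricRel X (r + ε) ⊆ U}
      univ_sets := ⟨1, one_pos, Set.subset_univ _⟩
      sets_of_superset := fun ⟨ε, hε, h⟩ hUV => ⟨ε, hε, h.trans hUV⟩
      inter_sets := by
        rintro U V ⟨ε, hε, hU⟩ ⟨δ, hδ, hV⟩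
        refine ⟨min ε δ, lt_min hε hδ, fun p hp => ⟨hU ?_, hV ?_⟩⟩
        · exact lt_of_lt_of_le (show dist p.1 p.2 < _ from hp) (by gcongr; exact min_le_left _ _)
        · exact lt_of_lt_of_le (show dist p.1 p.2 < _ from hp) (by gcongr; exact min_le_right _ _) }
  diag := by
    rintro U ⟨ε, hε, hU⟩ x
    refine hU ?_
    show dist x x < r + ε
    rw [dist_self]
    linarith
  inv := by
    rintro U ⟨ε, hε, hU⟩
    refine ⟨ε, hε, fun p hp => hU ?_⟩
    show dist p.2 p.1 < r + ε
    rw [dist_comm]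
    exact hp

namespace VR

/-! ## The Vietoris-Rips simplicial set of a relation -/

/-- The `n`-simplices of the simplicial set `X^U`: tuples `(x₀, …, xₙ)` with `(xᵢ, xⱼ) ∈ U` for all
`i < j` (the points need not be distinct). -/
def Simplex {X : Type*} (U : Set (X × X)) (n : ℕ) : Type _ :=
  {x : Fin (n + 1) → X // ∀ ⦃i j⦄, i < j → (x i, x j) ∈ U}

section Simplices

variable {X Y : Type*}

/-- The face map `∂ₖ`, which drops the `k`-th entry. -/
def face {U : Set (X × X)} {n : ℕ} (k : Fin (n + 2)) (σ : Simplex U (n + 1)) : Simplex U n :=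
  ⟨fun i => σ.1 (k.succAbove i),
    fun _ _ h => σ.2 (Fin.strictMono_succAbove k h)⟩

/-- A map `φ` with `(φ x, φ y) ∈ U` for all `(x, y) ∈ V` maps the simplices of `V` to
simplices of `U`. -/
def simplexMap {V : Set (Y × Y)} {U : Set (X × X)} (φ : Y → X)
    (h : ∀ p ∈ V, (φ p.1, φ p.2) ∈ U) {n : ℕ} (σ : Simplex V n) : Simplex U n :=
  ⟨fun i => φ (σ.1 i), fun _ _ hij => h _ (σ.2 hij)⟩

/-- The relation `U × V` on `X × Y`. -/
def prodRel (U : Set (X × X)) (V : Set (Y × Y)) : Set ((X × Y) × (X × Y)) :=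
  {p | (p.1.1, p.2.1) ∈ U ∧ (p.1.2, p.2.2) ∈ V}

/-- `((x₀, y₀), …, (xₙ, yₙ)) ↦ (x₀, …, xᵢ)`, where `n = i + j`. -/
def front {U : Set (X × X)} {V : Set (Y × Y)} {i j n : ℕ} (h : i + j = n)
    (σ : Simplex (prodRel U V) n) : Simplex U i :=
  ⟨fun k => (σ.1 ⟨k, by omega⟩).1, fun _ _ hkl => (σ.2 (by simpa using hkl)).1⟩

/-- `((x₀, y₀), …, (xₙ, yₙ)) ↦ (yᵢ, …, yₙ)`, where `n = i + j`. -/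
def back {U : Set (X × X)} {V : Set (Y × Y)} {i j n : ℕ} (h : i + j = n)
    (σ : Simplex (prodRel U V) n) : Simplex V j :=
  ⟨fun k => (σ.1 ⟨i + k, by omega⟩).2, fun _ _ hkl => (σ.2 (by simpa using hkl)).2⟩

end Simplices

/-! ## Homology with coefficients in the ring -/

section Homology

variable (R : Type*) [CommRing R] {X : Type*} (U : Set (X × X))

/-- The chains `C_n(X^U; R)`: the free `R`-module on the `n`-simplices. -/
def Chain (n : ℕ) : Type _ := Simplex U n →₀ R

noncomputable instance (n : ℕ) : AddCommGroup (Chain R U n) :=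
  inferInstanceAs (AddCommGroup (Simplex U n →₀ R))

noncomputable instance (n : ℕ) : Module R (Chain R U n) :=
  inferInstanceAs (Module R (Simplex U n →₀ R))

/-- The map of chains induced by the face map `∂ₖ`. -/
noncomputable def faceChain (n : ℕ) (k : Fin (n + 2)) : Chain R U (n + 1) →ₗ[R] Chain R U n :=
  Finsupp.lmapDomain (α := Simplex U (n + 1)) (α' := Simplex U n) R R (face k)

/-- The boundary `∑ₖ (-1)ᵏ ∂ₖ : C_{n+1}(X^U; R) → C_n(X^U; R)`. -/
noncomputable def boundary (n : ℕ) : Chain R U (n + 1) →ₗ[R] Chain R U n :=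
  ∑ k : Fin (n + 2), (-1 : R) ^ (k : ℕ) • faceChain R U n k

/-- The `n`-cycles; every `0`-chain is a cycle. -/
noncomputable def cycles : (n : ℕ) → Submodule R (Chain R U n)
  | 0 => ⊤
  | n + 1 => LinearMap.ker (boundary R U n)

/-- The homology module `H_n(X^U; R)`. -/
abbrev Homology (n : ℕ) : Type _ :=
  (cycles R U n) ⧸ (LinearMap.range (boundary R U n)).comap (cycles R U n).subtype

/-- `H_*(X^U; R)` is of finite type: finitely generated in every degree. -/
def FiniteType : Prop := ∀ n, Module.Finite R (Homology R U n)

end Homology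

/-- The semi-uniform structure has a base of relations `U` for which `H_*(X^U; R)` is of finite
type. -/
def HasFiniteTypeBase (R : Type*) [CommRing R] {X : Type*} (𝒰 : SemiUniformity X) : Prop :=
  ∀ U ∈ 𝒰.filter, ∃ V ∈ 𝒰.filter, V ⊆ U ∧ FiniteType R V

/-! ## Cohomology of the simplicial set of a relation -/

section Cohomology

variable (R : Type*) [CommRing R] {X Y Z : Type*}
variable (G : Type*) [AddCommGroup G] [Module R G]

/-- The cochains `C^n(X^U; G)`. A homomorphism to `G` from the free `R`-module
`C_n(X^U) ⊗ R` is the same as a function to `G` on the `n`-simplices. -/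
abbrev Cochain (U : Set (X × X)) (n : ℕ) : Type _ := Simplex U n → G

/-- The coboundary `(δ f)(σ) = ∑ₖ (-1)ᵏ f(∂ₖ σ)`. -/
def coboundary (U : Set (X × X)) (n : ℕ) : Cochain G U n →ₗ[R] Cochain G U (n + 1) where
  toFun f σ := ∑ k : Fin (n + 2), (-1 : R) ^ (k : ℕ) • f (face k σ)
  map_add' f g := by
    funext σ
    simp [Finset.sum_add_distrib]
  map_smul' a f := by
    funext σ
    simp only [Pi.smul_apply, RingHom.id_apply, Finset.smul_sum]
    exact Finset.sum_congr rfl fun k _ => smul_comm _ _ _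

/-- The image of the coboundary in degree `n`, which is `0` for `n = 0`. -/
def coboundaries (U : Set (X × X)) : (n : ℕ) → Submodule R (Cochain G U n)
  | 0 => ⊥
  | n + 1 => LinearMap.range (coboundary R G U n)

/-- The `n`-cocycles. -/
abbrev cocycles (U : Set (X × X)) (n : ℕ) : Submodule R (Cochain G U n) :=
  LinearMap.ker (coboundary R G U n)

/-- The cohomology module `H^n(X^U; G)`. -/
def Coh (U : Set (X × X)) (n : ℕ) : Type _ :=
  (cocycles R G U n) ⧸ (coboundaries R G U n).comap (cocycles R G U n).subtype

instance (U : Set (X × X)) (n : ℕ) : AddCommGroup (Coh R G U n) :=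
  inferInstanceAs (AddCommGroup
    ((cocycles R G U n) ⧸ (coboundaries R G U n).comap (cocycles R G U n).subtype))

instance (U : Set (X × X)) (n : ℕ) : Module R (Coh R G U n) :=
  inferInstanceAs (Module R
    ((cocycles R G U n) ⧸ (coboundaries R G U n).comap (cocycles R G U n).subtype))

/-- The class of a cocycle. -/
def Coh.mk (U : Set (X × X)) (n : ℕ) : cocycles R G U n →ₗ[R] Coh R G U n :=
  Submodule.mkQ ((coboundaries R G U n).comap (cocycles R G U n).subtype)

theorem Coh.mk_surjective (U : Set (X × X)) (n : ℕ) : Function.Surjective (Coh.mk R G U n) :=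
  Submodule.mkQ_surjective _

theorem Coh.mk_eq_zero (U : Set (X × X)) (n : ℕ) (f : cocycles R G U n) :
    Coh.mk R G U n f = 0 ↔ f.1 ∈ coboundaries R G U n :=
  Submodule.Quotient.mk_eq_zero ((coboundaries R G U n).comap (cocycles R G U n).subtype)

/-- Linear maps out of `H^n(X^U; G)`. -/
def Coh.lift {M : Type*} [AddCommGroup M] [Module R M] (U : Set (X × X)) (n : ℕ)
    (F : cocycles R G U n →ₗ[R] M)
    (hF : ∀ f : cocycles R G U n, f.1 ∈ coboundaries R G U n → F f = 0) : Coh R G U n →ₗ[R] M :=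
  Submodule.liftQ ((coboundaries R G U n).comap (cocycles R G U n).subtype) F hF

theorem Coh.lift_mk {M : Type*} [AddCommGroup M] [Module R M] (U : Set (X × X)) (n : ℕ)
    (F : cocycles R G U n →ₗ[R] M)
    (hF : ∀ f : cocycles R G U n, f.1 ∈ coboundaries R G U n → F f = 0)
    (f : cocycles R G U n) : Coh.lift R G U n F hF (Coh.mk R G U n f) = F f := rfl

/-- The cochain map induced by a simplicial map. -/
def cochainMap {V : Set (Y × Y)} {U : Set (X × X)} (φ : Y → X)
    (h : ∀ p ∈ V, (φ p.1, φ p.2) ∈ U) (n : ℕ) : Cochain G U n →ₗ[R] Cochain G V n where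
  toFun f σ := f (simplexMap φ h σ)
  map_add' _ _ := rfl
  map_smul' _ _ := rfl

variable {V : Set (Y × Y)} {U : Set (X × X)} (φ : Y → X) (h : ∀ p ∈ V, (φ p.1, φ p.2) ∈ U)

theorem coboundary_cochainMap (n : ℕ) (f : Cochain G U n) :
    coboundary R G V n (cochainMap R G φ h n f) =
      cochainMap R G φ h (n + 1) (coboundary R G U n f) := rfl

theorem cochainMap_mem_cocycles (n : ℕ) (f : Cochain G U n) (hf : f ∈ cocycles R G U n) :
    cochainMap R G φ h n f ∈ cocycles R G V n := by
  rw [LinearMap.mem_ker, coboundary_cochainMap, LinearMap.mem_ker.1 hf, map_zero]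

theorem cochainMap_mem_coboundaries (n : ℕ) (f : Cochain G U n)
    (hf : f ∈ coboundaries R G U n) : cochainMap R G φ h n f ∈ coboundaries R G V n := by
  cases n with
  | zero =>
    have h0 : f = 0 := hf
    subst h0
    exact Submodule.zero_mem _
  | succ n =>
    obtain ⟨g, rfl⟩ := hf
    exact ⟨cochainMap R G φ h n g, rfl⟩

/-- The map `H^n(X^U; G) → H^n(Y^V; G)` induced by a simplicial map `Y^V → X^U`. -/
def cohMap (n : ℕ) : Coh R G U n →ₗ[R] Coh R G V n :=
  Coh.lift R G U n
    (Coh.mk R G V n ∘ₗ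
      (cochainMap R G φ h n).restrict (fun f hf => cochainMap_mem_cocycles R G φ h n f hf))
    (fun f hf => (Coh.mk_eq_zero R G V n _).2 (cochainMap_mem_coboundaries R G φ h n f.1 hf))

theorem cohMap_mk (n : ℕ) (f : cocycles R G U n) :
    cohMap R G φ h n (Coh.mk R G U n f) =
      Coh.mk R G V n ⟨cochainMap R G φ h n f.1, cochainMap_mem_cocycles R G φ h n f.1 f.2⟩ := rfl

theorem cohMap_cohMap {W : Set (Z × Z)} (ψ : Z → Y) (k : ∀ p ∈ W, (ψ p.1, ψ p.2) ∈ V)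
    (l : ∀ p ∈ W, (φ (ψ p.1), φ (ψ p.2)) ∈ U) (n : ℕ) (x : Coh R G U n) :
    cohMap R G ψ k n (cohMap R G φ h n x) = cohMap R G (fun z => φ (ψ z)) l n x := by
  obtain ⟨f, rfl⟩ := Coh.mk_surjective _ _ _ _ x
  rfl

end Cohomology

/-! ## Vietoris-Rips cohomology of a semi-uniform space -/

/-- The members of a semi-uniform structure. -/
structure Entourage {X : Type*} (𝒰 : SemiUniformity X) where
  rel : Set (X × X)
  mem : rel ∈ 𝒰.filter

/-- The order by reverse inclusion: `U ≤ V` if and only if `V ⊆ U`. -/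
instance {X : Type*} (𝒰 : SemiUniformity X) : Preorder (Entourage 𝒰) where
  le U V := V.rel ⊆ U.rel
  le_refl U := subset_refl U.rel
  le_trans _ _ _ h k := k.trans h

instance {X : Type*} (𝒰 : SemiUniformity X) : Nonempty (Entourage 𝒰) :=
  ⟨⟨Set.univ, Filter.univ_mem⟩⟩

instance {X : Type*} (𝒰 : SemiUniformity X) : IsDirectedOrder (Entourage 𝒰) :=
  ⟨fun U V => ⟨⟨U.rel ∩ V.rel, Filter.inter_mem U.mem V.mem⟩,
    Set.inter_subset_left, Set.inter_subset_right⟩⟩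

noncomputable instance {X : Type*} (𝒰 : SemiUniformity X) : DecidableEq (Entourage 𝒰) :=
  Classical.decEq _

section Limit

variable (R : Type*) [CommRing R] {X Y : Type*}
variable (G : Type*) [AddCommGroup G] [Module R G]
variable (G' : Type*) [AddCommGroup G'] [Module R G']

/-- The restriction map `H^n(X^U; G) → H^n(X^V; G)` for `V ⊆ U`. -/
def restr (𝒰 : SemiUniformity X) (n : ℕ) (U V : Entourage 𝒰) (h : U ≤ V) :
    Coh R G U.rel n →ₗ[R] Coh R G V.rel n :=
  cohMap R G (fun x => x) (fun _ hp => h hp) n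

instance (𝒰 : SemiUniformity X) (n : ℕ) :
    DirectedSystem (fun U : Entourage 𝒰 => Coh R G U.rel n)
      (fun U V h => restr R G 𝒰 n U V h) where
  map_self U x := by
    obtain ⟨f, rfl⟩ := Coh.mk_surjective _ _ _ _ x
    rfl
  map_map U V W h k x := by
    obtain ⟨f, rfl⟩ := Coh.mk_surjective _ _ _ _ x
    rfl

/-- The Vietoris-Rips cohomology `H^n_VR(X, 𝒰; G) = colim H^n(X^U; G)` in degrees `n ≥ 0`. -/
abbrev LimCoh (𝒰 : SemiUniformity X) (n : ℕ) : Type _ :=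
  Module.DirectLimit (fun U : Entourage 𝒰 => Coh R G U.rel n) (restr R G 𝒰 n)

/-- A map `φ` for which the preimages of entourages are entourages induces a map in
Vietoris-Rips cohomology. -/
noncomputable def limCohMap (𝒰 : SemiUniformity X) (𝒱 : SemiUniformity Y) (φ : Y → X)
    (hφ : ∀ U ∈ 𝒰.filter, {p : Y × Y | (φ p.1, φ p.2) ∈ U} ∈ 𝒱.filter) (n : ℕ) :
    LimCoh R G 𝒰 n →ₗ[R] LimCoh R G 𝒱 n :=
  Module.DirectLimit.lift R _ _ _
    (fun U => Module.DirectLimit.of R (Entourage 𝒱) (fun V => Coh R G V.rel n) (restr R G 𝒱 n)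
        ⟨{p : Y × Y | (φ p.1, φ p.2) ∈ U.rel}, hφ U.rel U.mem⟩ ∘ₗ
      cohMap R G φ (fun _ hp => hp) n)
    (by
      intro U V hUV x
      have hle : (⟨{p : Y × Y | (φ p.1, φ p.2) ∈ U.rel}, hφ U.rel U.mem⟩ : Entourage 𝒱) ≤
          ⟨{p : Y × Y | (φ p.1, φ p.2) ∈ V.rel}, hφ V.rel V.mem⟩ := fun p hp =>
        hUV hp
      simp only [LinearMap.comp_apply]
      rw [← Module.DirectLimit.of_f (f := restr R G 𝒱 n) (hij := hle)]
      congr 1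
      obtain ⟨f, rfl⟩ := Coh.mk_surjective _ _ _ _ x
      rfl)

/-! ## The cross product -/

/-- The cross product of cochains,
`(f × g)((x₀, y₀), …, (xₙ, yₙ)) = f(x₀, …, xᵢ) ⊗ g(yᵢ, …, yₙ)`. -/
def crossCochain (U : Set (X × X)) (V : Set (Y × Y)) {i j n : ℕ} (h : i + j = n) :
    Cochain G U i →ₗ[R] Cochain G' V j →ₗ[R] Cochain (G ⊗[R] G') (prodRel U V) n :=
  LinearMap.mk₂ R (fun f g σ => f (front h σ) ⊗ₜ[R] g (back h σ))
    (fun _ _ _ => funext fun _ => TensorProduct.add_tmul _ _ _)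
    (fun _ _ _ => funext fun _ => TensorProduct.smul_tmul' _ _ _)
    (fun _ _ _ => funext fun _ => TensorProduct.tmul_add _ _ _)
    (fun _ _ _ => funext fun _ => TensorProduct.tmul_smul _ _ _)

/-- The Leibniz rule `δ(f × g) = δf × g + (-1)ⁱ f × δg`. -/
theorem coboundary_crossCochain (U : Set (X × X)) (V : Set (Y × Y)) {i j n : ℕ} (h : i + j = n)
    (f : Cochain G U i) (g : Cochain G' V j) :
    coboundary R (G ⊗[R] G') (prodRel U V) n (crossCochain R G G' U V h f g) =
      crossCochain R G G' U V (i := i + 1) (j := j) (n := n + 1) (by omega)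
          (coboundary R G U i f) g +
        (-1 : R) ^ i • crossCochain R G G' U V (i := i) (j := j + 1) (n := n + 1) (by omega) f
          (coboundary R G' V j g) := by
  subst h
  funext σ
  show ∑ k : Fin (i + j + 2), (-1 : R) ^ (k : ℕ) •
      (f (front rfl (face k σ)) ⊗ₜ[R] g (back rfl (face k σ))) =
    (∑ k : Fin (i + 2), (-1 : R) ^ (k : ℕ) • f (face k (front _ σ))) ⊗ₜ[R] g (back _ σ) +
      (-1 : R) ^ i • (f (front _ σ) ⊗ₜ[R]
        (∑ k : Fin (j + 2), (-1 : R) ^ (k : ℕ) • g (face k (back _ σ))))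
  have e : (i + 1) + (j + 1) = i + j + 2 := by omega
  rw [← (finCongr e).sum_comp, Fin.sum_univ_add, Fin.sum_univ_castSucc (n := i + 1),
    Fin.sum_univ_succ (n := j + 1), TensorProduct.add_tmul, TensorProduct.sum_tmul,
    TensorProduct.tmul_add, TensorProduct.tmul_sum, smul_add, Finset.smul_sum]
  have hA : ∀ k : Fin (i + 1),
      (-1 : R) ^ (finCongr e (Fin.castAdd (j + 1) k) : ℕ) •
        (f (front rfl (face (finCongr e (Fin.castAdd (j + 1) k)) σ)) ⊗ₜ[R]
          g (back rfl (face (finCongr e (Fin.castAdd (j + 1) k)) σ))) =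
      ((-1 : R) ^ (k.castSucc : ℕ) • f (face k.castSucc
        (front (i := i + 1) (j := j) (n := i + j + 1) (by omega) σ))) ⊗ₜ[R]
        g (back (i := i + 1) (j := j) (n := i + j + 1) (by omega) σ) := by
    intro k
    have h1 : front rfl (face (finCongr e (Fin.castAdd (j + 1) k)) σ) = face k.castSucc
        (front (i := i + 1) (j := j) (n := i + j + 1) (by omega) σ) := by
      refine Subtype.ext (funext fun m => congrArg (fun t => (σ.1 t).1) (Fin.ext ?_))
      simp only [Fin.succAbove, Fin.lt_def, finCongr_apply, Fin.val_cast, Fin.val_castAdd,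
        Fin.val_castSucc]
      split_ifs <;> simp
    have h2 : back rfl (face (finCongr e (Fin.castAdd (j + 1) k)) σ) =
        back (i := i + 1) (j := j) (n := i + j + 1) (by omega) σ := by
      refine Subtype.ext (funext fun m => congrArg (fun t => (σ.1 t).2) (Fin.ext ?_))
      simp only [Fin.succAbove, Fin.lt_def, finCongr_apply, Fin.val_cast, Fin.val_castAdd,
        Fin.val_castSucc]
      split_ifs <;> simp <;> omega
    rw [h1, h2, TensorProduct.smul_tmul']
    simp
  have hB : ∀ k : Fin (j + 1),
      (-1 : R) ^ (finCongr e (Fin.natAdd (i + 1) k) : ℕ) •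
        (f (front rfl (face (finCongr e (Fin.natAdd (i + 1) k)) σ)) ⊗ₜ[R]
          g (back rfl (face (finCongr e (Fin.natAdd (i + 1) k)) σ))) =
      (-1 : R) ^ i • (f (front (i := i) (j := j + 1) (n := i + j + 1) (by omega) σ) ⊗ₜ[R]
        ((-1 : R) ^ (k.succ : ℕ) • g (face k.succ
          (back (i := i) (j := j + 1) (n := i + j + 1) (by omega) σ)))) := by
    intro k
    have h1 : front rfl (face (finCongr e (Fin.natAdd (i + 1) k)) σ) =
        front (i := i) (j := j + 1) (n := i + j + 1) (by omega) σ := by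
      refine Subtype.ext (funext fun m => congrArg (fun t => (σ.1 t).1) (Fin.ext ?_))
      simp only [Fin.succAbove, Fin.lt_def, finCongr_apply, Fin.val_cast, Fin.val_natAdd,
        Fin.val_castSucc]
      split_ifs <;> simp <;> omega
    have h2 : back rfl (face (finCongr e (Fin.natAdd (i + 1) k)) σ) = face k.succ
        (back (i := i) (j := j + 1) (n := i + j + 1) (by omega) σ) := by
      refine Subtype.ext (funext fun m => congrArg (fun t => (σ.1 t).2) (Fin.ext ?_))
      simp only [Fin.succAbove, Fin.lt_def, finCongr_apply, Fin.val_cast, Fin.val_natAdd,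
        Fin.val_castSucc, Fin.val_succ]
      split_ifs <;> simp <;> omega
    rw [h1, h2, TensorProduct.tmul_smul, smul_smul, ← pow_add]
    congr 2
    simp
    omega
  have hC : face (Fin.last (i + 1))
        (front (i := i + 1) (j := j) (n := i + j + 1) (by omega) σ) =
      front (i := i) (j := j + 1) (n := i + j + 1) (by omega) σ := by
    refine Subtype.ext (funext fun m => congrArg (fun t => (σ.1 t).1) (Fin.ext ?_))
    simp
  have hD : face 0 (back (i := i) (j := j + 1) (n := i + j + 1) (by omega) σ) =
      back (i := i + 1) (j := j) (n := i + j + 1) (by omega) σ := by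
    refine Subtype.ext (funext fun m => congrArg (fun t => (σ.1 t).2) (Fin.ext ?_))
    simp
    omega
  rw [Finset.sum_congr rfl fun k _ => hA k, Finset.sum_congr rfl fun k _ => hB k, hC, hD]
  simp only [Fin.val_last, Fin.val_zero, pow_zero, one_smul, pow_succ, mul_neg, mul_one,
    neg_smul, TensorProduct.neg_tmul, TensorProduct.smul_tmul']
  abel

theorem crossCochain_mem_cocycles (U : Set (X × X)) (V : Set (Y × Y)) {i j n : ℕ}
    (h : i + j = n) (f : Cochain G U i) (g : Cochain G' V j) (hf : f ∈ cocycles R G U i)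
    (hg : g ∈ cocycles R G' V j) :
    crossCochain R G G' U V h f g ∈ cocycles R (G ⊗[R] G') (prodRel U V) n := by
  rw [LinearMap.mem_ker] at hf hg ⊢
  rw [coboundary_crossCochain, hf, hg, map_zero, LinearMap.zero_apply, map_zero, smul_zero,
    add_zero]

theorem crossCochain_mem_coboundaries_left (U : Set (X × X)) (V : Set (Y × Y)) {i j n : ℕ}
    (h : i + j = n) (f : Cochain G U i) (g : Cochain G' V j) (hf : f ∈ coboundaries R G U i)
    (hg : g ∈ cocycles R G' V j) :
    crossCochain R G G' U V h f g ∈ coboundaries R (G ⊗[R] G') (prodRel U V) n := by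
  cases i with
  | zero =>
    have h0 : f = 0 := hf
    rw [h0, map_zero, LinearMap.zero_apply]
    exact Submodule.zero_mem _
  | succ i =>
    obtain ⟨f, rfl⟩ := hf
    obtain ⟨n, rfl⟩ : ∃ m, n = m + 1 := ⟨i + j, by omega⟩
    refine ⟨crossCochain R G G' U V (by omega) f g, ?_⟩
    rw [coboundary_crossCochain, LinearMap.mem_ker.1 hg, map_zero, smul_zero, add_zero]

theorem crossCochain_mem_coboundaries_right (U : Set (X × X)) (V : Set (Y × Y)) {i j n : ℕ}
    (h : i + j = n) (f : Cochain G U i) (g : Cochain G' V j) (hf : f ∈ cocycles R G U i)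
    (hg : g ∈ coboundaries R G' V j) :
    crossCochain R G G' U V h f g ∈ coboundaries R (G ⊗[R] G') (prodRel U V) n := by
  cases j with
  | zero =>
    have h0 : g = 0 := hg
    rw [h0, map_zero]
    exact Submodule.zero_mem _
  | succ j =>
    obtain ⟨g, rfl⟩ := hg
    obtain ⟨n, rfl⟩ : ∃ m, n = m + 1 := ⟨i + j, by omega⟩
    refine ⟨(-1 : R) ^ i • crossCochain R G G' U V (by omega) f g, ?_⟩
    rw [map_smul, coboundary_crossCochain, LinearMap.mem_ker.1 hf, map_zero,
      LinearMap.zero_apply, zero_add, smul_smul, ← mul_pow]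
    simp

/-- The cross product `H^i(X^U; G) × H^j(Y^V; G') → H^n((X × Y)^{U × V}; G ⊗ G')`, `n = i + j`,
which sends the classes of `f` and `g` to the class of `f × g`. -/
def crossCoh (U : Set (X × X)) (V : Set (Y × Y)) {i j n : ℕ} (h : i + j = n) :
    Coh R G U i →ₗ[R] Coh R G' V j →ₗ[R] Coh R (G ⊗[R] G') (prodRel U V) n :=
  Coh.lift R G U i
    (LinearMap.flip (Coh.lift R G' V j
      (LinearMap.mk₂ R
        (fun (g : cocycles R G' V j) (f : cocycles R G U i) =>
          Coh.mk R (G ⊗[R] G') (prodRel U V) n ⟨crossCochain R G G' U V h f.1 g.1,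
            crossCochain_mem_cocycles R G G' U V h f.1 g.1 f.2 g.2⟩)
        (fun g₁ g₂ f => congrArg (Coh.mk R (G ⊗[R] G') (prodRel U V) n)
          (Subtype.ext (map_add (crossCochain R G G' U V h f.1) g₁.1 g₂.1)))
        (fun a g f => congrArg (Coh.mk R (G ⊗[R] G') (prodRel U V) n)
          (Subtype.ext (map_smul (crossCochain R G G' U V h f.1) a g.1)))
        (fun g f₁ f₂ => congrArg (Coh.mk R (G ⊗[R] G') (prodRel U V) n)
          (Subtype.ext (LinearMap.map_add₂ (crossCochain R G G' U V h) f₁.1 f₂.1 g.1)))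
        (fun a g f => congrArg (Coh.mk R (G ⊗[R] G') (prodRel U V) n)
          (Subtype.ext (LinearMap.map_smul₂ (crossCochain R G G' U V h) a f.1 g.1))))
      (fun g hg => LinearMap.ext fun f => (Coh.mk_eq_zero _ _ _ _ _).2
        (crossCochain_mem_coboundaries_right R G G' U V h f.1 g.1 f.2 hg))))
    (fun f hf => LinearMap.ext fun y => by
      obtain ⟨g, rfl⟩ := Coh.mk_surjective _ _ _ _ y
      exact (Coh.mk_eq_zero _ _ _ _ _).2
        (crossCochain_mem_coboundaries_left R G G' U V h f.1 g.1 hf g.2))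

theorem crossCoh_mk (U : Set (X × X)) (V : Set (Y × Y)) {i j n : ℕ} (h : i + j = n)
    (f : cocycles R G U i) (g : cocycles R G' V j) :
    crossCoh R G G' U V h (Coh.mk R G U i f) (Coh.mk R G' V j g) =
      Coh.mk R (G ⊗[R] G') (prodRel U V) n ⟨crossCochain R G G' U V h f.1 g.1,
        crossCochain_mem_cocycles R G G' U V h f.1 g.1 f.2 g.2⟩ := rfl

/-- The cross product on Vietoris-Rips cohomology, for a semi-uniform structure `𝒲` on `X × Y`
which contains all relations `U × V`. -/
noncomputable def crossLim (𝒰 : SemiUniformity X) (𝒱 : SemiUniformity Y)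
    (𝒲 : SemiUniformity (X × Y))
    (hW : ∀ U ∈ 𝒰.filter, ∀ V ∈ 𝒱.filter, prodRel U V ∈ 𝒲.filter) {i j n : ℕ} (h : i + j = n) :
    LimCoh R G 𝒰 i →ₗ[R] LimCoh R G' 𝒱 j →ₗ[R] LimCoh R (G ⊗[R] G') 𝒲 n :=
  Module.DirectLimit.lift R _ _ _
    (fun U => LinearMap.flip (Module.DirectLimit.lift R _ _ _
      (fun V => LinearMap.flip
        ((crossCoh R G G' U.rel V.rel h).compr₂
          (Module.DirectLimit.of R (Entourage 𝒲) (fun W => Coh R (G ⊗[R] G') W.rel n)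
            (restr R (G ⊗[R] G') 𝒲 n) ⟨prodRel U.rel V.rel, hW U.rel U.mem V.rel V.mem⟩)))
      (by
        intro V V' hV y
        ext x
        have hle : (⟨prodRel U.rel V.rel, hW U.rel U.mem V.rel V.mem⟩ : Entourage 𝒲) ≤
          ⟨prodRel U.rel V'.rel, hW U.rel U.mem V'.rel V'.mem⟩ := fun p hp => ⟨hp.1, hV hp.2⟩
        simp only [LinearMap.flip_apply, LinearMap.compr₂_apply]
        rw [← Module.DirectLimit.of_f (f := restr R (G ⊗[R] G') 𝒲 n) (hij := hle)]
        congr 1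
        obtain ⟨f, rfl⟩ := Coh.mk_surjective _ _ _ _ x
        obtain ⟨g, rfl⟩ := Coh.mk_surjective _ _ _ _ y
        rfl)))
    (by
      intro U U' hU x
      refine Module.DirectLimit.hom_ext fun V => LinearMap.ext fun y => ?_
      have hle : (⟨prodRel U.rel V.rel, hW U.rel U.mem V.rel V.mem⟩ : Entourage 𝒲) ≤
        ⟨prodRel U'.rel V.rel, hW U'.rel U'.mem V.rel V.mem⟩ := fun p hp => ⟨hU hp.1, hp.2⟩
      simp only [LinearMap.comp_apply, LinearMap.flip_apply, Module.DirectLimit.lift_of,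
        LinearMap.compr₂_apply]
      rw [← Module.DirectLimit.of_f (f := restr R (G ⊗[R] G') 𝒲 n) (hij := hle)]
      congr 1
      obtain ⟨f, rfl⟩ := Coh.mk_surjective _ _ _ _ x
      obtain ⟨g, rfl⟩ := Coh.mk_surjective _ _ _ _ y
      rfl)

end Limit

/-! ## All integral degrees, and the terms of the Künneth sequence -/

section Graded

variable (R : Type u) [CommRing R] {X Y X' Y' : Type u}
variable (G : Type u) [AddCommGroup G] [Module R G] (G' : Type u) [AddCommGroup G'] [Module R G']

/-- The Vietoris-Rips cohomology `H^n_VR(X, 𝒰; G)`, `n ∈ ℤ`; it is zero for `n < 0`. -/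
noncomputable def cohomology (𝒰 : SemiUniformity X) : ℤ → ModuleCat.{u} R
  | Int.ofNat n => ModuleCat.of R (LimCoh R G 𝒰 n)
  | Int.negSucc _ => ModuleCat.of R PUnit.{u + 1}

/-- The map in cohomology induced by a map `φ` for which the preimages of entourages are
entourages. -/
noncomputable def cohomologyMap (𝒰 : SemiUniformity X) (𝒱 : SemiUniformity X') (φ : X' → X)
    (hφ : ∀ U ∈ 𝒰.filter, {p : X' × X' | (φ p.1, φ p.2) ∈ U} ∈ 𝒱.filter) :
    (n : ℤ) → cohomology R G 𝒰 n →ₗ[R] cohomology R G 𝒱 n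
  | Int.ofNat n => limCohMap R G 𝒰 𝒱 φ hφ n
  | Int.negSucc _ => 0

/-- The cross product `H^i(X; G) × H^j(Y; G') → H^q(X × Y; G ⊗ G')`, `q = i + j`. -/
noncomputable def cohomologyCross (𝒰 : SemiUniformity X) (𝒱 : SemiUniformity Y)
    (𝒲 : SemiUniformity (X × Y))
    (hW : ∀ U ∈ 𝒰.filter, ∀ V ∈ 𝒱.filter, prodRel U V ∈ 𝒲.filter) :
    (i j q : ℤ) → i + j = q →
      (cohomology R G 𝒰 i →ₗ[R] cohomology R G' 𝒱 j →ₗ[R] cohomology R (G ⊗[R] G') 𝒲 q)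
  | Int.ofNat _, Int.ofNat _, Int.ofNat _, h => crossLim R G G' 𝒰 𝒱 𝒲 hW (Int.ofNat.inj h)
  | Int.ofNat _, Int.ofNat _, Int.negSucc _, _ => 0
  | Int.ofNat _, Int.negSucc _, _, _ => 0
  | Int.negSucc _, _, _, _ => 0

/-- `⨁_{i+j=q} H^i_VR(X; G) ⊗ H^j_VR(Y; G')`. -/
abbrev TensorTerm (𝒰 : SemiUniformity X) (𝒱 : SemiUniformity Y) (q : ℤ) : Type u :=
  ⨁ p : {p : ℤ × ℤ // p.1 + p.2 = q},
    (cohomology R G 𝒰 p.1.1 ⊗[R] cohomology R G' 𝒱 p.1.2)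

/-- `Tor_1(M, N)` over `R`. -/
noncomputable abbrev Tor₁ (M N : ModuleCat.{u} R) : ModuleCat.{u} R :=
  ((CategoryTheory.Tor (ModuleCat.{u} R) 1).obj M).obj N

/-- `⨁_{i+j=q+1} Tor_1(H^i_VR(X; G), H^j_VR(Y; G'))`. -/
abbrev TorTerm (𝒰 : SemiUniformity X) (𝒱 : SemiUniformity Y) (q : ℤ) : Type u :=
  ⨁ p : {p : ℤ × ℤ // p.1 + p.2 = q + 1},
    Tor₁ R (cohomology R G 𝒰 p.1.1) (cohomology R G' 𝒱 p.1.2)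

/-- The map `⨁_{i+j=q} H^i_VR(X; G) ⊗ H^j_VR(Y; G') → H^q_VR(X × Y; G ⊗ G')` given by the cross
product. -/
noncomputable def crossMap (𝒰 : SemiUniformity X) (𝒱 : SemiUniformity Y)
    (𝒲 : SemiUniformity (X × Y))
    (hW : ∀ U ∈ 𝒰.filter, ∀ V ∈ 𝒱.filter, prodRel U V ∈ 𝒲.filter) (q : ℤ) :
    TensorTerm R G G' 𝒰 𝒱 q →ₗ[R] cohomology R (G ⊗[R] G') 𝒲 q :=
  DirectSum.toModule R _ _ fun p =>
    TensorProduct.lift (cohomologyCross R G G' 𝒰 𝒱 𝒲 hW p.1.1 p.1.2 q p.2)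

/-- The map `⨁ (φ^* ⊗ ψ^*)`. -/
noncomputable def tensorTermMap (𝒰 : SemiUniformity X) (𝒰' : SemiUniformity X')
    (𝒱 : SemiUniformity Y) (𝒱' : SemiUniformity Y') (φ : X' → X)
    (hφ : ∀ U ∈ 𝒰.filter, {p : X' × X' | (φ p.1, φ p.2) ∈ U} ∈ 𝒰'.filter) (ψ : Y' → Y)
    (hψ : ∀ V ∈ 𝒱.filter, {p : Y' × Y' | (ψ p.1, ψ p.2) ∈ V} ∈ 𝒱'.filter) (q : ℤ) :
    TensorTerm R G G' 𝒰 𝒱 q →ₗ[R] TensorTerm R G G' 𝒰' 𝒱' q :=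
  DirectSum.lmap fun p => TensorProduct.map (cohomologyMap R G 𝒰 𝒰' φ hφ p.1.1)
    (cohomologyMap R G' 𝒱 𝒱' ψ hψ p.1.2)

end Graded

/-! ## Metric spaces -/

section Metric

variable {X Y X' Y' : Type*} [MetricSpace X] [MetricSpace Y] [MetricSpace X'] [MetricSpace Y']

/-- Mathlib's metric on `X × Y` is the maximum metric. -/
theorem dist_eq_max (p q : X × Y) : dist p q = max (dist p.1 q.1) (dist p.2 q.2) := rfl

theorem prodRel_mem (r : ℝ) (hr : 0 < r) (U : Set (X × X))
    (hU : U ∈ (metricSemiUniformity X r hr).filter) (V : Set (Y × Y))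
    (hV : V ∈ (metricSemiUniformity Y r hr).filter) :
    prodRel U V ∈ (metricSemiUniformity (X × Y) r hr).filter := by
  obtain ⟨ε, hε, hU⟩ := hU
  obtain ⟨δ, hδ, hV⟩ := hV
  refine ⟨min ε δ, lt_min hε hδ, fun p hp => ?_⟩
  have hp' : max (dist p.1.1 p.2.1) (dist p.1.2 p.2.2) < r + min ε δ := hp
  refine ⟨hU ?_, hV ?_⟩
  · show dist p.1.1 p.2.1 < r + ε
    linarith [le_max_left (dist p.1.1 p.2.1) (dist p.1.2 p.2.2), min_le_left ε δ]
  · show dist p.1.2 p.2.2 < r + δ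
    linarith [le_max_right (dist p.1.1 p.2.1) (dist p.1.2 p.2.2), min_le_right ε δ]

/-- The preimage of an entourage under a non-expansive map is an entourage. -/
theorem preimage_mem (r : ℝ) (hr : 0 < r) {φ : X' → X} (hφ : LipschitzWith 1 φ)
    (U : Set (X × X)) (hU : U ∈ (metricSemiUniformity X r hr).filter) :
    {p : X' × X' | (φ p.1, φ p.2) ∈ U} ∈ (metricSemiUniformity X' r hr).filter := by
  obtain ⟨ε, hε, hU⟩ := hU
  refine ⟨ε, hε, fun p hp => hU ?_⟩
  have h1 : dist (φ p.1) (φ p.2) ≤ dist p.1 p.2 := by simpa using hφ.dist_le_mul p.1 p.2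
  exact lt_of_le_of_lt h1 hp

theorem lipschitz_prodMap {φ : X' → X} (hφ : LipschitzWith 1 φ) {ψ : Y' → Y}
    (hψ : LipschitzWith 1 ψ) : LipschitzWith 1 (Prod.map φ ψ) := by
  refine LipschitzWith.of_dist_le_mul fun p q => ?_
  have h1 := hφ.dist_le_mul p.1 q.1
  have h2 := hψ.dist_le_mul p.2 q.2
  simp only [NNReal.coe_one, one_mul] at h1 h2 ⊢
  exact max_le_max h1 h2

end Metric

section MetricCohomology

variable (R : Type u) [CommRing R] (G : Type u) [AddCommGroup G] [Module R G]
variable (G' : Type u) [AddCommGroup G'] [Module R G'] (r : ℝ) (hr : 0 < r)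

/-- `H^n_VR(X, 𝒰_r; G)` for a metric space `X`. -/
noncomputable abbrev H (X : Type u) [MetricSpace X] (n : ℤ) : ModuleCat.{u} R :=
  cohomology R G (metricSemiUniformity X r hr) n

/-- The map `φ^*` induced by a non-expansive map. -/
noncomputable abbrev pullback {X X' : Type u} [MetricSpace X] [MetricSpace X'] {φ : X' → X}
    (hφ : LipschitzWith 1 φ) (n : ℤ) : H R G r hr X n →ₗ[R] H R G r hr X' n :=
  cohomologyMap R G _ _ φ (preimage_mem r hr hφ) n

/-- `⨁_{i+j=q} H^i_VR(X, 𝒰_r; G) ⊗ H^j_VR(Y, 𝒰_r; G')`. -/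
abbrev KunnethTensor (X Y : Type u) [MetricSpace X] [MetricSpace Y] (q : ℤ) : Type u :=
  TensorTerm R G G' (metricSemiUniformity X r hr) (metricSemiUniformity Y r hr) q

/-- `⨁_{i+j=q+1} Tor_1(H^i_VR(X, 𝒰_r; G), H^j_VR(Y, 𝒰_r; G'))`. -/
abbrev KunnethTor (X Y : Type u) [MetricSpace X] [MetricSpace Y] (q : ℤ) : Type u :=
  TorTerm R G G' (metricSemiUniformity X r hr) (metricSemiUniformity Y r hr) q

/-- The map from `⨁_{i+j=q} H^i_VR(X, 𝒰_r; G) ⊗ H^j_VR(Y, 𝒰_r; G')` to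
`H^q_VR(X × Y, 𝒰_r; G ⊗ G')` given by the cross product. -/
noncomputable abbrev kunnethCross (X Y : Type u) [MetricSpace X] [MetricSpace Y] (q : ℤ) :
    KunnethTensor R G G' r hr X Y q →ₗ[R] H R (G ⊗[R] G') r hr (X × Y) q :=
  crossMap R G G' _ _ _ (prodRel_mem r hr) q

/-- The map `⨁ (φ^* ⊗ ψ^*)` induced by non-expansive maps `φ` and `ψ`. -/
noncomputable abbrev pullbackTensor {X X' Y Y' : Type u} [MetricSpace X] [MetricSpace X']
    [MetricSpace Y] [MetricSpace Y'] {φ : X' → X} (hφ : LipschitzWith 1 φ) {ψ : Y' → Y}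
    (hψ : LipschitzWith 1 ψ) (q : ℤ) :
    KunnethTensor R G G' r hr X Y q →ₗ[R] KunnethTensor R G G' r hr X' Y' q :=
  tensorTermMap R G G' _ _ _ _ φ (preimage_mem r hr hφ) ψ (preimage_mem r hr hψ) q

/-- The Künneth sequences split naturally: for all metric spaces `X`, `Y` whose structures `𝒰_r`
have bases of finite type and all `q` there are left inverses of the cross product maps which
commute with the maps induced by non-expansive maps of `X` and `Y`. -/
def HasNaturalSplitting : Prop :=
  ∃ ρ : ∀ (X Y : Type u) [MetricSpace X] [MetricSpace Y],
      HasFiniteTypeBase R (metricSemiUniformity X r hr) →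
      HasFiniteTypeBase R (metricSemiUniformity Y r hr) → ∀ q : ℤ,
      (H R (G ⊗[R] G') r hr (X × Y) q →ₗ[R] KunnethTensor R G G' r hr X Y q),
    (∀ (X Y : Type u) [MetricSpace X] [MetricSpace Y]
      (hX : HasFiniteTypeBase R (metricSemiUniformity X r hr))
      (hY : HasFiniteTypeBase R (metricSemiUniformity Y r hr)) (q : ℤ),
      ρ X Y hX hY q ∘ₗ kunnethCross R G G' r hr X Y q = LinearMap.id) ∧
    (∀ (X X' Y Y' : Type u) [MetricSpace X] [MetricSpace X'] [MetricSpace Y] [MetricSpace Y']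
      (hX : HasFiniteTypeBase R (metricSemiUniformity X r hr))
      (hX' : HasFiniteTypeBase R (metricSemiUniformity X' r hr))
      (hY : HasFiniteTypeBase R (metricSemiUniformity Y r hr))
      (hY' : HasFiniteTypeBase R (metricSemiUniformity Y' r hr))
      (φ : X' → X) (hφ : LipschitzWith 1 φ) (ψ : Y' → Y) (hψ : LipschitzWith 1 ψ) (q : ℤ),
      ρ X' Y' hX' hY' q ∘ₗ pullback R (G ⊗[R] G') r hr (lipschitz_prodMap hφ hψ) q =
        pullbackTensor R G G' r hr hφ hψ q ∘ₗ ρ X Y hX hY q)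

end MetricCohomology

end VR

/-! ## Differential modules -/

/-! For a relation U containing the diagonal, take all chain modules of X^U together as one module
C(U) with a boundary and a sign involution. Dually, take the bounded cochains C^*(U; G), the direct
sum of the cochain modules in all degrees. Homological algebra is done with such ungraded
differential modules, and the grading is recovered at the end by projections.

The first step is that the cross product of cochains is a quasi-isomorphism for small enough
relations. It factors through the bounded cochains on C(U) ⊗ C(V). The second factor is the dual of
the Alexander-Whitney map. Acyclic models contract the mapping cone of that map
(`exists_awContraction`), so its dual is a quasi-isomorphism for all coefficients
(`quasiIso_alexanderWhitney_dual`). For the first factor, homology of finite type makes the identity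
of C(V) homotopic to a map of finite rank in each degree (`FiniteType.exists_homotopy_sum`). Up to
this homotopy a cochain on C(U) ⊗ C(V) is a finite sum of products, provided that the coefficients
G' can be separated on the side of U. This uses a homotopy of finite rank on C(U), or the fact that
tensoring with a finitely presented module commutes with products (`quasiIso_tensorCochainMap`,
`quasiIso_totCross`). In the maximum metric the products of entourages are cofinal, and homology
commutes with direct limits, so the cross product of the limit complexes is a quasi-isomorphism too
(`exists_isCrossQuasiIso`, `quasiIso_limCross`).

The second step is algebraic. Over a principal ideal domain a graded differential module receives a
quasi-isomorphism from the sum of two-term projective resolutions of its homology modules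
(`IsGradedDM.exists_resolution_quasiIso`). The tensor product of two of these maps is a
quasi-isomorphism although cochain modules need not be flat: Tor(G, G') = 0 means that for each
prime p one of G and G' has no p-torsion (`smul_eq_zero_or_of_isZero_tor`), hence at each maximal
ideal one of the two limit complexes becomes flat (`flat_localized_limTot_or`), and acyclicity is a
local property (`DQuasiIso.map`). If one of the two resolutions is then replaced by the homology H
that it resolves, there remains a direct sum of two-term complexes Hᵢ ⊗ ker ρⱼ → Hᵢ ⊗ Qⱼ, where ρⱼ
is the presentation of Kⱼ by Qⱼ. The cokernels are Hᵢ ⊗ Kⱼ, embedded by the cross product, and the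
kernels are Tor(Hᵢ, Kⱼ). This is the Künneth sequence together with a splitting
(`exists_homologyTensor_map`, `exists_bijective_coprod`), which depends on the chosen
quasi-isomorphisms.

Naturality fails for the projective plane P, realized as a finite metric space. Let f be an integral
lift of the nonzero class in H¹ modulo 2, so that δf = 2b, where b is the Bockstein. Then w = f × b
- b × f is a cocycle on P × P. Its pullback to S × P, for a square S that runs around an essential
loop of P on which b vanishes, is the product of f|S and b. A natural retraction would send this
pullback to f|S ⊗ b, which is nonzero modulo 2, and also into the image of H¹(P) ⊗ H²(P). Integral
cocycles of P vanish on the loop, because its double bounds, so this is impossible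
(`not_hasNaturalSplitting_of_bockstein`). -/

section DifferentialModules

variable {R : Type*} [CommRing R]
variable {M N M' N' K : Type*} [AddCommGroup M] [Module R M] [AddCommGroup N] [Module R N]
  [AddCommGroup M'] [Module R M'] [AddCommGroup N'] [Module R N'] [AddCommGroup K] [Module R K]

/-- Every cycle of the differential `d` is a boundary. -/
def IsAcyclic (d : M →ₗ[R] M) : Prop := ∀ x, d x = 0 → ∃ y, d y = x

/-- A map of differential modules which induces an isomorphism in homology. -/
structure DQuasiIso (dM : M →ₗ[R] M) (dN : N →ₗ[R] N) (f : M →ₗ[R] N) : Prop where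
  comm : ∀ x, f (dM x) = dN (f x)
  surj : ∀ y, dN y = 0 → ∃ x z, dM x = 0 ∧ y = f x + dN z
  inj : ∀ x z, dM x = 0 → f x = dN z → ∃ w, x = dM w

/-- The differential of the mapping cone. -/
def coneD (dM : M →ₗ[R] M) (dN : N →ₗ[R] N) (f : M →ₗ[R] N) : M × N →ₗ[R] M × N :=
  LinearMap.prod (-(dM ∘ₗ LinearMap.fst R M N)) (f ∘ₗ LinearMap.fst R M N + dN ∘ₗ LinearMap.snd R M N)

@[simp] theorem coneD_apply (dM : M →ₗ[R] M) (dN : N →ₗ[R] N) (f : M →ₗ[R] N) (x : M × N) :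
    coneD dM dN f x = (-dM x.1, f x.1 + dN x.2) := rfl

/-- In a cycle (x, y) of the mapping cone, x is a cycle whose image bounds. Injectivity in homology
makes x a boundary, and surjectivity deals with the cycle that is left in N. -/
theorem DQuasiIso.isAcyclic_coneD {dM : M →ₗ[R] M} {dN : N →ₗ[R] N} {f : M →ₗ[R] N}
    (h : DQuasiIso dM dN f) : IsAcyclic (coneD dM dN f) := by
  rintro ⟨x, y⟩ hxy
  simp only [coneD_apply, Prod.mk_eq_zero, neg_eq_zero] at hxy
  obtain ⟨w, rfl⟩ := h.inj x (-y) hxy.1 (by rw [map_neg]; exact eq_neg_of_add_eq_zero_left hxy.2)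
  obtain ⟨v, z, hv, hz⟩ := h.surj (f w + y) (by rw [map_add, ← h.comm]; exact hxy.2)
  refine ⟨(v - w, z), ?_⟩
  simp only [coneD_apply, map_sub, hv, Prod.mk.injEq]
  refine ⟨by simp, ?_⟩
  have : y = f v + dN z - f w := by rw [← hz]; abel
  rw [this]; abel

theorem DQuasiIso.of_isAcyclic {dM : M →ₗ[R] M} {dN : N →ₗ[R] N} {f : M →ₗ[R] N}
    (comm : ∀ x, f (dM x) = dN (f x)) (h : IsAcyclic (coneD dM dN f)) : DQuasiIso dM dN f where
  comm := comm
  surj y hy := by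
    obtain ⟨⟨x, z⟩, hxz⟩ := h (0, y) (by simp [hy])
    simp only [coneD_apply, Prod.mk.injEq, neg_eq_zero] at hxz
    exact ⟨x, z, hxz.1, hxz.2.symm⟩
  inj x z hx hz := by
    obtain ⟨⟨w, v⟩, hw⟩ := h (x, -z) (by simp [hx, hz])
    simp only [coneD_apply, Prod.mk.injEq] at hw
    exact ⟨-w, by rw [map_neg, hw.1]⟩

theorem IsAcyclic.congr {dM : M →ₗ[R] M} {dN : N →ₗ[R] N} (e : M ≃ₗ[R] N)
    (he : ∀ x, e (dM x) = dN (e x)) (h : IsAcyclic dM) : IsAcyclic dN := by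
  intro y hy
  obtain ⟨x, hx⟩ := h (e.symm y) (e.injective (by rw [he]; simp [hy]))
  exact ⟨e x, by rw [← he, hx]; simp⟩

theorem DQuasiIso.comp {dM : M →ₗ[R] M} {dN : N →ₗ[R] N} {dK : K →ₗ[R] K} {f : M →ₗ[R] N}
    {g : N →ₗ[R] K} (hg : DQuasiIso dN dK g) (hf : DQuasiIso dM dN f) :
    DQuasiIso dM dK (g ∘ₗ f) where
  comm x := by simp [hf.comm, hg.comm]
  surj y hy := by
    obtain ⟨x, z, hx, rfl⟩ := hg.surj y hy
    obtain ⟨x', z', hx', rfl⟩ := hf.surj x hx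
    exact ⟨x', g z' + z, hx', by simp [hg.comm, add_assoc]⟩
  inj x z hx hz := by
    obtain ⟨w, hw⟩ := hg.inj (f x) z (by rw [← hf.comm, hx, map_zero]) hz
    exact hf.inj x w hx hw

theorem DQuasiIso.congr {dM : M →ₗ[R] M} {dN : N →ₗ[R] N} {dM' : M' →ₗ[R] M'}
    {dN' : N' →ₗ[R] N'} {f : M →ₗ[R] N} {f' : M' →ₗ[R] N'} (e : M ≃ₗ[R] M') (e' : N ≃ₗ[R] N')
    (he : ∀ x, e (dM x) = dM' (e x)) (he' : ∀ x, e' (dN x) = dN' (e' x))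
    (hf : ∀ x, e' (f x) = f' (e x)) (h : DQuasiIso dM dN f) : DQuasiIso dM' dN' f' := by
  have key : ∀ x, f' x = e' (f (e.symm x)) := fun x => by rw [hf]; simp
  have hes : ∀ x, dM (e.symm x) = e.symm (dM' x) := fun x => e.injective (by rw [he]; simp)
  have hes' : ∀ x, dN (e'.symm x) = e'.symm (dN' x) := fun x => e'.injective (by rw [he']; simp)
  refine ⟨fun x => ?_, fun y hy => ?_, fun x z hx hz => ?_⟩
  · rw [key, key, ← he', ← h.comm, hes]
  · obtain ⟨x, z, hx, hz⟩ := h.surj (e'.symm y) (by rw [hes', hy, map_zero])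
    refine ⟨e x, e' z, by rw [← he, hx, map_zero], ?_⟩
    rw [← hf, ← he', ← map_add, ← hz]; simp
  · obtain ⟨w, hw⟩ := h.inj (e.symm x) (e'.symm z) (by rw [hes, hx, map_zero])
      (e'.injective (by rw [hf, he']; simpa using hz))
    exact ⟨e w, by rw [← he, ← hw]; simp⟩

/-- If `Z → N → B → 0` is exact with `Z → N` injective and `B` flat, then `X ⊗ Z → X ⊗ N` is
injective. -/
theorem lTensor_injective_of_flat_quotient {Z B : Type*} [AddCommGroup Z] [Module R Z]
    [AddCommGroup B] [Module R B] [Module.Flat R B] (X : Type*) [AddCommGroup X] [Module R X]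
    (i : Z →ₗ[R] N) (p : N →ₗ[R] B) (hi : Function.Injective i) (hip : Function.Exact i p)
    (hp : Function.Surjective p) : Function.Injective (i.lTensor X) := by
  -- present `X` as a quotient of a free module `F` with kernel `L`
  obtain ⟨F, _, _, _, q, hq⟩ : ∃ (F : Type _) (_ : AddCommGroup F) (_ : Module R F)
      (_ : Module.Flat R F) (q : F →ₗ[R] X), Function.Surjective q :=
    ⟨X →₀ R, inferInstance, inferInstance, inferInstance, Finsupp.linearCombination R id,
      Finsupp.linearCombination_surjective R Function.surjective_id⟩
  let L := LinearMap.ker q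
  have hLq : Function.Exact L.subtype q := fun x =>
    ⟨fun h => ⟨⟨x, h⟩, rfl⟩, by rintro ⟨y, rfl⟩; exact y.2⟩
  rw [injective_iff_map_eq_zero]
  intro x hx
  obtain ⟨a, rfl⟩ := LinearMap.rTensor_surjective Z hq x
  have e1 : q.rTensor N (i.lTensor F a) = 0 := by
    rw [← LinearMap.comp_apply, LinearMap.rTensor_comp_lTensor, ← LinearMap.lTensor_comp_rTensor]
    exact hx
  obtain ⟨b, hb⟩ := (rTensor_exact N hLq hq _).1 e1
  -- Flatness of B enters here: L ⊗ B embeds in F ⊗ B, where the image of b is that of i ⊗ a and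
  -- vanishes.
  have e2 : p.lTensor L b = 0 := by
    apply Module.Flat.rTensor_preserves_injective_linearMap (M := B) L.subtype
      Subtype.val_injective
    rw [map_zero, ← LinearMap.comp_apply, LinearMap.rTensor_comp_lTensor,
      ← LinearMap.lTensor_comp_rTensor, LinearMap.comp_apply, hb, ← LinearMap.comp_apply,
      ← LinearMap.lTensor_comp]
    have : p ∘ₗ i = 0 := LinearMap.ext fun z => hip.apply_apply_eq_zero z
    rw [this]; simp
  obtain ⟨c, hc⟩ := (lTensor_exact L hip hp _).1 e2
  -- Since F is flat, a itself comes from L ⊗ Z and therefore dies in X ⊗ Z.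
  have e3 : L.subtype.rTensor Z c = a := by
    apply Module.Flat.lTensor_preserves_injective_linearMap (M := F) i hi
    rw [← hb, ← hc, ← LinearMap.comp_apply, ← LinearMap.comp_apply,
      LinearMap.rTensor_comp_lTensor, LinearMap.lTensor_comp_rTensor]
  rw [← e3, ← LinearMap.comp_apply, ← LinearMap.rTensor_comp]
  have : q ∘ₗ L.subtype = 0 := LinearMap.ext fun z => hLq.apply_apply_eq_zero z
  rw [this]; simp

/-- Over a principal ideal domain flat means torsion-free, and this passes to submodules. -/
theorem flat_of_injective_of_isPrincipal [IsDomain R] [IsPrincipalIdealRing R] [Module.Flat R N]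
    (i : M →ₗ[R] N) (hi : Function.Injective i) : Module.Flat R M := by
  have h : Module.IsTorsionFree R N := inferInstance
  have : Module.IsTorsionFree R M := hi.moduleIsTorsionFree i (fun r x => map_smul i r x)
  infer_instance

/-- The tensor product of an acyclic differential module and a flat one over a principal ideal
domain is acyclic. -/
theorem IsAcyclic.tensor [IsDomain R] [IsPrincipalIdealRing R] [Module.Flat R N]
    {dM : M →ₗ[R] M} {dN s : N →ₗ[R] N} {t : M →ₗ[R] M} {c : R} (hM : IsAcyclic dM)
    (hMM : dM ∘ₗ dM = 0) (hs : s ∘ₗ s = LinearMap.id) (hsd : dN ∘ₗ s = c • (s ∘ₗ dN))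
    (hc : c * c = 1) (hNN : dN ∘ₗ dN = 0)
    (hD : (TensorProduct.map dM s + TensorProduct.map t dN) ∘ₗ
      (TensorProduct.map dM s + TensorProduct.map t dN) = 0) :
    IsAcyclic (TensorProduct.map dM s + TensorProduct.map t dN) := by
  set D := TensorProduct.map dM s + TensorProduct.map t dN with hDdef
  -- Split N into its cycles Z and boundaries B. Both are flat, so M ⊗ Z and M ⊗ B are acyclic under
  -- the differential of M, and M ⊗ Z embeds in M ⊗ N.
  let Z := LinearMap.ker dN
  let B := LinearMap.range dN
  have flatZ : Module.Flat R Z := flat_of_injective_of_isPrincipal Z.subtype Subtype.val_injective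
  have flatB : Module.Flat R B := flat_of_injective_of_isPrincipal B.subtype Subtype.val_injective
  let p : N →ₗ[R] B := dN.rangeRestrict
  have hp : Function.Surjective p := dN.surjective_rangeRestrict
  have hZp : Function.Exact Z.subtype p := by
    intro x
    constructor
    · intro h
      exact ⟨⟨x, congrArg Subtype.val h⟩, rfl⟩
    · rintro ⟨y, rfl⟩
      exact Subtype.ext y.2
  have hpd : p ∘ₗ dN = 0 := by
    ext x; exact LinearMap.congr_fun hNN x
  have hsd' : s ∘ₗ dN = c • (dN ∘ₗ s) := by
    rw [hsd, smul_smul, hc, one_smul]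
  let sB : B →ₗ[R] B := s.restrict (by
    rintro _ ⟨y, rfl⟩
    refine ⟨c • s y, ?_⟩
    rw [map_smul]
    exact (LinearMap.congr_fun hsd' y).symm)
  have hps : p ∘ₗ s = c • (sB ∘ₗ p) := by
    ext x; exact LinearMap.congr_fun hsd x
  have hsB : sB ∘ₗ sB = LinearMap.id := by
    ext x; exact LinearMap.congr_fun hs x
  let sZ : Z →ₗ[R] Z := s.restrict (by
    intro y hy
    have := LinearMap.congr_fun hsd y
    simp only [LinearMap.comp_apply, LinearMap.smul_apply] at this
    rw [LinearMap.mem_ker, this, LinearMap.mem_ker.1 hy, map_zero, smul_zero])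
  have hsZ : sZ ∘ₗ sZ = LinearMap.id := by
    ext x; exact LinearMap.congr_fun hs x
  have exM : Function.Exact dM dM := fun x =>
    ⟨fun h => hM x h, by rintro ⟨y, rfl⟩; exact LinearMap.congr_fun hMM y⟩
  have exB := Module.Flat.rTensor_exact B exM
  have exZ := Module.Flat.rTensor_exact Z exM
  -- Modulo M ⊗ Z the second term of D disappears, and D becomes the differential of M up to the
  -- invertible twist by c and sB.
  have hlp : ∀ w, p.lTensor M (D w) = c • sB.lTensor M (dM.rTensor B (p.lTensor M w)) := by
    intro w
    have : p.lTensor M ∘ₗ D = c • (sB.lTensor M ∘ₗ dM.rTensor B ∘ₗ p.lTensor M) := by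
      rw [hDdef, LinearMap.comp_add]
      simp only [LinearMap.lTensor, LinearMap.rTensor, ← TensorProduct.map_comp, hps, hpd,
        LinearMap.id_comp, LinearMap.comp_id, TensorProduct.map_zero_right,
        TensorProduct.map_smul_right, add_zero]
    exact LinearMap.congr_fun this w
  have inv : ∀ {P : Type _} [AddCommGroup P] [Module R P] (σ : P →ₗ[R] P), σ ∘ₗ σ = LinearMap.id →
      ∀ v, σ.lTensor M (σ.lTensor M v) = v := by
    intro P _ _ σ hσ v
    rw [← LinearMap.comp_apply, ← LinearMap.lTensor_comp, hσ]; simp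
  intro x hx
  have h1 : dM.rTensor B (p.lTensor M x) = 0 := by
    have := hlp x
    rw [hx, map_zero] at this
    have h2 := congrArg (fun v => c • sB.lTensor M v) this
    simp only [map_zero, smul_zero, map_smul, smul_smul, hc, one_smul] at h2
    rw [inv sB hsB] at h2
    exact h2.symm
  obtain ⟨w, hw⟩ := (exB _).1 h1
  -- The twist is its own inverse. Applying it to w before lifting makes D w' and x agree in M ⊗ B,
  -- so their difference comes from M ⊗ Z.
  obtain ⟨w', hw'⟩ := LinearMap.lTensor_surjective M hp (c • sB.lTensor M w)
  have h3 : p.lTensor M (x - D w') = 0 := by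
    rw [map_sub, hlp, hw', map_smul, map_smul, smul_smul, hc, one_smul, ← hw,
      ← LinearMap.comp_apply (LinearMap.rTensor B dM), LinearMap.rTensor_comp_lTensor,
      ← LinearMap.lTensor_comp_rTensor, LinearMap.comp_apply, inv sB hsB, sub_self]
  obtain ⟨v, hv⟩ := (lTensor_exact M hZp hp _).1 h3
  have hDZ : ∀ v, D (Z.subtype.lTensor M v) =
      Z.subtype.lTensor M (sZ.lTensor M (dM.rTensor Z v)) := by
    intro v
    have : D ∘ₗ Z.subtype.lTensor M =
        Z.subtype.lTensor M ∘ₗ sZ.lTensor M ∘ₗ dM.rTensor Z := by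
      rw [hDdef, LinearMap.add_comp]
      have h1 : dN ∘ₗ Z.subtype = 0 := by ext y; exact y.2
      have h2 : s ∘ₗ Z.subtype = Z.subtype ∘ₗ sZ := by ext y; rfl
      simp only [LinearMap.lTensor, LinearMap.rTensor, ← TensorProduct.map_comp, h1, h2,
        LinearMap.id_comp, LinearMap.comp_id, TensorProduct.map_zero_right, add_zero]
    exact LinearMap.congr_fun this v
  have inj := lTensor_injective_of_flat_quotient M Z.subtype p Subtype.val_injective hZp hp
  have h4 : dM.rTensor Z v = 0 := by
    have h5 : D (Z.subtype.lTensor M v) = 0 := by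
      rw [hv, map_sub, hx, ← LinearMap.comp_apply, hD]; simp
    rw [hDZ] at h5
    have h6 := inj (h5.trans (map_zero _).symm)
    rw [← inv sZ hsZ (dM.rTensor Z v), h6, map_zero]
  obtain ⟨v', hv'⟩ := (exZ _).1 h4
  refine ⟨Z.subtype.lTensor M (sZ.lTensor M v') + w', ?_⟩
  have h7 : dM.rTensor Z (sZ.lTensor M v') = sZ.lTensor M (dM.rTensor Z v') := by
    rw [← LinearMap.comp_apply, LinearMap.rTensor_comp_lTensor, ← LinearMap.lTensor_comp_rTensor]
    rfl
  rw [map_add, hDZ, h7, inv sZ hsZ, hv', hv]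
  abel

/-- The differential of a tensor product. -/
noncomputable abbrev tensorD (dM σ : M →ₗ[R] M) (dN : N →ₗ[R] N) : M ⊗[R] N →ₗ[R] M ⊗[R] N :=
  TensorProduct.map dM LinearMap.id + TensorProduct.map σ dN

/-- A differential `d` with an involution `σ` which anticommutes with it. -/
structure IsSigned (d σ : M →ₗ[R] M) : Prop where
  dd : ∀ x, d (d x) = 0
  ss : ∀ x, σ (σ x) = x
  sd : ∀ x, σ (d x) = -d (σ x)

theorem IsSigned.tensorD_tensorD {dM σ : M →ₗ[R] M} {dN : N →ₗ[R] N} (h : IsSigned dM σ)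
    (hN : ∀ x, dN (dN x) = 0) (x : M ⊗[R] N) : tensorD dM σ dN (tensorD dM σ dN x) = 0 := by
  have : tensorD dM σ dN ∘ₗ tensorD dM σ dN = 0 := by
    refine TensorProduct.ext' fun x y => ?_
    simp [h.dd, h.sd, hN, TensorProduct.neg_tmul]
  exact LinearMap.congr_fun this x

/-- The mapping cone of f ⊗ K is the tensor product of the cone of f with K, which is acyclic by
`IsAcyclic.tensor`. -/
theorem DQuasiIso.rTensor [IsDomain R] [IsPrincipalIdealRing R] [Module.Flat R K]
    {dM σM : M →ₗ[R] M} {dN σN : N →ₗ[R] N} {dK : K →ₗ[R] K} {f : M →ₗ[R] N}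
    (h : DQuasiIso dM dN f) (hM : IsSigned dM σM) (hN : IsSigned dN σN)
    (hf : ∀ x, f (σM x) = σN (f x)) (hK : ∀ x, dK (dK x) = 0) :
    DQuasiIso (tensorD dM σM dK) (tensorD dN σN dK) (f.rTensor K) := by
  refine DQuasiIso.of_isAcyclic (fun x => ?_) ?_
  · have : f.rTensor K ∘ₗ tensorD dM σM dK = tensorD dN σN dK ∘ₗ f.rTensor K := by
      refine TensorProduct.ext' fun x y => ?_
      simp [h.comm, hf]
    exact LinearMap.congr_fun this x
  -- The component M is shifted by one degree in the mapping cone, hence its sign is reversed.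
  · let t : M × N →ₗ[R] M × N :=
      LinearMap.prod (-(σM ∘ₗ LinearMap.fst R M N)) (σN ∘ₗ LinearMap.snd R M N)
    have ac : IsAcyclic (TensorProduct.map (coneD dM dN f) (LinearMap.id : K →ₗ[R] K) +
        TensorProduct.map t dK) := by
      refine h.isAcyclic_coneD.tensor (c := 1) ?_ rfl (by simp) (by simp) (LinearMap.ext hK) ?_
      · ext x <;> simp [hM.dd, hN.dd, h.comm]
      · refine TensorProduct.ext' fun x y => ?_
        simp only [LinearMap.comp_apply, LinearMap.add_apply, TensorProduct.map_tmul,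
          LinearMap.id_apply, map_add, hK, TensorProduct.tmul_zero, add_zero,
          LinearMap.zero_apply]
        have e1 : coneD dM dN f (coneD dM dN f x) = 0 := by
          simp [hM.dd, hN.dd, h.comm]
        have e2 : coneD dM dN f (t x) = - t (coneD dM dN f x) := by
          simp [t, hM.sd, hN.sd, hf, add_comm]
        rw [e1, e2, TensorProduct.zero_tmul, TensorProduct.neg_tmul]
        abel
    refine ac.congr (TensorProduct.prodLeft R R M N K) fun x => ?_
    have : (TensorProduct.prodLeft R R M N K).toLinearMap ∘ₗ
        (TensorProduct.map (coneD dM dN f) (LinearMap.id : K →ₗ[R] K) + TensorProduct.map t dK) =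
        coneD (tensorD dM σM dK) (tensorD dN σN dK) (f.rTensor K) ∘ₗ
          (TensorProduct.prodLeft R R M N K).toLinearMap := by
      refine TensorProduct.ext' ?_
      rintro ⟨x₁, x₂⟩ y
      ext1
      · simp [t, TensorProduct.neg_tmul, add_comm]
      · simp [t, TensorProduct.add_tmul, add_assoc]
    exact LinearMap.congr_fun this x

/-- The factors are exchanged in order to use `IsAcyclic.tensor` again. The sign of K then
multiplies the differential of the cone, which is the case c = -1 of that lemma. -/
theorem DQuasiIso.lTensor [IsDomain R] [IsPrincipalIdealRing R] [Module.Flat R K]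
    {dM : M →ₗ[R] M} {dN : N →ₗ[R] N} {dK σK : K →ₗ[R] K} {f : M →ₗ[R] N}
    (h : DQuasiIso dM dN f) (hM : ∀ x, dM (dM x) = 0) (hN : ∀ x, dN (dN x) = 0)
    (hK : IsSigned dK σK) :
    DQuasiIso (tensorD dK σK dM) (tensorD dK σK dN) (f.lTensor K) := by
  refine DQuasiIso.of_isAcyclic (fun x => ?_) ?_
  · have : f.lTensor K ∘ₗ tensorD dK σK dM = tensorD dK σK dN ∘ₗ f.lTensor K := by
      refine TensorProduct.ext' fun x y => ?_
      simp [h.comm]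
    exact LinearMap.congr_fun this x
  · have e1 : ∀ x, coneD dM dN f (coneD dM dN f x) = 0 := fun x => by simp [hM, hN, h.comm]
    have ac : IsAcyclic (TensorProduct.map (coneD dM dN f) σK +
        TensorProduct.map LinearMap.id dK) := by
      refine h.isAcyclic_coneD.tensor (c := -1) (LinearMap.ext e1) (LinearMap.ext hK.ss)
        (LinearMap.ext fun x => by simp [hK.sd]) (by simp) (LinearMap.ext hK.dd) ?_
      refine TensorProduct.ext' fun x y => ?_
      simp only [LinearMap.comp_apply, LinearMap.add_apply, TensorProduct.map_tmul,
        LinearMap.id_apply, map_add, hK.dd, TensorProduct.tmul_zero, add_zero,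
        LinearMap.zero_apply, e1, hK.sd, TensorProduct.zero_tmul, TensorProduct.tmul_neg]
      abel
    -- Moving the shift of the component M past K costs the sign of K.
    let τ : K ≃ₗ[R] K := LinearEquiv.ofInvolutive σK hK.ss
    let e : (M × N) ⊗[R] K ≃ₗ[R] (K ⊗[R] M) × (K ⊗[R] N) :=
      (TensorProduct.comm R (M × N) K ≪≫ₗ TensorProduct.prodRight R R K M N) ≪≫ₗ
        (LinearEquiv.prodCongr (TensorProduct.congr τ (LinearEquiv.refl R M))
          (LinearEquiv.refl R (K ⊗[R] N)))
    refine ac.congr e fun x => ?_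
    have : e.toLinearMap ∘ₗ (TensorProduct.map (coneD dM dN f) σK +
        TensorProduct.map LinearMap.id dK) =
        coneD (tensorD dK σK dM) (tensorD dK σK dN) (f.lTensor K) ∘ₗ e.toLinearMap := by
      refine TensorProduct.ext' fun x y => ?_
      have hτ : ∀ x, τ x = σK x := fun x => rfl
      ext1
      · simp [e, hτ, TensorProduct.neg_tmul, TensorProduct.tmul_neg, hK.sd, hK.ss]
      · simp [e, hτ, TensorProduct.tmul_add]
        abel
    exact LinearMap.congr_fun this x

end DifferentialModules

/-! ### Localization at maximal ideals: acyclicity, flatness, torsion. -/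

section Localization

variable {R : Type*} [CommRing R]
variable {M N M' N' : Type*} [AddCommGroup M] [Module R M] [AddCommGroup N] [Module R N]
  [AddCommGroup M'] [Module R M'] [AddCommGroup N'] [Module R N']

theorem isLocalizedModule_mk_one (P : Ideal R) [P.IsPrime] (M : Type*) [AddCommGroup M]
    [Module R M] :
    IsLocalizedModule P.primeCompl (TensorProduct.mk R (Localization.AtPrime P) M 1) :=
  (isLocalizedModule_iff_isBaseChange P.primeCompl (Localization.AtPrime P) _).2
    (TensorProduct.isBaseChange R M (Localization.AtPrime P))

/-- The scalars that carry a cycle x into the boundaries form an ideal. If it were proper it would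
lie in a maximal ideal P, but acyclicity at P yields such a scalar outside P. -/
theorem isAcyclic_of_localized {d : M →ₗ[R] M}
    (h : ∀ (P : Ideal R) [P.IsMaximal], IsAcyclic (d.lTensor (Localization.AtPrime P))) :
    IsAcyclic d := by
  intro x hx
  by_contra hne
  let I : Ideal R := (LinearMap.range d).comap (LinearMap.toSpanSingleton R M x)
  have hI : I ≠ ⊤ := by
    intro hI
    have h1 : (1 : R) ∈ I := hI ▸ Submodule.mem_top
    apply hne
    simpa [I] using h1
  obtain ⟨P, hP, hIP⟩ := Ideal.exists_le_maximal I hI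
  have := isLocalizedModule_mk_one P M
  obtain ⟨y, hy⟩ := h P (1 ⊗ₜ x) (by simp [hx])
  obtain ⟨⟨z, s⟩, hz⟩ := IsLocalizedModule.surj P.primeCompl
    (TensorProduct.mk R (Localization.AtPrime P) M 1) y
  simp only [TensorProduct.mk_apply] at hz
  have h2 : TensorProduct.mk R (Localization.AtPrime P) M 1 (d z) =
      TensorProduct.mk R (Localization.AtPrime P) M 1 (s • x) := by
    have := congrArg (d.lTensor (Localization.AtPrime P)) hz
    simp only [LinearMap.lTensor_tmul] at this
    rw [TensorProduct.mk_apply, ← this, Submonoid.smul_def, map_smul, hy]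
    simp [Submonoid.smul_def]
  obtain ⟨c, hc⟩ := (IsLocalizedModule.eq_iff_exists P.primeCompl _).1 h2
  have h3 : (c * s : R) ∈ I := by
    refine ⟨c • z, ?_⟩
    simp only [Submonoid.smul_def] at hc
    rw [Submonoid.smul_def, map_smul, hc]
    simp [mul_smul]
  exact (c * s).2 (hIP h3)

/-- A flat module is a differential module with zero differential and trivial sign. -/
theorem DQuasiIso.lTensor_flat [IsDomain R] [IsPrincipalIdealRing R] (L : Type*)
    [AddCommGroup L] [Module R L] [Module.Flat R L] {dM : M →ₗ[R] M} {dN : N →ₗ[R] N}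
    {f : M →ₗ[R] N} (h : DQuasiIso dM dN f) (hM : ∀ x, dM (dM x) = 0)
    (hN : ∀ x, dN (dN x) = 0) :
    DQuasiIso (dM.lTensor L) (dN.lTensor L) (f.lTensor L) := by
  have := h.lTensor (K := L) (dK := 0) (σK := LinearMap.id) hM hN ⟨by simp, by simp, by simp⟩
  simp only [tensorD, TensorProduct.map_zero_left, zero_add] at this
  exact this

/-- Localization commutes with forming the mapping cone, whose acyclicity is a local property. -/
theorem DQuasiIso.of_localized {dM : M →ₗ[R] M} {dN : N →ₗ[R] N} {f : M →ₗ[R] N}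
    (comm : ∀ x, f (dM x) = dN (f x))
    (h : ∀ (P : Ideal R) [P.IsMaximal], DQuasiIso (dM.lTensor (Localization.AtPrime P))
      (dN.lTensor (Localization.AtPrime P)) (f.lTensor (Localization.AtPrime P))) :
    DQuasiIso dM dN f := by
  refine DQuasiIso.of_isAcyclic comm (isAcyclic_of_localized fun P _ => ?_)
  refine (h P).isAcyclic_coneD.congr
    (TensorProduct.prodRight R R (Localization.AtPrime P) M N).symm fun x => ?_
  rw [LinearEquiv.symm_apply_eq]
  obtain ⟨y, rfl⟩ := (TensorProduct.prodRight R R (Localization.AtPrime P) M N).surjective x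
  rw [LinearEquiv.symm_apply_apply]
  induction y with
  | zero => simp only [map_zero]
  | add a b ha hb => simp only [map_add, ha, hb]
  | tmul a b => simp [TensorProduct.tmul_neg, TensorProduct.tmul_add]

theorem IsSigned.lTensor {d σ : M →ₗ[R] M} (h : IsSigned d σ) (L : Type*) [AddCommGroup L]
    [Module R L] : IsSigned (d.lTensor L) (σ.lTensor L) where
  dd x := by
    have : d.lTensor L ∘ₗ d.lTensor L = 0 := TensorProduct.ext' fun a b => by simp [h.dd]
    exact LinearMap.congr_fun this x
  ss x := by
    have : σ.lTensor L ∘ₗ σ.lTensor L = LinearMap.id :=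
      TensorProduct.ext' fun a b => by simp [h.ss]
    exact LinearMap.congr_fun this x
  sd x := by
    have : σ.lTensor L ∘ₗ d.lTensor L = -(d.lTensor L ∘ₗ σ.lTensor L) :=
      TensorProduct.ext' fun a b => by simp [h.sd, TensorProduct.tmul_neg]
    exact LinearMap.congr_fun this x

/-- The tensor product of two quasi-isomorphisms `C' → C` and `D' → D` with flat sources is a
quasi-isomorphism if at every maximal ideal `C` or `D` is flat. -/
theorem DQuasiIso.map [IsDomain R] [IsPrincipalIdealRing R] [Module.Flat R M']
    [Module.Flat R N'] {dM σM : M →ₗ[R] M} {dN σN : N →ₗ[R] N} {dM' σM' : M' →ₗ[R] M'}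
    {dN' σN' : N' →ₗ[R] N'} {f : M' →ₗ[R] M} {g : N' →ₗ[R] N} (hf : DQuasiIso dM' dM f)
    (hg : DQuasiIso dN' dN g) (hM : IsSigned dM σM) (hN : IsSigned dN σN)
    (hM' : IsSigned dM' σM') (hN' : IsSigned dN' σN') (hfσ : ∀ x, f (σM' x) = σM (f x))
    (hloc : ∀ (P : Ideal R) [P.IsMaximal], Module.Flat R (Localization.AtPrime P ⊗[R] M) ∨
      Module.Flat R (Localization.AtPrime P ⊗[R] N)) :
    DQuasiIso (tensorD dM' σM' dN') (tensorD dM σM dN) (TensorProduct.map f g) := by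
  refine DQuasiIso.of_localized (fun x => ?_) fun P _ => ?_
  · have : TensorProduct.map f g ∘ₗ tensorD dM' σM' dN' =
        tensorD dM σM dN ∘ₗ TensorProduct.map f g :=
      TensorProduct.ext' fun a b => by simp [hf.comm, hg.comm, hfσ]
    exact LinearMap.congr_fun this x
  · set L := Localization.AtPrime P
    have flatL : Module.Flat R L := IsLocalization.flat _ P.primeCompl
    -- The two factors are changed one after the other, and the factor that stays fixed has to be
    -- flat. M' and N' are flat, whereas M or N is so only after localization; which of them it is
    -- determines the order.
    rcases hloc P with h | h
    · have h1 := (hf.rTensor (K := N') hM' hM hfσ hN'.dd).lTensor_flat L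
        (hM'.tensorD_tensorD hN'.dd) (hM.tensorD_tensorD hN'.dd)
      have h3 : DQuasiIso ((tensorD dM σM dN').lTensor L) ((tensorD dM σM dN).lTensor L)
          ((g.lTensor M).lTensor L) := by
        have h2 := hg.lTensor (K := L ⊗[R] M) hN'.dd hN.dd (hM.lTensor L)
        refine h2.congr (TensorProduct.assoc R L M N') (TensorProduct.assoc R L M N)
          (fun x => ?_) (fun x => ?_) (fun x => ?_)
        · refine LinearMap.congr_fun (f := (TensorProduct.assoc R L M N').toLinearMap ∘ₗ
            tensorD (dM.lTensor L) (σM.lTensor L) dN') (g := (tensorD dM σM dN').lTensor L ∘ₗ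
            (TensorProduct.assoc R L M N').toLinearMap) (TensorProduct.ext_threefold
              fun a b c => ?_) x
          simp
        · refine LinearMap.congr_fun (f := (TensorProduct.assoc R L M N).toLinearMap ∘ₗ
            tensorD (dM.lTensor L) (σM.lTensor L) dN) (g := (tensorD dM σM dN).lTensor L ∘ₗ
            (TensorProduct.assoc R L M N).toLinearMap) (TensorProduct.ext_threefold
              fun a b c => ?_) x
          simp
        · refine LinearMap.congr_fun (f := (TensorProduct.assoc R L M N).toLinearMap ∘ₗ
            g.lTensor (L ⊗[R] M)) (g := (g.lTensor M).lTensor L ∘ₗ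
            (TensorProduct.assoc R L M N').toLinearMap) (TensorProduct.ext_threefold
              fun a b c => ?_) x
          simp
      have h4 := h3.comp h1
      rwa [← LinearMap.lTensor_comp, LinearMap.lTensor_comp_rTensor] at h4
    · have h1 := (hg.lTensor (K := M') hN'.dd hN.dd hM').lTensor_flat L
        (hM'.tensorD_tensorD hN'.dd) (hM'.tensorD_tensorD hN.dd)
      have h3 : DQuasiIso ((tensorD dM' σM' dN).lTensor L) ((tensorD dM σM dN).lTensor L)
          ((f.rTensor N).lTensor L) := by
        have h2 := hf.rTensor (K := L ⊗[R] N) hM' hM hfσ (hN.lTensor L).dd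
        refine h2.congr (TensorProduct.leftComm R M' L N) (TensorProduct.leftComm R M L N)
          (fun x => ?_) (fun x => ?_) (fun x => ?_)
        · refine LinearMap.congr_fun (f := (TensorProduct.leftComm R M' L N).toLinearMap ∘ₗ
            tensorD dM' σM' (dN.lTensor L)) (g := (tensorD dM' σM' dN).lTensor L ∘ₗ
            (TensorProduct.leftComm R M' L N).toLinearMap) (TensorProduct.ext_threefold'
              fun a b c => ?_) x
          simp
        · refine LinearMap.congr_fun (f := (TensorProduct.leftComm R M L N).toLinearMap ∘ₗ
            tensorD dM σM (dN.lTensor L)) (g := (tensorD dM σM dN).lTensor L ∘ₗ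
            (TensorProduct.leftComm R M L N).toLinearMap) (TensorProduct.ext_threefold'
              fun a b c => ?_) x
          simp
        · refine LinearMap.congr_fun (f := (TensorProduct.leftComm R M L N).toLinearMap ∘ₗ
            f.rTensor (L ⊗[R] N)) (g := (f.rTensor N).lTensor L ∘ₗ
            (TensorProduct.leftComm R M' L N).toLinearMap) (TensorProduct.ext_threefold'
              fun a b c => ?_) x
          simp
      have h4 := h3.comp h1
      rwa [← LinearMap.lTensor_comp, LinearMap.rTensor_comp_lTensor] at h4

/-- Elements outside P become units, so a nonzero scalar acts on the localization like a power of
the generator of P. If that action is injective the localization is torsion-free, hence flat. -/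
theorem flat_localized_of_prime_smul [IsDomain R] [IsPrincipalIdealRing R] (P : Ideal R)
    [hP : P.IsMaximal] (h : ∀ p : R, Prime p → Ideal.span {p} = P → ∀ m : M, p • m = 0 → m = 0) :
    Module.Flat R (Localization.AtPrime P ⊗[R] M) := by
  have := isLocalizedModule_mk_one P M
  suffices Module.IsTorsionFree R (Localization.AtPrime P ⊗[R] M) by infer_instance
  refine Module.IsTorsionFree.of_smul_eq_zero fun r x hrx => or_iff_not_imp_left.2 fun hr => ?_
  obtain ⟨⟨m, s⟩, hm⟩ := IsLocalizedModule.surj P.primeCompl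
    (TensorProduct.mk R (Localization.AtPrime P) M 1) x
  simp only at hm
  have hinj := IsLocalizedModule.smul_injective
    (TensorProduct.mk R (Localization.AtPrime P) M 1) s
  -- powers of the generator act injectively on `M`
  obtain ⟨p, hp⟩ := IsPrincipalIdealRing.principal P
  have hp' : Ideal.span {p} = P := hp.symm
  obtain ⟨k, r', hr', hrk⟩ : ∃ (k : ℕ) (r' : R), r' ∉ P ∧
      ((∀ m : M, p ^ k • m = 0 → m = 0) ∧ r = p ^ k * r') := by
    -- If P = 0, the nonzero scalar r already lies outside P and no power of the generator is
    -- needed.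
    by_cases hp0 : p = 0
    · refine ⟨0, r, ?_, by simp, by simp⟩
      rw [← hp', hp0]
      simpa using hr
    · have hprime : Prime p := (Ideal.span_singleton_prime hp0).1 (hp' ▸ hP.isPrime)
      obtain ⟨k, r', hr', hrk⟩ := WfDvdMonoid.max_power_factor hr hprime.irreducible
      refine ⟨k, r', fun hmem => hr' ?_, ?_, hrk⟩
      · rw [← hp'] at hmem
        exact Ideal.mem_span_singleton.1 hmem
      · clear hrk
        induction k with
        | zero => simp
        | succ k ih =>
          intro m hm
          rw [pow_succ, mul_smul] at hm
          exact h p hprime hp' m (ih _ hm)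
  have h1 : TensorProduct.mk R (Localization.AtPrime P) M 1 (r • m) = 0 := by
    rw [map_smul, ← hm, Submonoid.smul_def, smul_comm, hrx, smul_zero]
  obtain ⟨c, hc⟩ := (IsLocalizedModule.eq_zero_iff P.primeCompl _).1 h1
  have h2 : (c * r') • m = 0 := by
    apply hrk.1
    rw [← hc, hrk.2, Submonoid.smul_def, smul_smul, smul_smul]
    congr 1; ring
  have h3 : TensorProduct.mk R (Localization.AtPrime P) M 1 m = 0 :=
    (IsLocalizedModule.eq_zero_iff P.primeCompl _).2 ⟨c * ⟨r', hr'⟩, h2⟩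
  apply hinj
  simp only [smul_zero]
  rw [hm, h3]

/-- If `M ⊗ K → M ⊗ F` is injective for a torsion-free module `F` with a submodule `K`, then
for each prime `p` there is no `p`-torsion in `M` or no `p`-torsion in `F / K`. -/
theorem smul_eq_zero_or_of_injective [IsDomain R] [IsPrincipalIdealRing R] [Module.Flat R N]
    (π : N →ₗ[R] N') (hπ : Function.Surjective π)
    (h : Function.Injective ((LinearMap.ker π).subtype.lTensor M)) (p : R) (hp : Prime p) :
    (∀ x : M, p • x = 0 → x = 0) ∨ (∀ y : N', p • y = 0 → y = 0) := by
  by_contra hcon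
  push Not at hcon
  obtain ⟨⟨x, hpx, hx⟩, ⟨y, hpy, hy⟩⟩ := hcon
  obtain ⟨f, rfl⟩ := hπ y
  have hK : p • f ∈ LinearMap.ker π := by rw [LinearMap.mem_ker, map_smul, hpy]
  have flatK : Module.Flat R (LinearMap.ker π) :=
    flat_of_injective_of_isPrincipal (LinearMap.ker π).subtype Subtype.val_injective
  -- In M ⊗ N the factor p moves over to x, which it kills.
  have h0 : x ⊗ₜ[R] (⟨p • f, hK⟩ : LinearMap.ker π) = 0 := by
    apply h
    rw [map_zero, LinearMap.lTensor_tmul, Submodule.subtype_apply, ← TensorProduct.smul_tmul, hpx,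
      TensorProduct.zero_tmul]
  -- the submodule generated by `x` is `R / p`
  let j : (R ⧸ Ideal.span {p}) →ₗ[R] M := Submodule.liftQ _ (LinearMap.toSpanSingleton R M x) (by
    rw [Ideal.span, Submodule.span_singleton_le_iff_mem]
    simpa using hpx)
  have hj1 : j (Ideal.Quotient.mk _ 1) = x := by
    change LinearMap.toSpanSingleton R M x 1 = x
    simp
  have hmax : (Ideal.span {p}).IsMaximal :=
    PrincipalIdealRing.isMaximal_of_irreducible hp.irreducible
  have hj : Function.Injective j := by
    rw [injective_iff_map_eq_zero]
    intro a ha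
    obtain ⟨a, rfl⟩ := Ideal.Quotient.mk_surjective a
    by_contra hne
    have ha' : a • x = 0 := ha
    have hanot : a ∉ Ideal.span {p} := fun hmem => hne (Ideal.Quotient.eq_zero_iff_mem.2 hmem)
    obtain ⟨b, hb⟩ := hmax.exists_inv hanot
    obtain ⟨i, hi, hbi⟩ := hb
    obtain ⟨c, rfl⟩ := Ideal.mem_span_singleton'.1 hi
    apply hx
    rw [← one_smul R x, ← hbi, add_smul, mul_smul, mul_smul, ha', hpx, smul_zero, smul_zero,
      add_zero]
  -- The kernel is flat, so R / p ⊗ ker π embeds in M ⊗ ker π. Hence p • f is divisible by p within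
  -- the kernel, and as N is torsion-free f itself lies in the kernel.
  have h1 : (Ideal.Quotient.mk (Ideal.span {p}) 1) ⊗ₜ[R] (⟨p • f, hK⟩ : LinearMap.ker π) = 0 := by
    apply Module.Flat.rTensor_preserves_injective_linearMap (M := LinearMap.ker π) j hj
    rw [map_zero, LinearMap.rTensor_tmul, hj1, h0]
  have h2 := congrArg (TensorProduct.quotTensorEquivQuotSMul (LinearMap.ker π) (Ideal.span {p})) h1
  rw [TensorProduct.quotTensorEquivQuotSMul_mk_tmul, map_zero, one_smul,
    Submodule.Quotient.mk_eq_zero, Submodule.ideal_span_singleton_smul,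
    Submodule.mem_smul_pointwise_iff_exists] at h2
  obtain ⟨k, -, hk⟩ := h2
  have h3 : p • ((k : N) - f) = 0 := by
    rw [smul_sub, sub_eq_zero]
    exact congrArg Subtype.val hk
  have h4 : (k : N) - f = 0 := (smul_eq_zero.1 h3).resolve_left hp.ne_zero
  apply hy
  rw [← sub_eq_zero.1 h4]
  exact k.2

end Localization

namespace VR

/-! ### The total chain complex of a relation. -/

section TotalChains

variable (R : Type*) [CommRing R] {X Y Z X' Y' : Type*}

/-- The direct sum of the chain modules of `X^U` in all degrees. -/
def TotChain (U : Set (X × X)) : Type _ := (Σ n, Simplex U n) →₀ R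

noncomputable instance (U : Set (X × X)) : AddCommGroup (TotChain R U) :=
  inferInstanceAs (AddCommGroup ((Σ n, Simplex U n) →₀ R))

noncomputable instance (U : Set (X × X)) : Module R (TotChain R U) :=
  inferInstanceAs (Module R ((Σ n, Simplex U n) →₀ R))

variable {R} in
/-- The chain given by a simplex. -/
noncomputable def gen {U : Set (X × X)} (n : ℕ) (σ : Simplex U n) : TotChain R U :=
  (Finsupp.single ⟨n, σ⟩ 1 : (Σ n, Simplex U n) →₀ R)

/-- The linear map with given values on simplices. -/
noncomputable def totLift {U : Set (X × X)} {M : Type*} [AddCommGroup M] [Module R M]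
    (f : (Σ n, Simplex U n) → M) : TotChain R U →ₗ[R] M :=
  (Finsupp.linearCombination R f : ((Σ n, Simplex U n) →₀ R) →ₗ[R] M)

/-- The boundary of a simplex in the total chain module. -/
noncomputable def simplexBoundary (U : Set (X × X)) : (Σ n, Simplex U n) → TotChain R U
  | ⟨0, _⟩ => 0
  | ⟨n + 1, σ⟩ => ∑ k : Fin (n + 2), (-1 : R) ^ (k : ℕ) • gen n (face k σ)

/-- The boundary on the total chain module. -/
noncomputable def totBoundary (U : Set (X × X)) : TotChain R U →ₗ[R] TotChain R U :=
  totLift R (simplexBoundary R U)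

/-- The sign `(-1)ⁿ` in degree `n`. -/
noncomputable def totSign (U : Set (X × X)) : TotChain R U →ₗ[R] TotChain R U :=
  totLift R (fun s => (-1 : R) ^ s.1 • gen s.1 s.2)

variable {U : Set (X × X)} {V : Set (Y × Y)}

theorem totLift_gen {M : Type*} [AddCommGroup M] [Module R M]
    (f : (Σ n, Simplex U n) → M) (n : ℕ) (σ : Simplex U n) :
    totLift R f (gen n σ) = f ⟨n, σ⟩ :=
  (Finsupp.linearCombination_single R 1 _).trans (one_smul R _)

theorem totChain_hom_ext {M : Type*} [AddCommGroup M] [Module R M]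
    {f g : TotChain R U →ₗ[R] M} (h : ∀ n σ, f (gen n σ) = g (gen n σ)) : f = g :=
  Finsupp.lhom_ext' (M := R) fun s => LinearMap.ext_ring (h s.1 s.2)

@[simp] theorem totBoundary_gen_zero (σ : Simplex U 0) : totBoundary R U (gen 0 σ) = 0 :=
  totLift_gen R _ _ _

@[simp] theorem totBoundary_gen_succ (n : ℕ) (σ : Simplex U (n + 1)) :
    totBoundary R U (gen (n + 1) σ) =
      ∑ k : Fin (n + 2), (-1 : R) ^ (k : ℕ) • gen n (face k σ) :=
  totLift_gen R _ _ _

@[simp] theorem totSign_gen (n : ℕ) (σ : Simplex U n) :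
    totSign R U (gen n σ) = (-1 : R) ^ n • gen n σ :=
  totLift_gen R _ _ _

/-- The chain map induced by a simplicial map. -/
noncomputable def totMap (φ : Y → X) (h : ∀ p ∈ V, (φ p.1, φ p.2) ∈ U) :
    TotChain R V →ₗ[R] TotChain R U :=
  totLift R (fun s => gen s.1 (simplexMap φ h s.2))

@[simp] theorem totMap_gen (φ : Y → X) (h : ∀ p ∈ V, (φ p.1, φ p.2) ∈ U) (n : ℕ)
    (σ : Simplex V n) : totMap R φ h (gen n σ) = gen n (simplexMap φ h σ) :=
  totLift_gen R _ _ _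

theorem totBoundary_totMap (φ : Y → X) (h : ∀ p ∈ V, (φ p.1, φ p.2) ∈ U) (x : TotChain R V) :
    totBoundary R U (totMap R φ h x) = totMap R φ h (totBoundary R V x) := by
  refine LinearMap.congr_fun (f := totBoundary R U ∘ₗ totMap R φ h)
    (g := totMap R φ h ∘ₗ totBoundary R V) (totChain_hom_ext R fun n σ => ?_) x
  cases n with
  | zero => simp
  | succ n =>
    simp only [LinearMap.comp_apply, totMap_gen, totBoundary_gen_succ, map_sum, map_smul]
    rfl

theorem totSign_totMap (φ : Y → X) (h : ∀ p ∈ V, (φ p.1, φ p.2) ∈ U) (x : TotChain R V) :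
    totSign R U (totMap R φ h x) = totMap R φ h (totSign R V x) := by
  refine LinearMap.congr_fun (f := totSign R U ∘ₗ totMap R φ h)
    (g := totMap R φ h ∘ₗ totSign R V) (totChain_hom_ext R fun n σ => ?_) x
  simp

theorem totSign_totSign (x : TotChain R U) : totSign R U (totSign R U x) = x := by
  refine LinearMap.congr_fun (f := totSign R U ∘ₗ totSign R U) (g := LinearMap.id)
    (totChain_hom_ext R fun n σ => ?_) x
  simp [smul_smul, ← mul_pow]

theorem totSign_totBoundary (x : TotChain R U) :
    totSign R U (totBoundary R U x) = -totBoundary R U (totSign R U x) := by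
  refine LinearMap.congr_fun (f := totSign R U ∘ₗ totBoundary R U)
    (g := -(totBoundary R U ∘ₗ totSign R U)) (totChain_hom_ext R fun n σ => ?_) x
  cases n with
  | zero => simp
  | succ n =>
    simp only [LinearMap.comp_apply, LinearMap.neg_apply, totSign_gen, totBoundary_gen_succ,
      map_sum, map_smul, Finset.smul_sum, ← Finset.sum_neg_distrib]
    refine Finset.sum_congr rfl fun k _ => ?_
    rw [smul_comm, pow_succ, mul_neg_one, neg_smul, neg_neg]

/-! ### Cones -/

/-- The simplex `(p, x₀, …, xₙ)`. -/
def consSimplex (p : X) (hp : ∀ x, (p, x) ∈ U) {n : ℕ} (σ : Simplex U n) : Simplex U (n + 1) :=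
  ⟨Fin.cons p σ.1, fun i j hij => by
    obtain ⟨j, rfl⟩ := Fin.exists_succ_eq.2 (Fin.ne_zero_of_lt hij)
    rw [Fin.cons_succ]
    induction i using Fin.cases with
    | zero => exact hp _
    | succ i => exact σ.2 (Fin.succ_lt_succ_iff.1 hij)⟩

variable (U) in
/-- A point as a simplex. -/
def ptSimplex (p : X) : Simplex U 0 := ⟨fun _ => p, fun i j hij => by omega⟩

theorem face_zero_consSimplex (p : X) (hp : ∀ x, (p, x) ∈ U) {n : ℕ} (σ : Simplex U n) :
    face 0 (consSimplex p hp σ) = σ :=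
  Subtype.ext (funext fun i => by simp [face, consSimplex])

theorem face_succ_consSimplex (p : X) (hp : ∀ x, (p, x) ∈ U) {n : ℕ} (k : Fin (n + 2))
    (σ : Simplex U (n + 1)) :
    face k.succ (consSimplex p hp σ) = consSimplex p hp (face k σ) := by
  refine Subtype.ext (funext fun i => ?_)
  induction i using Fin.cases with
  | zero => simp [face, consSimplex]
  | succ i => simp [face, consSimplex]

theorem face_one_consSimplex (p : X) (hp : ∀ x, (p, x) ∈ U) (σ : Simplex U 0) :
    face 1 (consSimplex p hp σ) = ptSimplex U p := by
  refine Subtype.ext (funext fun i => ?_)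
  have : i = 0 := by omega
  subst this
  rfl

/-- The cone operator. -/
noncomputable def coneOp (p : X) (hp : ∀ x, (p, x) ∈ U) : TotChain R U →ₗ[R] TotChain R U :=
  totLift R (fun s => gen (s.1 + 1) (consSimplex p hp s.2))

/-- The augmentation of a simplex. -/
def simplexAug : (Σ n, Simplex U n) → R
  | ⟨0, _⟩ => 1
  | ⟨_ + 1, _⟩ => 0

variable (U) in
/-- The augmentation. -/
noncomputable def aug : TotChain R U →ₗ[R] R := totLift R (simplexAug R)

@[simp] theorem coneOp_gen (p : X) (hp : ∀ x, (p, x) ∈ U) (n : ℕ) (σ : Simplex U n) :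
    coneOp R p hp (gen n σ) = gen (n + 1) (consSimplex p hp σ) :=
  totLift_gen R _ _ _

@[simp] theorem aug_gen_zero (σ : Simplex U 0) : aug R U (gen 0 σ) = 1 :=
  totLift_gen R _ _ _

@[simp] theorem aug_gen_succ (n : ℕ) (σ : Simplex U (n + 1)) : aug R U (gen (n + 1) σ) = 0 :=
  totLift_gen R _ _ _

theorem aug_totBoundary (x : TotChain R U) : aug R U (totBoundary R U x) = 0 := by
  refine LinearMap.congr_fun (f := aug R U ∘ₗ totBoundary R U) (g := 0)
    (totChain_hom_ext R fun n σ => ?_) x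
  rcases n with _ | _ | n
  · simp
  · simp [Fin.sum_univ_two]
  · simp

theorem aug_totSign (x : TotChain R U) : aug R U (totSign R U x) = aug R U x := by
  refine LinearMap.congr_fun (f := aug R U ∘ₗ totSign R U) (g := aug R U)
    (totChain_hom_ext R fun n σ => ?_) x
  rcases n with _ | n <;> simp

/-- Dropping the new vertex returns the simplex, and the other faces are cones on its faces. For a
0-simplex the other face is the vertex p, which accounts for the augmentation term. -/
theorem totBoundary_coneOp (p : X) (hp : ∀ x, (p, x) ∈ U) (x : TotChain R U) :
    totBoundary R U (coneOp R p hp x) =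
      x - aug R U x • gen 0 (ptSimplex U p) - coneOp R p hp (totBoundary R U x) := by
  refine LinearMap.congr_fun (f := totBoundary R U ∘ₗ coneOp R p hp)
    (g := LinearMap.id - (aug R U).smulRight (gen 0 (ptSimplex U p)) -
      coneOp R p hp ∘ₗ totBoundary R U) (totChain_hom_ext R fun n σ => ?_) x
  rcases n with _ | n
  · simp [Fin.sum_univ_two, face_zero_consSimplex, face_one_consSimplex, sub_eq_add_neg]
  · simp only [LinearMap.comp_apply, coneOp_gen, totBoundary_gen_succ, LinearMap.sub_apply,
      LinearMap.id_apply, LinearMap.smulRight_apply, aug_gen_succ, zero_smul, sub_zero, map_sum,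
      map_smul]
    rw [Fin.sum_univ_succ, face_zero_consSimplex, sub_eq_add_neg, ← Finset.sum_neg_distrib]
    congr 1
    · simp
    · refine Finset.sum_congr rfl fun k _ => ?_
      rw [face_succ_consSimplex, Fin.val_succ, pow_succ, mul_neg_one, neg_smul]

theorem totSign_coneOp (p : X) (hp : ∀ x, (p, x) ∈ U) (x : TotChain R U) :
    totSign R U (coneOp R p hp x) = -coneOp R p hp (totSign R U x) := by
  refine LinearMap.congr_fun (f := totSign R U ∘ₗ coneOp R p hp)
    (g := -(coneOp R p hp ∘ₗ totSign R U)) (totChain_hom_ext R fun n σ => ?_) x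
  simp [pow_succ]

/-- For the full relation every simplex is the cone on its face 0 with its first vertex as cone
point. The cone formula then gives the claim by induction, in place of the usual cancellation in a
double sum. -/
theorem totBoundary_totBoundary_univ (n : ℕ) (σ : Simplex (Set.univ : Set (X × X)) n) :
    totBoundary R Set.univ (totBoundary R Set.univ (gen n σ)) = 0 := by
  induction n with
  | zero => simp
  | succ n ih =>
    have hσ : σ = consSimplex (σ.1 0) (fun _ => Set.mem_univ _) (face 0 σ) := by
      refine Subtype.ext (funext fun i => ?_)
      induction i using Fin.cases with
      | zero => rfl
      | succ i => simp [consSimplex, face]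
    have h := totBoundary_coneOp R (U := Set.univ) (σ.1 0) (fun _ => Set.mem_univ _)
    have hc : gen (R := R) (n + 1) σ =
        coneOp R (U := Set.univ) (σ.1 0) (fun _ => Set.mem_univ _) (gen n (face 0 σ)) := by
      rw [coneOp_gen, ← hσ]
    rw [hc, h, map_sub, h, map_sub, ih, map_zero, aug_totBoundary]
    simp

/-- The chains of any relation embed in those of the full relation, where cones are available. -/
theorem totBoundary_totBoundary (x : TotChain R U) :
    totBoundary R U (totBoundary R U x) = 0 := by
  refine LinearMap.congr_fun (f := totBoundary R U ∘ₗ totBoundary R U) (g := 0)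
    (totChain_hom_ext R fun n σ => ?_) x
  have hi : Function.Injective (totMap R (U := Set.univ) (V := U) id
      fun _ _ => Set.mem_univ _) := by
    let f : (Σ n, Simplex U n) → Σ n, Simplex (Set.univ : Set (X × X)) n :=
      fun s => ⟨s.1, simplexMap id (fun _ _ => Set.mem_univ _) s.2⟩
    have : totMap R (U := Set.univ) (V := U) id (fun _ _ => Set.mem_univ _) =
        (Finsupp.lmapDomain R R f : ((Σ n, Simplex U n) →₀ R) →ₗ[R]
          ((Σ n, Simplex (Set.univ : Set (X × X)) n) →₀ R)) := by
      refine totChain_hom_ext R fun n σ => ?_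
      rw [totMap_gen]
      exact (Finsupp.mapDomain_single (f := f) (a := ⟨n, σ⟩) (b := (1 : R))).symm
    rw [this]
    refine Finsupp.mapDomain_injective (M := R) (f := f) ?_
    rintro ⟨n, σ⟩ ⟨m, τ⟩ h
    obtain ⟨rfl, h2⟩ := Sigma.mk.inj_iff.1 h
    have h3 := congrArg Subtype.val (eq_of_heq h2)
    exact congrArg _ (Subtype.ext h3)
  apply hi
  simp only [LinearMap.comp_apply, LinearMap.zero_apply, map_zero, ← totBoundary_totMap,
    totMap_gen, totBoundary_totBoundary_univ]

end TotalChains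

end VR

namespace VR

/-! ### The Alexander-Whitney map and cones. -/

section AlexanderWhitney

variable (R : Type*) [CommRing R] {X Y X' Y' : Type*} {U : Set (X × X)} {V : Set (Y × Y)}
  {U' : Set (X' × X')} {V' : Set (Y' × Y')}

theorem tensor_hom_ext {M : Type*} [AddCommGroup M] [Module R M]
    {f g : TotChain R U ⊗[R] TotChain R V →ₗ[R] M}
    (h : ∀ i j σ τ, f (gen i σ ⊗ₜ gen j τ) = g (gen i σ ⊗ₜ gen j τ)) : f = g := by
  refine TensorProduct.ext (totChain_hom_ext R fun i σ => totChain_hom_ext R fun j τ => ?_)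
  exact h i j σ τ

/-- The linear map on the tensor product of the total chain modules with given values on pairs
of simplices. -/
noncomputable def tensorLift {M : Type*} [AddCommGroup M] [Module R M]
    (F : (Σ n, Simplex U n) → (Σ n, Simplex V n) → M) :
    TotChain R U ⊗[R] TotChain R V →ₗ[R] M :=
  TensorProduct.lift (totLift R fun s => totLift R (F s))

@[simp] theorem tensorLift_gen {M : Type*} [AddCommGroup M] [Module R M]
    (F : (Σ n, Simplex U n) → (Σ n, Simplex V n) → M) (i j : ℕ) (σ : Simplex U i)
    (τ : Simplex V j) : tensorLift R F (gen i σ ⊗ₜ gen j τ) = F ⟨i, σ⟩ ⟨j, τ⟩ := by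
  simp [tensorLift, totLift_gen]

/-- The tensor `(x₀, …, xᵢ) ⊗ (yᵢ, …, yₙ)`. -/
noncomputable def frontBack {i j n : ℕ} (h : i + j = n) (s : Simplex (prodRel U V) n) :
    TotChain R U ⊗[R] TotChain R V :=
  gen i (front h s) ⊗ₜ gen j (back h s)

/-- Sums over `Fin` produce degrees such as n - i that agree with the expected ones only
propositionally; this lemma replaces transports between them. -/
theorem frontBack_congr {i j i' j' n : ℕ} (h : i + j = n) (h' : i' + j' = n) (hi : i = i')
    (s : Simplex (prodRel U V) n) : frontBack R h s = frontBack R h' s := by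
  subst hi
  obtain rfl : j = j' := by omega
  rfl

variable (U V) in
/-- The Alexander-Whitney map. -/
noncomputable def alexanderWhitney :
    TotChain R (prodRel U V) →ₗ[R] TotChain R U ⊗[R] TotChain R V :=
  totLift R
    (fun s => ∑ i : Fin (s.1 + 1), frontBack R (i := i) (j := s.1 - i) (by omega) s.2)

theorem alexanderWhitney_gen (n : ℕ) (s : Simplex (prodRel U V) n) :
    alexanderWhitney R U V (gen n s) =
      ∑ i : Fin (n + 1), frontBack R (i := i) (j := n - i) (by omega) s :=
  totLift_gen R _ _ _

variable (U V) in
/-- The boundary on the tensor product of the total chain modules. -/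
noncomputable abbrev tensorBoundary :
    TotChain R U ⊗[R] TotChain R V →ₗ[R] TotChain R U ⊗[R] TotChain R V :=
  TensorProduct.map (totBoundary R U) LinearMap.id +
    TensorProduct.map (totSign R U) (totBoundary R V)

theorem tensorBoundary_tensorBoundary (x : TotChain R U ⊗[R] TotChain R V) :
    tensorBoundary R U V (tensorBoundary R U V x) = 0 := by
  refine LinearMap.congr_fun (f := tensorBoundary R U V ∘ₗ tensorBoundary R U V) (g := 0)
    (TensorProduct.ext' fun a b => ?_) x
  simp [totBoundary_totBoundary, totSign_totBoundary, TensorProduct.neg_tmul]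

/-- The Leibniz rule for one summand of the Alexander-Whitney map. -/
theorem sum_frontBack_face {i j n : ℕ} (h : i + j = n) (s : Simplex (prodRel U V) (n + 1)) :
    ∑ k : Fin (n + 2), (-1 : R) ^ (k : ℕ) • frontBack R h (face k s) =
      TensorProduct.map (totBoundary R U) LinearMap.id
          (frontBack R (i := i + 1) (j := j) (by omega) s) +
        TensorProduct.map (totSign R U) (totBoundary R V)
          (frontBack R (i := i) (j := j + 1) (by omega) s) := by
  -- The Leibniz rule for cross products is applied to the universal cochains, which send a simplex
  -- to the chain that it generates.
  have := congrFun (coboundary_crossCochain R (TotChain R U) (TotChain R V) U V h (gen i)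
    (gen j)) s
  refine this.trans ?_
  simp only [frontBack, TensorProduct.map_tmul, totBoundary_gen_succ, LinearMap.id_apply,
    totSign_gen, ← TensorProduct.smul_tmul']
  rfl

/-- Sum the Leibniz rule over all cuts of the simplex. The terms of the tensor boundary that have no
counterpart are those which differentiate a 0-simplex, and these vanish. -/
theorem alexanderWhitney_totBoundary (x : TotChain R (prodRel U V)) :
    alexanderWhitney R U V (totBoundary R _ x) =
      tensorBoundary R U V (alexanderWhitney R U V x) := by
  refine LinearMap.congr_fun (f := alexanderWhitney R U V ∘ₗ totBoundary R _)
    (g := tensorBoundary R U V ∘ₗ alexanderWhitney R U V) (totChain_hom_ext R fun n s => ?_) x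
  rcases n with _ | n
  · simp [alexanderWhitney_gen, frontBack]
  · simp only [LinearMap.comp_apply, totBoundary_gen_succ, map_sum, map_smul,
      alexanderWhitney_gen, LinearMap.add_apply, Finset.smul_sum]
    rw [Finset.sum_comm, Finset.sum_congr rfl fun i _ => sum_frontBack_face R _ s,
      Finset.sum_add_distrib, Finset.sum_add_distrib]
    congr 1
    · rw [Fin.sum_univ_succ (n := n + 1)]
      have h0 : TensorProduct.map (totBoundary R U) LinearMap.id
          (frontBack R (i := ((0 : Fin (n + 2)) : ℕ)) (j := n + 1 - ((0 : Fin (n + 2)) : ℕ))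
            (by omega) s) = 0 := by
        rw [frontBack_congr R (i' := 0) (j' := n + 1) _ (by omega) (by simp)]
        simp [frontBack]
      rw [h0, zero_add]
      refine Finset.sum_congr rfl fun i _ => ?_
      rw [frontBack_congr R _ _ (Fin.val_succ i)]
    · rw [Fin.sum_univ_castSucc (n := n + 1)]
      have h0 : TensorProduct.map (totSign R U) (totBoundary R V)
          (frontBack R (i := (Fin.last (n + 1) : ℕ)) (j := n + 1 - (Fin.last (n + 1) : ℕ))
            (by simp) s) = 0 := by
        rw [frontBack_congr R (i' := n + 1) (j' := 0) _ (by omega) (by simp)]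
        simp [frontBack]
      rw [h0, add_zero]
      refine Finset.sum_congr rfl fun i _ => ?_
      rw [frontBack_congr R _ _ (Fin.val_castSucc i)]

theorem mem_prodRel_cone {p : X} (hp : ∀ x, (p, x) ∈ U) {q : Y} (hq : ∀ y, (q, y) ∈ V)
    (z : X × Y) : ((p, q), z) ∈ prodRel U V := ⟨hp z.1, hq z.2⟩

theorem frontBack_consSimplex_zero (p : X) (hp : ∀ x, (p, x) ∈ U) (q : Y) (hq : ∀ y, (q, y) ∈ V)
    (n : ℕ) (s : Simplex (prodRel U V) n) :
    frontBack R (i := 0) (j := n + 1) (by omega)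
      (consSimplex (U := prodRel U V) (p, q) (mem_prodRel_cone hp hq) s) =
    gen 0 (ptSimplex U p) ⊗ₜ gen (n + 1) (consSimplex q hq (back (i := 0) (by omega) s)) := by
  unfold frontBack
  refine congrArg₂ _ (congrArg _ ?_) (congrArg _ ?_)
  · refine Subtype.ext (funext fun i => ?_)
    obtain rfl : i = 0 := by omega
    rfl
  · refine Subtype.ext (funext fun i => ?_)
    induction i using Fin.cases with
    | zero => rfl
    | succ i =>
      simp only [back, consSimplex, Fin.cons_succ, Fin.val_succ, zero_add]
      rfl

theorem frontBack_consSimplex_succ (p : X) (hp : ∀ x, (p, x) ∈ U) (q : Y) (hq : ∀ y, (q, y) ∈ V)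
    {i j n : ℕ} (h : i + j = n) (s : Simplex (prodRel U V) n) :
    frontBack R (i := i + 1) (j := j) (by omega)
      (consSimplex (U := prodRel U V) (p, q) (mem_prodRel_cone hp hq) s) =
    gen (i + 1) (consSimplex p hp (front h s)) ⊗ₜ gen j (back h s) := by
  unfold frontBack
  refine congrArg₂ _ (congrArg _ ?_) (congrArg _ ?_)
  · refine Subtype.ext (funext fun i => ?_)
    induction i using Fin.cases with
    | zero => rfl
    | succ i =>
      simp only [front, consSimplex, Fin.cons_succ, Fin.val_succ]
      rfl
  · refine Subtype.ext (funext fun k => ?_)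
    simp only [back, consSimplex]
    have : (⟨i + 1 + k, by omega⟩ : Fin (n + 1 + 1)) = Fin.succ ⟨i + k, by omega⟩ :=
      Fin.ext (by simp; omega)
    rw [this, Fin.cons_succ]

/-- The idempotent which projects to a vertex in degree `0`. -/
noncomputable def ptProj (p : X) : TotChain R U →ₗ[R] TotChain R U :=
  (aug R U).smulRight (gen 0 (ptSimplex U p))

/-- The cone operator on the tensor product. -/
noncomputable def tensorConeOp (p : X) (hp : ∀ x, (p, x) ∈ U) (q : Y) (hq : ∀ y, (q, y) ∈ V) :
    TotChain R U ⊗[R] TotChain R V →ₗ[R] TotChain R U ⊗[R] TotChain R V :=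
  TensorProduct.map (coneOp R p hp) LinearMap.id +
    TensorProduct.map (ptProj R p) (coneOp R q hq)

/-- Cutting a cone at its first vertex leaves p alone in front and a cone with vertex q behind;
every later cut cones the front. These are the two terms of `tensorConeOp`. -/
theorem alexanderWhitney_coneOp (p : X) (hp : ∀ x, (p, x) ∈ U) (q : Y) (hq : ∀ y, (q, y) ∈ V)
    (x : TotChain R (prodRel U V)) :
    alexanderWhitney R U V (coneOp R (U := prodRel U V) (p, q) (mem_prodRel_cone hp hq) x) =
      tensorConeOp R p hp q hq (alexanderWhitney R U V x) := by
  refine LinearMap.congr_fun (f := alexanderWhitney R U V ∘ₗ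
      coneOp R (U := prodRel U V) (p, q) (mem_prodRel_cone hp hq))
    (g := tensorConeOp R p hp q hq ∘ₗ alexanderWhitney R U V)
    (totChain_hom_ext R fun n s => ?_) x
  simp only [LinearMap.comp_apply, coneOp_gen, alexanderWhitney_gen, map_sum]
  have h1 : ∀ i : Fin (n + 1), tensorConeOp R p hp q hq
      (frontBack R (i := i) (j := n - i) (by omega) s) =
      frontBack R (i := i + 1) (j := n - i) (by omega)
        (consSimplex (U := prodRel U V) (p, q) (mem_prodRel_cone hp hq) s) +
      TensorProduct.map (ptProj R p) (coneOp R q hq)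
        (frontBack R (i := i) (j := n - i) (by omega) s) := by
    intro i
    rw [frontBack_consSimplex_succ R p hp q hq (by omega)]
    simp [tensorConeOp, frontBack]
  rw [Finset.sum_congr rfl fun i _ => h1 i, Finset.sum_add_distrib, Fin.sum_univ_succ, add_comm]
  congr 1
  · refine Finset.sum_congr rfl fun i _ => ?_
    rw [frontBack_congr R _ _ (Fin.val_succ i).symm]
  · rw [Fin.sum_univ_succ, frontBack_congr R (i' := 0) (j' := n + 1) _ (by omega) (by simp),
      frontBack_consSimplex_zero R p hp q hq, Finset.sum_eq_zero, add_zero,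
      frontBack_congr R (i' := 0) (j' := n) _ (by omega) (by simp)]
    · simp [frontBack, ptProj]
    · intro i _
      rw [frontBack_congr R (i' := (i : ℕ) + 1) (j' := n - (i + 1)) _ (by omega) (by simp)]
      simp [frontBack, ptProj]

/-- Contract the first factor, and where it has been projected to p contract the second. -/
theorem tensorBoundary_tensorConeOp (p : X) (hp : ∀ x, (p, x) ∈ U) (q : Y)
    (hq : ∀ y, (q, y) ∈ V) (x : TotChain R U ⊗[R] TotChain R V) :
    tensorBoundary R U V (tensorConeOp R p hp q hq x) =
      x - TensorProduct.map (ptProj R p) (ptProj R q) x -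
        tensorConeOp R p hp q hq (tensorBoundary R U V x) := by
  refine LinearMap.congr_fun (f := tensorBoundary R U V ∘ₗ tensorConeOp R p hp q hq)
    (g := LinearMap.id - TensorProduct.map (ptProj R p) (ptProj R q) -
        tensorConeOp R p hp q hq ∘ₗ tensorBoundary R U V) (TensorProduct.ext' fun a b => ?_) x
  simp only [tensorConeOp, LinearMap.comp_apply, LinearMap.add_apply, LinearMap.sub_apply,
    TensorProduct.map_tmul, LinearMap.id_apply, map_add, totBoundary_coneOp, totSign_coneOp,
    ptProj, LinearMap.smulRight_apply, map_smul, totBoundary_gen_zero, totSign_gen, pow_zero,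
    one_smul, aug_totBoundary, aug_totSign, zero_smul, smul_zero, TensorProduct.zero_tmul,
    TensorProduct.sub_tmul, TensorProduct.tmul_sub, TensorProduct.neg_tmul]
  abel

/-! ### Acyclic models -/

variable (U V) in
/-- The mapping cone of the Alexander-Whitney map. -/
abbrev AWCone : Type _ := TotChain R (prodRel U V) × (TotChain R U ⊗[R] TotChain R V)

variable (U V) in
/-- The boundary on the mapping cone of the Alexander-Whitney map. -/
noncomputable def awBoundary : AWCone R U V →ₗ[R] AWCone R U V :=
  LinearMap.prod (-(totBoundary R _ ∘ₗ LinearMap.fst R _ _))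
    (alexanderWhitney R U V ∘ₗ LinearMap.fst R _ _ + tensorBoundary R U V ∘ₗ LinearMap.snd R _ _)

@[simp] theorem awBoundary_apply (x : AWCone R U V) : awBoundary R U V x =
    (-totBoundary R _ x.1, alexanderWhitney R U V x.1 + tensorBoundary R U V x.2) := rfl

theorem awBoundary_awBoundary (x : AWCone R U V) : awBoundary R U V (awBoundary R U V x) = 0 := by
  simp only [awBoundary_apply, map_neg, totBoundary_totBoundary, alexanderWhitney_totBoundary,
    map_add, tensorBoundary_tensorBoundary]
  simp

/-- The contraction of the mapping cone if there are cone points. -/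
noncomputable def awConeOp (p : X) (hp : ∀ x, (p, x) ∈ U) (q : Y) (hq : ∀ y, (q, y) ∈ V) :
    AWCone R U V →ₗ[R] AWCone R U V :=
  LinearMap.prod
    (-(coneOp R (U := prodRel U V) (p, q) (mem_prodRel_cone hp hq) ∘ₗ LinearMap.fst R _ _) +
      (LinearMap.toSpanSingleton R _ (gen 0 (ptSimplex (prodRel U V) (p, q))) ∘ₗ
        (TensorProduct.lid R R).toLinearMap ∘ₗ TensorProduct.map (aug R U) (aug R V)) ∘ₗ
        LinearMap.snd R _ _)
    (tensorConeOp R p hp q hq ∘ₗ LinearMap.snd R _ _)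

theorem awConeOp_apply (p : X) (hp : ∀ x, (p, x) ∈ U) (q : Y) (hq : ∀ y, (q, y) ∈ V)
    (x : AWCone R U V) : awConeOp R p hp q hq x =
      (-coneOp R (U := prodRel U V) (p, q) (mem_prodRel_cone hp hq) x.1 +
        TensorProduct.lid R R (TensorProduct.map (aug R U) (aug R V) x.2) •
          gen 0 (ptSimplex (prodRel U V) (p, q)), tensorConeOp R p hp q hq x.2) := rfl

theorem aug_tensorBoundary (x : TotChain R U ⊗[R] TotChain R V) :
    TensorProduct.map (aug R U) (aug R V) (tensorBoundary R U V x) = 0 := by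
  refine LinearMap.congr_fun (f := TensorProduct.map (aug R U) (aug R V) ∘ₗ
    tensorBoundary R U V) (g := 0) (TensorProduct.ext' fun a b => ?_) x
  simp [aug_totBoundary]

theorem aug_alexanderWhitney (x : TotChain R (prodRel U V)) :
    TensorProduct.lid R R (TensorProduct.map (aug R U) (aug R V) (alexanderWhitney R U V x)) =
      aug R _ x := by
  refine LinearMap.congr_fun (f := (TensorProduct.lid R R).toLinearMap ∘ₗ
    TensorProduct.map (aug R U) (aug R V) ∘ₗ alexanderWhitney R U V) (g := aug R _)
    (totChain_hom_ext R fun n s => ?_) x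
  rcases n with _ | n
  · simp [alexanderWhitney_gen, frontBack]
  · simp only [LinearMap.comp_apply, alexanderWhitney_gen, map_sum, aug_gen_succ]
    refine Finset.sum_eq_zero fun i _ => ?_
    induction i using Fin.cases with
    | zero =>
      rw [frontBack_congr R (i' := 0) (j' := n + 1) _ (by omega) (by simp)]
      simp [frontBack]
    | succ i =>
      rw [frontBack_congr R (i' := (i : ℕ) + 1) (j' := n - i) _ (by omega) (by simp)]
      simp [frontBack]

theorem ptProj_tensor (p : X) (q : Y) (x : TotChain R U ⊗[R] TotChain R V) :
    TensorProduct.map (ptProj R p) (ptProj R q) x =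
      TensorProduct.lid R R (TensorProduct.map (aug R U) (aug R V) x) •
        (gen 0 (ptSimplex U p) ⊗ₜ gen 0 (ptSimplex V q)) := by
  induction x with
  | zero => simp
  | add a b ha hb => simp only [map_add, ha, hb, add_smul]
  | tmul a b => simp [ptProj, TensorProduct.smul_tmul', TensorProduct.tmul_smul, smul_smul, mul_comm]

theorem alexanderWhitney_pt (p : X) (q : Y) :
    alexanderWhitney R U V (gen 0 (ptSimplex (prodRel U V) (p, q))) =
      gen 0 (ptSimplex U p) ⊗ₜ gen 0 (ptSimplex V q) := by
  rw [alexanderWhitney_gen, Fin.sum_univ_one]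
  rfl

/-- The cones contract the source and the target of the Alexander-Whitney map compatibly, each to a
vertex. The augmentation term cancels the two vertices against each other, so that the contraction
of the mapping cone is complete. -/
theorem awBoundary_awConeOp (p : X) (hp : ∀ x, (p, x) ∈ U) (q : Y) (hq : ∀ y, (q, y) ∈ V)
    (x : AWCone R U V) :
    awBoundary R U V (awConeOp R p hp q hq x) =
      x - awConeOp R p hp q hq (awBoundary R U V x) := by
  obtain ⟨x, y⟩ := x
  simp only [awBoundary_apply, awConeOp_apply, map_add, map_neg, map_smul, totBoundary_coneOp,
    totBoundary_gen_zero, smul_zero, alexanderWhitney_coneOp R p hp q hq, tensorBoundary_tensorConeOp,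
    aug_tensorBoundary, aug_alexanderWhitney, add_zero, alexanderWhitney_pt,
    ptProj_tensor, Prod.mk_sub_mk, Prod.mk.injEq]
  constructor <;> abel

end AlexanderWhitney

end VR

namespace VR

/-! ### A natural contraction by acyclic models. -/

section AcyclicModels

variable (R : Type*) [CommRing R] {X Y X' Y' X'' Y'' : Type*} {U : Set (X × X)} {V : Set (Y × Y)}
  {U' : Set (X' × X')} {V' : Set (Y' × Y')} {U'' : Set (X'' × X'')} {V'' : Set (Y'' × Y'')}

theorem prodMap_mem {φ : X' → X} {ψ : Y' → Y} (hφ : ∀ p ∈ U', (φ p.1, φ p.2) ∈ U)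
    (hψ : ∀ p ∈ V', (ψ p.1, ψ p.2) ∈ V) (p : (X' × Y') × (X' × Y')) (hp : p ∈ prodRel U' V') :
    (Prod.map φ ψ p.1, Prod.map φ ψ p.2) ∈ prodRel U V :=
  ⟨hφ _ hp.1, hψ _ hp.2⟩

theorem alexanderWhitney_totMap {φ : X' → X} {ψ : Y' → Y} (hφ : ∀ p ∈ U', (φ p.1, φ p.2) ∈ U)
    (hψ : ∀ p ∈ V', (ψ p.1, ψ p.2) ∈ V) (x : TotChain R (prodRel U' V')) :
    alexanderWhitney R U V (totMap R (Prod.map φ ψ) (prodMap_mem hφ hψ) x) =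
      TensorProduct.map (totMap R φ hφ) (totMap R ψ hψ) (alexanderWhitney R U' V' x) := by
  refine LinearMap.congr_fun
    (f := alexanderWhitney R U V ∘ₗ totMap R (Prod.map φ ψ) (prodMap_mem hφ hψ))
    (g := TensorProduct.map (totMap R φ hφ) (totMap R ψ hψ) ∘ₗ alexanderWhitney R U' V')
    (totChain_hom_ext R fun n s => ?_) x
  simp only [LinearMap.comp_apply, totMap_gen, alexanderWhitney_gen, map_sum, frontBack,
    TensorProduct.map_tmul]
  rfl

/-- The map induced on the mapping cones of the Alexander-Whitney maps. -/
noncomputable def awMap {φ : X' → X} {ψ : Y' → Y} (hφ : ∀ p ∈ U', (φ p.1, φ p.2) ∈ U)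
    (hψ : ∀ p ∈ V', (ψ p.1, ψ p.2) ∈ V) : AWCone R U' V' →ₗ[R] AWCone R U V :=
  LinearMap.prodMap (totMap R (Prod.map φ ψ) (prodMap_mem hφ hψ))
    (TensorProduct.map (totMap R φ hφ) (totMap R ψ hψ))

theorem awBoundary_awMap {φ : X' → X} {ψ : Y' → Y} (hφ : ∀ p ∈ U', (φ p.1, φ p.2) ∈ U)
    (hψ : ∀ p ∈ V', (ψ p.1, ψ p.2) ∈ V) (x : AWCone R U' V') :
    awBoundary R U V (awMap R hφ hψ x) = awMap R hφ hψ (awBoundary R U' V' x) := by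
  have h : ∀ y, tensorBoundary R U V (TensorProduct.map (totMap R φ hφ) (totMap R ψ hψ) y) =
      TensorProduct.map (totMap R φ hφ) (totMap R ψ hψ) (tensorBoundary R U' V' y) := by
    intro y
    refine LinearMap.congr_fun
      (f := tensorBoundary R U V ∘ₗ TensorProduct.map (totMap R φ hφ) (totMap R ψ hψ))
      (g := TensorProduct.map (totMap R φ hφ) (totMap R ψ hψ) ∘ₗ tensorBoundary R U' V')
      (TensorProduct.ext' fun a b => ?_) y
    simp [totBoundary_totMap, totSign_totMap]
  simp only [awMap, awBoundary_apply, LinearMap.prodMap_apply, totBoundary_totMap,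
    alexanderWhitney_totMap R hφ hψ, h, map_neg, map_add]

theorem awMap_awMap {φ : X' → X} {ψ : Y' → Y} (hφ : ∀ p ∈ U', (φ p.1, φ p.2) ∈ U)
    (hψ : ∀ p ∈ V', (ψ p.1, ψ p.2) ∈ V) {φ' : X'' → X'} {ψ' : Y'' → Y'}
    (hφ' : ∀ p ∈ U'', (φ' p.1, φ' p.2) ∈ U') (hψ' : ∀ p ∈ V'', (ψ' p.1, ψ' p.2) ∈ V')
    {φ'' : X'' → X} {ψ'' : Y'' → Y} (hφ'' : ∀ p ∈ U'', (φ'' p.1, φ'' p.2) ∈ U)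
    (hψ'' : ∀ p ∈ V'', (ψ'' p.1, ψ'' p.2) ∈ V) (h : φ'' = φ ∘ φ') (k : ψ'' = ψ ∘ ψ')
    (x : AWCone R U'' V'') :
    awMap R hφ hψ (awMap R hφ' hψ' x) = awMap R hφ'' hψ'' x := by
  subst h k
  refine LinearMap.congr_fun (f := awMap R hφ hψ ∘ₗ awMap R hφ' hψ')
    (g := awMap R hφ'' hψ'') (LinearMap.prod_ext (totChain_hom_ext R fun n s => ?_)
      (tensor_hom_ext R fun i j σ τ => ?_)) x
  · simp only [awMap, LinearMap.comp_apply, LinearMap.inl_apply, LinearMap.prodMap_apply,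
      totMap_gen, map_zero]
    rfl
  · simp only [awMap, LinearMap.comp_apply, LinearMap.inr_apply, LinearMap.prodMap_apply,
      totMap_gen, map_zero, TensorProduct.map_tmul]
    rfl

/-- The order relation of `{0, …, n}`. -/
def leRel (n : ℕ) : Set (Fin (n + 1) × Fin (n + 1)) := {p | p.1 ≤ p.2}

theorem leRel_refl (n : ℕ) (i : Fin (n + 1)) : (i, i) ∈ leRel n := le_refl i

/-- The simplex `(0, …, n)`. -/
def idSimplex (n : ℕ) : Simplex (leRel n) n := ⟨id, fun _ _ h => le_of_lt h⟩

/-- The simplex `((0, 0), …, (n, n))`. -/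
def diagSimplex (n : ℕ) : Simplex (prodRel (leRel n) (leRel n)) n :=
  ⟨fun i => (i, i), fun _ _ h => ⟨le_of_lt h, le_of_lt h⟩⟩

/-- The vertex map of a simplex is a map of relations from the model {0, …, n} with its order. Since
the order is reflexive, U must contain the diagonal. -/
theorem Simplex.rel (hU : ∀ x, (x, x) ∈ U) {n : ℕ} (σ : Simplex U n)
    (p : Fin (n + 1) × Fin (n + 1)) (hp : p ∈ leRel n) : (σ.1 p.1, σ.1 p.2) ∈ U := by
  rcases eq_or_lt_of_le (show p.1 ≤ p.2 from hp) with h | h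
  · rw [h]; exact hU _
  · exact σ.2 h

/-- The first component of a simplex. -/
def fstSimplex {n : ℕ} (s : Simplex (prodRel U V) n) : Simplex U n :=
  simplexMap Prod.fst (fun _ h => h.1) s

/-- The second component of a simplex. -/
def sndSimplex {n : ℕ} (s : Simplex (prodRel U V) n) : Simplex V n :=
  simplexMap Prod.snd (fun _ h => h.2) s

/-- Elements of the mapping cones of the Alexander-Whitney maps on the models. -/
abbrev ModelFamily : Type _ :=
  (∀ n, AWCone R (leRel n) (leRel n)) × (∀ i j, AWCone R (leRel i) (leRel j))

/-- The natural operator with given values on the models. -/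
noncomputable def natOp (s : ModelFamily R) (hU : ∀ x, (x, x) ∈ U) (hV : ∀ y, (y, y) ∈ V) :
    AWCone R U V →ₗ[R] AWCone R U V :=
  LinearMap.coprod
    (totLift R fun t => awMap R ((fstSimplex t.2).rel hU) ((sndSimplex t.2).rel hV) (s.1 t.1))
    (tensorLift R fun a b => awMap R (a.2.rel hU) (b.2.rel hV) (s.2 a.1 b.1))

theorem natOp_inl (s : ModelFamily R) (hU : ∀ x, (x, x) ∈ U) (hV : ∀ y, (y, y) ∈ V) (n : ℕ)
    (t : Simplex (prodRel U V) n) : natOp R s hU hV (gen n t, 0) =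
      awMap R ((fstSimplex t).rel hU) ((sndSimplex t).rel hV) (s.1 n) := by
  simp [natOp, totLift_gen]

theorem natOp_inr (s : ModelFamily R) (hU : ∀ x, (x, x) ∈ U) (hV : ∀ y, (y, y) ∈ V) (i j : ℕ)
    (σ : Simplex U i) (τ : Simplex V j) : natOp R s hU hV (0, gen i σ ⊗ₜ gen j τ) =
      awMap R (σ.rel hU) (τ.rel hV) (s.2 i j) := by
  simp [natOp]

/-- Generators are images of model generators, and a map acts on a generator by composition. Hence
values prescribed on the models always give a natural operator. -/
theorem natOp_awMap (s : ModelFamily R) (hU : ∀ x, (x, x) ∈ U) (hV : ∀ y, (y, y) ∈ V)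
    (hU' : ∀ x, (x, x) ∈ U') (hV' : ∀ y, (y, y) ∈ V') {φ : X' → X} {ψ : Y' → Y}
    (hφ : ∀ p ∈ U', (φ p.1, φ p.2) ∈ U) (hψ : ∀ p ∈ V', (ψ p.1, ψ p.2) ∈ V)
    (x : AWCone R U' V') :
    natOp R s hU hV (awMap R hφ hψ x) = awMap R hφ hψ (natOp R s hU' hV' x) := by
  refine LinearMap.congr_fun (f := natOp R s hU hV ∘ₗ awMap R hφ hψ)
    (g := awMap R hφ hψ ∘ₗ natOp R s hU' hV') (LinearMap.prod_ext
      (totChain_hom_ext R fun n s => ?_) (tensor_hom_ext R fun i j σ τ => ?_)) x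
  · simp only [LinearMap.comp_apply, LinearMap.inl_apply, natOp_inl]
    simp only [awMap, LinearMap.prodMap_apply, totMap_gen, map_zero]
    rw [natOp_inl]
    exact (awMap_awMap R hφ hψ _ _ _ _ rfl rfl _).symm
  · simp only [LinearMap.comp_apply, LinearMap.inr_apply, natOp_inr]
    simp only [awMap, LinearMap.prodMap_apply, totMap_gen, map_zero, TensorProduct.map_tmul]
    rw [natOp_inr]
    exact (awMap_awMap R hφ hψ _ _ _ _ rfl rfl _).symm

/-- A linear map vanishes on all generators of degree less than `N`. -/
def VanishesBelow {M : Type*} [AddCommGroup M] [Module R M] (N : ℕ)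
    (F : AWCone R U V →ₗ[R] M) : Prop :=
  -- Simplices of the product are shifted by one degree in the mapping cone.
  (∀ n (t : Simplex (prodRel U V) n), n + 1 < N → F (gen n t, 0) = 0) ∧
    ∀ i j (σ : Simplex U i) (τ : Simplex V j), i + j < N → F (0, gen i σ ⊗ₜ gen j τ) = 0

/-- The boundary of the mapping cone lowers degrees by one, so the range of vanishing grows by one;
`VanishesBelow.awBoundary_inr` treats the other component. -/
theorem VanishesBelow.awBoundary_inl {M : Type*} [AddCommGroup M] [Module R M] {N : ℕ}
    {F : AWCone R U V →ₗ[R] M} (h : VanishesBelow R N F) (n : ℕ) (t : Simplex (prodRel U V) n)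
    (hn : n + 1 < N + 1) : F (awBoundary R U V (gen n t, 0)) = 0 := by
  have h1 : ∀ a b, F (a, b) = F.comp (LinearMap.inl R _ _) a + F.comp (LinearMap.inr R _ _) b := by
    intro a b
    simp [← map_add]
  rw [awBoundary_apply, h1]
  simp only [map_zero, add_zero, map_neg]
  have h2 : F.comp (LinearMap.inl R _ _) (totBoundary R _ (gen n t)) = 0 := by
    rcases n with _ | n
    · rw [totBoundary_gen_zero, map_zero]
    · simp only [totBoundary_gen_succ, map_sum, map_smul]
      refine Finset.sum_eq_zero fun k _ => ?_
      rw [LinearMap.comp_apply, LinearMap.inl_apply, h.1 _ _ (by omega), smul_zero]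
  have h3 : F.comp (LinearMap.inr R _ _) (alexanderWhitney R U V (gen n t)) = 0 := by
    simp only [alexanderWhitney_gen, map_sum]
    refine Finset.sum_eq_zero fun k _ => ?_
    rw [LinearMap.comp_apply, LinearMap.inr_apply, frontBack, h.2 _ _ _ _ (by omega)]
  rw [h2, h3, neg_zero, add_zero]

theorem VanishesBelow.awBoundary_inr {M : Type*} [AddCommGroup M] [Module R M] {N : ℕ}
    {F : AWCone R U V →ₗ[R] M} (h : VanishesBelow R N F) (i j : ℕ) (σ : Simplex U i)
    (τ : Simplex V j) (hn : i + j < N + 1) :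
    F (awBoundary R U V (0, gen i σ ⊗ₜ gen j τ)) = 0 := by
  have h1 : ∀ b, F (0, b) = F.comp (LinearMap.inr R _ _) b := fun b => rfl
  rw [awBoundary_apply]
  simp only [map_zero, neg_zero, zero_add, h1]
  rw [LinearMap.add_apply, map_add, TensorProduct.map_tmul, TensorProduct.map_tmul]
  have h2 : F.comp (LinearMap.inr R _ _) (totBoundary R U (gen i σ) ⊗ₜ gen j τ) = 0 := by
    rcases i with _ | i
    · rw [totBoundary_gen_zero, TensorProduct.zero_tmul, map_zero]
    · simp only [totBoundary_gen_succ, TensorProduct.sum_tmul, map_sum, ← TensorProduct.smul_tmul',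
        map_smul]
      refine Finset.sum_eq_zero fun k _ => ?_
      rw [LinearMap.comp_apply, LinearMap.inr_apply, h.2 _ _ _ _ (by omega), smul_zero]
  have h3 : F.comp (LinearMap.inr R _ _)
      (totSign R U (gen i σ) ⊗ₜ totBoundary R V (gen j τ)) = 0 := by
    rcases j with _ | j
    · rw [totBoundary_gen_zero, TensorProduct.tmul_zero, map_zero]
    · simp only [totBoundary_gen_succ, TensorProduct.tmul_sum, map_sum, totSign_gen,
        ← TensorProduct.smul_tmul', TensorProduct.tmul_smul, map_smul]
      refine Finset.sum_eq_zero fun k _ => ?_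
      rw [LinearMap.comp_apply, LinearMap.inr_apply, h.2 _ _ _ _ (by omega), smul_zero, smul_zero]
  rw [LinearMap.id_apply, h2, h3, add_zero]

theorem zero_mem_leRel (n : ℕ) (k : Fin (n + 1)) : ((0 : Fin (n + 1)), k) ∈ leRel n :=
  Fin.zero_le k

/-- The contraction on the model `(i, j)`. -/
noncomputable def modelCone (i j : ℕ) :
    AWCone R (leRel i) (leRel j) →ₗ[R] AWCone R (leRel i) (leRel j) :=
  awConeOp R 0 (zero_mem_leRel i) 0 (zero_mem_leRel j)

/-- The approximations of a natural contraction of the mapping cone of the Alexander-Whitney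
map. -/
noncomputable def contractionFamily : ℕ → ModelFamily R
  | 0 => (fun _ => 0, fun _ _ => 0)
  | N + 1 =>
    -- If the contraction h is correct one degree lower, then u - h∂u is a cycle for each model
    -- generator u, and the cone contraction provides a chain that it bounds.
    (fun n => modelCone R n n ((gen n (diagSimplex n), 0) -
        natOp R (contractionFamily N) (leRel_refl n) (leRel_refl n)
          (awBoundary R _ _ (gen n (diagSimplex n), 0))),
      fun i j => modelCone R i j ((0, gen i (idSimplex i) ⊗ₜ gen j (idSimplex j)) -
        natOp R (contractionFamily N) (leRel_refl i) (leRel_refl j)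
          (awBoundary R _ _ (0, gen i (idSimplex i) ⊗ₜ gen j (idSimplex j)))))

/-- The natural operator of `contractionFamily`. -/
noncomputable abbrev contractionOp (N : ℕ) (hU : ∀ x, (x, x) ∈ U) (hV : ∀ y, (y, y) ∈ V) :
    AWCone R U V →ₗ[R] AWCone R U V := natOp R (contractionFamily R N) hU hV

/-- The failure of `contractionOp` to be a contraction. -/
noncomputable abbrev contractionDefect (N : ℕ) (hU : ∀ x, (x, x) ∈ U) (hV : ∀ y, (y, y) ∈ V) :
    AWCone R U V →ₗ[R] AWCone R U V :=
  awBoundary R U V ∘ₗ contractionOp R N hU hV + contractionOp R N hU hV ∘ₗ awBoundary R U V -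
    LinearMap.id

/-- The contraction identity at ∂u makes u - h∂u a cycle, so coning it gives the identity at u;
naturality transports this along φ and ψ. The value at u depends on the previous stage only through
∂u, hence it becomes stable one degree after the values at ∂u. -/
theorem contraction_step {N : ℕ} (hU : ∀ x, (x, x) ∈ U) (hV : ∀ y, (y, y) ∈ V) {i j : ℕ}
    {φ : Fin (i + 1) → X} {ψ : Fin (j + 1) → Y} (hφ : ∀ p ∈ leRel i, (φ p.1, φ p.2) ∈ U)
    (hψ : ∀ p ∈ leRel j, (ψ p.1, ψ p.2) ∈ V) (u : AWCone R (leRel i) (leRel j))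
    (hu : ∀ N, contractionOp R (N + 1) hU hV (awMap R hφ hψ u) = awMap R hφ hψ (modelCone R i j
      (u - contractionOp R N (leRel_refl i) (leRel_refl j) (awBoundary R _ _ u))))
    (hd : contractionDefect R N (leRel_refl i) (leRel_refl j) (awBoundary R _ _ u) = 0)
    (hs : (contractionOp R (N + 1) (leRel_refl i) (leRel_refl j) -
      contractionOp R N (leRel_refl i) (leRel_refl j)) (awBoundary R _ _ u) = 0) :
    contractionDefect R (N + 1) hU hV (awMap R hφ hψ u) = 0 ∧
    (contractionOp R (N + 2) hU hV - contractionOp R (N + 1) hU hV) (awMap R hφ hψ u) = 0 := by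
  rw [LinearMap.sub_apply, sub_eq_zero] at hs
  constructor
  · have h1 : awBoundary R _ _
        (u - contractionOp R N (leRel_refl i) (leRel_refl j) (awBoundary R _ _ u)) = 0 := by
      simp only [LinearMap.sub_apply, LinearMap.add_apply, LinearMap.comp_apply,
        LinearMap.id_apply, awBoundary_awBoundary, map_zero, add_zero] at hd
      rw [map_sub, sub_eq_zero.1 hd, sub_self]
    rw [LinearMap.sub_apply, LinearMap.add_apply, LinearMap.comp_apply, LinearMap.comp_apply, hu,
      awBoundary_awMap, awBoundary_awMap, natOp_awMap R _ hU hV (leRel_refl i) (leRel_refl j), hs,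
      modelCone, awBoundary_awConeOp, h1]
    simp
  · rw [LinearMap.sub_apply, hu (N + 1), hu N, hs, sub_self]

/-- Every generator comes from a generator of a model, so `contraction_step` only needs information
about models in lower degrees. -/
theorem contraction_vanishes_succ {N : ℕ}
    (hd : ∀ i j, VanishesBelow R N (contractionDefect R N (leRel_refl i) (leRel_refl j)))
    (hs : ∀ i j, VanishesBelow R N (contractionOp R (N + 1) (leRel_refl i) (leRel_refl j) -
      contractionOp R N (leRel_refl i) (leRel_refl j)))
    (hU : ∀ x, (x, x) ∈ U) (hV : ∀ y, (y, y) ∈ V) :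
    VanishesBelow R (N + 1) (contractionDefect R (N + 1) hU hV) ∧
    VanishesBelow R (N + 1) (contractionOp R (N + 2) hU hV - contractionOp R (N + 1) hU hV) := by
  have h1 : ∀ n (t : Simplex (prodRel U V) n), n + 1 < N + 1 →
      contractionDefect R (N + 1) hU hV (gen n t, 0) = 0 ∧
      (contractionOp R (N + 2) hU hV - contractionOp R (N + 1) hU hV) (gen n t, 0) = 0 := by
    intro n t hn
    have e : (gen n t, 0) = awMap R ((fstSimplex t).rel hU) ((sndSimplex t).rel hV)
        (gen n (diagSimplex n), 0) := by
      simp only [awMap, LinearMap.prodMap_apply, totMap_gen, map_zero]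
      rfl
    rw [e]
    refine contraction_step R hU hV _ _ _ (fun M => ?_) ((hd n n).awBoundary_inl R _ _ hn)
      ((hs n n).awBoundary_inl R _ _ hn)
    rw [← e, contractionOp, natOp_inl]
    rfl
  have h2 : ∀ i j (σ : Simplex U i) (τ : Simplex V j), i + j < N + 1 →
      contractionDefect R (N + 1) hU hV (0, gen i σ ⊗ₜ gen j τ) = 0 ∧
      (contractionOp R (N + 2) hU hV - contractionOp R (N + 1) hU hV)
        (0, gen i σ ⊗ₜ gen j τ) = 0 := by
    intro i j σ τ hn
    have e : (0, gen i σ ⊗ₜ gen j τ) = awMap R (σ.rel hU) (τ.rel hV)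
        (0, gen i (idSimplex i) ⊗ₜ gen j (idSimplex j)) := by
      simp only [awMap, LinearMap.prodMap_apply, totMap_gen, map_zero, TensorProduct.map_tmul]
      rfl
    rw [e]
    refine contraction_step R hU hV _ _ _ (fun M => ?_) ((hd i j).awBoundary_inr R _ _ _ _ hn)
      ((hs i j).awBoundary_inr R _ _ _ _ hn)
    rw [← e, contractionOp, natOp_inr]
    rfl
  exact ⟨⟨fun n t h => (h1 n t h).1, fun i j σ τ h => (h2 i j σ τ h).1⟩,
    ⟨fun n t h => (h1 n t h).2, fun i j σ τ h => (h2 i j σ τ h).2⟩⟩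

theorem contraction_vanishes_model (N : ℕ) :
    (∀ i j, VanishesBelow R N (contractionDefect R N (leRel_refl i) (leRel_refl j))) ∧
    (∀ i j, VanishesBelow R N (contractionOp R (N + 1) (leRel_refl i) (leRel_refl j) -
      contractionOp R N (leRel_refl i) (leRel_refl j))) := by
  induction N with
  | zero => exact ⟨fun i j => ⟨fun _ _ h => by omega, fun _ _ _ _ h => by omega⟩,
      fun i j => ⟨fun _ _ h => by omega, fun _ _ _ _ h => by omega⟩⟩
  | succ N ih =>
    exact ⟨fun i j => (contraction_vanishes_succ R ih.1 ih.2 _ _).1,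
      fun i j => (contraction_vanishes_succ R ih.1 ih.2 _ _).2⟩

theorem contraction_vanishes (N : ℕ) (hU : ∀ x, (x, x) ∈ U) (hV : ∀ y, (y, y) ∈ V) :
    VanishesBelow R N (contractionDefect R N hU hV) ∧
    VanishesBelow R N (contractionOp R (N + 1) hU hV - contractionOp R N hU hV) := by
  cases N with
  | zero => exact ⟨⟨fun _ _ h => by omega, fun _ _ _ _ h => by omega⟩,
      ⟨fun _ _ h => by omega, fun _ _ _ _ h => by omega⟩⟩
  | succ N =>
    exact contraction_vanishes_succ R (contraction_vanishes_model R N).1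
      (contraction_vanishes_model R N).2 hU hV

theorem contraction_stable (N M : ℕ) (h : N ≤ M) (hU : ∀ x, (x, x) ∈ U) (hV : ∀ y, (y, y) ∈ V) :
    VanishesBelow R N (contractionOp R M hU hV - contractionOp R N hU hV) := by
  induction M, h using Nat.le_induction with
  | base => rw [sub_self]; exact ⟨fun _ _ _ => rfl, fun _ _ _ _ _ => rfl⟩
  | succ M hM ih =>
    have h1 := (contraction_vanishes R M hU hV).2
    rw [← sub_add_sub_cancel _ (contractionOp R M hU hV)]
    refine ⟨fun n t hn => ?_, fun i j σ τ hn => ?_⟩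
    · rw [LinearMap.add_apply, ih.1 n t hn, h1.1 n t (by omega), add_zero]
    · rw [LinearMap.add_apply, ih.2 i j σ τ hn, h1.2 i j σ τ (by omega), add_zero]

/-- The mapping cone of the Alexander-Whitney map is contractible. -/
theorem exists_awContraction (hU : ∀ x, (x, x) ∈ U) (hV : ∀ y, (y, y) ∈ V) :
    ∃ h : AWCone R U V →ₗ[R] AWCone R U V,
      ∀ x, awBoundary R U V (h x) + h (awBoundary R U V x) = x := by
  -- In degree n + 1 all stages from n + 2 on agree, and in degree i + j all stages from i + j + 1
  -- on. These values are therefore the limit of the approximations.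
  let s : ModelFamily R := (fun n => (contractionFamily R (n + 2)).1 n,
    fun i j => (contractionFamily R (i + j + 1)).2 i j)
  have hs : ∀ N, VanishesBelow R N (natOp R s hU hV - contractionOp R N hU hV) := by
    intro N
    refine ⟨fun n t hn => ?_, fun i j σ τ hn => ?_⟩
    · have := (contraction_stable R (n + 2) N (by omega) hU hV).1 n t (by omega)
      rw [LinearMap.sub_apply, sub_eq_zero, contractionOp, contractionOp, natOp_inl] at this
      rw [LinearMap.sub_apply, natOp_inl, contractionOp, natOp_inl, this, natOp_inl, sub_self]
    · have := (contraction_stable R (i + j + 1) N (by omega) hU hV).2 i j σ τ (by omega)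
      rw [LinearMap.sub_apply, sub_eq_zero, contractionOp, contractionOp, natOp_inr] at this
      rw [LinearMap.sub_apply, natOp_inr, contractionOp, natOp_inr, this, natOp_inr, sub_self]
  refine ⟨natOp R s hU hV, fun x => ?_⟩
  have key : awBoundary R U V ∘ₗ natOp R s hU hV + natOp R s hU hV ∘ₗ awBoundary R U V =
      LinearMap.id := by
    have step : ∀ (N : ℕ) (x : AWCone R U V),
        contractionDefect R N hU hV x = 0 →
        (natOp R s hU hV - contractionOp R N hU hV) x = 0 →
        (natOp R s hU hV - contractionOp R N hU hV) (awBoundary R U V x) = 0 →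
        (awBoundary R U V ∘ₗ natOp R s hU hV + natOp R s hU hV ∘ₗ awBoundary R U V) x = x := by
      intro N x h1 h2 h3
      rw [LinearMap.sub_apply, sub_eq_zero] at h2 h3
      rw [LinearMap.add_apply, LinearMap.comp_apply, LinearMap.comp_apply, h2, h3]
      rw [LinearMap.sub_apply, sub_eq_zero] at h1
      exact h1
    refine LinearMap.prod_ext (totChain_hom_ext R fun n t => ?_)
      (tensor_hom_ext R fun i j σ τ => ?_)
    · exact step (n + 2) _ ((contraction_vanishes R (n + 2) hU hV).1.1 n t (by omega))
        ((hs (n + 2)).1 n t (by omega)) ((hs (n + 2)).awBoundary_inl R n t (by omega))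
    · exact step (i + j + 1) _ ((contraction_vanishes R (i + j + 1) hU hV).1.2 i j σ τ (by omega))
        ((hs (i + j + 1)).2 i j σ τ (by omega))
        ((hs (i + j + 1)).awBoundary_inr R i j σ τ (by omega))
  exact LinearMap.congr_fun key x

end AcyclicModels

end VR

/-! ### Bounded duals of filtered families. -/

section BoundedDual

variable {R : Type*} [CommRing R] {A B : Type*} [AddCommGroup A] [Module R A] [AddCommGroup B]
  [Module R B]

/-- The linear maps which vanish on all but finitely many of the submodules `F n`. -/
def boundedDual (F : ℕ → Submodule R A) (G : Type*) [AddCommGroup G] [Module R G] :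
    Submodule R (A →ₗ[R] G) where
  carrier := {f | ∃ N, ∀ n, N ≤ n → ∀ x ∈ F n, f x = 0}
  zero_mem' := ⟨0, fun _ _ _ _ => rfl⟩
  add_mem' := by
    rintro f g ⟨N, hN⟩ ⟨M, hM⟩
    refine ⟨max N M, fun n hn x hx => ?_⟩
    rw [LinearMap.add_apply, hN n (le_of_max_le_left hn) x hx,
      hM n (le_of_max_le_right hn) x hx, add_zero]
  smul_mem' := by
    rintro a f ⟨N, hN⟩
    exact ⟨N, fun n hn x hx => by rw [LinearMap.smul_apply, hN n hn x hx, smul_zero]⟩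

/-- A map which lowers degrees by at most one. -/
def IsGradedMap (F : ℕ → Submodule R A) (F' : ℕ → Submodule R B) (φ : A →ₗ[R] B) : Prop :=
  ∀ n, ∃ m, n ≤ m + 1 ∧ ∀ x ∈ F n, φ x ∈ F' m

variable {F : ℕ → Submodule R A} {F' : ℕ → Submodule R B} {φ : A →ₗ[R] B}

/-- The map of bounded duals induced by a graded map. -/
def boundedDualMap (G : Type*) [AddCommGroup G] [Module R G] (hφ : IsGradedMap F F' φ) :
    boundedDual F' G →ₗ[R] boundedDual F G :=
  (φ.lcomp R G).restrict (by
    rintro f ⟨N, hN⟩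
    refine ⟨N + 1, fun n hn x hx => ?_⟩
    obtain ⟨m, hm, h⟩ := hφ n
    exact hN m (by omega) _ (h x hx))

@[simp] theorem boundedDualMap_apply (G : Type*) [AddCommGroup G] [Module R G]
    (hφ : IsGradedMap F F' φ) (f : boundedDual F' G) (x : A) :
    (boundedDualMap G hφ f).1 x = f.1 (φ x) := rfl

end BoundedDual

namespace VR

/-! ### Bounded cochains and the dual Alexander-Whitney map. -/

section Cochains

variable (R : Type*) [CommRing R] {X Y X' Y' : Type*} (U : Set (X × X)) (V : Set (Y × Y))
  (G : Type*) [AddCommGroup G] [Module R G]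

/-- The chains of degree `n` in the total chain module. -/
noncomputable def totDeg (n : ℕ) : Submodule R (TotChain R U) := Submodule.span R (Set.range (gen n))

/-- The tensors of degree `n`. -/
noncomputable def tensorDeg (n : ℕ) : Submodule R (TotChain R U ⊗[R] TotChain R V) :=
  Submodule.span R {t | ∃ i j σ τ, i + j = n ∧ gen i σ ⊗ₜ gen j τ = t}

/-- The direct sum of the cochain modules of `X^U` in all degrees. -/
abbrev TotCochain : Type _ := boundedDual (totDeg R U) G

/-- The bounded cochains on the tensor product of the total chain modules. -/
abbrev TensorCochain : Type _ := boundedDual (tensorDeg R U V) G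

variable {R U V}

theorem gen_mem_totDeg (n : ℕ) (σ : Simplex U n) : gen n σ ∈ totDeg R U n :=
  Submodule.subset_span ⟨σ, rfl⟩

theorem gen_tmul_gen_mem_tensorDeg (i j : ℕ) (σ : Simplex U i) (τ : Simplex V j) :
    gen i σ ⊗ₜ gen j τ ∈ tensorDeg R U V (i + j) :=
  Submodule.subset_span ⟨i, j, σ, τ, rfl, rfl⟩

theorem tmul_mem_tensorDeg {i j : ℕ} {a : TotChain R U} {b : TotChain R V}
    (ha : a ∈ totDeg R U i) (hb : b ∈ totDeg R V j) : a ⊗ₜ b ∈ tensorDeg R U V (i + j) := by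
  induction ha using Submodule.span_induction with
  | mem a ha =>
    obtain ⟨σ, rfl⟩ := ha
    induction hb using Submodule.span_induction with
    | mem b hb =>
      obtain ⟨τ, rfl⟩ := hb
      exact gen_tmul_gen_mem_tensorDeg i j σ τ
    | zero => rw [TensorProduct.tmul_zero]; exact Submodule.zero_mem _
    | add b b' _ _ h h' => rw [TensorProduct.tmul_add]; exact Submodule.add_mem _ h h'
    | smul c b _ h => rw [TensorProduct.tmul_smul]; exact Submodule.smul_mem _ _ h
  | zero => rw [TensorProduct.zero_tmul]; exact Submodule.zero_mem _
  | add b b' _ _ h h' => rw [TensorProduct.add_tmul]; exact Submodule.add_mem _ h h'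
  | smul c b _ h => rw [← TensorProduct.smul_tmul']; exact Submodule.smul_mem _ _ h

theorem map_mem_of_gen {B : Type*} [AddCommGroup B] [Module R B] {φ : TotChain R U →ₗ[R] B}
    {n : ℕ} {S : Submodule R B} (h : ∀ σ, φ (gen n σ) ∈ S) {x : TotChain R U}
    (hx : x ∈ totDeg R U n) : φ x ∈ S := by
  refine (Submodule.span_le (p := S.comap φ)).2 ?_ hx
  rintro _ ⟨σ, rfl⟩
  exact h σ

theorem map_mem_of_gen_tmul_gen {B : Type*} [AddCommGroup B] [Module R B]
    {φ : TotChain R U ⊗[R] TotChain R V →ₗ[R] B} {n : ℕ} {S : Submodule R B}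
    (h : ∀ i j σ τ, i + j = n → φ (gen i σ ⊗ₜ gen j τ) ∈ S) {x : TotChain R U ⊗[R] TotChain R V}
    (hx : x ∈ tensorDeg R U V n) : φ x ∈ S := by
  refine (Submodule.span_le (p := S.comap φ)).2 ?_ hx
  rintro _ ⟨i, j, σ, τ, hij, rfl⟩
  exact h i j σ τ hij

theorem totBoundary_mem (n : ℕ) (x : TotChain R U) (hx : x ∈ totDeg R U (n + 1)) :
    totBoundary R U x ∈ totDeg R U n := by
  refine map_mem_of_gen (fun σ => ?_) hx
  rw [totBoundary_gen_succ]
  exact Submodule.sum_mem _ fun k _ => Submodule.smul_mem _ _ (gen_mem_totDeg n _)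

theorem totBoundary_eq_zero (x : TotChain R U) (hx : x ∈ totDeg R U 0) : totBoundary R U x = 0 := by
  rw [← Submodule.mem_bot R]
  exact map_mem_of_gen (fun σ => by simp) hx

theorem isGradedMap_totBoundary : IsGradedMap (totDeg R U) (totDeg R U) (totBoundary R U) := by
  rintro (_ | n)
  · refine ⟨0, by omega, fun x hx => ?_⟩
    rw [totBoundary_eq_zero x hx]
    exact Submodule.zero_mem _
  · exact ⟨n, le_rfl, totBoundary_mem n⟩

theorem totSign_of_mem {n : ℕ} {x : TotChain R U} (hx : x ∈ totDeg R U n) :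
    totSign R U x = (-1 : R) ^ n • x := by
  rw [← sub_eq_zero, ← Submodule.mem_bot R]
  exact map_mem_of_gen (φ := totSign R U - (-1 : R) ^ n • LinearMap.id)
    (fun σ => by simp) hx

theorem isGradedMap_totSign : IsGradedMap (totDeg R U) (totDeg R U) (totSign R U) := by
  refine fun n => ⟨n, by omega, fun x hx => ?_⟩
  rw [totSign_of_mem hx]
  exact Submodule.smul_mem _ _ hx

theorem isGradedMap_totMap {U' : Set (X' × X')} (φ : X' → X)
    (h : ∀ p ∈ U', (φ p.1, φ p.2) ∈ U) :
    IsGradedMap (totDeg R U') (totDeg R U) (totMap R φ h) := by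
  refine fun n => ⟨n, by omega, fun x => map_mem_of_gen fun σ => ?_⟩
  rw [totMap_gen]
  exact gen_mem_totDeg n _

theorem isGradedMap_tensorBoundary :
    IsGradedMap (tensorDeg R U V) (tensorDeg R U V) (tensorBoundary R U V) := by
  have h1 : ∀ n, ∃ m, n ≤ m + 1 ∧ m = n - 1 := fun n => ⟨n - 1, by omega, rfl⟩
  refine fun n => (h1 n).imp fun m hm => ⟨hm.1, fun x => map_mem_of_gen_tmul_gen ?_⟩
  rintro i j σ τ rfl
  simp only [LinearMap.add_apply, TensorProduct.map_tmul, LinearMap.id_apply]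
  refine Submodule.add_mem _ ?_ ?_
  · rcases i with _ | i
    · simp
    · rw [show m = i + j by omega]
      exact tmul_mem_tensorDeg (totBoundary_mem i _ (gen_mem_totDeg _ _)) (gen_mem_totDeg _ _)
  · rcases j with _ | j
    · simp
    · rw [show m = i + j by omega, totSign_gen]
      exact tmul_mem_tensorDeg (Submodule.smul_mem _ _ (gen_mem_totDeg _ _))
        (totBoundary_mem j _ (gen_mem_totDeg _ _))

theorem isGradedMap_alexanderWhitney :
    IsGradedMap (totDeg R (prodRel U V)) (tensorDeg R U V) (alexanderWhitney R U V) := by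
  refine fun n => ⟨n, by omega, fun x => map_mem_of_gen fun σ => ?_⟩
  rw [alexanderWhitney_gen]
  refine Submodule.sum_mem _ fun k _ => ?_
  exact Submodule.subset_span ⟨k, n - k, _, _, by omega, rfl⟩

/-! ### Truncation -/

variable (R U V) in
/-- The projection to the chains of degree less than `N`. -/
noncomputable def trunc (N : ℕ) : TotChain R U →ₗ[R] TotChain R U :=
  totLift R (fun s => if s.1 < N then gen s.1 s.2 else 0)

variable (R U V) in
/-- The projection to the tensors of degree less than `N`. -/
noncomputable def tensorTrunc (N : ℕ) :
    TotChain R U ⊗[R] TotChain R V →ₗ[R] TotChain R U ⊗[R] TotChain R V :=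
  tensorLift R (fun s t => if s.1 + t.1 < N then gen s.1 s.2 ⊗ₜ gen t.1 t.2 else 0)

theorem trunc_gen (N n : ℕ) (σ : Simplex U n) :
    trunc R U N (gen n σ) = if n < N then gen n σ else 0 :=
  totLift_gen R _ _ _

theorem tensorTrunc_gen (N i j : ℕ) (σ : Simplex U i) (τ : Simplex V j) :
    tensorTrunc R U V N (gen i σ ⊗ₜ gen j τ) = if i + j < N then gen i σ ⊗ₜ gen j τ else 0 :=
  tensorLift_gen R _ _ _ _ _

theorem trunc_of_mem {N n : ℕ} {x : TotChain R U} (hx : x ∈ totDeg R U n) :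
    trunc R U N x = if n < N then x else 0 := by
  have := map_mem_of_gen (φ := trunc R U N - if n < N then LinearMap.id else 0) (S := ⊥)
    (fun σ => by rw [LinearMap.sub_apply, trunc_gen]; split_ifs <;> simp) hx
  rw [Submodule.mem_bot, LinearMap.sub_apply, sub_eq_zero] at this
  rw [this]
  split_ifs <;> rfl

theorem tensorTrunc_of_mem {N n : ℕ} {x : TotChain R U ⊗[R] TotChain R V}
    (hx : x ∈ tensorDeg R U V n) : tensorTrunc R U V N x = if n < N then x else 0 := by
  have h1 : ∀ i j (σ : Simplex U i) (τ : Simplex V j), i + j = n → n < N →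
      tensorTrunc R U V N (gen i σ ⊗ₜ gen j τ) = gen i σ ⊗ₜ gen j τ := by
    intro i j σ τ hij h
    rw [tensorTrunc_gen, if_pos (by omega)]
  split_ifs with h
  · refine (Submodule.span_le (p := LinearMap.eqLocus (tensorTrunc R U V N) LinearMap.id)).2 ?_ hx
    rintro _ ⟨i, j, σ, τ, hij, rfl⟩
    exact h1 i j σ τ hij h
  · rw [← Submodule.mem_bot R]
    refine map_mem_of_gen_tmul_gen (fun i j σ τ hij => ?_) hx
    rw [tensorTrunc_gen, if_neg (by omega)]
    exact Submodule.zero_mem _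

theorem trunc_totBoundary (N : ℕ) (x : TotChain R U) :
    trunc R U N (totBoundary R U x) = totBoundary R U (trunc R U (N + 1) x) := by
  suffices h : trunc R U N ∘ₗ totBoundary R U = totBoundary R U ∘ₗ trunc R U (N + 1) from
    LinearMap.congr_fun h x
  refine totChain_hom_ext R fun n σ => ?_
  rw [LinearMap.comp_apply, LinearMap.comp_apply, trunc_gen]
  rcases n with _ | n
  · split_ifs <;> simp
  · rw [trunc_of_mem (totBoundary_mem n _ (gen_mem_totDeg _ _))]
    simp only [Nat.add_lt_add_iff_right]
    split_ifs <;> simp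

theorem tensorTrunc_tensorBoundary (N : ℕ) (x : TotChain R U ⊗[R] TotChain R V) :
    tensorTrunc R U V N (tensorBoundary R U V x) =
      tensorBoundary R U V (tensorTrunc R U V (N + 1) x) := by
  refine LinearMap.congr_fun (f := tensorTrunc R U V N ∘ₗ tensorBoundary R U V)
    (g := tensorBoundary R U V ∘ₗ tensorTrunc R U V (N + 1))
    (tensor_hom_ext R fun i j σ τ => ?_) x
  rw [LinearMap.comp_apply, LinearMap.comp_apply, tensorTrunc_gen, LinearMap.add_apply, map_add,
    TensorProduct.map_tmul, TensorProduct.map_tmul, LinearMap.id_apply]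
  have h1 : tensorTrunc R U V N (totBoundary R U (gen i σ) ⊗ₜ gen j τ) =
      if i + j < N + 1 then totBoundary R U (gen i σ) ⊗ₜ gen j τ else 0 := by
    rcases i with _ | i
    · simp
    · rw [tensorTrunc_of_mem (tmul_mem_tensorDeg (totBoundary_mem i _ (gen_mem_totDeg _ _))
        (gen_mem_totDeg _ _))]
      exact if_congr (by omega) rfl rfl
  have h2 : tensorTrunc R U V N (totSign R U (gen i σ) ⊗ₜ totBoundary R V (gen j τ)) =
      if i + j < N + 1 then totSign R U (gen i σ) ⊗ₜ totBoundary R V (gen j τ) else 0 := by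
    rcases j with _ | j
    · simp
    · rw [totSign_gen, tensorTrunc_of_mem (tmul_mem_tensorDeg
        (Submodule.smul_mem _ _ (gen_mem_totDeg _ _)) (totBoundary_mem j _ (gen_mem_totDeg _ _)))]
      exact if_congr (by omega) rfl rfl
  rw [h1, h2]
  split_ifs
  · simp
  · simp

theorem tensorTrunc_alexanderWhitney (N : ℕ) (x : TotChain R (prodRel U V)) :
    tensorTrunc R U V N (alexanderWhitney R U V x) = alexanderWhitney R U V (trunc R _ N x) := by
  refine LinearMap.congr_fun (f := tensorTrunc R U V N ∘ₗ alexanderWhitney R U V)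
    (g := alexanderWhitney R U V ∘ₗ trunc R _ N) (totChain_hom_ext R fun n σ => ?_) x
  rw [LinearMap.comp_apply, LinearMap.comp_apply, trunc_gen, alexanderWhitney_gen, map_sum]
  have h : ∀ k : Fin (n + 1), tensorTrunc R U V N (frontBack R (i := k) (j := n - k) (by omega) σ) =
      if n < N then frontBack R (i := k) (j := n - k) (by omega) σ else 0 := by
    intro k
    rw [frontBack, tensorTrunc_gen]
    exact if_congr (by omega) rfl rfl
  rw [Finset.sum_congr rfl fun k _ => h k]
  split_ifs
  · rw [alexanderWhitney_gen]
  · simp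

variable {G}

theorem comp_trunc_mem (f : TotChain R U →ₗ[R] G) (N : ℕ) :
    f ∘ₗ trunc R U N ∈ boundedDual (totDeg R U) G :=
  ⟨N, fun n hn x hx => by
    rw [LinearMap.comp_apply, trunc_of_mem hx, if_neg (by omega), map_zero]⟩

theorem comp_tensorTrunc_mem (f : TotChain R U ⊗[R] TotChain R V →ₗ[R] G) (N : ℕ) :
    f ∘ₗ tensorTrunc R U V N ∈ boundedDual (tensorDeg R U V) G :=
  ⟨N, fun n hn x hx => by
    rw [LinearMap.comp_apply, tensorTrunc_of_mem hx, if_neg (by omega), map_zero]⟩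

theorem exists_comp_trunc (f : TotCochain R U G) :
    ∃ N, ∀ M, N ≤ M → ∀ x, f.1 (trunc R U M x) = f.1 x := by
  obtain ⟨f, N, hN⟩ := f
  refine ⟨N, fun M hM x => ?_⟩
  refine LinearMap.congr_fun (f := f ∘ₗ trunc R U M) (totChain_hom_ext R fun n σ => ?_) x
  rw [LinearMap.comp_apply, trunc_gen]
  split_ifs with h
  · rfl
  · rw [map_zero, hN n (by omega) _ (gen_mem_totDeg n σ)]

theorem exists_comp_tensorTrunc (f : TensorCochain R U V G) :
    ∃ N, ∀ M, N ≤ M → ∀ x, f.1 (tensorTrunc R U V M x) = f.1 x := by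
  obtain ⟨f, N, hN⟩ := f
  refine ⟨N, fun M hM x => ?_⟩
  refine LinearMap.congr_fun (f := f ∘ₗ tensorTrunc R U V M)
    (tensor_hom_ext R fun i j σ τ => ?_) x
  rw [LinearMap.comp_apply, tensorTrunc_gen]
  split_ifs with h
  · rfl
  · rw [map_zero, hN (i + j) (by omega) _ (gen_tmul_gen_mem_tensorDeg i j σ τ)]

variable (R U V G)

/-- The total coboundary. -/
noncomputable abbrev totCoboundary : TotCochain R U G →ₗ[R] TotCochain R U G :=
  boundedDualMap G isGradedMap_totBoundary

/-- The sign `(-1)ⁿ` on cochains of degree `n`. -/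
noncomputable abbrev cochainSign : TotCochain R U G →ₗ[R] TotCochain R U G :=
  boundedDualMap G isGradedMap_totSign

/-- The coboundary on the bounded cochains on the tensor product. -/
noncomputable abbrev tensorCoboundary : TensorCochain R U V G →ₗ[R] TensorCochain R U V G :=
  boundedDualMap G isGradedMap_tensorBoundary

theorem isSigned_totCoboundary : IsSigned (totCoboundary R U G) (cochainSign R U G) where
  dd f := Subtype.ext (LinearMap.ext fun x => by simp [totBoundary_totBoundary])
  ss f := Subtype.ext (LinearMap.ext fun x => by simp [totSign_totSign])
  sd f := Subtype.ext (LinearMap.ext fun x => by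
    rw [boundedDualMap_apply, boundedDualMap_apply, Submodule.coe_neg, LinearMap.neg_apply,
      boundedDualMap_apply, boundedDualMap_apply, totSign_totBoundary, map_neg, neg_neg])

/-- The dual of the Alexander-Whitney map is a quasi-isomorphism. -/
theorem quasiIso_alexanderWhitney_dual (hU : ∀ x, (x, x) ∈ U) (hV : ∀ y, (y, y) ∈ V) :
    DQuasiIso (tensorCoboundary R U V G) (totCoboundary R (prodRel U V) G)
      (boundedDualMap G isGradedMap_alexanderWhitney) := by
  obtain ⟨h, hh⟩ := exists_awContraction R hU hV
  -- A functional that vanishes on the boundaries of the mapping cone is recovered from the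
  -- contraction as f h ∂.
  have key : ∀ f : AWCone R U V →ₗ[R] G, (∀ x, f (awBoundary R U V x) = 0) →
      ∀ x, f x = f (h (awBoundary R U V x)) := by
    intro f hf x
    conv_lhs => rw [← hh x, map_add, hf, zero_add]
  have hsplit : ∀ (f : AWCone R U V →ₗ[R] G) (a b),
      f (h (awBoundary R U V (a, b))) = -(f ∘ₗ h ∘ₗ LinearMap.inl R _ _) (totBoundary R _ a) +
        (f ∘ₗ h ∘ₗ LinearMap.inr R _ _)
          (alexanderWhitney R U V a + tensorBoundary R U V b) := by
    intro f a b
    simp only [LinearMap.comp_apply, LinearMap.inl_apply, LinearMap.inr_apply]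
    rw [← map_neg, ← map_neg, ← map_add, ← map_add, awBoundary_apply]
    congr 2
    simp
  refine ⟨fun x => Subtype.ext (LinearMap.ext fun a => ?_), fun y hy => ?_, fun x z hx hz => ?_⟩
  · simp only [boundedDualMap_apply]
    rw [alexanderWhitney_totBoundary]
  · replace hy : ∀ a, y.1 (totBoundary R _ a) = 0 := fun a =>
      LinearMap.congr_fun (Subtype.ext_iff.1 hy) a
    -- Extend the cocycle y by zero to the mapping cone. The two components of the resulting
    -- identity give a cocycle on the tensor product and write y as its image plus a coboundary.
    have hf := key (y.1 ∘ₗ LinearMap.fst R _ _) (fun x => by simp [hy])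
    simp only [hsplit] at hf
    set F := y.1 ∘ₗ LinearMap.fst R (TotChain R (prodRel U V)) (TotChain R U ⊗[R] TotChain R V)
    have h1 : ∀ b, (F ∘ₗ h ∘ₗ LinearMap.inr R _ _) (tensorBoundary R U V b) = 0 := by
      intro b
      have := (hf (0, b)).symm
      simp only [map_zero, zero_add, neg_zero] at this
      exact this.trans (by simp [F])
    have h2 : ∀ a, y.1 a = -(F ∘ₗ h ∘ₗ LinearMap.inl R _ _) (totBoundary R _ a) +
        (F ∘ₗ h ∘ₗ LinearMap.inr R _ _) (alexanderWhitney R U V a) := by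
      intro a
      have := hf (a, 0)
      simp only [map_zero, add_zero] at this
      exact this
    -- The contraction is not known to respect degrees, so cochains composed with it may be
    -- unbounded. As y is bounded they can be truncated; the cut-offs differ by one because the
    -- boundary lowers degrees by one.
    obtain ⟨N, hN⟩ := exists_comp_trunc y
    refine ⟨⟨_, comp_tensorTrunc_mem (F ∘ₗ h ∘ₗ LinearMap.inr R _ _) (N + 1)⟩,
      -⟨_, comp_trunc_mem (F ∘ₗ h ∘ₗ LinearMap.inl R _ _) N⟩,
      Subtype.ext (LinearMap.ext fun b => ?_), Subtype.ext (LinearMap.ext fun a => ?_)⟩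
    · rw [boundedDualMap_apply, LinearMap.comp_apply, tensorTrunc_tensorBoundary, h1]
      rfl
    · rw [Submodule.coe_add, LinearMap.add_apply, map_neg, Submodule.coe_neg, LinearMap.neg_apply,
        boundedDualMap_apply, boundedDualMap_apply, LinearMap.comp_apply, LinearMap.comp_apply
        (g := trunc R _ N), tensorTrunc_alexanderWhitney, trunc_totBoundary, ← hN (N + 1) (by omega),
        h2, add_comm]
  · replace hx : ∀ b, x.1 (tensorBoundary R U V b) = 0 := fun b =>
      LinearMap.congr_fun (Subtype.ext_iff.1 hx) b
    replace hz : ∀ a, x.1 (alexanderWhitney R U V a) = z.1 (totBoundary R _ a) := fun a =>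
      LinearMap.congr_fun (Subtype.ext_iff.1 hz) a
    -- That x becomes the coboundary of z says exactly that z and x together vanish on the
    -- boundaries of the mapping cone.
    set F := z.1 ∘ₗ LinearMap.fst R (TotChain R (prodRel U V)) (TotChain R U ⊗[R] TotChain R V) +
      x.1 ∘ₗ LinearMap.snd R _ _ with hF
    have hf := key F (fun t => by
      rw [awBoundary_apply, hF, LinearMap.add_apply, LinearMap.comp_apply, LinearMap.comp_apply,
        LinearMap.fst_apply, LinearMap.snd_apply, map_neg, map_add, hx, hz]
      simp)
    obtain ⟨N, hN⟩ := exists_comp_tensorTrunc x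
    refine ⟨⟨_, comp_tensorTrunc_mem (F ∘ₗ h ∘ₗ LinearMap.inr R _ _) N⟩,
      Subtype.ext (LinearMap.ext fun b => ?_)⟩
    rw [boundedDualMap_apply, LinearMap.comp_apply, tensorTrunc_tensorBoundary,
      ← hN (N + 1) (by omega)]
    have := hf (0, tensorTrunc R U V (N + 1) b)
    rw [hsplit] at this
    simp only [map_zero, zero_add, neg_zero] at this
    refine Eq.trans ?_ this
    simp [hF]

end Cochains

end VR

namespace VR

/-! ### Finite type homology and homotopies of finite rank. -/

section FiniteType

variable {R : Type*} [CommRing R] {X Y : Type*} {U : Set (X × X)}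

/-- The inclusion of the chains of degree `n` into the total chain module. -/
noncomputable def chainIncl (n : ℕ) : Chain R U n →ₗ[R] TotChain R U :=
  (Finsupp.lmapDomain R R (Sigma.mk n) : (Simplex U n →₀ R) →ₗ[R] ((Σ n, Simplex U n) →₀ R))

/-- The chain of degree `n` given by a simplex. -/
noncomputable def chainGen (n : ℕ) (σ : Simplex U n) : Chain R U n :=
  (Finsupp.single σ 1 : Simplex U n →₀ R)

theorem chainIncl_chainGen (n : ℕ) (σ : Simplex U n) :
    chainIncl n (chainGen (R := R) n σ) = gen n σ :=
  Finsupp.mapDomain_single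

theorem chainIncl_injective (n : ℕ) : Function.Injective (chainIncl (R := R) (U := U) n) :=
  Finsupp.mapDomain_injective sigma_mk_injective

theorem chain_hom_ext {M : Type*} [AddCommGroup M] [Module R M] {n : ℕ}
    {f g : Chain R U n →ₗ[R] M} (h : ∀ σ, f (chainGen n σ) = g (chainGen n σ)) : f = g :=
  Finsupp.lhom_ext' (M := R) fun s => LinearMap.ext_ring (h s)

theorem boundary_chainGen (n : ℕ) (σ : Simplex U (n + 1)) :
    boundary R U n (chainGen (n + 1) σ) =
      ∑ k : Fin (n + 2), (-1 : R) ^ (k : ℕ) • chainGen n (face k σ) := by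
  rw [boundary, LinearMap.sum_apply]
  refine Finset.sum_congr rfl fun k _ => ?_
  rw [LinearMap.smul_apply]
  congr 1
  exact Finsupp.mapDomain_single

theorem totBoundary_chainIncl (n : ℕ) (c : Chain R U (n + 1)) :
    totBoundary R U (chainIncl (n + 1) c) = chainIncl n (boundary R U n c) := by
  suffices h : totBoundary R U ∘ₗ chainIncl (n + 1) = chainIncl n ∘ₗ boundary R U n from
    LinearMap.congr_fun h c
  refine chain_hom_ext fun σ => ?_
  rw [LinearMap.comp_apply, LinearMap.comp_apply, chainIncl_chainGen, boundary_chainGen,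
    totBoundary_gen_succ, map_sum]
  refine Finset.sum_congr rfl fun k _ => ?_
  rw [map_smul, chainIncl_chainGen]

theorem exists_chainIncl {n : ℕ} {x : TotChain R U} (hx : x ∈ totDeg R U n) :
    ∃ c, chainIncl n c = x := by
  refine (Submodule.span_le (p := LinearMap.range (chainIncl (R := R) (U := U) n))).2 ?_ hx
  rintro _ ⟨σ, rfl⟩
  exact ⟨_, chainIncl_chainGen n σ⟩

theorem chainIncl_mem (n : ℕ) (c : Chain R U n) : chainIncl n c ∈ totDeg R U n := by
  rw [← Submodule.Quotient.mk_eq_zero, ← Submodule.mkQ_apply, ← LinearMap.comp_apply]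
  refine LinearMap.congr_fun (g := 0) (chain_hom_ext fun σ => ?_) c
  rw [LinearMap.comp_apply, chainIncl_chainGen, Submodule.mkQ_apply, LinearMap.zero_apply,
    Submodule.Quotient.mk_eq_zero]
  exact gen_mem_totDeg n σ

/-- Lift finitely many generators of the homology in degree n to cycles. -/
theorem FiniteType.exists_cycles (hU : FiniteType R U) (n : ℕ) :
    ∃ F : Submodule R (TotChain R U), F.FG ∧ F ≤ totDeg R U n ∧
      ∀ x ∈ totDeg R U n, totBoundary R U x = 0 →
        ∃ y ∈ totDeg R U (n + 1), ∃ f ∈ F, x = totBoundary R U y + f := by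
  obtain ⟨m, s, hs⟩ := @Module.Finite.exists_fin R (Homology R U n) _ _ _ (hU n)
  choose t ht using fun i => Submodule.mkQ_surjective _ (s i)
  have htop : Submodule.span R (Set.range s) =
      (Submodule.span R (Set.range t)).map (Submodule.mkQ _) := by
    rw [Submodule.map_span, ← Set.range_comp]
    congr 2
    exact funext fun i => (ht i).symm
  refine ⟨(Submodule.span R (Set.range t)).map (chainIncl n ∘ₗ (cycles R U n).subtype),
    (Submodule.fg_span (Set.finite_range t)).map _, ?_, fun x hx h0 => ?_⟩
  · rintro _ ⟨c, _, rfl⟩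
    exact chainIncl_mem n _
  · obtain ⟨c, rfl⟩ := exists_chainIncl hx
    have hc : c ∈ cycles R U n := by
      cases n with
      | zero => exact Submodule.mem_top
      | succ n =>
        refine chainIncl_injective n ?_
        rw [← totBoundary_chainIncl, h0, map_zero]
    have h1 : Submodule.mkQ _ (⟨c, hc⟩ : cycles R U n) ∈
        (Submodule.span R (Set.range t)).map (Submodule.mkQ
          ((LinearMap.range (boundary R U n)).comap (cycles R U n).subtype)) := by
      rw [← htop, hs]
      exact Submodule.mem_top
    obtain ⟨f, hf, hfc⟩ := h1
    rw [← sub_eq_zero, ← map_sub, Submodule.mkQ_apply, Submodule.Quotient.mk_eq_zero] at hfc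
    obtain ⟨y, hy⟩ := hfc
    refine ⟨chainIncl (n + 1) (-y), chainIncl_mem _ _, _, ⟨f, hf, rfl⟩, ?_⟩
    rw [totBoundary_chainIncl, map_neg, hy, LinearMap.comp_apply, ← map_add]
    congr 1
    simp

theorem exists_fg_map_eq {A B : Type*} [AddCommGroup A] [Module R A] [AddCommGroup B] [Module R B]
    (f : A →ₗ[R] B) (P : Submodule R A) (Q : Submodule R B) (hQ : Q.FG)
    (h : ∀ x ∈ Q, ∃ y ∈ P, f y = x) :
    ∃ L : Submodule R A, L.FG ∧ L ≤ P ∧ ∀ x ∈ Q, ∃ y ∈ L, f y = x := by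
  obtain ⟨s, rfl⟩ := hQ
  choose g hg using fun x : (s : Set B) => h x (Submodule.subset_span x.2)
  refine ⟨Submodule.span R (Set.range g), Submodule.fg_span (Set.finite_range g), ?_,
    fun x hx => ?_⟩
  · rw [Submodule.span_le]
    rintro _ ⟨i, rfl⟩
    exact (hg i).1
  · refine (Submodule.span_le (p := (Submodule.span R (Set.range g)).map f)).2 ?_ hx
    exact fun x hx => ⟨g ⟨x, hx⟩, Submodule.subset_span ⟨_, rfl⟩, (hg _).2⟩

/-- A partial homotopy whose defect is finitely generated in degrees less than `n`. -/
structure PartialHomotopy (R : Type*) [CommRing R] {X : Type*} (U : Set (X × X)) (n : ℕ) where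
  op : TotChain R U →ₗ[R] TotChain R U
  fin : Submodule R (TotChain R U)
  fg : fin.FG
  mem : ∀ k σ, op (gen k σ) ∈ totDeg R U (k + 1)
  defect : ∀ k, k < n → ∀ σ, gen k σ - totBoundary R U (op (gen k σ)) -
    op (totBoundary R U (gen k σ)) ∈ fin

/-- For an n-simplex σ the chain x = σ - h∂σ need not be a cycle, but its boundary is the defect at
∂σ and lies in a fixed finitely generated module. After subtracting an element of a finitely
generated module L, the rest is a cycle, hence a boundary ∂y up to the generators of homology. Put
h(σ) = y. -/
theorem PartialHomotopy.exists_extension [IsNoetherianRing R] (hU : FiniteType R U) {n : ℕ}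
    (H : PartialHomotopy R U n) :
    ∃ H' : PartialHomotopy R U (n + 1), ∀ k, k < n → ∀ σ, H'.op (gen k σ) = H.op (gen k σ) := by
  obtain ⟨F, hF, hFn, hFc⟩ := hU.exists_cycles n
  -- This intersection is finitely generated because R is noetherian, and L lifts it to chains of
  -- degree n.
  obtain ⟨L, hL, hLn, hLF⟩ := exists_fg_map_eq (totBoundary R U) (totDeg R U n)
    (H.fin ⊓ (totDeg R U n).map (totBoundary R U))
    (Submodule.FG.of_le H.fg inf_le_left) (fun x hx => hx.2)
  have hop : ∀ k, ∀ x ∈ totDeg R U k, H.op x ∈ totDeg R U (k + 1) :=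
    fun k x => map_mem_of_gen (H.mem k)
  have key : ∀ σ : Simplex U n, ∃ y ∈ totDeg R U (n + 1),
      gen n σ - totBoundary R U y - H.op (totBoundary R U (gen n σ)) ∈ L ⊔ F := by
    intro σ
    set x := gen n σ - H.op (totBoundary R U (gen n σ)) with hx
    have hxn : x ∈ totDeg R U n := by
      refine Submodule.sub_mem _ (gen_mem_totDeg n σ) ?_
      rcases n with _ | n
      · simp
      · exact hop n _ (totBoundary_mem n _ (gen_mem_totDeg _ _))
    have hdx : totBoundary R U x ∈ H.fin := by
      rcases n with _ | n
      · rw [totBoundary_eq_zero x hxn]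
        exact Submodule.zero_mem _
      · have := map_mem_of_gen (φ := LinearMap.id - totBoundary R U ∘ₗ H.op -
          H.op ∘ₗ totBoundary R U) (S := H.fin) (fun τ => H.defect n (by omega) τ)
          (totBoundary_mem n _ (gen_mem_totDeg _ σ))
        simp only [LinearMap.sub_apply, LinearMap.comp_apply, LinearMap.id_apply,
          totBoundary_totBoundary, map_zero, sub_zero] at this
        rwa [hx, map_sub]
    obtain ⟨l, hl, hlx⟩ := hLF _ ⟨hdx, x, hxn, rfl⟩
    obtain ⟨y, hy, f, hf, hyf⟩ := hFc (x - l) (Submodule.sub_mem _ hxn (hLn hl))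
      (by rw [map_sub, hlx, sub_self])
    refine ⟨y, hy, ?_⟩
    have e : gen n σ - totBoundary R U y - H.op (totBoundary R U (gen n σ)) = l + f := by
      rw [sub_right_comm, ← hx, sub_eq_iff_eq_add, add_assoc, add_comm f, ← hyf]
      abel
    rw [e]
    exact Submodule.add_mem_sup hl hf
  choose y hy hyL using key
  let g : (Σ k, Simplex U k) → TotChain R U := fun s =>
    if h : s.1 = n then y (h ▸ s.2) else H.op (gen s.1 s.2)
  have hg1 : ∀ σ, totLift R g (gen n σ) = y σ := fun σ => by
    rw [totLift_gen]
    simp [g]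
  have hg2 : ∀ k σ, k ≠ n → totLift R g (gen k σ) = H.op (gen k σ) := fun k σ hk => by
    rw [totLift_gen]
    simp [g, hk]
  have hg3 : ∀ k, k ≤ n → ∀ σ : Simplex U k,
      totLift R g (totBoundary R U (gen k σ)) = H.op (totBoundary R U (gen k σ)) := by
    intro k hk σ
    rcases k with _ | k
    · simp
    · rw [totBoundary_gen_succ, map_sum, map_sum]
      refine Finset.sum_congr rfl fun i _ => ?_
      rw [map_smul, map_smul, hg2 k _ (by omega)]
  refine ⟨⟨totLift R g, H.fin ⊔ (L ⊔ F), H.fg.sup (hL.sup hF), fun k σ => ?_, fun k hk σ => ?_⟩,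
    fun k hk σ => hg2 k σ (by omega)⟩
  · by_cases h : k = n
    · subst h
      rw [hg1]
      exact hy σ
    · rw [hg2 k σ h]
      exact H.mem k σ
  · by_cases h : k = n
    · subst h
      rw [hg1, hg3 k le_rfl]
      exact Submodule.mem_sup_right (hyL σ)
    · rw [hg2 k σ h, hg3 k (by omega)]
      exact Submodule.mem_sup_left (H.defect k (by omega) σ)

/-- A homotopy from the identity to a map whose image is finitely generated in each degree. -/
theorem FiniteType.exists_homotopy [IsNoetherianRing R] (hU : FiniteType R U) :
    ∃ h : TotChain R U →ₗ[R] TotChain R U,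
      (∀ n, ∀ x ∈ totDeg R U n, h x ∈ totDeg R U (n + 1)) ∧
      ∀ N, ∃ F : Submodule R (TotChain R U), F.FG ∧ ∀ n, n < N → ∀ σ,
        gen n σ - totBoundary R U (h (gen n σ)) - h (totBoundary R U (gen n σ)) ∈ F := by
  choose ext hext using fun n (H : PartialHomotopy R U n) => H.exists_extension hU
  let S : ∀ n, PartialHomotopy R U n := fun n => Nat.rec
    ⟨0, ⊥, Submodule.fg_bot, fun _ _ => Submodule.zero_mem _, fun k hk => absurd hk (Nat.not_lt_zero k)⟩
    ext n
  have hS : ∀ k n, k < n → ∀ σ, (S n).op (gen k σ) = (S (k + 1)).op (gen k σ) := by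
    intro k n hk σ
    induction n, hk using Nat.le_induction with
    | base => rfl
    | succ n hn ih => exact (hext n (S n) k hn σ).trans ih
  -- In degree k all stages after k agree, so stage k + 1 already has the final value there.
  let h : TotChain R U →ₗ[R] TotChain R U := totLift R fun s => (S (s.1 + 1)).op (gen s.1 s.2)
  have hh : ∀ k n, k < n → ∀ σ : Simplex U k, h (gen k σ) = (S n).op (gen k σ) :=
    fun k n hk σ => (totLift_gen R _ _ _).trans (hS k n hk σ).symm
  refine ⟨h, fun n x => map_mem_of_gen fun σ => ?_, fun N => ⟨(S N).fin, (S N).fg,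
    fun n hn σ => ?_⟩⟩
  · rw [hh n (n + 1) (by omega)]
    exact (S (n + 1)).mem n σ
  · have h3 : h (totBoundary R U (gen n σ)) = (S N).op (totBoundary R U (gen n σ)) := by
      rcases n with _ | n
      · simp
      · rw [totBoundary_gen_succ, map_sum, map_sum]
        refine Finset.sum_congr rfl fun i _ => ?_
        rw [map_smul, map_smul, hh n N (by omega)]
    rw [h3, hh n N hn]
    exact (S N).defect n hn σ

/-- The degreewise finite rank form of `FiniteType.exists_homotopy`. -/
theorem FiniteType.exists_homotopy_sum [IsDomain R] [IsPrincipalIdealRing R]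
    (hU : FiniteType R U) :
    ∃ h : TotChain R U →ₗ[R] TotChain R U,
      (∀ n, ∀ x ∈ totDeg R U n, h x ∈ totDeg R U (n + 1)) ∧
      ∀ N, ∃ (k : ℕ) (β : Fin k → TotChain R U →ₗ[R] R) (e : Fin k → TotChain R U),
        (∀ m n, N ≤ n → ∀ x ∈ totDeg R U n, β m x = 0) ∧ ∀ n, n < N → ∀ x ∈ totDeg R U n,
          x - totBoundary R U (h x) - h (totBoundary R U x) = ∑ m, β m x • e m := by
  obtain ⟨h, hh, hF⟩ := hU.exists_homotopy
  refine ⟨h, hh, fun N => ?_⟩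
  obtain ⟨F, hFG, hF⟩ := hF N
  have : Module.Free R (TotChain R U) :=
    inferInstanceAs (Module.Free R ((Σ n, Simplex U n) →₀ R))
  have : Module.Finite R F := Module.Finite.iff_fg.2 hFG
  let b := Module.finBasis R F
  -- Truncated below N, the defect has its image in one finitely generated submodule of a free
  -- module. Over a principal ideal domain this is free, and its coordinates give the terms of rank
  -- one.
  let p : TotChain R U →ₗ[R] TotChain R U :=
    (LinearMap.id - totBoundary R U ∘ₗ h - h ∘ₗ totBoundary R U) ∘ₗ trunc R U N
  have hp : ∀ x, p x ∈ F := by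
    intro x
    rw [← Submodule.Quotient.mk_eq_zero, ← Submodule.mkQ_apply, ← LinearMap.comp_apply]
    refine LinearMap.congr_fun (g := 0) (totChain_hom_ext R fun n σ => ?_) x
    rw [LinearMap.comp_apply, Submodule.mkQ_apply, LinearMap.zero_apply,
      Submodule.Quotient.mk_eq_zero]
    simp only [p, LinearMap.comp_apply, trunc_gen]
    split_ifs with hn
    · exact hF n hn σ
    · rw [map_zero]
      exact Submodule.zero_mem _
  refine ⟨_, fun m => b.coord m ∘ₗ p.codRestrict F hp, fun m => b m, fun m n hn x hx => ?_,
    fun n hn x hx => ?_⟩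
  · have : p.codRestrict F hp x = 0 := Subtype.ext (by
      simp only [p, LinearMap.codRestrict_apply, LinearMap.comp_apply, trunc_of_mem hx,
        if_neg (not_lt.2 hn), map_zero]
      rfl)
    rw [LinearMap.comp_apply, this, map_zero]
  · have h1 : (p.codRestrict F hp x : TotChain R U) =
        x - totBoundary R U (h x) - h (totBoundary R U x) := by
      simp only [p, LinearMap.codRestrict_apply, LinearMap.comp_apply, trunc_of_mem hx, if_pos hn]
      rfl
    rw [← h1]
    refine (congrArg F.subtype (b.sum_repr (p.codRestrict F hp x))).symm.trans ?_
    rw [map_sum]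
    rfl

end FiniteType

end VR

/-! ### Quasi-isomorphisms obtained from homotopies. -/

section Homotopy

variable {R : Type*} [CommRing R] {M N : Type*} [AddCommGroup M] [Module R M] [AddCommGroup N]
  [Module R N]

/-- A map of differential modules which is homotopic to the identity. -/
def IsHomotopicToId (d e : M →ₗ[R] M) : Prop := ∃ k : M →ₗ[R] M, ∀ x, e x = x - d (k x) - k (d x)

theorem IsHomotopicToId.comm {d e : M →ₗ[R] M} (h : IsHomotopicToId d e) (hd : ∀ x, d (d x) = 0)
    (x : M) : e (d x) = d (e x) := by
  obtain ⟨k, hk⟩ := h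
  simp [hk, hd]

theorem IsHomotopicToId.comp {d e e' : M →ₗ[R] M} (h : IsHomotopicToId d e)
    (h' : IsHomotopicToId d e') (hd : ∀ x, d (d x) = 0) : IsHomotopicToId d (e ∘ₗ e') := by
  have hc := h'.comm hd
  obtain ⟨k, hk⟩ := h
  obtain ⟨k', hk'⟩ := h'
  refine ⟨k' + k ∘ₗ e', fun x => ?_⟩
  simp only [LinearMap.comp_apply, LinearMap.add_apply, map_add, hc]
  rw [hk, hk' x]
  abel

/-- A map which is invertible up to endomorphisms homotopic to the identity is a
quasi-isomorphism. -/
theorem DQuasiIso.of_homotopic {dM eM : M →ₗ[R] M} {dN eN : N →ₗ[R] N} {f : M →ₗ[R] N}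
    (hM : ∀ x, dM (dM x) = 0) (hN : ∀ x, dN (dN x) = 0) (heM : IsHomotopicToId dM eM)
    (heN : IsHomotopicToId dN eN) (comm : ∀ x, f (dM x) = dN (f x))
    (hfe : ∀ x, f (eM x) = eN (f x)) (ha : ∀ z, ∃ x, f x = eN z)
    (hb : ∀ x, f x = 0 → eM x = 0) : DQuasiIso dM dN f where
  comm := comm
  surj z hz := by
    obtain ⟨x, hx⟩ := ha z
    -- The square of eN is homotopic to the identity as well, and it is f (eM x) that equals this
    -- square at z.
    obtain ⟨k, hk⟩ := heN.comp heN hN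
    refine ⟨eM x, k (z), ?_, ?_⟩
    · rw [← heM.comm hM]
      refine hb _ ?_
      rw [comm, hx, ← heN.comm hN, hz, map_zero]
    · rw [hfe, hx, ← LinearMap.comp_apply, hk, hz, map_zero, sub_zero, sub_add_cancel]
  inj x w hx hw := by
    obtain ⟨v, hv⟩ := ha w
    obtain ⟨k, hk⟩ := heM.comp heM hM
    -- Both f (eM x) and f (dM v) are equal to eN (dN w), so eM annihilates the difference.
    have h1 : eM (eM x - dM v) = 0 := by
      refine hb _ ?_
      rw [map_sub, hfe, comm, hv, hw, heN.comm hN, sub_self]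
    have h2 := hk x
    rw [map_sub, sub_eq_zero, heM.comm hM] at h1
    rw [hx, map_zero, sub_zero, LinearMap.comp_apply, h1] at h2
    refine ⟨eM v + k x, ?_⟩
    rw [map_add, h2, sub_add_cancel]

theorem IsHomotopicToId.rTensor {d σ e k : M →ₗ[R] M} {d' : N →ₗ[R] N}
    (hk : ∀ x, e x = x - d (k x) - k (d x)) (hσ : ∀ x, k (σ x) = -σ (k x)) :
    IsHomotopicToId (tensorD d σ d') (TensorProduct.map e LinearMap.id) := by
  refine ⟨TensorProduct.map k LinearMap.id, fun z => ?_⟩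
  induction z with
  | zero => simp
  | add x y hx hy => simp only [map_add, hx, hy]; abel
  | tmul x y =>
    simp [hk, hσ, TensorProduct.sub_tmul, TensorProduct.neg_tmul]
    abel

/-- The homotopy has odd degree, so on the second factor it is accompanied by the sign of the first.
-/
theorem IsHomotopicToId.lTensor {d σ : M →ₗ[R] M} {d' e k : N →ₗ[R] N}
    (hk : ∀ x, e x = x - d' (k x) - k (d' x)) (h : IsSigned d σ) :
    IsHomotopicToId (tensorD d σ d') (TensorProduct.map LinearMap.id e) := by
  refine ⟨TensorProduct.map σ k, fun z => ?_⟩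
  induction z with
  | zero => simp
  | add x y hx hy => simp only [map_add, hx, hy]; abel
  | tmul x y =>
    simp [hk, h.sd, h.ss, TensorProduct.tmul_sub, TensorProduct.neg_tmul]
    abel

end Homotopy

/-! ### Generators and relations of finitely generated modules. -/

section Coefficients

variable {R : Type*} [CommRing R] {M N : Type*} [AddCommGroup M] [Module R M] [AddCommGroup N]
  [Module R N]

theorem exists_eq_sum_tmul {m : ℕ} {s : Fin m → N} (hs : Submodule.span R (Set.range s) = ⊤)
    (t : M ⊗[R] N) : ∃ c : Fin m → M, t = ∑ i, c i ⊗ₜ s i := by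
  induction t with
  | zero => exact ⟨0, by simp⟩
  | add x y hx hy =>
    obtain ⟨c, rfl⟩ := hx
    obtain ⟨c', rfl⟩ := hy
    exact ⟨c + c', by simp [TensorProduct.add_tmul, Finset.sum_add_distrib]⟩
  | tmul x y =>
    obtain ⟨a, rfl⟩ := (Submodule.mem_span_range_iff_exists_fun R).1
      (hs ▸ Submodule.mem_top : y ∈ Submodule.span R (Set.range s))
    exact ⟨fun i => a i • x, by simp [TensorProduct.tmul_sum, TensorProduct.smul_tmul]⟩

/-- Relations between generators of a finitely presented module, with coefficients in any
module. -/
theorem exists_relations [IsNoetherianRing R] {m : ℕ} {s : Fin m → N}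
    (hs : Submodule.span R (Set.range s) = ⊤) :
    ∃ (k : ℕ) (r : Fin k → Fin m → R), (∀ q, ∑ i, r q i • s i = 0) ∧
      ∀ c : Fin m → M, ∑ i, c i ⊗ₜ[R] s i = 0 → ∃ γ : Fin k → M, ∀ i, c i = ∑ q, r q i • γ q := by
  obtain ⟨k, r, hr⟩ := Submodule.fg_iff_exists_fin_generating_family.1
    (IsNoetherian.noetherian (LinearMap.ker (Fintype.linearCombination R s)))
  refine ⟨k, r, fun q => ?_, fun c hc => ?_⟩
  · have : r q ∈ LinearMap.ker (Fintype.linearCombination R s) :=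
      hr ▸ Submodule.subset_span ⟨q, rfl⟩
    simpa [Fintype.linearCombination_apply] using this
  · have hc' : ∑ i, s i ⊗ₜ[R] c i = 0 := by
      simpa using congrArg (TensorProduct.comm R M N) hc
    -- By the equational criterion the coefficients of a vanishing sum come from relations among the
    -- generators, and the relations are finitely generated.
    obtain ⟨κ, a, y, hy, ha⟩ := TensorProduct.vanishesTrivially_of_sum_tmul_eq_zero R hs hc'
    have : ∀ j, ∃ t : Fin k → R, ∑ q, t q • r q = fun i => a i j := fun j => by
      rw [← Submodule.mem_span_range_iff_exists_fun, hr]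
      simpa [Fintype.linearCombination_apply] using ha j
    choose t ht using this
    refine ⟨fun q => ∑ j, t j q • y j, fun i => ?_⟩
    rw [hy i]
    simp only [Finset.smul_sum, smul_smul]
    rw [Finset.sum_comm]
    refine Finset.sum_congr rfl fun j _ => ?_
    rw [← Finset.sum_smul]
    congr 1
    have := congrFun (ht j) i
    simp only [Finset.sum_apply, Pi.smul_apply, smul_eq_mul] at this
    rw [← this]
    exact Finset.sum_congr rfl fun _ _ => mul_comm _ _

end Coefficients

namespace VR

/-! ### The cross product of cochains for a pair of relations. -/

section FiniteLevel

variable {R : Type*} [CommRing R] {X Y : Type*} {U : Set (X × X)} {V : Set (Y × Y)}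
  {G : Type*} [AddCommGroup G] [Module R G] {G' : Type*} [AddCommGroup G'] [Module R G']

variable (R U V G G') in
/-- The map from the tensor product of cochain modules to the cochains on the tensor product. -/
noncomputable def tensorCochainMap :
    TotCochain R U G ⊗[R] TotCochain R V G' →ₗ[R] TensorCochain R U V (G ⊗[R] G') :=
  (TensorProduct.homTensorHomMap (RingHom.id R) (TotChain R U) (TotChain R V) G G' ∘ₗ
    TensorProduct.map (Submodule.subtype _) (Submodule.subtype _)).codRestrict _ (by
      intro z
      induction z with
      | zero => rw [map_zero]; exact Submodule.zero_mem _
      | add x y hx hy => rw [map_add]; exact Submodule.add_mem _ hx hy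
      | tmul x y =>
        obtain ⟨x, N, hN⟩ := x
        obtain ⟨y, M, hM⟩ := y
        refine ⟨N + M, fun n hn z hz => ?_⟩
        rw [← Submodule.mem_bot R]
        refine map_mem_of_gen_tmul_gen (fun i j σ τ hij => ?_) hz
        rw [Submodule.mem_bot]
        change x (gen i σ) ⊗ₜ y (gen j τ) = 0
        rcases (by omega : N ≤ i ∨ M ≤ j) with h | h
        · rw [hN i h _ (gen_mem_totDeg i σ), TensorProduct.zero_tmul]
        · rw [hM j h _ (gen_mem_totDeg j τ), TensorProduct.tmul_zero])

theorem tensorCochainMap_tmul (f : TotCochain R U G) (g : TotCochain R V G') (a : TotChain R U)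
    (b : TotChain R V) :
    (tensorCochainMap R U V G G' (f ⊗ₜ g)).1 (a ⊗ₜ b) = f.1 a ⊗ₜ g.1 b := rfl

theorem tensorCochainMap_comm (x : TotCochain R U G ⊗[R] TotCochain R V G') :
    tensorCochainMap R U V G G'
        (tensorD (totCoboundary R U G) (cochainSign R U G) (totCoboundary R V G') x) =
      tensorCoboundary R U V (G ⊗[R] G') (tensorCochainMap R U V G G' x) := by
  induction x with
  | zero => simp
  | add x y hx hy => simp only [map_add, hx, hy]
  | tmul f g =>
    refine Subtype.ext (TensorProduct.ext' fun a b => ?_)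
    rw [boundedDualMap_apply, LinearMap.add_apply, LinearMap.add_apply, TensorProduct.map_tmul,
      TensorProduct.map_tmul, TensorProduct.map_tmul, TensorProduct.map_tmul, map_add, map_add,
      Submodule.coe_add, LinearMap.add_apply]
    rfl

theorem tensorCochain_ext {z z' : TensorCochain R U V G}
    (h : ∀ a b, z.1 (a ⊗ₜ b) = z'.1 (a ⊗ₜ b)) : z = z' :=
  Subtype.ext (TensorProduct.ext' h)

/-- A linear map raising degrees by one. -/
def RaisesDegree (h : TotChain R U →ₗ[R] TotChain R U) : Prop :=
  ∀ n, ∀ x ∈ totDeg R U n, h x ∈ totDeg R U (n + 1)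

/-- The map `1 - ∂h - h∂`. -/
noncomputable def defect (h : TotChain R U →ₗ[R] TotChain R U) : TotChain R U →ₗ[R] TotChain R U :=
  LinearMap.id - totBoundary R U ∘ₗ h - h ∘ₗ totBoundary R U

theorem defect_apply (h : TotChain R U →ₗ[R] TotChain R U) (x : TotChain R U) :
    defect h x = x - totBoundary R U (h x) - h (totBoundary R U x) := rfl

theorem RaisesDegree.defect_mem {h : TotChain R U →ₗ[R] TotChain R U} (hh : RaisesDegree h)
    (n : ℕ) (x : TotChain R U) (hx : x ∈ totDeg R U n) : defect h x ∈ totDeg R U n := by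
  refine Submodule.sub_mem _ (Submodule.sub_mem _ hx (totBoundary_mem n _ (hh n x hx))) ?_
  rcases n with _ | n
  · rw [LinearMap.comp_apply, totBoundary_eq_zero x hx, map_zero]
    exact Submodule.zero_mem _
  · exact hh n _ (totBoundary_mem n x hx)

theorem RaisesDegree.isGradedMap {h : TotChain R U →ₗ[R] TotChain R U} (hh : RaisesDegree h) :
    IsGradedMap (totDeg R U) (totDeg R U) h := fun n => ⟨n + 1, by omega, hh n⟩

theorem RaisesDegree.isGradedMap_defect {h : TotChain R U →ₗ[R] TotChain R U}
    (hh : RaisesDegree h) : IsGradedMap (totDeg R U) (totDeg R U) (defect h) :=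
  fun n => ⟨n, by omega, hh.defect_mem n⟩

theorem RaisesDegree.totSign {h : TotChain R U →ₗ[R] TotChain R U} (hh : RaisesDegree h)
    (x : TotChain R U) : h (totSign R U x) = -totSign R U (h x) := by
  suffices H : h ∘ₗ VR.totSign R U = -(VR.totSign R U ∘ₗ h) from LinearMap.congr_fun H x
  refine totChain_hom_ext R fun n σ => ?_
  rw [LinearMap.neg_apply, LinearMap.comp_apply, LinearMap.comp_apply, totSign_gen,
    totSign_of_mem (hh n _ (gen_mem_totDeg n σ)), map_smul, pow_succ, mul_neg_one, neg_smul, neg_neg]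

theorem isGradedMap_map {p : TotChain R U →ₗ[R] TotChain R U} {q : TotChain R V →ₗ[R] TotChain R V}
    (c : ℕ) (hp : ∀ n, ∀ x ∈ totDeg R U n, p x ∈ totDeg R U n)
    (hq : ∀ n, ∀ x ∈ totDeg R V n, q x ∈ totDeg R V (n + c)) :
    IsGradedMap (tensorDeg R U V) (tensorDeg R U V) (TensorProduct.map p q) := by
  refine fun n => ⟨n + c, by omega, fun x => map_mem_of_gen_tmul_gen ?_⟩
  rintro i j σ τ rfl
  rw [TensorProduct.map_tmul, add_assoc]
  exact tmul_mem_tensorDeg (hp i _ (gen_mem_totDeg i σ)) (hq j _ (gen_mem_totDeg j τ))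

theorem isGradedMap_map_id {p : TotChain R U →ₗ[R] TotChain R U} (hp : RaisesDegree p) :
    IsGradedMap (tensorDeg R U V) (tensorDeg R U V) (TensorProduct.map p LinearMap.id) := by
  refine fun n => ⟨n + 1, by omega, fun x => map_mem_of_gen_tmul_gen ?_⟩
  rintro i j σ τ rfl
  rw [TensorProduct.map_tmul, add_right_comm]
  exact tmul_mem_tensorDeg (hp i _ (gen_mem_totDeg i σ)) (gen_mem_totDeg j τ)

theorem dualDefect_apply {h : TotChain R U →ₗ[R] TotChain R U} (hh : RaisesDegree h)
    (f : TotCochain R U G) : boundedDualMap G hh.isGradedMap_defect f =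
      f - totCoboundary R U G (boundedDualMap G hh.isGradedMap f) -
        boundedDualMap G hh.isGradedMap (totCoboundary R U G f) := by
  refine Subtype.ext (LinearMap.ext fun x => ?_)
  simp only [boundedDualMap_apply, Submodule.coe_sub, LinearMap.sub_apply, defect_apply, map_sub]
  abel

/-- The defect of h is homotopic to the identity through h itself. Dualize on each factor and
compose. -/
theorem isHomotopicToId_tensor {h : TotChain R U →ₗ[R] TotChain R U} (hh : RaisesDegree h)
    {k : TotChain R V →ₗ[R] TotChain R V} (hk : RaisesDegree k) :
    IsHomotopicToId (tensorD (totCoboundary R U G) (cochainSign R U G) (totCoboundary R V G'))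
      (TensorProduct.map (boundedDualMap G hh.isGradedMap_defect)
        (boundedDualMap G' hk.isGradedMap_defect)) := by
  have h1 := IsHomotopicToId.rTensor (d' := totCoboundary R V G') (dualDefect_apply (G := G) hh)
    (σ := cochainSign R U G) (fun f => Subtype.ext (LinearMap.ext fun x => by
      rw [boundedDualMap_apply, boundedDualMap_apply, Submodule.coe_neg, LinearMap.neg_apply,
        boundedDualMap_apply, boundedDualMap_apply, hh.totSign, map_neg, neg_neg]))
  have h2 := IsHomotopicToId.lTensor (dualDefect_apply (G := G') hk) (isSigned_totCoboundary R U G)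
  have h3 := h1.comp h2 ((isSigned_totCoboundary R U G).tensorD_tensorD
    (isSigned_totCoboundary R V G').dd)
  rwa [← TensorProduct.map_comp, LinearMap.comp_id, LinearMap.id_comp] at h3

theorem isGradedMap_defect_tensor {h : TotChain R U →ₗ[R] TotChain R U} (hh : RaisesDegree h)
    {k : TotChain R V →ₗ[R] TotChain R V} (hk : RaisesDegree k) :
    IsGradedMap (tensorDeg R U V) (tensorDeg R U V) (TensorProduct.map (defect h) (defect k)) :=
  isGradedMap_map 0 hh.defect_mem hk.defect_mem

/-- Here the homotopies are formed on the tensor product of the chain modules and dualized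
afterwards. -/
theorem isHomotopicToId_tensorCochain {h : TotChain R U →ₗ[R] TotChain R U} (hh : RaisesDegree h)
    {k : TotChain R V →ₗ[R] TotChain R V} (hk : RaisesDegree k) :
    IsHomotopicToId (tensorCoboundary R U V G)
      (boundedDualMap G (isGradedMap_defect_tensor hh hk)) := by
  have hid : ∀ n, ∀ x ∈ totDeg R U n, (LinearMap.id : TotChain R U →ₗ[R] _) x ∈ totDeg R U n :=
    fun n x hx => hx
  have hid' : ∀ n, ∀ x ∈ totDeg R V n, (LinearMap.id : TotChain R V →ₗ[R] _) x ∈ totDeg R V n :=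
    fun n x hx => hx
  have h1 : IsHomotopicToId (tensorCoboundary R U V G)
      (boundedDualMap G (isGradedMap_map 0 hh.defect_mem hid')) := by
    refine ⟨boundedDualMap G (isGradedMap_map_id hh), fun z => tensorCochain_ext fun a b => ?_⟩
    simp only [boundedDualMap_apply, Submodule.coe_sub, LinearMap.sub_apply, LinearMap.add_apply,
      TensorProduct.map_tmul, LinearMap.id_apply, defect_apply, map_add, hh.totSign,
      TensorProduct.sub_tmul, map_sub, TensorProduct.neg_tmul, map_neg]
    abel
  have h2 : IsHomotopicToId (tensorCoboundary R U V G)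
      (boundedDualMap G (isGradedMap_map 0 hid hk.defect_mem)) := by
    refine ⟨boundedDualMap G (isGradedMap_map (p := VR.totSign R U) 1 (fun n x hx => ?_) hk),
      fun z => tensorCochain_ext fun a b => ?_⟩
    · rw [totSign_of_mem hx]
      exact Submodule.smul_mem _ _ hx
    · simp only [boundedDualMap_apply, Submodule.coe_sub, LinearMap.sub_apply, LinearMap.add_apply,
        TensorProduct.map_tmul, LinearMap.id_apply, defect_apply, map_add, totSign_totBoundary,
        totSign_totSign, TensorProduct.tmul_sub, map_sub, TensorProduct.neg_tmul, map_neg]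
      abel
  have h3 := h1.comp h2 (fun z => Subtype.ext (LinearMap.ext fun x => by
    rw [boundedDualMap_apply, boundedDualMap_apply, tensorBoundary_tensorBoundary, map_zero]
    rfl))
  refine (congrArg _ ?_).mp h3
  exact LinearMap.ext fun z => tensorCochain_ext fun a b => rfl

variable (R U G) in
/-- The evaluation of cochains at a chain. -/
noncomputable def evalChain (a : TotChain R U) : TotCochain R U G →ₗ[R] G :=
  LinearMap.applyₗ a ∘ₗ Submodule.subtype _

@[simp] theorem evalChain_apply (a : TotChain R U) (f : TotCochain R U G) :
    evalChain R U G a f = f.1 a := rfl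

variable (G) in
/-- The cochains `g • β`. -/
noncomputable def smulCochain (β : TotChain R U →ₗ[R] R) {N : ℕ}
    (hβ : ∀ n, N ≤ n → ∀ x ∈ totDeg R U n, β x = 0) : G →ₗ[R] TotCochain R U G where
  toFun g := ⟨β.smulRight g, N, fun n hn x hx => by
    rw [LinearMap.smulRight_apply, hβ n hn x hx, zero_smul]⟩
  map_add' g g' := Subtype.ext (LinearMap.ext fun x => smul_add (β x) g g')
  map_smul' c g := Subtype.ext (LinearMap.ext fun x => smul_comm (β x) c g)

@[simp] theorem smulCochain_apply (β : TotChain R U →ₗ[R] R) {N : ℕ}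
    (hβ : ∀ n, N ≤ n → ∀ x ∈ totDeg R U n, β x = 0) (g : G) (x : TotChain R U) :
    (smulCochain G β hβ g).1 x = β x • g := rfl

/-- The decomposition of the defect of a homotopy as a finite sum in each degree. -/
def HasFiniteDefect (h : TotChain R U →ₗ[R] TotChain R U) : Prop :=
  ∀ N, ∃ (k : ℕ) (β : Fin k → TotChain R U →ₗ[R] R) (e : Fin k → TotChain R U),
    (∀ m n, N ≤ n → ∀ x ∈ totDeg R U n, β m x = 0) ∧ ∀ n, n < N → ∀ x ∈ totDeg R U n,
      defect h x = ∑ m, β m x • e m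

variable (G G') in
/-- The cochains with values in a tensor product can be factored after composition with the
defect of `h`. -/
structure Factors (h : TotChain R U →ₗ[R] TotChain R U) (hh : RaisesDegree h) : Prop where
  surj : ∀ φ : TotCochain R U (G ⊗[R] G'), ∃ x : TotCochain R U G ⊗[R] G',
    ∀ a, (evalChain R U G a).rTensor G' x = φ.1 (defect h a)
  inj : ∀ y : TotCochain R U G ⊗[R] G', (∀ a, (evalChain R U G a).rTensor G' y = 0) →
    (boundedDualMap G hh.isGradedMap_defect).rTensor G' y = 0

theorem totChain_forall {M : Type*} [AddCommGroup M] [Module R M] {f g : TotChain R U →ₗ[R] M}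
    (h : ∀ n, ∀ x ∈ totDeg R U n, f x = g x) (x : TotChain R U) : f x = g x :=
  LinearMap.congr_fun (totChain_hom_ext R fun n σ => h n _ (gen_mem_totDeg n σ)) x

theorem evalChain_comp_smulCochain (β : TotChain R U →ₗ[R] R) {N : ℕ}
    (hβ : ∀ n, N ≤ n → ∀ x ∈ totDeg R U n, β x = 0) (a : TotChain R U) :
    evalChain R U G a ∘ₗ smulCochain G β hβ = β a • LinearMap.id := rfl

/-- A bounded cochain sees only finitely many degrees, in which the defect has finite rank. The
bound does not depend on the decomposition, so it may be enlarged in order to treat several cochains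
at once. -/
theorem dualDefect_eq_sum {h : TotChain R U →ₗ[R] TotChain R U} (hh : RaisesDegree h)
    (f : TotCochain R U G) : ∃ N₀, ∀ N, N₀ ≤ N → ∀ (k : ℕ) (β : Fin k → TotChain R U →ₗ[R] R)
      (e : Fin k → TotChain R U) (hβ : ∀ m n, N ≤ n → ∀ x ∈ totDeg R U n, β m x = 0),
      (∀ n, n < N → ∀ x ∈ totDeg R U n, defect h x = ∑ m, β m x • e m) →
      boundedDualMap G hh.isGradedMap_defect f = ∑ m, smulCochain G (β m) (hβ m) (f.1 (e m)) := by
  obtain ⟨N₀, hN₀⟩ := f.2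
  refine ⟨N₀, fun N hN k β e hβ hd => Subtype.ext (LinearMap.ext (totChain_forall fun n x hx => ?_))⟩
  rw [boundedDualMap_apply, Submodule.coe_sum, LinearMap.sum_apply]
  simp only [smulCochain_apply]
  rcases lt_or_ge n N with h1 | h1
  · rw [hd n h1 x hx, map_sum]
    simp only [map_smul]
  · rw [hN₀ n (by omega) _ (hh.defect_mem n x hx)]
    exact (Finset.sum_eq_zero fun m _ => by rw [hβ m n h1 x hx, zero_smul]).symm

/-- After composition with a defect of finite rank, a cochain is determined by its values at
finitely many chains, and values in G ⊗ G' can be spread over cochains tensored with G'. -/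
theorem HasFiniteDefect.factors {h : TotChain R U →ₗ[R] TotChain R U} (hf : HasFiniteDefect h)
    (hh : RaisesDegree h) : Factors G G' h hh where
  surj φ := by
    obtain ⟨N₀, hN₀⟩ := dualDefect_eq_sum hh φ
    obtain ⟨k, β, e, hβ, hd⟩ := hf N₀
    refine ⟨∑ m, (smulCochain G (β m) (hβ m)).rTensor G' (φ.1 (e m)), fun a => ?_⟩
    have h1 := LinearMap.congr_fun (Subtype.ext_iff.1 (hN₀ N₀ le_rfl k β e hβ hd)) a
    rw [boundedDualMap_apply] at h1
    rw [h1, map_sum, Submodule.coe_sum, LinearMap.sum_apply]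
    refine Finset.sum_congr rfl fun m _ => ?_
    rw [← LinearMap.rTensor_comp_apply, evalChain_comp_smulCochain, LinearMap.rTensor_smul,
      LinearMap.rTensor_id]
    rfl
  inj y hy := by
    -- Simple tensors are handled by `dualDefect_eq_sum`; for a sum the larger of the two bounds is
    -- used.
    have key : ∃ N₀, ∀ N, N₀ ≤ N → ∀ (k : ℕ) (β : Fin k → TotChain R U →ₗ[R] R)
      (e : Fin k → TotChain R U) (hβ : ∀ m n, N ≤ n → ∀ x ∈ totDeg R U n, β m x = 0),
      (∀ n, n < N → ∀ x ∈ totDeg R U n, defect h x = ∑ m, β m x • e m) →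
      (boundedDualMap G hh.isGradedMap_defect).rTensor G' y =
        ∑ m, (smulCochain G (β m) (hβ m)).rTensor G' ((evalChain R U G (e m)).rTensor G' y) := by
      clear hy
      induction y with
      | zero => exact ⟨0, fun _ _ _ _ _ _ _ => by simp⟩
      | add y y' h1 h2 =>
        obtain ⟨N₁, h1⟩ := h1
        obtain ⟨N₂, h2⟩ := h2
        refine ⟨max N₁ N₂, fun N hN k β e hβ hd => ?_⟩
        simp only [map_add, Finset.sum_add_distrib]
        rw [h1 N (le_of_max_le_left hN) k β e hβ hd, h2 N (le_of_max_le_right hN) k β e hβ hd]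
      | tmul f g =>
        obtain ⟨N₀, hN₀⟩ := dualDefect_eq_sum hh f
        refine ⟨N₀, fun N hN k β e hβ hd => ?_⟩
        simp only [LinearMap.rTensor_tmul, evalChain_apply]
        rw [hN₀ N hN k β e hβ hd, TensorProduct.sum_tmul]
    obtain ⟨N₀, hN₀⟩ := key
    obtain ⟨k, β, e, hβ, hd⟩ := hf N₀
    rw [hN₀ N₀ le_rfl k β e hβ hd]
    exact Finset.sum_eq_zero fun m _ => by rw [hy, map_zero]

theorem raisesDegree_zero : RaisesDegree (0 : TotChain R U →ₗ[R] TotChain R U) :=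
  fun _ _ _ => Submodule.zero_mem _

theorem defect_zero (x : TotChain R U) : defect 0 x = x := by simp [defect_apply]

/-- The cochain with given values on simplices. -/
noncomputable def cochainOf (c : (Σ n, Simplex U n) → G) {N : ℕ}
    (hc : ∀ s, N ≤ s.1 → c s = 0) : TotCochain R U G :=
  ⟨totLift R c, N, fun n hn x hx => by
    rw [← Submodule.mem_bot R]
    exact map_mem_of_gen (fun σ => by rw [totLift_gen, hc ⟨n, σ⟩ hn]; exact Submodule.zero_mem _) hx⟩

theorem cochainOf_gen (c : (Σ n, Simplex U n) → G) {N : ℕ} (hc : ∀ s, N ≤ s.1 → c s = 0) (n : ℕ)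
    (σ : Simplex U n) : (cochainOf (R := R) c hc).1 (gen n σ) = c ⟨n, σ⟩ := totLift_gen R _ _ _

/-- Over a noetherian ring G' is finitely presented, and tensoring with it commutes with products.
Hence no homotopy is needed, and h = 0, with defect the identity, will do. Coefficients on
generators give surjectivity, coefficients on relations injectivity. -/
theorem factors_of_finite [IsNoetherianRing R] [Module.Finite R G'] :
    Factors G G' (0 : TotChain R U →ₗ[R] TotChain R U) raisesDegree_zero := by
  obtain ⟨m, s, hs⟩ := Module.Finite.exists_fin (R := R) (M := G')
  refine ⟨fun φ => ?_, fun y hy => ?_⟩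
  · obtain ⟨φ, N, hN⟩ := φ
    -- Coefficients are chosen simplex by simplex, and as zero in high degrees in order that the
    -- resulting cochains are bounded.
    have : ∀ t : Σ n, Simplex U n, ∃ c : Fin m → G, φ (gen t.1 t.2) = ∑ i, c i ⊗ₜ s i ∧
        (N ≤ t.1 → c = 0) := by
      intro t
      by_cases h : N ≤ t.1
      · refine ⟨0, ?_, fun _ => rfl⟩
        rw [hN _ h _ (gen_mem_totDeg t.1 t.2)]
        simp
      · obtain ⟨c, hc⟩ := exists_eq_sum_tmul hs (φ (gen t.1 t.2))
        exact ⟨c, hc, fun h' => absurd h' h⟩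
    choose c hc hcN using this
    refine ⟨∑ i, cochainOf (N := N) (fun t => c t i) (fun t ht => congrFun (hcN t ht) i) ⊗ₜ s i,
      fun a => ?_⟩
    rw [defect_zero, map_sum]
    simp only [LinearMap.rTensor_tmul, evalChain_apply]
    revert a
    suffices H : ∑ i, (TensorProduct.mk R G G').flip (s i) ∘ₗ (cochainOf (R := R) (N := N)
        (fun t => c t i) (fun t ht => congrFun (hcN t ht) i)).1 = φ from fun a => by
      rw [← H, LinearMap.sum_apply]
      rfl
    refine totChain_hom_ext R fun n σ => ?_
    rw [LinearMap.sum_apply, hc ⟨n, σ⟩]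
    refine Finset.sum_congr rfl fun i _ => ?_
    rw [LinearMap.comp_apply, cochainOf_gen]
    rfl
  · have hid : boundedDualMap G (raisesDegree_zero (R := R) (U := U)).isGradedMap_defect =
        LinearMap.id :=
      LinearMap.ext fun f => Subtype.ext (LinearMap.ext fun a => by
        rw [boundedDualMap_apply, defect_zero]
        rfl)
    rw [hid, LinearMap.rTensor_id, LinearMap.id_apply]
    obtain ⟨k, r, hr, hrel⟩ := exists_relations (M := G) (R := R) hs
    obtain ⟨f, rfl⟩ := exists_eq_sum_tmul hs y
    simp only [map_sum, LinearMap.rTensor_tmul, evalChain_apply] at hy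
    choose N hN using fun i => (f i).2
    have : ∀ t : Σ n, Simplex U n, ∃ γ : Fin k → G,
        (∀ i, (f i).1 (gen t.1 t.2) = ∑ q, r q i • γ q) ∧ (∑ i, N i ≤ t.1 → γ = 0) := by
      intro t
      by_cases h : ∑ i, N i ≤ t.1
      · refine ⟨0, fun i => ?_, fun _ => rfl⟩
        rw [hN i t.1 ((Finset.single_le_sum (fun _ _ => Nat.zero_le _)
          (Finset.mem_univ i)).trans h) _ (gen_mem_totDeg t.1 t.2)]
        simp
      · obtain ⟨γ, hγ⟩ := hrel _ (hy (gen t.1 t.2))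
        exact ⟨γ, hγ, fun h' => absurd h' h⟩
    choose γ hγ hγN using this
    have hf : ∀ i, f i = ∑ q, r q i • cochainOf (N := ∑ i, N i) (fun t => γ t q)
        (fun t ht => congrFun (hγN t ht) q) := by
      intro i
      refine Subtype.ext (totChain_hom_ext R fun n σ => ?_)
      rw [hγ ⟨n, σ⟩ i, Submodule.coe_sum, LinearMap.sum_apply]
      refine Finset.sum_congr rfl fun q _ => ?_
      rw [Submodule.coe_smul, LinearMap.smul_apply, cochainOf_gen]
    -- Exchanging the order of summation brings out the relations among the generators of G'.
    have h2 : ∑ i, f i ⊗ₜ[R] s i = ∑ q, cochainOf (R := R) (N := ∑ i, N i) (fun t => γ t q)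
        (fun t ht => congrFun (hγN t ht) q) ⊗ₜ[R] ∑ i, r q i • s i := by
      simp only [TensorProduct.tmul_sum, TensorProduct.tmul_smul]
      rw [Finset.sum_comm]
      refine Finset.sum_congr rfl fun i _ => ?_
      conv_lhs => rw [hf i]
      rw [TensorProduct.sum_tmul]
      exact Finset.sum_congr rfl fun q _ => (TensorProduct.smul_tmul' _ _ _).symm
    rw [h2]
    exact Finset.sum_eq_zero fun q _ => by rw [hr, TensorProduct.tmul_zero]

theorem tensorCochainMap_lTensor_smulCochain (β : TotChain R V →ₗ[R] R) {N : ℕ}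
    (hβ : ∀ n, N ≤ n → ∀ x ∈ totDeg R V n, β x = 0) (x : TotCochain R U G ⊗[R] G')
    (a : TotChain R U) (b : TotChain R V) :
    (tensorCochainMap R U V G G' ((smulCochain G' β hβ).lTensor _ x)).1 (a ⊗ₜ b) =
      β b • (evalChain R U G a).rTensor G' x := by
  induction x with
  | zero => simp
  | add x y hx hy =>
    simp only [map_add, Submodule.coe_add, LinearMap.add_apply, hx, hy, smul_add]
  | tmul f g =>
    rw [LinearMap.lTensor_tmul, tensorCochainMap_tmul, smulCochain_apply, TensorProduct.tmul_smul]
    rfl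

theorem evalChain_tensorCochainMap (x : TotCochain R U G ⊗[R] TotCochain R V G')
    (a : TotChain R U) (b : TotChain R V) :
    (evalChain R U G a).rTensor G' ((evalChain R V G' b).lTensor _ x) =
      (tensorCochainMap R U V G G' x).1 (a ⊗ₜ b) := by
  induction x with
  | zero => simp
  | add x y hx hy => simp only [map_add, Submodule.coe_add, LinearMap.add_apply, hx, hy]
  | tmul f g => rfl

/-- The cochains on a tensor product of chain modules, up to quasi-isomorphism. -/
theorem quasiIso_tensorCochainMap {h : TotChain R U →ₗ[R] TotChain R U} {hh : RaisesDegree h}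
    (hf : Factors G G' h hh) {k : TotChain R V →ₗ[R] TotChain R V} (hk : RaisesDegree k)
    (hfk : HasFiniteDefect k) :
    DQuasiIso (N := TensorCochain R U V (G ⊗[R] G'))
      (tensorD (totCoboundary R U G) (cochainSign R U G) (totCoboundary R V G'))
      (tensorCoboundary R U V (G ⊗[R] G')) (tensorCochainMap R U V G G') := by
  refine DQuasiIso.of_homotopic ((isSigned_totCoboundary R U G).tensorD_tensorD
    (isSigned_totCoboundary R V G').dd) (fun z => Subtype.ext (LinearMap.ext fun x => ?_))
    (isHomotopicToId_tensor hh hk) (isHomotopicToId_tensorCochain hh hk) tensorCochainMap_comm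
    (fun x => ?_) (fun z => ?_) (fun y hy => ?_)
  · rw [boundedDualMap_apply, boundedDualMap_apply, tensorBoundary_tensorBoundary, map_zero]
    rfl
  · induction x with
    | zero => simp
    | add x y hx hy => simp only [map_add, hx, hy]
    | tmul f g => exact tensorCochain_ext fun a b => rfl
  -- The defect of k turns z into a finite sum of the cochains z(-, eₘ) multiplied by βₘ. Each z(-,
  -- eₘ) still has values in G ⊗ G' and is factored after composition with the defect of h.
  · obtain ⟨z, N, hN⟩ := z
    obtain ⟨l, β, e, hβ, hd⟩ := hfk N
    have hz : ∀ n, N ≤ n → ∀ a ∈ totDeg R U n, ∀ b, z (a ⊗ₜ b) = 0 := by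
      intro n hn a ha
      exact totChain_forall (f := z ∘ₗ TensorProduct.mk R _ _ a) (g := 0)
        fun i b hb => hN (n + i) (by omega) _ (tmul_mem_tensorDeg ha hb)
    have hz' : ∀ n, N ≤ n → ∀ b ∈ totDeg R V n, ∀ a, z (a ⊗ₜ b) = 0 := by
      intro n hn b hb
      exact totChain_forall (f := z ∘ₗ (TensorProduct.mk R _ _).flip b) (g := 0)
        fun i a ha => hN (i + n) (by omega) _ (tmul_mem_tensorDeg ha hb)
    choose x hx using fun m => hf.surj
      ⟨z ∘ₗ (TensorProduct.mk R _ _).flip (e m), N, fun n hn a ha => hz n hn a ha (e m)⟩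
    refine ⟨∑ m, (smulCochain G' (β m) (hβ m)).lTensor _ (x m), tensorCochain_ext fun a => ?_⟩
    refine totChain_forall (f := (tensorCochainMap R U V G G' _).1 ∘ₗ TensorProduct.mk R _ _ a)
      (g := (z ∘ₗ TensorProduct.map (defect h) (defect k)) ∘ₗ TensorProduct.mk R _ _ a)
      fun n b hb => ?_
    simp only [LinearMap.comp_apply, TensorProduct.mk_apply, TensorProduct.map_tmul]
    rw [map_sum, Submodule.coe_sum, LinearMap.sum_apply]
    simp only [tensorCochainMap_lTensor_smulCochain, hx]
    rcases lt_or_ge n N with h1 | h1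
    · rw [hd n h1 b hb, TensorProduct.tmul_sum, map_sum]
      refine Finset.sum_congr rfl fun m _ => ?_
      rw [TensorProduct.tmul_smul, map_smul]
      rfl
    · rw [hz' n h1 _ (hk.defect_mem n b hb)]
      exact Finset.sum_eq_zero fun m _ => by rw [hβ m n h1 b hb, zero_smul]
  -- The dual defect of k expresses y by its values at the chains eₘ. These have zero evaluations
  -- because y maps to zero, so the dual defect of h kills them.
  · have key : ∃ N₀, ∀ N, N₀ ≤ N → ∀ (l : ℕ) (β : Fin l → TotChain R V →ₗ[R] R)
      (e : Fin l → TotChain R V) (hβ : ∀ m n, N ≤ n → ∀ x ∈ totDeg R V n, β m x = 0),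
      (∀ n, n < N → ∀ x ∈ totDeg R V n, defect k x = ∑ m, β m x • e m) →
      (boundedDualMap G' hk.isGradedMap_defect).lTensor (TotCochain R U G) y =
        ∑ m, (smulCochain G' (β m) (hβ m)).lTensor _ ((evalChain R V G' (e m)).lTensor _ y) := by
      clear hy
      induction y with
      | zero => exact ⟨0, fun _ _ _ _ _ _ _ => by simp⟩
      | add y y' h1 h2 =>
        obtain ⟨N₁, h1⟩ := h1
        obtain ⟨N₂, h2⟩ := h2
        refine ⟨max N₁ N₂, fun N hN k β e hβ hd => ?_⟩
        simp only [map_add, Finset.sum_add_distrib]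
        rw [h1 N (le_of_max_le_left hN) k β e hβ hd, h2 N (le_of_max_le_right hN) k β e hβ hd]
      | tmul f g =>
        obtain ⟨N₀, hN₀⟩ := dualDefect_eq_sum hk g
        refine ⟨N₀, fun N hN l β e hβ hd => ?_⟩
        simp only [LinearMap.lTensor_tmul, evalChain_apply]
        rw [hN₀ N hN l β e hβ hd, TensorProduct.tmul_sum]
    obtain ⟨N₀, hN₀⟩ := key
    obtain ⟨l, β, e, hβ, hd⟩ := hfk N₀
    have h1 : TensorProduct.map (boundedDualMap G hh.isGradedMap_defect)
        (boundedDualMap G' hk.isGradedMap_defect) y =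
        (boundedDualMap G hh.isGradedMap_defect).rTensor _
          ((boundedDualMap G' hk.isGradedMap_defect).lTensor (TotCochain R U G) y) := by
      rw [← LinearMap.comp_apply, LinearMap.rTensor_comp_lTensor]
    rw [h1, hN₀ N₀ le_rfl l β e hβ hd, map_sum]
    refine Finset.sum_eq_zero fun m _ => ?_
    rw [← LinearMap.comp_apply, LinearMap.rTensor_comp_lTensor, ← LinearMap.lTensor_comp_rTensor,
      LinearMap.comp_apply, hf.inj, map_zero]
    intro a
    rw [evalChain_tensorCochainMap, hy]
    rfl

variable (R U V G G') in
/-- The cross product of cochains. -/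
noncomputable def totCross :
    TotCochain R U G ⊗[R] TotCochain R V G' →ₗ[R] TotCochain R (prodRel U V) (G ⊗[R] G') :=
  boundedDualMap (G ⊗[R] G') isGradedMap_alexanderWhitney ∘ₗ tensorCochainMap R U V G G'

/-- The cochain level cross product is a quasi-isomorphism under finiteness conditions. -/
theorem quasiIso_totCross [IsDomain R] [IsPrincipalIdealRing R] (hU : ∀ x, (x, x) ∈ U)
    (hV : ∀ y, (y, y) ∈ V) (hfV : FiniteType R V)
    (hfU : FiniteType R U ∨ Module.Finite R G') :
    DQuasiIso (N := TotCochain R (prodRel U V) (G ⊗[R] G'))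
      (tensorD (totCoboundary R U G) (cochainSign R U G) (totCoboundary R V G'))
      (totCoboundary R (prodRel U V) (G ⊗[R] G')) (totCross R U V G G') := by
  refine (quasiIso_alexanderWhitney_dual R U V _ hU hV).comp ?_
  obtain ⟨k, hk, hfk⟩ := hfV.exists_homotopy_sum
  rcases hfU with hfU | hfU
  · obtain ⟨h, hh, hfh⟩ := hfU.exists_homotopy_sum
    exact quasiIso_tensorCochainMap (HasFiniteDefect.factors hfh hh) hk hfk
  · exact quasiIso_tensorCochainMap factors_of_finite hk hfk

end FiniteLevel

end VR

/-! ### Tensor products of direct limits. -/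

section DirectLimitTensor

variable {R : Type*} [CommRing R] {ι κ : Type*} [DecidableEq ι] [DecidableEq κ] [Preorder ι]
  [Preorder κ] [IsDirectedOrder ι] [IsDirectedOrder κ]
  {M : ι → Type*} [∀ i, AddCommGroup (M i)] [∀ i, Module R (M i)]
  {N : κ → Type*} [∀ i, AddCommGroup (N i)] [∀ i, Module R (N i)]
  (f : ∀ i j, i ≤ j → M i →ₗ[R] M j) (g : ∀ i j, i ≤ j → N i →ₗ[R] N j)
  [DirectedSystem M (f · · ·)] [DirectedSystem N (g · · ·)]

/-- Tensor products commute with direct limits; the two limits are taken one at a time, first in the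
second variable. -/
theorem tensor_directLimit_of_eq_zero {i : ι} {j : κ} {x : M i ⊗[R] N j}
    (hx : TensorProduct.map (Module.DirectLimit.of R ι M f i)
      (Module.DirectLimit.of R κ N g j) x = 0) :
    ∃ k l, ∃ (hk : i ≤ k) (hl : j ≤ l), TensorProduct.map (f i k hk) (g j l hl) x = 0 := by
  rw [← LinearMap.lTensor_comp_rTensor, LinearMap.comp_apply] at hx
  have hr : ∀ w : Module.DirectLimit M f ⊗[R] N j,
      TensorProduct.directLimitRight g (Module.DirectLimit M f)
        ((Module.DirectLimit.of R κ N g j).lTensor _ w) =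
      Module.DirectLimit.of R κ _ (fun i j h => (g i j h).lTensor (Module.DirectLimit M f)) j w :=
    fun w => by
      induction w with
      | zero => simp
      | add x y hx hy => simp only [map_add, hx, hy]
      | tmul x y => simp
  have h1 := congrArg (TensorProduct.directLimitRight g (Module.DirectLimit M f)) hx
  rw [hr, map_zero] at h1
  obtain ⟨l, hl, h1⟩ := Module.DirectLimit.of.zero_exact h1
  rw [← LinearMap.comp_apply, LinearMap.lTensor_comp_rTensor, ← LinearMap.rTensor_comp_lTensor,
    LinearMap.comp_apply] at h1
  have h2 := congrArg (TensorProduct.directLimitLeft f (N l)) h1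
  rw [TensorProduct.directLimitLeft_rTensor_of, map_zero] at h2
  obtain ⟨k, hk, h2⟩ := Module.DirectLimit.of.zero_exact h2
  refine ⟨k, l, hk, hl, ?_⟩
  rwa [← LinearMap.comp_apply, LinearMap.rTensor_comp_lTensor] at h2

end DirectLimitTensor

namespace VR

/-! ### The limit complexes and their cross product. -/

section Limit

variable (R : Type*) [CommRing R] {X Y : Type*} (G : Type*) [AddCommGroup G] [Module R G]
  (G' : Type*) [AddCommGroup G'] [Module R G']

theorem entourage_le_iff {𝒰 : SemiUniformity X} {U V : Entourage 𝒰} (h : U ≤ V) (p : X × X)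
    (hp : p ∈ V.rel) : ((fun x => x) p.1, (fun x => x) p.2) ∈ U.rel := h hp

/-- The restriction of cochains to a smaller entourage. -/
noncomputable def totRestr (𝒰 : SemiUniformity X) (U V : Entourage 𝒰) (h : U ≤ V) :
    TotCochain R U.rel G →ₗ[R] TotCochain R V.rel G :=
  boundedDualMap G (isGradedMap_totMap (fun x => x) (entourage_le_iff h))

theorem totRestr_apply {𝒰 : SemiUniformity X} {U V : Entourage 𝒰} (h : U ≤ V)
    (f : TotCochain R U.rel G) (x : TotChain R V.rel) :
    (totRestr R G 𝒰 U V h f).1 x = f.1 (totMap R (fun x => x) (entourage_le_iff h) x) := rfl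

instance (𝒰 : SemiUniformity X) : DirectedSystem (fun U : Entourage 𝒰 => TotCochain R U.rel G)
    (fun U V h => totRestr R G 𝒰 U V h) where
  map_self U f := Subtype.ext (totChain_hom_ext R fun n σ => by
    rw [totRestr_apply, totMap_gen]
    rfl)
  map_map U V W h k f := Subtype.ext (totChain_hom_ext R fun n σ => by
    rw [totRestr_apply, totRestr_apply, totRestr_apply, totMap_gen, totMap_gen, totMap_gen]
    rfl)

/-- The direct limit of the total cochain modules. -/
def LimTot (𝒰 : SemiUniformity X) : Type _ :=
  Module.DirectLimit (fun U : Entourage 𝒰 => TotCochain R U.rel G) (totRestr R G 𝒰)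

noncomputable instance (𝒰 : SemiUniformity X) : AddCommGroup (LimTot R G 𝒰) :=
  inferInstanceAs (AddCommGroup (Module.DirectLimit
    (fun U : Entourage 𝒰 => TotCochain R U.rel G) (totRestr R G 𝒰)))

noncomputable instance (𝒰 : SemiUniformity X) : Module R (LimTot R G 𝒰) :=
  inferInstanceAs (Module R (Module.DirectLimit
    (fun U : Entourage 𝒰 => TotCochain R U.rel G) (totRestr R G 𝒰)))

/-- The class of a cochain. -/
noncomputable def limTotOf (𝒰 : SemiUniformity X) (U : Entourage 𝒰) :
    TotCochain R U.rel G →ₗ[R] LimTot R G 𝒰 :=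
  Module.DirectLimit.of R (Entourage 𝒰) (fun U => TotCochain R U.rel G) (totRestr R G 𝒰) U

variable {R G} in
theorem exists_limTotOf {𝒰 : SemiUniformity X} (x : LimTot R G 𝒰) :
    ∃ U f, limTotOf R G 𝒰 U f = x := Module.DirectLimit.exists_of x

theorem limTotOf_totRestr {𝒰 : SemiUniformity X} {U V : Entourage 𝒰} (h : U ≤ V)
    (f : TotCochain R U.rel G) :
    limTotOf R G 𝒰 V (totRestr R G 𝒰 U V h f) = limTotOf R G 𝒰 U f := Module.DirectLimit.of_f

variable {R G} in
theorem limTotOf_eq_zero {𝒰 : SemiUniformity X} {U : Entourage 𝒰} {f : TotCochain R U.rel G}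
    (h : limTotOf R G 𝒰 U f = 0) : ∃ V, ∃ h : U ≤ V, totRestr R G 𝒰 U V h f = 0 :=
  Module.DirectLimit.of.zero_exact (f := totRestr R G 𝒰) h

/-- Linear maps out of the direct limit. -/
noncomputable def limTotLift (𝒰 : SemiUniformity X) {M : Type*} [AddCommGroup M] [Module R M]
    (F : ∀ U : Entourage 𝒰, TotCochain R U.rel G →ₗ[R] M)
    (hF : ∀ U V (h : U ≤ V) f, F V (totRestr R G 𝒰 U V h f) = F U f) : LimTot R G 𝒰 →ₗ[R] M :=
  Module.DirectLimit.lift R _ _ _ F hF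

theorem limTotLift_of (𝒰 : SemiUniformity X) {M : Type*} [AddCommGroup M] [Module R M]
    (F : ∀ U : Entourage 𝒰, TotCochain R U.rel G →ₗ[R] M)
    (hF : ∀ U V (h : U ≤ V) f, F V (totRestr R G 𝒰 U V h f) = F U f) (U : Entourage 𝒰)
    (f : TotCochain R U.rel G) : limTotLift R G 𝒰 F hF (limTotOf R G 𝒰 U f) = F U f :=
  Module.DirectLimit.lift_of _ _ _

theorem totRestr_totRestr {𝒰 : SemiUniformity X} {U V W : Entourage 𝒰} (h : U ≤ V) (k : V ≤ W)
    (f : TotCochain R U.rel G) :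
    totRestr R G 𝒰 V W k (totRestr R G 𝒰 U V h f) = totRestr R G 𝒰 U W (h.trans k) f :=
  DirectedSystem.map_map (f := fun U V h => totRestr R G 𝒰 U V h) h k f

theorem totRestr_self {𝒰 : SemiUniformity X} {U : Entourage 𝒰} (f : TotCochain R U.rel G) :
    totRestr R G 𝒰 U U le_rfl f = f :=
  DirectedSystem.map_self (f := fun U V h => totRestr R G 𝒰 U V h) f

theorem totCoboundary_totRestr {𝒰 : SemiUniformity X} {U V : Entourage 𝒰} (h : U ≤ V)
    (f : TotCochain R U.rel G) : totCoboundary R V.rel G (totRestr R G 𝒰 U V h f) =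
      totRestr R G 𝒰 U V h (totCoboundary R U.rel G f) :=
  Subtype.ext (LinearMap.ext fun x => by
    rw [totRestr_apply, boundedDualMap_apply, boundedDualMap_apply, totRestr_apply,
      totBoundary_totMap])

theorem cochainSign_totRestr {𝒰 : SemiUniformity X} {U V : Entourage 𝒰} (h : U ≤ V)
    (f : TotCochain R U.rel G) : cochainSign R V.rel G (totRestr R G 𝒰 U V h f) =
      totRestr R G 𝒰 U V h (cochainSign R U.rel G f) :=
  Subtype.ext (LinearMap.ext fun x => by
    rw [totRestr_apply, boundedDualMap_apply, boundedDualMap_apply, totRestr_apply,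
      totSign_totMap])

/-- The differential of the limit complex. -/
noncomputable def limD (𝒰 : SemiUniformity X) : LimTot R G 𝒰 →ₗ[R] LimTot R G 𝒰 :=
  limTotLift R G 𝒰 (fun U => limTotOf R G 𝒰 U ∘ₗ totCoboundary R U.rel G) (fun U V h f => by
    rw [LinearMap.comp_apply, totCoboundary_totRestr, limTotOf_totRestr]
    rfl)

/-- The sign on the limit complex. -/
noncomputable def limSign (𝒰 : SemiUniformity X) : LimTot R G 𝒰 →ₗ[R] LimTot R G 𝒰 :=
  limTotLift R G 𝒰 (fun U => limTotOf R G 𝒰 U ∘ₗ cochainSign R U.rel G) (fun U V h f => by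
    rw [LinearMap.comp_apply, cochainSign_totRestr, limTotOf_totRestr]
    rfl)

theorem limD_of (𝒰 : SemiUniformity X) (U : Entourage 𝒰) (f : TotCochain R U.rel G) :
    limD R G 𝒰 (limTotOf R G 𝒰 U f) = limTotOf R G 𝒰 U (totCoboundary R U.rel G f) :=
  limTotLift_of R G 𝒰 _ _ U f

theorem limSign_of (𝒰 : SemiUniformity X) (U : Entourage 𝒰) (f : TotCochain R U.rel G) :
    limSign R G 𝒰 (limTotOf R G 𝒰 U f) = limTotOf R G 𝒰 U (cochainSign R U.rel G f) :=
  limTotLift_of R G 𝒰 _ _ U f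

theorem isSigned_limD (𝒰 : SemiUniformity X) : IsSigned (limD R G 𝒰) (limSign R G 𝒰) where
  dd x := by
    obtain ⟨U, f, rfl⟩ := exists_limTotOf x
    rw [limD_of, limD_of, (isSigned_totCoboundary R U.rel G).dd, map_zero]
  ss x := by
    obtain ⟨U, f, rfl⟩ := exists_limTotOf x
    rw [limSign_of, limSign_of, (isSigned_totCoboundary R U.rel G).ss]
  sd x := by
    obtain ⟨U, f, rfl⟩ := exists_limTotOf x
    rw [limD_of, limSign_of, limSign_of, limD_of, (isSigned_totCoboundary R U.rel G).sd, map_neg]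

variable {R G G'}

theorem totCross_apply {U : Set (X × X)} {V : Set (Y × Y)}
    (x : TotCochain R U G ⊗[R] TotCochain R V G') (c : TotChain R (prodRel U V)) :
    (totCross R U V G G' x).1 c = (tensorCochainMap R U V G G' x).1 (alexanderWhitney R U V c) :=
  rfl

theorem tensorCochainMap_totRestr {𝒰 : SemiUniformity X} {𝒱 : SemiUniformity Y}
    {U U' : Entourage 𝒰} (hU : U ≤ U') {V V' : Entourage 𝒱} (hV : V ≤ V')
    (x : TotCochain R U.rel G ⊗[R] TotCochain R V.rel G')
    (t : TotChain R U'.rel ⊗[R] TotChain R V'.rel) :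
    (tensorCochainMap R U'.rel V'.rel G G'
      (TensorProduct.map (totRestr R G 𝒰 U U' hU) (totRestr R G' 𝒱 V V' hV) x)).1 t =
    (tensorCochainMap R U.rel V.rel G G' x).1 (TensorProduct.map
      (totMap R (fun x => x) (entourage_le_iff hU)) (totMap R (fun x => x) (entourage_le_iff hV)) t) := by
  induction x with
  | zero => simp
  | add x y hx hy => simp only [map_add, Submodule.coe_add, LinearMap.add_apply, hx, hy]
  | tmul f g =>
    induction t with
    | zero => simp
    | add x y hx hy => simp only [map_add, hx, hy]
    | tmul a b => rfl

variable {𝒰 : SemiUniformity X} {𝒱 : SemiUniformity Y} {𝒲 : SemiUniformity (X × Y)}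
  (hW : ∀ U ∈ 𝒰.filter, ∀ V ∈ 𝒱.filter, prodRel U V ∈ 𝒲.filter)

/-- The entourage `U × V`. -/
abbrev prodEntourage (U : Entourage 𝒰) (V : Entourage 𝒱) : Entourage 𝒲 :=
  ⟨prodRel U.rel V.rel, hW U.rel U.mem V.rel V.mem⟩

theorem prodEntourage_le {U U' : Entourage 𝒰} (hU : U ≤ U') {V V' : Entourage 𝒱} (hV : V ≤ V') :
    prodEntourage hW U V ≤ prodEntourage hW U' V' := fun _ hp => ⟨hU hp.1, hV hp.2⟩

theorem totCross_totRestr {U U' : Entourage 𝒰} (hU : U ≤ U') {V V' : Entourage 𝒱} (hV : V ≤ V')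
    (x : TotCochain R U.rel G ⊗[R] TotCochain R V.rel G') :
    totCross R U'.rel V'.rel G G'
        (TensorProduct.map (totRestr R G 𝒰 U U' hU) (totRestr R G' 𝒱 V V' hV) x) =
      totRestr R (G ⊗[R] G') 𝒲 (prodEntourage hW U V) (prodEntourage hW U' V')
        (prodEntourage_le hW hU hV) (totCross R U.rel V.rel G G' x) := by
  refine Subtype.ext (LinearMap.ext fun c => ?_)
  rw [totCross_apply, tensorCochainMap_totRestr]
  change _ = (tensorCochainMap R U.rel V.rel G G' x).1 (alexanderWhitney R U.rel V.rel _)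
  congr 1
  exact (alexanderWhitney_totMap R (entourage_le_iff hU) (entourage_le_iff hV) c).symm

variable (R G G')

/-- The cross product in the limit, for a fixed cochain on the left. -/
noncomputable def limCrossRight (U : Entourage 𝒰) :
    TotCochain R U.rel G →ₗ[R] LimTot R G' 𝒱 →ₗ[R] LimTot R (G ⊗[R] G') 𝒲 :=
  LinearMap.flip (limTotLift R G' 𝒱
    (fun V => LinearMap.flip ((TensorProduct.mk R _ _).compr₂
      (limTotOf R (G ⊗[R] G') 𝒲 (prodEntourage hW U V) ∘ₗ totCross R U.rel V.rel G G')))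
    (fun V V' hV g => LinearMap.ext fun f => by
      have h := totCross_totRestr hW (le_refl U) hV (f ⊗ₜ[R] g)
      rw [TensorProduct.map_tmul, totRestr_self] at h
      exact (congrArg (limTotOf R (G ⊗[R] G') 𝒲 (prodEntourage hW U V')) h).trans
        (limTotOf_totRestr _ _ _ _)))

theorem limCrossRight_of (U : Entourage 𝒰) (V : Entourage 𝒱) (f : TotCochain R U.rel G)
    (g : TotCochain R V.rel G') : limCrossRight R G G' hW U f (limTotOf R G' 𝒱 V g) =
      limTotOf R (G ⊗[R] G') 𝒲 (prodEntourage hW U V) (totCross R U.rel V.rel G G' (f ⊗ₜ g)) := by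
  rw [limCrossRight, LinearMap.flip_apply, limTotLift_of]
  rfl

/-- The cross product in the limit. -/
noncomputable def limCross : LimTot R G 𝒰 ⊗[R] LimTot R G' 𝒱 →ₗ[R] LimTot R (G ⊗[R] G') 𝒲 :=
  TensorProduct.lift (limTotLift R G 𝒰 (limCrossRight R G G' hW)
    (fun U U' hU f => LinearMap.ext fun y => by
      obtain ⟨V, g, rfl⟩ := exists_limTotOf y
      have h := totCross_totRestr hW hU (le_refl V) (f ⊗ₜ[R] g)
      rw [TensorProduct.map_tmul, totRestr_self] at h
      rw [limCrossRight_of, limCrossRight_of]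
      exact (congrArg (limTotOf R (G ⊗[R] G') 𝒲 (prodEntourage hW U' V)) h).trans
        (limTotOf_totRestr _ _ _ _)))

theorem limCross_of (U : Entourage 𝒰) (V : Entourage 𝒱)
    (x : TotCochain R U.rel G ⊗[R] TotCochain R V.rel G') :
    limCross R G G' hW (TensorProduct.map (limTotOf R G 𝒰 U) (limTotOf R G' 𝒱 V) x) =
      limTotOf R (G ⊗[R] G') 𝒲 (prodEntourage hW U V) (totCross R U.rel V.rel G G' x) := by
  suffices h : limCross R G G' hW ∘ₗ TensorProduct.map (limTotOf R G 𝒰 U) (limTotOf R G' 𝒱 V) =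
      limTotOf R (G ⊗[R] G') 𝒲 (prodEntourage hW U V) ∘ₗ totCross R U.rel V.rel G G' from
    LinearMap.congr_fun h x
  refine TensorProduct.ext' fun f g => ?_
  rw [LinearMap.comp_apply, TensorProduct.map_tmul, limCross, TensorProduct.lift.tmul,
    limTotLift_of, limCrossRight_of]
  rfl

theorem tensor_limTotOf_totRestr {U U' : Entourage 𝒰} (hU : U ≤ U') {V V' : Entourage 𝒱}
    (hV : V ≤ V') (x : TotCochain R U.rel G ⊗[R] TotCochain R V.rel G') :
    TensorProduct.map (limTotOf R G 𝒰 U') (limTotOf R G' 𝒱 V')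
        (TensorProduct.map (totRestr R G 𝒰 U U' hU) (totRestr R G' 𝒱 V V' hV) x) =
      TensorProduct.map (limTotOf R G 𝒰 U) (limTotOf R G' 𝒱 V) x := by
  induction x with
  | zero => simp
  | add x y hx hy => simp only [map_add, hx, hy]
  | tmul f g => simp only [TensorProduct.map_tmul, limTotOf_totRestr]

variable {R G G'} in
theorem exists_tensor_limTotOf (t : LimTot R G 𝒰 ⊗[R] LimTot R G' 𝒱) :
    ∃ U V x, TensorProduct.map (limTotOf R G 𝒰 U) (limTotOf R G' 𝒱 V) x = t := by
  induction t with
  | zero => exact ⟨Classical.arbitrary _, Classical.arbitrary _, 0, by simp⟩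
  | tmul x y =>
    obtain ⟨i, x, rfl⟩ := exists_limTotOf x
    obtain ⟨j, y, rfl⟩ := exists_limTotOf y
    exact ⟨i, j, x ⊗ₜ y, rfl⟩
  | add s t hs ht =>
    obtain ⟨i, j, x, rfl⟩ := hs
    obtain ⟨i', j', x', rfl⟩ := ht
    obtain ⟨k, hik, hik'⟩ := exists_ge_ge i i'
    obtain ⟨l, hjl, hjl'⟩ := exists_ge_ge j j'
    exact ⟨k, l, TensorProduct.map (totRestr R G 𝒰 i k hik) (totRestr R G' 𝒱 j l hjl) x +
      TensorProduct.map (totRestr R G 𝒰 i' k hik') (totRestr R G' 𝒱 j' l hjl') x', by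
        rw [map_add, tensor_limTotOf_totRestr, tensor_limTotOf_totRestr]⟩

variable {R G G'} in
theorem tensor_limTotOf_eq_zero {U : Entourage 𝒰} {V : Entourage 𝒱}
    {x : TotCochain R U.rel G ⊗[R] TotCochain R V.rel G'}
    (hx : TensorProduct.map (limTotOf R G 𝒰 U) (limTotOf R G' 𝒱 V) x = 0) :
    ∃ U' V', ∃ (hU : U ≤ U') (hV : V ≤ V'),
      TensorProduct.map (totRestr R G 𝒰 U U' hU) (totRestr R G' 𝒱 V V' hV) x = 0 :=
  tensor_directLimit_of_eq_zero (totRestr R G 𝒰) (totRestr R G' 𝒱) hx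

theorem tensorD_limTotOf (U : Entourage 𝒰) (V : Entourage 𝒱)
    (x : TotCochain R U.rel G ⊗[R] TotCochain R V.rel G') :
    tensorD (limD R G 𝒰) (limSign R G 𝒰) (limD R G' 𝒱)
        (TensorProduct.map (limTotOf R G 𝒰 U) (limTotOf R G' 𝒱 V) x) =
      TensorProduct.map (limTotOf R G 𝒰 U) (limTotOf R G' 𝒱 V)
        (tensorD (totCoboundary R U.rel G) (cochainSign R U.rel G) (totCoboundary R V.rel G') x) := by
  induction x with
  | zero => simp
  | add x y hx hy => simp only [map_add, hx, hy]
  | tmul f g =>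
    simp only [LinearMap.add_apply, TensorProduct.map_tmul, LinearMap.id_apply, map_add, limD_of,
      limSign_of]

theorem tensorD_totRestr {U U' : Entourage 𝒰} (hU : U ≤ U') {V V' : Entourage 𝒱}
    (hV : V ≤ V') (x : TotCochain R U.rel G ⊗[R] TotCochain R V.rel G') :
    tensorD (totCoboundary R U'.rel G) (cochainSign R U'.rel G) (totCoboundary R V'.rel G')
        (TensorProduct.map (totRestr R G 𝒰 U U' hU) (totRestr R G' 𝒱 V V' hV) x) =
      TensorProduct.map (totRestr R G 𝒰 U U' hU) (totRestr R G' 𝒱 V V' hV)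
        (tensorD (totCoboundary R U.rel G) (cochainSign R U.rel G) (totCoboundary R V.rel G') x) := by
  induction x with
  | zero => simp
  | add x y hx hy => simp only [map_add, hx, hy]
  | tmul f g =>
    simp only [LinearMap.add_apply, TensorProduct.map_tmul, LinearMap.id_apply, map_add,
      totCoboundary_totRestr, cochainSign_totRestr]

variable {R G G'}

/-- The entourages for which the finite level cross product is a quasi-isomorphism. -/
def IsCrossQuasiIso (R : Type*) [CommRing R] (G : Type*) [AddCommGroup G] [Module R G]
    (G' : Type*) [AddCommGroup G'] [Module R G'] (U : Set (X × X)) (V : Set (Y × Y)) : Prop :=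
  DQuasiIso (N := TotCochain R (prodRel U V) (G ⊗[R] G'))
    (tensorD (totCoboundary R U G) (cochainSign R U G) (totCoboundary R V G'))
    (totCoboundary R (prodRel U V) (G ⊗[R] G')) (totCross R U V G G')

/-- Cycles, boundaries and the equations between them live at some stage of the limit, and this
stage can be refined to a product of relations for which the cross product is a quasi-isomorphism.
-/
theorem quasiIso_limCross
    (hgood : ∀ (U : Entourage 𝒰) (V : Entourage 𝒱) (W : Entourage 𝒲), ∃ U' V', U ≤ U' ∧ V ≤ V' ∧
      W ≤ prodEntourage hW U' V' ∧ IsCrossQuasiIso R G G' U'.rel V'.rel) :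
    DQuasiIso (N := LimTot R (G ⊗[R] G') 𝒲)
      (tensorD (limD R G 𝒰) (limSign R G 𝒰) (limD R G' 𝒱)) (limD R (G ⊗[R] G') 𝒲)
      (limCross R G G' hW) where
  comm t := by
    obtain ⟨U, V, x, rfl⟩ := exists_tensor_limTotOf t
    obtain ⟨U', V', hU, hV, -, hq⟩ := hgood U V ⟨Set.univ, Filter.univ_mem⟩
    rw [← tensor_limTotOf_totRestr R G G' hU hV, tensorD_limTotOf, limCross_of, limCross_of, limD_of,
      hq.comm]
  surj y hy := by
    obtain ⟨W, y, rfl⟩ := exists_limTotOf y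
    rw [limD_of] at hy
    obtain ⟨W', hW', hy⟩ := limTotOf_eq_zero hy
    obtain ⟨U, V, -, -, hle, hq⟩ := hgood ⟨Set.univ, Filter.univ_mem⟩ ⟨Set.univ, Filter.univ_mem⟩ W'
    have hd : totCoboundary R _ (G ⊗[R] G')
        (totRestr R (G ⊗[R] G') 𝒲 W (prodEntourage hW U V) (hW'.trans hle) y) = 0 := by
      rw [totCoboundary_totRestr, ← totRestr_totRestr R (G ⊗[R] G') hW' hle, hy, map_zero]
    obtain ⟨x, z, hx, hxz⟩ := hq.surj _ hd
    refine ⟨TensorProduct.map (limTotOf R G 𝒰 U) (limTotOf R G' 𝒱 V) x,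
      limTotOf R (G ⊗[R] G') 𝒲 (prodEntourage hW U V) z, ?_, ?_⟩
    · rw [tensorD_limTotOf, hx, map_zero]
    · rw [limCross_of, limD_of, ← map_add, ← limTotOf_totRestr R (G ⊗[R] G') (hW'.trans hle)]
      exact congrArg _ hxz
  inj t z ht htz := by
    obtain ⟨U, V, x, rfl⟩ := exists_tensor_limTotOf t
    obtain ⟨W, z, rfl⟩ := exists_limTotOf z
    rw [tensorD_limTotOf] at ht
    obtain ⟨U₁, V₁, hU₁, hV₁, ht⟩ := tensor_limTotOf_eq_zero ht
    -- First refine until the product relation is contained in W, so that x and z can be compared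
    -- there at all. A second refinement makes the equation between them hold.
    obtain ⟨U₂, V₂, hU₂, hV₂, hle, -⟩ := hgood U₁ V₁ W
    have hU := hU₁.trans hU₂
    have hV := hV₁.trans hV₂
    rw [← tensor_limTotOf_totRestr R G G' hU hV, limCross_of,
      ← limTotOf_totRestr R (G ⊗[R] G') hle, limD_of, ← sub_eq_zero, ← map_sub] at htz
    obtain ⟨W₃, hW₃, h3⟩ := limTotOf_eq_zero htz
    obtain ⟨U', V', hU', hV', hle', hq⟩ := hgood U₂ V₂ W₃
    have e : ∀ w : TotCochain R U.rel G ⊗[R] TotCochain R V.rel G',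
        TensorProduct.map (totRestr R G 𝒰 U U' (hU.trans hU')) (totRestr R G' 𝒱 V V' (hV.trans hV')) w =
        TensorProduct.map (totRestr R G 𝒰 U₂ U' hU') (totRestr R G' 𝒱 V₂ V' hV')
          (TensorProduct.map (totRestr R G 𝒰 U U₂ hU) (totRestr R G' 𝒱 V V₂ hV) w) := by
      intro w
      induction w with
      | zero => simp
      | add x y hx hy => simp only [map_add, hx, hy]
      | tmul f g => simp only [TensorProduct.map_tmul, totRestr_totRestr]
    have e₁ : ∀ w : TotCochain R U.rel G ⊗[R] TotCochain R V.rel G',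
        TensorProduct.map (totRestr R G 𝒰 U U' (hU.trans hU')) (totRestr R G' 𝒱 V V' (hV.trans hV')) w =
        TensorProduct.map (totRestr R G 𝒰 U₁ U' (hU₂.trans hU'))
          (totRestr R G' 𝒱 V₁ V' (hV₂.trans hV'))
          (TensorProduct.map (totRestr R G 𝒰 U U₁ hU₁) (totRestr R G' 𝒱 V V₁ hV₁) w) := by
      intro w
      induction w with
      | zero => simp
      | add x y hx hy => simp only [map_add, hx, hy]
      | tmul f g => simp only [TensorProduct.map_tmul, totRestr_totRestr]
    have hd : tensorD (totCoboundary R U'.rel G) (cochainSign R U'.rel G)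
        (totCoboundary R V'.rel G') (TensorProduct.map (totRestr R G 𝒰 U U' (hU.trans hU'))
          (totRestr R G' 𝒱 V V' (hV.trans hV')) x) = 0 := by
      rw [tensorD_totRestr, e₁, ht, map_zero]
    have hc : totCross R U'.rel V'.rel G G' (TensorProduct.map (totRestr R G 𝒰 U U' (hU.trans hU'))
          (totRestr R G' 𝒱 V V' (hV.trans hV')) x) = totCoboundary R (prodRel U'.rel V'.rel)
          (G ⊗[R] G') (totRestr R (G ⊗[R] G') 𝒲 W (prodEntourage hW U' V')
            (hle.trans (prodEntourage_le hW hU' hV')) z) := by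
      have h4 := congrArg (totRestr R (G ⊗[R] G') 𝒲 W₃ (prodEntourage hW U' V') hle') h3
      rw [totRestr_totRestr, map_zero, map_sub, sub_eq_zero, ← totCoboundary_totRestr,
        totRestr_totRestr] at h4
      rw [e, totCross_totRestr hW hU' hV', h4]
    obtain ⟨w, hw⟩ := hq.inj _ _ hd hc
    refine ⟨TensorProduct.map (limTotOf R G 𝒰 U') (limTotOf R G' 𝒱 V') w, ?_⟩
    rw [tensorD_limTotOf, ← hw, tensor_limTotOf_totRestr]

end Limit

end VR

/-! ### Gradings by projections. -/

section Graded

variable (R : Type*) [CommRing R]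

/-- The sign `(-1)ⁱ`, `i ∈ ℤ`. -/
def zsign (i : ℤ) : R := ((i.negOnePow : ℤ) : R)

theorem zsign_succ (i : ℤ) : zsign R (i + 1) = -zsign R i := by
  simp [zsign, Int.negOnePow_succ]

theorem zsign_natCast (n : ℕ) : zsign R n = (-1) ^ n := by
  simp [zsign, Int.negOnePow_def]

theorem zsign_mul_self (i : ℤ) : zsign R i * zsign R i = 1 := by
  rw [zsign, ← Int.cast_mul, ← Units.val_mul, ← sq, Int.units_sq]
  simp

variable {R} {C : Type*} [AddCommGroup C] [Module R C]

/-- A grading, given by projections, of a differential module. -/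
structure IsGradedDM (d σ : C →ₗ[R] C) (p : ℤ → C →ₗ[R] C) : Prop where
  signed : IsSigned d σ
  proj : ∀ i j x, p i (p j x) = if i = j then p j x else 0
  d_proj : ∀ i x, d (p i x) = p (i + 1) (d x)
  sign : ∀ i x, σ (p i x) = zsign R i • p i x
  supp : ∀ x, ∃ F : Finset ℤ, x = ∑ i ∈ F, p i x

/-- The modules `H i` are the homology modules of a graded differential module. -/
structure IsHomologyOf (d : C →ₗ[R] C) (p : ℤ → C →ₗ[R] C) {H : ℤ → Type*}
    [∀ i, AddCommGroup (H i)] [∀ i, Module R (H i)]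
    (θ : ∀ i, H i →ₗ[R] C ⧸ LinearMap.range d) : Prop where
  inj : ∀ i, Function.Injective (θ i)
  exists_rep : ∀ i h, ∃ z, p i z = z ∧ d z = 0 ∧ θ i h = Submodule.mkQ _ z
  exists_class : ∀ i z, p i z = z → d z = 0 → ∃ h, θ i h = Submodule.mkQ _ z

end Graded

namespace VR

/-! ### Homogeneous components of cochains. -/

section Components

variable (R : Type*) [CommRing R] {X Y : Type*} {U : Set (X × X)} {V : Set (Y × Y)}
  (G : Type*) [AddCommGroup G] [Module R G] (G' : Type*) [AddCommGroup G'] [Module R G']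

variable (U) in
/-- The projection to the chains of degree `i`. -/
noncomputable def degProj (i : ℤ) : TotChain R U →ₗ[R] TotChain R U :=
  totLift R (fun s => if (s.1 : ℤ) = i then gen s.1 s.2 else 0)

theorem degProj_gen (i : ℤ) (n : ℕ) (σ : Simplex U n) :
    degProj R U i (gen n σ) = if (n : ℤ) = i then gen n σ else 0 := totLift_gen R _ _ _

theorem degProj_of_mem (i : ℤ) {n : ℕ} {x : TotChain R U} (hx : x ∈ totDeg R U n) :
    degProj R U i x = if (n : ℤ) = i then x else 0 := by
  split_ifs with h
  · refine (Submodule.span_le (p := LinearMap.eqLocus (degProj R U i) LinearMap.id)).2 ?_ hx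
    rintro _ ⟨σ, rfl⟩
    exact (degProj_gen R i n σ).trans (if_pos h)
  · refine (Submodule.span_le (p := LinearMap.ker (degProj R U i))).2 ?_ hx
    rintro _ ⟨σ, rfl⟩
    exact (degProj_gen R i n σ).trans (if_neg h)

theorem isGradedMap_degProj (i : ℤ) : IsGradedMap (totDeg R U) (totDeg R U) (degProj R U i) := by
  refine fun n => ⟨n, by omega, fun x hx => ?_⟩
  rw [degProj_of_mem R i hx]
  split_ifs
  · exact hx
  · exact Submodule.zero_mem _

theorem degProj_totBoundary (i : ℤ) (x : TotChain R U) :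
    degProj R U i (totBoundary R U x) = totBoundary R U (degProj R U (i + 1) x) := by
  suffices h : degProj R U i ∘ₗ totBoundary R U = totBoundary R U ∘ₗ degProj R U (i + 1) from
    LinearMap.congr_fun h x
  refine totChain_hom_ext R fun n σ => ?_
  rw [LinearMap.comp_apply, LinearMap.comp_apply, degProj_gen]
  rcases n with _ | n
  · rw [totBoundary_gen_zero, map_zero]
    split_ifs <;> simp
  · rw [degProj_of_mem R i (totBoundary_mem n _ (gen_mem_totDeg _ _))]
    push_cast
    simp only [add_left_inj]
    split_ifs
    · rfl
    · rw [map_zero]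

theorem degProj_totMap {U' : Set (Y × Y)} (φ : Y → X) (h : ∀ p ∈ U', (φ p.1, φ p.2) ∈ U) (i : ℤ)
    (x : TotChain R U') :
    degProj R U i (totMap R φ h x) = totMap R φ h (degProj R U' i x) := by
  suffices H : degProj R U i ∘ₗ totMap R φ h = totMap R φ h ∘ₗ degProj R U' i from
    LinearMap.congr_fun H x
  refine totChain_hom_ext R fun n σ => ?_
  rw [LinearMap.comp_apply, LinearMap.comp_apply, degProj_gen, totMap_gen, degProj_gen]
  split_ifs
  · rw [totMap_gen]
  · rw [map_zero]

/-- The component of degree `i` of a cochain. -/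
noncomputable abbrev cochainProj (U : Set (X × X)) (i : ℤ) :
    TotCochain R U G →ₗ[R] TotCochain R U G :=
  boundedDualMap G (isGradedMap_degProj R i)

theorem cochainProj_gen (i : ℤ) (f : TotCochain R U G) (n : ℕ) (σ : Simplex U n) :
    (cochainProj R G U i f).1 (gen n σ) = if (n : ℤ) = i then f.1 (gen n σ) else 0 := by
  rw [boundedDualMap_apply, degProj_gen]
  split_ifs <;> simp

theorem totCochain_ext {f g : TotCochain R U G} (h : ∀ n σ, f.1 (gen n σ) = g.1 (gen n σ)) :
    f = g := Subtype.ext (totChain_hom_ext R h)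

theorem isGradedDM_totCoboundary (U : Set (X × X)) :
    IsGradedDM (totCoboundary R U G) (cochainSign R U G) (cochainProj R G U) where
  signed := isSigned_totCoboundary R U G
  proj i j f := totCochain_ext R G fun n σ => by
    rw [cochainProj_gen]
    split_ifs with h1 h2 h2
    · rfl
    · rw [cochainProj_gen, if_neg (fun h => h2 (h1.symm.trans h))]
      rfl
    · rw [cochainProj_gen, if_neg (fun h => h1 (h.trans h2.symm))]
    · rfl
  d_proj i f := totCochain_ext R G fun n σ => by
    rw [boundedDualMap_apply, boundedDualMap_apply, boundedDualMap_apply, boundedDualMap_apply,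
      degProj_totBoundary]
  sign i f := totCochain_ext R G fun n σ => by
    rw [boundedDualMap_apply, totSign_gen, map_smul, Submodule.coe_smul, LinearMap.smul_apply,
      cochainProj_gen]
    split_ifs with h
    · rw [← h, zsign_natCast]
    · rw [smul_zero, smul_zero]
  supp f := by
    obtain ⟨N, hN⟩ := f.2
    refine ⟨(Finset.range N).map Nat.castEmbedding, totCochain_ext R G fun n σ => ?_⟩
    rw [Submodule.coe_sum, LinearMap.sum_apply]
    simp only [cochainProj_gen, Finset.sum_map, Nat.castEmbedding_apply, Nat.cast_inj]
    rw [Finset.sum_ite_eq]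
    split_ifs with h
    · rfl
    · exact hN n (by simpa using h) _ (gen_mem_totDeg n σ)

/-- A cochain of degree `n` as a total cochain. -/
noncomputable def toTot (U : Set (X × X)) (n : ℕ) : Cochain G U n →ₗ[R] TotCochain R U G where
  toFun f := cochainOf (N := n + 1) (fun s => if h : s.1 = n then f (h ▸ s.2) else 0)
    (fun s hs => dif_neg (by omega))
  map_add' f g := totCochain_ext R G fun m σ => by
    rw [Submodule.coe_add, LinearMap.add_apply, cochainOf_gen, cochainOf_gen, cochainOf_gen]
    split_ifs <;> simp
  map_smul' a f := totCochain_ext R G fun m σ => by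
    rw [Submodule.coe_smul, LinearMap.smul_apply, cochainOf_gen, cochainOf_gen]
    split_ifs <;> simp

@[simp] theorem toTot_gen (n : ℕ) (f : Cochain G U n) (σ : Simplex U n) :
    (toTot R G U n f).1 (gen n σ) = f σ :=
  (cochainOf_gen (N := n + 1) _ (fun s hs => dif_neg (by omega)) _ _).trans (dif_pos rfl)

theorem toTot_gen_of_ne {m n : ℕ} (h : m ≠ n) (f : Cochain G U n) (σ : Simplex U m) :
    (toTot R G U n f).1 (gen m σ) = 0 :=
  (cochainOf_gen (N := n + 1) _ (fun s hs => dif_neg (by omega)) _ _).trans (dif_neg h)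

theorem totCoboundary_toTot (n : ℕ) (f : Cochain G U n) :
    totCoboundary R U G (toTot R G U n f) = toTot R G U (n + 1) (coboundary R G U n f) := by
  refine totCochain_ext R G fun m σ => ?_
  rw [boundedDualMap_apply]
  rcases m with _ | m
  · rw [totBoundary_gen_zero, map_zero, toTot_gen_of_ne R G (by omega)]
  · rw [totBoundary_gen_succ, map_sum]
    by_cases h : m = n
    · subst h
      rw [toTot_gen]
      simp only [map_smul, toTot_gen]
      rfl
    · rw [toTot_gen_of_ne R G (by omega)]
      refine Finset.sum_eq_zero fun k _ => ?_
      rw [map_smul, toTot_gen_of_ne R G h, smul_zero]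

theorem cochainProj_toTot (n : ℕ) (f : Cochain G U n) :
    cochainProj R G U n (toTot R G U n f) = toTot R G U n f := by
  refine totCochain_ext R G fun m σ => ?_
  rw [cochainProj_gen]
  split_ifs with h
  · rfl
  · rw [toTot_gen_of_ne R G (by simpa using h)]

theorem toTot_component (n : ℕ) (f : TotCochain R U G) (hf : cochainProj R G U n f = f) :
    toTot R G U n (fun σ => f.1 (gen n σ)) = f := by
  refine totCochain_ext R G fun m σ => ?_
  by_cases h : m = n
  · subst h
    rw [toTot_gen]
  · rw [toTot_gen_of_ne R G h, ← hf, cochainProj_gen, if_neg (by simpa using h)]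

theorem toTot_injective (n : ℕ) : Function.Injective (toTot R G U n) := fun f g h =>
  funext fun σ => by rw [← toTot_gen R G n f, h, toTot_gen]

/-- Among all cuts of a simplex only the one after position i meets the supports of both cochains.
-/
theorem totCross_toTot {i j n : ℕ} (h : i + j = n) (f : Cochain G U i) (g : Cochain G' V j) :
    totCross R U V G G' (toTot R G U i f ⊗ₜ toTot R G' V j g) =
      toTot R (G ⊗[R] G') (prodRel U V) n (crossCochain R G G' U V h f g) := by
  refine totCochain_ext R _ fun m s => ?_
  rw [totCross_apply, alexanderWhitney_gen, map_sum]
  have h1 : ∀ (k l : ℕ) (hkl : k + l = m), k ≠ i ∨ l ≠ j →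
      (tensorCochainMap R U V G G' (toTot R G U i f ⊗ₜ toTot R G' V j g)).1
        (frontBack R hkl s) = 0 := by
    intro k l hkl hk
    rw [frontBack, tensorCochainMap_tmul]
    rcases hk with hk | hk
    · rw [toTot_gen_of_ne R G hk, TensorProduct.zero_tmul]
    · rw [toTot_gen_of_ne R G' hk, TensorProduct.tmul_zero]
  by_cases hm : m = n
  · subst hm
    rw [Finset.sum_eq_single ⟨i, by omega⟩ (fun k _ hk => h1 _ _ _ (Or.inl fun h =>
      hk (Fin.ext h))) (fun h => absurd (Finset.mem_univ _) h), frontBack_congr R _ h rfl, frontBack,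
      tensorCochainMap_tmul, toTot_gen, toTot_gen, toTot_gen]
    rfl
  · rw [toTot_gen_of_ne R _ hm]
    exact Finset.sum_eq_zero fun k _ => h1 _ _ _ (by omega)

theorem totRestr_toTot {𝒰 : SemiUniformity X} {U V : Entourage 𝒰} (h : U ≤ V) (n : ℕ)
    (f : Cochain G U.rel n) : totRestr R G 𝒰 U V h (toTot R G U.rel n f) =
      toTot R G V.rel n (cochainMap R G (fun x => x) (entourage_le_iff h) n f) := by
  refine totCochain_ext R G fun m σ => ?_
  rw [totRestr_apply, totMap_gen]
  by_cases hm : m = n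
  · subst hm
    rw [toTot_gen, toTot_gen]
    rfl
  · rw [toTot_gen_of_ne R G hm, toTot_gen_of_ne R G hm]

theorem cochainProj_totRestr {𝒰 : SemiUniformity X} {U V : Entourage 𝒰} (h : U ≤ V) (i : ℤ)
    (f : TotCochain R U.rel G) : cochainProj R G V.rel i (totRestr R G 𝒰 U V h f) =
      totRestr R G 𝒰 U V h (cochainProj R G U.rel i f) := by
  refine totCochain_ext R G fun m σ => ?_
  rw [boundedDualMap_apply, totRestr_apply, totRestr_apply, boundedDualMap_apply, degProj_totMap]

end Components

/-! ### Vietoris-Rips cohomology as the homology of the limit complex. -/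

section LimitComponents

variable (R : Type u) [CommRing R] {X Y : Type u} (G : Type u) [AddCommGroup G] [Module R G]
  (G' : Type u) [AddCommGroup G'] [Module R G'] (𝒰 : SemiUniformity X) (𝒱 : SemiUniformity Y)

/-- The component of degree `i` in the limit complex. -/
noncomputable def limProj (i : ℤ) : LimTot R G 𝒰 →ₗ[R] LimTot R G 𝒰 :=
  limTotLift R G 𝒰 (fun U => limTotOf R G 𝒰 U ∘ₗ cochainProj R G U.rel i) (fun U V h f => by
    rw [LinearMap.comp_apply, cochainProj_totRestr, limTotOf_totRestr]
    rfl)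

theorem limProj_of (i : ℤ) (U : Entourage 𝒰) (f : TotCochain R U.rel G) :
    limProj R G 𝒰 i (limTotOf R G 𝒰 U f) = limTotOf R G 𝒰 U (cochainProj R G U.rel i f) :=
  limTotLift_of R G 𝒰 _ _ U f

theorem isGradedDM_limD : IsGradedDM (limD R G 𝒰) (limSign R G 𝒰) (limProj R G 𝒰) where
  signed := isSigned_limD R G 𝒰
  proj i j x := by
    obtain ⟨U, f, rfl⟩ := exists_limTotOf x
    rw [limProj_of, limProj_of, (isGradedDM_totCoboundary R G U.rel).proj]
    split_ifs
    · rfl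
    · rw [map_zero]
  d_proj i x := by
    obtain ⟨U, f, rfl⟩ := exists_limTotOf x
    rw [limProj_of, limD_of, limD_of, limProj_of, (isGradedDM_totCoboundary R G U.rel).d_proj]
  sign i x := by
    obtain ⟨U, f, rfl⟩ := exists_limTotOf x
    rw [limProj_of, limSign_of, (isGradedDM_totCoboundary R G U.rel).sign, map_smul]
  supp x := by
    obtain ⟨U, f, rfl⟩ := exists_limTotOf x
    obtain ⟨F, hF⟩ := (isGradedDM_totCoboundary R G U.rel).supp f
    refine ⟨F, ?_⟩
    conv_lhs => rw [hF]
    simp only [map_sum, limProj_of]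

/-- The class in the limit complex of a cohomology class. -/
noncomputable def limClassNat (n : ℕ) :
    LimCoh R G 𝒰 n →ₗ[R] LimTot R G 𝒰 ⧸ LinearMap.range (limD R G 𝒰) :=
  Module.DirectLimit.lift R _ _ _
    (fun U => Coh.lift R G U.rel n
      (Submodule.mkQ _ ∘ₗ limTotOf R G 𝒰 U ∘ₗ toTot R G U.rel n ∘ₗ Submodule.subtype _)
      (fun f hf => by
        rw [LinearMap.comp_apply, Submodule.mkQ_apply, Submodule.Quotient.mk_eq_zero]
        cases n with
        | zero =>
          have h0 : f.1 = 0 := hf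
          rw [LinearMap.comp_apply, LinearMap.comp_apply, Submodule.subtype_apply, h0, map_zero,
            map_zero]
          exact Submodule.zero_mem _
        | succ n =>
          obtain ⟨g, hg⟩ := hf
          refine ⟨limTotOf R G 𝒰 U (toTot R G U.rel n g), ?_⟩
          rw [limD_of, totCoboundary_toTot, hg]
          rfl))
    (fun U V h x => by
      obtain ⟨f, rfl⟩ := Coh.mk_surjective _ _ _ _ x
      change Submodule.mkQ _ (limTotOf R G 𝒰 V (toTot R G V.rel n
        (cochainMap R G (fun x => x) (entourage_le_iff h) n f.1))) =
          Submodule.mkQ _ (limTotOf R G 𝒰 U (toTot R G U.rel n f.1))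
      rw [← totRestr_toTot R G h, limTotOf_totRestr])

theorem limClassNat_of (n : ℕ) (U : Entourage 𝒰) (f : cocycles R G U.rel n) :
    limClassNat R G 𝒰 n (Module.DirectLimit.of R (Entourage 𝒰) (fun U => Coh R G U.rel n)
      (restr R G 𝒰 n) U (Coh.mk R G U.rel n f)) =
      Submodule.mkQ _ (limTotOf R G 𝒰 U (toTot R G U.rel n f.1)) :=
  (Module.DirectLimit.lift_of _ _ _).trans (Coh.lift_mk R G U.rel n _ _ f)

theorem exists_limCoh_rep (n : ℕ) (x : LimCoh R G 𝒰 n) : ∃ U f,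
    Module.DirectLimit.of R (Entourage 𝒰) (fun U => Coh R G U.rel n)
      (restr R G 𝒰 n) U (Coh.mk R G U.rel n f) = x := by
  obtain ⟨U, y, rfl⟩ := Module.DirectLimit.exists_of x
  obtain ⟨f, rfl⟩ := Coh.mk_surjective _ _ _ _ y
  exact ⟨U, f, rfl⟩

/-- A witness for the vanishing of the class lives on some smaller relation. There its component one
degree below bounds the cocycle; in degree 0 the cocycle itself is zero. -/
theorem limClassNat_injective (n : ℕ) : Function.Injective (limClassNat R G 𝒰 n) := by
  rw [← LinearMap.ker_eq_bot, LinearMap.ker_eq_bot']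
  intro x hx
  obtain ⟨U, f, rfl⟩ := exists_limCoh_rep R G 𝒰 n x
  rw [limClassNat_of, Submodule.mkQ_apply, Submodule.Quotient.mk_eq_zero] at hx
  obtain ⟨y, hy⟩ := hx
  obtain ⟨V, g, rfl⟩ := exists_limTotOf y
  obtain ⟨W, hU, hV⟩ := exists_ge_ge U V
  rw [← limTotOf_totRestr R G hV, limD_of, ← limTotOf_totRestr R G hU, ← sub_eq_zero, ← map_sub] at hy
  obtain ⟨W', hW, h0⟩ := limTotOf_eq_zero hy
  rw [map_sub, sub_eq_zero, totRestr_totRestr, totRestr_toTot, ← totCoboundary_totRestr,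
    totRestr_totRestr] at h0
  rw [← Module.DirectLimit.of_f (f := restr R G 𝒰 n) (hij := hU.trans hW)]
  have h1 : restr R G 𝒰 n U W' (hU.trans hW) (Coh.mk R G U.rel n f) = 0 := by
    refine (Coh.mk_eq_zero R G W'.rel n _).2 ?_
    set f' := cochainMap R G (fun x => x) (entourage_le_iff (hU.trans hW)) n f.1
    change f' ∈ coboundaries R G W'.rel n
    cases n with
    | zero =>
      change f' = 0
      funext σ
      rw [← toTot_gen R G 0 f', ← h0, boundedDualMap_apply, totBoundary_gen_zero, map_zero]
      rfl
    | succ n =>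
      refine ⟨fun σ => (totRestr R G 𝒰 V W' (hV.trans hW) g).1 (gen n σ), funext fun σ => ?_⟩
      rw [← toTot_gen R G (n + 1) f', ← h0, boundedDualMap_apply, totBoundary_gen_succ, map_sum]
      simp only [map_smul]
      rfl
  rw [h1, map_zero]

/-- The class in the limit complex of a cohomology class. -/
noncomputable def limClass : ∀ i : ℤ,
    cohomology R G 𝒰 i →ₗ[R] LimTot R G 𝒰 ⧸ LinearMap.range (limD R G 𝒰)
  | Int.ofNat n => limClassNat R G 𝒰 n
  | Int.negSucc _ => 0

theorem limProj_negSucc (n : ℕ) (x : LimTot R G 𝒰) : limProj R G 𝒰 (Int.negSucc n) x = 0 := by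
  obtain ⟨U, f, rfl⟩ := exists_limTotOf x
  rw [limProj_of]
  have : cochainProj R G U.rel (Int.negSucc n) f = 0 := totCochain_ext R G fun m σ => by
    rw [cochainProj_gen, if_neg (by omega)]
    rfl
  rw [this, map_zero]

/-- A cycle of degree n in the limit is represented by a homogeneous cocycle on a small enough
relation. In negative degrees everything vanishes, as there are no simplices. -/
theorem isHomologyOf_limClass : IsHomologyOf (limD R G 𝒰) (limProj R G 𝒰) (limClass R G 𝒰) where
  inj
    | Int.ofNat n => limClassNat_injective R G 𝒰 n
    | Int.negSucc _ => fun x y _ => @Subsingleton.elim PUnit _ x y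
  exists_rep
    | Int.ofNat n => fun h => by
      obtain ⟨U, f, rfl⟩ := exists_limCoh_rep R G 𝒰 n h
      refine ⟨limTotOf R G 𝒰 U (toTot R G U.rel n f.1), ?_, ?_, limClassNat_of R G 𝒰 n U f⟩
      · rw [limProj_of]
        exact congrArg _ (cochainProj_toTot R G n f.1)
      · rw [limD_of, totCoboundary_toTot, LinearMap.mem_ker.1 f.2, map_zero, map_zero]
    | Int.negSucc n => fun h => ⟨0, map_zero _, map_zero _, by rw [map_zero]; rfl⟩
  exists_class
    | Int.ofNat n => fun z hz hd => by
      obtain ⟨U, g, rfl⟩ := exists_limTotOf z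
      rw [limProj_of, ← sub_eq_zero, ← map_sub] at hz
      -- On V the representative becomes homogeneous, and on the smaller W it becomes closed as
      -- well.
      obtain ⟨V, hV, hz⟩ := limTotOf_eq_zero hz
      rw [map_sub, sub_eq_zero, ← cochainProj_totRestr] at hz
      rw [← limTotOf_totRestr R G hV, limD_of] at hd
      obtain ⟨W, hW, hd⟩ := limTotOf_eq_zero hd
      rw [← totCoboundary_totRestr, totRestr_totRestr] at hd
      have hz' : cochainProj R G W.rel (n : ℤ) (totRestr R G 𝒰 U W (hV.trans hW) g) =
          totRestr R G 𝒰 U W (hV.trans hW) g := by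
        rw [← totRestr_totRestr R G hV hW, cochainProj_totRestr]
        exact congrArg _ hz
      have h1 := toTot_component R G n _ hz'
      have h2 : (fun σ => (totRestr R G 𝒰 U W (hV.trans hW) g).1 (gen n σ)) ∈
          cocycles R G W.rel n := by
        refine toTot_injective R G (n + 1) ?_
        rw [← totCoboundary_toTot, h1, hd, map_zero]
      refine ⟨Module.DirectLimit.of R (Entourage 𝒰) (fun U => Coh R G U.rel n)
        (restr R G 𝒰 n) W (Coh.mk R G W.rel n ⟨_, h2⟩),
        (limClassNat_of R G 𝒰 n W ⟨_, h2⟩).trans ?_⟩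
      rw [h1, limTotOf_totRestr]
    | Int.negSucc n => fun z hz _ => ⟨0, by rw [← hz, limProj_negSucc, map_zero, map_zero]⟩

variable {𝒰 𝒱} {𝒲 : SemiUniformity (X × Y)}
  (hW : ∀ U ∈ 𝒰.filter, ∀ V ∈ 𝒱.filter, prodRel U V ∈ 𝒲.filter)

/-- With representing cocycles on relations U and V this is `totCross_toTot`. If a factor has
negative degree, it is zero. -/
theorem limClass_cross : ∀ (i j q : ℤ) (hq : i + j = q) (x : cohomology R G 𝒰 i)
    (y : cohomology R G' 𝒱 j), ∃ z w, limProj R G 𝒰 i z = z ∧ limD R G 𝒰 z = 0 ∧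
      limClass R G 𝒰 i x = Submodule.mkQ _ z ∧ limProj R G' 𝒱 j w = w ∧ limD R G' 𝒱 w = 0 ∧
      limClass R G' 𝒱 j y = Submodule.mkQ _ w ∧
      limClass R (G ⊗[R] G') 𝒲 q (cohomologyCross R G G' 𝒰 𝒱 𝒲 hW i j q hq x y) =
        Submodule.mkQ _ (limCross R G G' hW (z ⊗ₜ w))
  | Int.ofNat i, Int.ofNat j, Int.ofNat q, hq => fun x y => by
    obtain ⟨U, f, rfl⟩ := exists_limCoh_rep R G 𝒰 i x
    obtain ⟨V, g, rfl⟩ := exists_limCoh_rep R G' 𝒱 j y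
    refine ⟨limTotOf R G 𝒰 U (toTot R G U.rel i f.1), limTotOf R G' 𝒱 V (toTot R G' V.rel j g.1),
      ?_, ?_, limClassNat_of R G 𝒰 i U f, ?_, ?_, limClassNat_of R G' 𝒱 j V g, ?_⟩
    · rw [limProj_of]
      exact congrArg _ (cochainProj_toTot R G i f.1)
    · rw [limD_of, totCoboundary_toTot, LinearMap.mem_ker.1 f.2, map_zero, map_zero]
    · rw [limProj_of]
      exact congrArg _ (cochainProj_toTot R G' j g.1)
    · rw [limD_of, totCoboundary_toTot, LinearMap.mem_ker.1 g.2, map_zero, map_zero]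
    · rw [← TensorProduct.map_tmul, limCross_of, totCross_toTot R G G' (Int.ofNat.inj hq)]
      refine Eq.trans (congrArg (limClassNat R (G ⊗[R] G') 𝒲 q) ?_)
        (limClassNat_of R (G ⊗[R] G') 𝒲 q (prodEntourage hW U V)
          ⟨crossCochain R G G' U.rel V.rel (Int.ofNat.inj hq) f.1 g.1,
            crossCochain_mem_cocycles R G G' U.rel V.rel _ f.1 g.1 f.2 g.2⟩)
      change crossLim R G G' 𝒰 𝒱 𝒲 hW (Int.ofNat.inj hq) _ _ = _
      rw [crossLim, Module.DirectLimit.lift_of, LinearMap.flip_apply, Module.DirectLimit.lift_of]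
      rfl
  | Int.ofNat i, Int.ofNat j, Int.negSucc q, hq => by
    have : ((i : ℤ)) + j = Int.negSucc q := hq
    omega
  | Int.ofNat i, Int.negSucc j, q, hq => fun x y => by
    obtain ⟨z, h1, h2, h3⟩ := (isHomologyOf_limClass R G 𝒰).exists_rep (Int.ofNat i) x
    refine ⟨z, 0, h1, h2, h3, map_zero _, map_zero _, by rw [map_zero]; rfl, ?_⟩
    rw [TensorProduct.tmul_zero, map_zero, map_zero]
    exact map_zero _
  | Int.negSucc i, j, q, hq => fun x y => by
    obtain ⟨w, h1, h2, h3⟩ := (isHomologyOf_limClass R G' 𝒱).exists_rep j y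
    refine ⟨0, w, map_zero _, map_zero _, by rw [map_zero]; rfl, h1, h2, h3, ?_⟩
    rw [TensorProduct.zero_tmul, map_zero, map_zero]
    exact map_zero _

/-- The degrees of the front and the back of a simplex add up to its degree. -/
theorem limCross_proj (i j : ℤ) (x : LimTot R G 𝒰) (y : LimTot R G' 𝒱) :
    limProj R (G ⊗[R] G') 𝒲 (i + j)
        (limCross R G G' hW (limProj R G 𝒰 i x ⊗ₜ limProj R G' 𝒱 j y)) =
      limCross R G G' hW (limProj R G 𝒰 i x ⊗ₜ limProj R G' 𝒱 j y) := by
  obtain ⟨U, f, rfl⟩ := exists_limTotOf x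
  obtain ⟨V, g, rfl⟩ := exists_limTotOf y
  rw [limProj_of, limProj_of, ← TensorProduct.map_tmul, limCross_of, limProj_of]
  congr 1
  refine totCochain_ext R _ fun n s => ?_
  rw [cochainProj_gen]
  split_ifs with h
  · rfl
  · rw [totCross_apply, alexanderWhitney_gen, map_sum]
    refine (Finset.sum_eq_zero fun k _ => ?_).symm
    rw [frontBack, tensorCochainMap_tmul, cochainProj_gen, cochainProj_gen]
    split_ifs with h1 h2
    · omega
    · rw [TensorProduct.tmul_zero]
    · rw [TensorProduct.zero_tmul]
    · rw [TensorProduct.zero_tmul]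

/-- Cochains are functions with values in G, and an equation in the direct limit holds at some
stage, so torsion would have to come from G. -/
theorem limTot_smul_eq_zero {c : R} (hc : ∀ g : G, c • g = 0 → g = 0) (x : LimTot R G 𝒰)
    (hx : c • x = 0) : x = 0 := by
  obtain ⟨U, f, rfl⟩ := exists_limTotOf x
  rw [← map_smul] at hx
  obtain ⟨V, hV, hx⟩ := limTotOf_eq_zero hx
  rw [map_smul] at hx
  rw [← limTotOf_totRestr R G hV]
  have : totRestr R G 𝒰 U V hV f = 0 := totCochain_ext R G fun n σ =>
    hc _ (LinearMap.congr_fun (Subtype.ext_iff.1 hx) (gen n σ))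
  rw [this, map_zero]

end LimitComponents

end VR

/-! ### Submodules of projective modules over a principal ideal domain. -/

section Hereditary

variable {R : Type u} [CommRing R] [IsDomain R]

/-- Extend r ↦ r • y along multiplication by a and evaluate at 1. -/
theorem exists_smul_eq_of_injective {Q : Type u} [AddCommGroup Q] [Module R Q]
    [Module.Injective R Q] {a : R} (ha : a ≠ 0) (y : Q) : ∃ w, a • w = y := by
  obtain ⟨h, hh⟩ := Module.Injective.out (LinearMap.toSpanSingleton R R a)
    (fun r s hrs => mul_right_cancel₀ ha (by simpa using hrs)) (LinearMap.toSpanSingleton R Q y)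
  refine ⟨h 1, ?_⟩
  have := hh 1
  simp only [LinearMap.toSpanSingleton_apply, one_smul] at this
  rw [← this, ← map_smul, smul_eq_mul, mul_one]

variable [IsPrincipalIdealRing R]

/-- Over a principal ideal domain the quotients of an injective module are injective. -/
theorem injective_of_surjective {Q Q' : Type u} [AddCommGroup Q] [Module R Q] [AddCommGroup Q']
    [Module R Q'] [Module.Injective R Q] (f : Q →ₗ[R] Q') (hf : Function.Surjective f) :
    Module.Injective R Q' := by
  -- All ideals are principal, so Baer's criterion only asks for divisibility, which passes to
  -- quotients.
  refine Module.Baer.injective fun I g => ?_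
  obtain ⟨a, rfl⟩ := IsPrincipalIdealRing.principal I
  by_cases ha : a = 0
  · subst ha
    refine ⟨0, fun x hx => ?_⟩
    have : (⟨x, hx⟩ : Submodule.span R {(0 : R)}) = 0 := Subtype.ext (by simpa using hx)
    rw [this, map_zero, LinearMap.zero_apply]
  · obtain ⟨y, hy⟩ := hf (g ⟨a, Submodule.mem_span_singleton_self a⟩)
    obtain ⟨w, hw⟩ := exists_smul_eq_of_injective ha y
    refine ⟨LinearMap.toSpanSingleton R Q' (f w), fun x hx => ?_⟩
    obtain ⟨r, rfl⟩ := Submodule.mem_span_singleton.1 hx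
    have : (⟨r • a, hx⟩ : Submodule.span R {a}) =
      r • ⟨a, Submodule.mem_span_singleton_self a⟩ := rfl
    rw [this, map_smul g, ← hy, ← hw, LinearMap.toSpanSingleton_apply, map_smul f, smul_smul,
      smul_eq_mul]

/-- Over a principal ideal domain the submodules of a projective module are projective. -/
theorem projective_of_injective {P N : Type u} [AddCommGroup P] [Module R P] [AddCommGroup N]
    [Module R N] [Module.Projective R P] (i : N →ₗ[R] P) (hi : Function.Injective i) :
    Module.Projective R N := by
  refine Module.Projective.of_lifting_property'' fun f hf => ?_
  -- Embed the free module on N in an injective module J. The quotient J / K by the image of ker f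
  -- is injective again, so N → J / K extends to P, and since P is projective the extension lifts to
  -- J.
  let J := CategoryTheory.Injective.under (ModuleCat.of R (N →₀ R))
  let j : (N →₀ R) →ₗ[R] J := (CategoryTheory.Injective.ι (ModuleCat.of R (N →₀ R))).hom
  have hj : Function.Injective j :=
    (ModuleCat.mono_iff_injective (CategoryTheory.Injective.ι (ModuleCat.of R (N →₀ R)))).1
      inferInstance
  have : Module.Injective R J := Module.injective_module_of_injective_object R J
    (inj := inferInstanceAs (CategoryTheory.Injective
      (CategoryTheory.Injective.under (ModuleCat.of R (N →₀ R)))))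
  let K := (LinearMap.ker f).map j
  have := injective_of_surjective K.mkQ K.mkQ_surjective
  let t : N →ₗ[R] J ⧸ K := (LinearMap.ker f).liftQ (K.mkQ ∘ₗ j) (fun x hx =>
    (Submodule.Quotient.mk_eq_zero K).2 ⟨x, hx, rfl⟩) ∘ₗ (f.quotKerEquivOfSurjective hf).symm
  have ht : ∀ x, t (f x) = K.mkQ (j x) := fun x => by
    have : (f.quotKerEquivOfSurjective hf).symm (f x) = (LinearMap.ker f).mkQ x := by
      rw [LinearEquiv.symm_apply_eq]; rfl
    simp only [t, LinearMap.comp_apply, LinearEquiv.coe_coe, this]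
    rfl
  obtain ⟨t', ht'⟩ := Module.Injective.out i hi t
  obtain ⟨g, hg⟩ := Module.projective_lifting_property K.mkQ t' K.mkQ_surjective
  -- On N the lift agrees with j modulo K, and K lies in the image of j. It therefore takes values
  -- in the free module, where it is a section of f.
  have key : ∀ n, ∃ x, g (i n) = j x ∧ f x = n := fun n => by
    obtain ⟨x, rfl⟩ := hf n
    have h1 : K.mkQ (g (i (f x))) = K.mkQ (j x) := by
      rw [← ht, ← ht', ← hg]; rfl
    obtain ⟨k, hk, hk'⟩ := (Submodule.Quotient.eq K).1 h1
    exact ⟨k + x, by rw [map_add, hk']; abel, by rw [map_add, LinearMap.mem_ker.1 hk, zero_add]⟩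
  choose h hh using key
  refine ⟨{ toFun := h, map_add' := fun a b => hj ?_, map_smul' := fun r a => hj ?_ }, ?_⟩
  · rw [map_add j, ← (hh _).1, ← (hh _).1, ← (hh _).1, map_add, map_add]
  · rw [RingHom.id_apply, map_smul j, ← (hh _).1, ← (hh _).1, map_smul, map_smul]
  · exact LinearMap.ext fun n => (hh n).2

end Hereditary

section Tor

/-! ### Tor and projective presentations. -/

open CategoryTheory Limits

variable {R : Type u} [CommRing R]

/-- The homology of a short complex is the kernel of the map induced on the cokernel of its first
map, and this cokernel is K. -/
theorem shortComplex_exists_homology (S : ShortComplex (ModuleCat.{u} R)) {K : Type u}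
    [AddCommGroup K] [Module R K] (e : S.X₂ →ₗ[R] K) (g : K →ₗ[R] S.X₃)
    (he : Function.Surjective e) (hfe : Function.Exact S.f.hom e) (hg : ∀ x, g (e x) = S.g x) :
    ∃ τ : S.homology →ₗ[R] K, Function.Injective τ ∧ Function.Exact τ g := by
  have hz : S.f ≫ ModuleCat.ofHom e = 0 := by
    ext x
    exact (hfe (S.f x)).2 ⟨x, rfl⟩
  let t : S.opcycles ⟶ ModuleCat.of R K := S.descOpcycles (ModuleCat.ofHom e) hz
  have ht : ∀ x, t.hom (S.pOpcycles.hom x) = e x := fun x =>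
    LinearMap.congr_fun (congrArg ModuleCat.Hom.hom (S.p_descOpcycles (ModuleCat.ofHom e) hz)) x
  have hp : Function.Surjective S.pOpcycles.hom :=
    (ModuleCat.epi_iff_surjective S.pOpcycles).1 inferInstance
  have htinj : Function.Injective t.hom := by
    rw [injective_iff_map_eq_zero]
    intro y hy
    obtain ⟨x, rfl⟩ := hp y
    rw [ht] at hy
    exact (S.moduleCat_pOpcycles_eq_zero_iff x).2 ((hfe x).1 hy)
  have hι : Function.Injective S.homologyι.hom :=
    (ModuleCat.mono_iff_injective S.homologyι).1 inferInstance
  have hfrom : ∀ y, S.fromOpcycles.hom y = g (t.hom y) := fun y => by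
    obtain ⟨x, rfl⟩ := hp y
    rw [ht, hg]
    exact LinearMap.congr_fun (congrArg ModuleCat.Hom.hom S.p_fromOpcycles) x
  refine ⟨t.hom ∘ₗ S.homologyι.hom, htinj.comp hι, fun y => ⟨fun hy => ?_, ?_⟩⟩
  · obtain ⟨x, rfl⟩ := he y
    rw [← ht, ← hfrom] at hy
    obtain ⟨z, hz⟩ := (ShortComplex.moduleCat_exact_iff _).1 (ShortComplex.exact_of_f_is_kernel
      (ShortComplex.mk _ _ S.homologyι_comp_fromOpcycles) S.homologyIsKernel) _ hy
    exact ⟨z, by rw [← ht]; exact congrArg _ hz⟩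
  · rintro ⟨z, rfl⟩
    rw [LinearMap.comp_apply, ← hfrom]
    exact LinearMap.congr_fun (congrArg ModuleCat.Hom.hom S.homologyι_comp_fromOpcycles) z

/-- Each module `N` is the quotient of a projective module `Q` by a submodule `K` such that
`0 → Tor₁(M, N) → M ⊗ K → M ⊗ Q` is exact for all `M`. -/
theorem exists_tor_exact (N : ModuleCat.{u} R) :
    ∃ (Q : Type u) (_ : AddCommGroup Q) (_ : Module R Q) (_ : Module.Projective R Q)
      (π : Q →ₗ[R] N), Function.Surjective π ∧ ∀ M : ModuleCat.{u} R,
        ∃ τ : VR.Tor₁ R M N →ₗ[R] M ⊗[R] LinearMap.ker π, Function.Injective τ ∧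
          Function.Exact τ ((LinearMap.ker π).subtype.lTensor M) := by
  -- Q is the module P₀ of a projective resolution, and P₁ maps onto the kernel of Q → N. The
  -- resolution is chosen before M, so one presentation of N serves all M.
  let P := ProjectiveResolution.of N
  let π : P.complex.X 0 →ₗ[R] N := (P.π.f 0).hom
  have hex : Function.Exact (P.complex.d 1 0).hom π :=
    (ShortComplex.ShortExact.moduleCat_exact_iff_function_exact _).1 P.exact₀
  let d : P.complex.X 1 →ₗ[R] LinearMap.ker π :=
    (P.complex.d 1 0).hom.codRestrict _ fun x => (hex _).2 ⟨x, rfl⟩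
  have hd : Function.Surjective d := fun y => by
    obtain ⟨x, hx⟩ := (hex y.1).1 y.2
    exact ⟨x, Subtype.ext hx⟩
  have hex' : Function.Exact (P.complex.d 2 1).hom d := fun x => by
    rw [← (ShortComplex.ShortExact.moduleCat_exact_iff_function_exact _).1 (P.exact_succ 0) x]
    exact ⟨fun h => Subtype.ext_iff.1 h, fun h => Subtype.ext h⟩
  refine ⟨P.complex.X 0, inferInstance, inferInstance,
    (IsProjective.iff_projective (P.complex.X 0)).2 (P.projective 0), π,
    (ModuleCat.epi_iff_surjective (P.π.f 0)).1 inferInstance, fun M => ?_⟩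
  let F := (MonoidalCategory.tensoringLeft (ModuleCat.{u} R)).obj M
  let e1 := P.isoLeftDerivedObj F 1
  let C := (F.mapHomologicalComplex (ComplexShape.down ℕ)).obj P.complex
  let e2 : C.homology 1 ≅ (C.sc' 2 1 0).homology :=
    ShortComplex.homologyMapIso (C.isoSc' 2 1 0 (by simp) (by simp))
  obtain ⟨τ, hτ, hτ'⟩ := shortComplex_exists_homology (C.sc' 2 1 0) (d.lTensor M)
    ((LinearMap.ker π).subtype.lTensor M) (LinearMap.lTensor_surjective M hd)
    (lTensor_exact M hex' hd) (fun x => by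
      change ((LinearMap.ker π).subtype.lTensor M ∘ₗ d.lTensor M) x =
        (P.complex.d 1 0).hom.lTensor M x
      rw [← LinearMap.lTensor_comp]
      rfl)
  let e : VR.Tor₁ R M N ≃ₗ[R] (C.sc' 2 1 0).homology := (e1 ≪≫ e2).toLinearEquiv
  refine ⟨τ ∘ₗ e.toLinearMap, hτ.comp e.injective, fun y => (hτ' y).trans ⟨?_, ?_⟩⟩
  · rintro ⟨x, rfl⟩
    exact ⟨e.symm x, congrArg τ (e.apply_symm_apply x)⟩
  · rintro ⟨x, rfl⟩
    exact ⟨e x, rfl⟩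

end Tor

/-! ### Sums of two-term projective resolutions. -/

section Resolution

variable {R : Type u} [CommRing R] {H P : ℤ → Type u} [∀ i, AddCommGroup (H i)]
  [∀ i, Module R (H i)] [∀ i, AddCommGroup (P i)] [∀ i, Module R (P i)]
  (π : ∀ i, P i →ₗ[R] H i)

/-- The sum of the resolutions `ker πᵢ → Pᵢ` of the modules `Hᵢ`. -/
abbrev Resolution : Type u := ⨁ i, (LinearMap.ker (π i) × P i)

/-- The inclusion of `Pᵢ`. -/
noncomputable def resGen (i : ℤ) : P i →ₗ[R] Resolution π :=
  DirectSum.lof R ℤ (fun i => LinearMap.ker (π i) × P i) i ∘ₗ LinearMap.inr R _ _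

/-- The inclusion of `ker πᵢ`. -/
noncomputable def resRel (i : ℤ) : LinearMap.ker (π i) →ₗ[R] Resolution π :=
  DirectSum.lof R ℤ (fun i => LinearMap.ker (π i) × P i) i ∘ₗ LinearMap.inl R _ _

theorem resolution_hom_ext {M : Type*} [AddCommGroup M] [Module R M]
    {f g : Resolution π →ₗ[R] M} (h0 : ∀ i x, f (resGen π i x) = g (resGen π i x))
    (h1 : ∀ i x, f (resRel π i x) = g (resRel π i x)) : f = g :=
  DirectSum.linearMap_ext _ fun i => LinearMap.prod_ext (LinearMap.ext (h1 i))
    (LinearMap.ext (h0 i))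

/-- A linear map out of the sum of the resolutions. -/
noncomputable def resLift {M : Type*} [AddCommGroup M] [Module R M] (a : ∀ i, P i →ₗ[R] M)
    (b : ∀ i, LinearMap.ker (π i) →ₗ[R] M) : Resolution π →ₗ[R] M :=
  DirectSum.toModule R ℤ M fun i => LinearMap.coprod (b i) (a i)

section

variable {M : Type*} [AddCommGroup M] [Module R M] (a : ∀ i, P i →ₗ[R] M)
    (b : ∀ i, LinearMap.ker (π i) →ₗ[R] M)

theorem resLift_resGen (i : ℤ) (x : P i) : resLift π a b (resGen π i x) = a i x := by
  simp [resLift, resGen]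

theorem resLift_resRel (i : ℤ) (x : LinearMap.ker (π i)) :
    resLift π a b (resRel π i x) = b i x := by
  simp [resLift, resRel]

end

/-- The differential of the sum of the resolutions. -/
noncomputable def resD : Resolution π →ₗ[R] Resolution π :=
  resLift π 0 (fun i => resGen π i ∘ₗ (LinearMap.ker (π i)).subtype)

theorem resD_resGen (i : ℤ) (x : P i) : resD π (resGen π i x) = 0 := resLift_resGen π _ _ _ _

theorem resD_resRel (i : ℤ) (x : LinearMap.ker (π i)) :
    resD π (resRel π i x) = resGen π i x.1 := resLift_resRel π _ _ _ _

/-- The sign of the sum of the resolutions, in which `Pᵢ` has degree `i`. -/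
noncomputable def resSign : Resolution π →ₗ[R] Resolution π :=
  resLift π (fun i => zsign R i • resGen π i) (fun i => -(zsign R i • resRel π i))

theorem resSign_resGen (i : ℤ) (x : P i) :
    resSign π (resGen π i x) = zsign R i • resGen π i x := resLift_resGen π _ _ _ _

theorem resSign_resRel (i : ℤ) (x : LinearMap.ker (π i)) :
    resSign π (resRel π i x) = -(zsign R i • resRel π i x) := resLift_resRel π _ _ _ _

theorem isSigned_resD : IsSigned (resD π) (resSign π) where
  dd x := by
    suffices h : resD π ∘ₗ resD π = 0 from LinearMap.congr_fun h x
    refine resolution_hom_ext π (fun i x => ?_) (fun i x => ?_)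
    · rw [LinearMap.comp_apply, resD_resGen, map_zero, LinearMap.zero_apply]
    · rw [LinearMap.comp_apply, resD_resRel, resD_resGen, LinearMap.zero_apply]
  ss x := by
    suffices h : resSign π ∘ₗ resSign π = LinearMap.id from LinearMap.congr_fun h x
    refine resolution_hom_ext π (fun i x => ?_) (fun i x => ?_)
    · rw [LinearMap.comp_apply, resSign_resGen, map_smul, resSign_resGen, smul_smul,
        zsign_mul_self, one_smul, LinearMap.id_apply]
    · rw [LinearMap.comp_apply, resSign_resRel, map_neg, map_smul, resSign_resRel, smul_neg,
        neg_neg, smul_smul, zsign_mul_self, one_smul, LinearMap.id_apply]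
  sd x := by
    suffices h : resSign π ∘ₗ resD π = -(resD π ∘ₗ resSign π) from LinearMap.congr_fun h x
    refine resolution_hom_ext π (fun i x => ?_) (fun i x => ?_)
    · rw [LinearMap.comp_apply, LinearMap.neg_apply, LinearMap.comp_apply, resD_resGen,
        resSign_resGen, map_smul, resD_resGen, map_zero, smul_zero, neg_zero]
    · rw [LinearMap.comp_apply, LinearMap.neg_apply, LinearMap.comp_apply, resD_resRel,
        resSign_resGen, resSign_resRel, map_neg, map_smul, resD_resRel, neg_neg]

/-- A cycle of the sum of the resolutions is a sum of elements of the `Pᵢ`. -/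
theorem exists_of_resD_eq_zero {x : Resolution π} (hx : resD π x = 0) (i : ℤ) : (x i).1 = 0 := by
  have h : ∀ x, ((resD π x) i).2 = ((x i).1 : P i) := fun x => by
    let f : Resolution π →ₗ[R] P i :=
      LinearMap.snd R _ _ ∘ₗ DirectSum.component R ℤ (fun i => LinearMap.ker (π i) × P i) i
    let g : Resolution π →ₗ[R] P i := (LinearMap.ker (π i)).subtype ∘ₗ
      LinearMap.fst R _ _ ∘ₗ DirectSum.component R ℤ (fun i => LinearMap.ker (π i) × P i) i
    suffices h : f ∘ₗ resD π = g from LinearMap.congr_fun h x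
    refine resolution_hom_ext π (fun j x => ?_) (fun j x => ?_)
    · rw [LinearMap.comp_apply, resD_resGen, map_zero]
      by_cases hij : j = i
      · subst hij
        simp [g, resGen, DirectSum.component.lof_self]
      · simp [g, resGen, DirectSum.component.of, hij]
    · rw [LinearMap.comp_apply, resD_resRel]
      by_cases hij : j = i
      · subst hij
        simp [f, g, resGen, resRel, DirectSum.component.lof_self]
      · simp [f, g, resGen, resRel, DirectSum.component.of, hij]
  have := h x
  rw [hx] at this
  exact Subtype.ext this.symm

/-- The augmentation of the sum of the resolutions. -/
noncomputable def resAug : Resolution π →ₗ[R] ⨁ i, H i :=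
  resLift π (fun i => DirectSum.lof R ℤ H i ∘ₗ π i) 0

theorem resAug_resGen (i : ℤ) (x : P i) :
    resAug π (resGen π i x) = DirectSum.lof R ℤ H i (π i x) := resLift_resGen π _ _ _ _

theorem resAug_resRel (i : ℤ) (x : LinearMap.ker (π i)) :
    resAug π (resRel π i x) = 0 := resLift_resRel π _ _ _ _

theorem resAug_apply (x : Resolution π) (i : ℤ) : resAug π x i = π i (x i).2 := by
  let f : Resolution π →ₗ[R] H i :=
    π i ∘ₗ LinearMap.snd R _ _ ∘ₗ
      DirectSum.component R ℤ (fun i => LinearMap.ker (π i) × P i) i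
  suffices h : DirectSum.component R ℤ H i ∘ₗ resAug π = f from LinearMap.congr_fun h x
  refine resolution_hom_ext π (fun j x => ?_) (fun j x => ?_)
  · rw [LinearMap.comp_apply, resAug_resGen]
    by_cases hij : j = i
    · subst hij
      simp [f, resGen, DirectSum.component.lof_self]
    · simp [f, resGen, DirectSum.component.of, hij]
  · rw [LinearMap.comp_apply, resAug_resRel, map_zero]
    by_cases hij : j = i
    · subst hij
      simp [f, resRel, DirectSum.component.lof_self]
    · simp [f, resRel, DirectSum.component.of, hij]

theorem resolution_eq_sum (x : Resolution π) (F : Finset ℤ) (hF : ∀ i, i ∉ F → x i = 0) :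
    x = ∑ i ∈ F, (resRel π i (x i).1 + resGen π i (x i).2) := by
  refine DFinsupp.ext fun j => ?_
  have e : ∀ i, resRel π i (x i).1 + resGen π i (x i).2 =
      DirectSum.lof R ℤ (fun i => LinearMap.ker (π i) × P i) i (x i) := fun i => by
    simp only [resRel, resGen, LinearMap.comp_apply, ← map_add]
    congr 1
    ext <;> simp
  simp only [e]
  change DirectSum.component R ℤ (fun i => LinearMap.ker (π i) × P i) j x =
    DirectSum.component R ℤ (fun i => LinearMap.ker (π i) × P i) j _
  rw [map_sum]
  by_cases hj : j ∈ F
  · rw [Finset.sum_eq_single j]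
    · rw [DirectSum.component.lof_self]; rfl
    · intro i _ hij
      rw [DirectSum.component.of, dif_neg hij]
    · exact fun h => absurd hj h
  · rw [Finset.sum_eq_zero]
    · exact hF j hj
    · intro i hi
      rw [DirectSum.component.of, dif_neg (by rintro rfl; exact hj hi)]

open Classical in
theorem exists_support (x : Resolution π) : ∃ F : Finset ℤ, ∀ i, i ∉ F → x i = 0 :=
  ⟨DFinsupp.support x, fun _ hi => DFinsupp.notMem_support_iff.1 hi⟩

theorem eq_resD_of_mem_ker {x : Resolution π} (hx : resD π x = 0) (h : ∀ i, π i (x i).2 = 0) :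
    ∃ w, x = resD π w := by
  obtain ⟨F, hF⟩ := exists_support π x
  refine ⟨∑ i ∈ F, resRel π i ⟨(x i).2, h i⟩, ?_⟩
  conv_lhs => rw [resolution_eq_sum π x F hF]
  rw [map_sum]
  refine Finset.sum_congr rfl fun i _ => ?_
  rw [exists_of_resD_eq_zero π hx, map_zero, zero_add, resD_resRel]

theorem resAug_surjective (hπ : ∀ i, Function.Surjective (π i)) :
    Function.Surjective (fun x : {x // resD π x = 0} => resAug π x.1) := by
  intro y
  induction y using DirectSum.induction_on with
  | zero => exact ⟨⟨0, map_zero _⟩, map_zero _⟩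
  | of i y =>
    obtain ⟨x, rfl⟩ := hπ i y
    exact ⟨⟨resGen π i x, resD_resGen π i x⟩, resAug_resGen π i x⟩
  | add y z hy hz =>
    obtain ⟨⟨x, hx⟩, rfl⟩ := hy
    obtain ⟨⟨x', hx'⟩, rfl⟩ := hz
    exact ⟨⟨x + x', by rw [map_add, hx, hx', add_zero]⟩, map_add _ _ _⟩

/-- Each summand resolves one of the modules Hᵢ, which form a complex with zero differential. -/
theorem quasiIso_resAug (hπ : ∀ i, Function.Surjective (π i)) :
    DQuasiIso (resD π) (0 : (⨁ i, H i) →ₗ[R] _) (resAug π) where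
  comm x := by
    suffices h : resAug π ∘ₗ resD π = 0 from LinearMap.congr_fun h x
    refine resolution_hom_ext π (fun i x => ?_) (fun i x => ?_)
    · rw [LinearMap.comp_apply, resD_resGen, map_zero, LinearMap.zero_apply]
    · rw [LinearMap.comp_apply, resD_resRel, resAug_resGen, LinearMap.mem_ker.1 x.2, map_zero,
        LinearMap.zero_apply]
  surj y _ := by
    obtain ⟨⟨x, hx⟩, rfl⟩ := resAug_surjective π hπ y
    exact ⟨x, 0, hx, by simp⟩
  inj x z hx hz := eq_resD_of_mem_ker π hx fun i => by
    rw [← resAug_apply, hz]; rfl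

/-- The sign of `⨁ Hᵢ`. -/
noncomputable def homologySign : (⨁ i, H i) →ₗ[R] ⨁ i, H i :=
  DirectSum.lmap fun i => zsign R i • LinearMap.id

theorem homologySign_lof (i : ℤ) (h : H i) :
    homologySign (R := R) (H := H) (DirectSum.lof R ℤ H i h) = zsign R i • DirectSum.lof R ℤ H i h := by
  rw [homologySign, DirectSum.lmap_lof]
  simp

theorem isSigned_homologySign : IsSigned (0 : (⨁ i, H i) →ₗ[R] ⨁ i, H i) (homologySign (R := R) (H := H)) where
  dd _ := rfl
  ss x := by
    suffices h : homologySign (R := R) (H := H) ∘ₗ homologySign = LinearMap.id from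
      LinearMap.congr_fun h x
    refine DirectSum.linearMap_ext _ fun i => LinearMap.ext fun y => ?_
    rw [LinearMap.comp_apply, LinearMap.comp_apply, homologySign_lof, map_smul, homologySign_lof,
      smul_smul, zsign_mul_self, one_smul]
    rfl
  sd x := by simp

theorem resAug_resSign (x : Resolution π) :
    resAug π (resSign π x) = homologySign (R := R) (H := H) (resAug π x) := by
  suffices h : resAug π ∘ₗ resSign π = homologySign (R := R) (H := H) ∘ₗ resAug π from LinearMap.congr_fun h x
  refine resolution_hom_ext π (fun i x => ?_) (fun i x => ?_)
  · rw [LinearMap.comp_apply, LinearMap.comp_apply, resSign_resGen, map_smul, resAug_resGen,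
      homologySign_lof]
  · rw [LinearMap.comp_apply, LinearMap.comp_apply, resSign_resRel, map_neg, map_smul,
      resAug_resRel, map_zero, smul_zero, neg_zero]

/-- The kernels are projective, being submodules of projective modules over a principal ideal
domain. -/
theorem flat_resolution [IsDomain R] [IsPrincipalIdealRing R] [∀ i, Module.Projective R (P i)] :
    Module.Flat R (Resolution π) := by
  have h : ∀ i, Module.Projective R (LinearMap.ker (π i)) := fun i =>
    projective_of_injective (LinearMap.ker (π i)).subtype Subtype.val_injective
  infer_instance

/-! ### Comparing a complex with the resolutions of its homology. -/

section Lift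

variable {C : Type u} [AddCommGroup C] [Module R C] {d σ : C →ₗ[R] C} {p : ℤ → C →ₗ[R] C}
  {θ : ∀ i, H i →ₗ[R] C ⧸ LinearMap.range d}

theorem IsGradedDM.sign_of_eq (hd : IsGradedDM d σ p) {i : ℤ} {x : C} (hx : p i x = x) :
    σ x = zsign R i • x := by
  have := hd.sign i x
  rwa [hx] at this

theorem IsGradedDM.proj_of_eq (hd : IsGradedDM d σ p) {i : ℤ} {x : C} (hx : p i x = x) (j : ℤ) :
    p j x = if j = i then x else 0 := by
  have := hd.proj j i x
  rwa [hx] at this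

/-- Homogeneous cycles map onto the classes of their degree, and P i is projective. -/
theorem IsHomologyOf.exists_cycle_lift (hθ : IsHomologyOf d p θ) (i : ℤ)
    [Module.Projective R (P i)] :
    ∃ a : P i →ₗ[R] C, ∀ x, p i (a x) = a x ∧ d (a x) = 0 ∧
      θ i (π i x) = Submodule.mkQ _ (a x) := by
  let Z : Submodule R C := LinearMap.ker (p i - LinearMap.id) ⊓ LinearMap.ker d
  let c : Z →ₗ[R] C ⧸ LinearMap.range d := Submodule.mkQ _ ∘ₗ Z.subtype
  let t : P i →ₗ[R] LinearMap.range c := LinearMap.codRestrict _ (θ i ∘ₗ π i) fun x => by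
    obtain ⟨z, h1, h2, h3⟩ := hθ.exists_rep i (π i x)
    exact ⟨⟨z, by simp [Z, h1, h2]⟩, h3.symm⟩
  obtain ⟨g, hg⟩ := Module.projective_lifting_property c.rangeRestrict t
    (LinearMap.surjective_rangeRestrict c)
  refine ⟨Z.subtype ∘ₗ g, fun x => ⟨sub_eq_zero.1 (LinearMap.mem_ker.1 (g x).2.1),
    (g x).2.2, ?_⟩⟩
  exact (Subtype.ext_iff.1 (LinearMap.congr_fun hg x)).symm

/-- A lift exists by projectivity of Q. Projecting it to degree i - 1 does not change its boundary,
because f is homogeneous of degree i. -/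
theorem IsGradedDM.exists_boundary_lift (hd : IsGradedDM d σ p) {Q : Type u} [AddCommGroup Q]
    [Module R Q] [Module.Projective R Q] (i : ℤ) (f : Q →ₗ[R] C) (hf : ∀ x, p i (f x) = f x)
    (hf' : ∀ x, f x ∈ LinearMap.range d) :
    ∃ b : Q →ₗ[R] C, ∀ x, p (i - 1) (b x) = b x ∧ d (b x) = f x := by
  let t : Q →ₗ[R] LinearMap.range d := LinearMap.codRestrict _ f hf'
  obtain ⟨g, hg⟩ := Module.projective_lifting_property d.rangeRestrict t
    (LinearMap.surjective_rangeRestrict d)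
  have hg' : ∀ x, d (g x) = f x := fun x => Subtype.ext_iff.1 (LinearMap.congr_fun hg x)
  refine ⟨p (i - 1) ∘ₗ g, fun x => ⟨?_, ?_⟩⟩
  · rw [LinearMap.comp_apply, hd.proj, if_pos rfl]
  · rw [LinearMap.comp_apply, hd.d_proj, sub_add_cancel, hg', hf]

/-- The sum of the resolutions of the homology modules of a graded differential module is
quasi-isomorphic to it. -/
theorem IsGradedDM.exists_resolution_quasiIso [IsDomain R] [IsPrincipalIdealRing R]
    [∀ i, Module.Projective R (P i)] (hd : IsGradedDM d σ p) (hθ : IsHomologyOf d p θ)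
    (hπ : ∀ i, Function.Surjective (π i)) :
    ∃ α : Resolution π →ₗ[R] C, DQuasiIso (resD π) d α ∧ (∀ x, α (resSign π x) = σ (α x)) ∧
      (∀ i x, p i (α (resGen π i x)) = α (resGen π i x)) ∧
      (∀ i x, d (α (resGen π i x)) = 0) ∧
      (∀ i x, θ i (π i x) = Submodule.mkQ _ (α (resGen π i x))) ∧
      (∀ i x, p (i - 1) (α (resRel π i x)) = α (resRel π i x)) := by
  choose a ha using fun i => hθ.exists_cycle_lift π i
  -- Only because the kernels are projective can the cycles over them be bounded linearly.
  have hker : ∀ i, Module.Projective R (LinearMap.ker (π i)) := fun i =>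
    projective_of_injective (LinearMap.ker (π i)).subtype Subtype.val_injective
  choose b hb using fun i => hd.exists_boundary_lift i (a i ∘ₗ (LinearMap.ker (π i)).subtype)
    (fun x => (ha i x.1).1) (fun x => (Submodule.Quotient.mk_eq_zero _).1 (by
      have h := (ha i x.1).2.2
      rw [LinearMap.mem_ker.1 x.2, map_zero] at h
      exact h.symm))
  refine ⟨resLift π a b, ⟨fun x => ?_, fun y hy => ?_, fun x z hx hz => ?_⟩, fun x => ?_,
    fun i x => ?_, fun i x => ?_, fun i x => ?_, fun i x => ?_⟩
  · suffices h : resLift π a b ∘ₗ resD π = d ∘ₗ resLift π a b from LinearMap.congr_fun h x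
    refine resolution_hom_ext π (fun i x => ?_) (fun i x => ?_)
    · rw [LinearMap.comp_apply, LinearMap.comp_apply, resD_resGen, resLift_resGen, (ha i x).2.1,
        map_zero]
    · rw [LinearMap.comp_apply, LinearMap.comp_apply, resD_resRel, resLift_resGen,
        resLift_resRel, (hb i x).2]
      rfl
  · obtain ⟨F, hF⟩ := hd.supp y
    have key : ∀ i, ∃ x z, y = y ∧ p i y = a i x + d z := fun i => by
      obtain ⟨h, hh⟩ := hθ.exists_class i (p i y) (by rw [hd.proj, if_pos rfl])
        (by rw [hd.d_proj, hy, map_zero])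
      obtain ⟨x, rfl⟩ := hπ i h
      rw [(ha i x).2.2] at hh
      obtain ⟨z, hz⟩ := (Submodule.Quotient.eq _).1 hh.symm
      exact ⟨x, z, rfl, by rw [hz]; abel⟩
    choose x z _ hxz using key
    refine ⟨∑ i ∈ F, resGen π i (x i), ∑ i ∈ F, z i, ?_, ?_⟩
    · rw [map_sum]
      exact Finset.sum_eq_zero fun i _ => resD_resGen π i _
    · rw [map_sum, map_sum, ← Finset.sum_add_distrib, hF]
      refine Finset.sum_congr rfl fun i _ => ?_
      rw [resLift_resGen, hxz]
  · refine eq_resD_of_mem_ker π hx fun i => ?_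
    -- The component of degree i in the image of a cycle depends only on its component in P i. If
    -- the image is a boundary, this component has class zero in H i.
    have h1 : ∀ x, resD π x = 0 → p i (resLift π a b x) = a i (x i).2 := fun x hx => by
      obtain ⟨F, hF⟩ := exists_support π x
      conv_lhs => rw [resolution_eq_sum π x F hF]
      simp only [exists_of_resD_eq_zero π hx, map_zero, zero_add, map_sum, resLift_resGen]
      by_cases hi : i ∈ F
      · rw [Finset.sum_eq_single i, (ha i _).1]
        · intro j _ hj
          rw [hd.proj_of_eq (ha j _).1, if_neg (Ne.symm hj)]
        · exact fun h => absurd hi h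
      · rw [Finset.sum_eq_zero, hF i hi, Prod.snd_zero, map_zero]
        intro j hj
        rw [hd.proj_of_eq (ha j _).1, if_neg (by rintro rfl; exact hi hj)]
    refine hθ.inj i ?_
    rw [(ha i _).2.2, map_zero, ← h1 x hx, hz]
    refine (Submodule.Quotient.mk_eq_zero _).2 ⟨p (i - 1) z, ?_⟩
    rw [hd.d_proj, sub_add_cancel]
  · suffices h : resLift π a b ∘ₗ resSign π = σ ∘ₗ resLift π a b from LinearMap.congr_fun h x
    refine resolution_hom_ext π (fun i x => ?_) (fun i x => ?_)
    · rw [LinearMap.comp_apply, LinearMap.comp_apply, resSign_resGen, map_smul, resLift_resGen,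
        hd.sign_of_eq (ha i x).1]
    · have := zsign_succ R (i - 1)
      rw [sub_add_cancel] at this
      rw [LinearMap.comp_apply, LinearMap.comp_apply, resSign_resRel, map_neg, map_smul,
        resLift_resRel, hd.sign_of_eq (hb i x).1, this, neg_smul, neg_neg]
  · rw [resLift_resGen, (ha i x).1]
  · rw [resLift_resGen, (ha i x).2.1]
  · rw [resLift_resGen, (ha i x).2.2]
  · rw [resLift_resRel, (hb i x).1]

end Lift

end Resolution

/-! ### Homology along a roof of quasi-isomorphisms. -/

section HomologyMap

variable {R : Type*} [CommRing R] {M N E : Type*} [AddCommGroup M] [Module R M] [AddCommGroup N]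
  [Module R N] [AddCommGroup E] [Module R E] {dM : M →ₗ[R] M} {dN : N →ₗ[R] N} {dE : E →ₗ[R] E}

/-- Quasi-isomorphisms `N ← M → E` identify the homology modules of `N` and `E`. -/
theorem DQuasiIso.exists_homology_map {f : M →ₗ[R] N} {g : M →ₗ[R] E} (hf : DQuasiIso dM dN f)
    (hg : DQuasiIso dM dE g) :
    ∃ Ψ : LinearMap.ker dN →ₗ[R] E ⧸ LinearMap.range dE,
      (∀ x (y : LinearMap.ker dN), dM x = 0 → f x = y.1 → Ψ y = Submodule.mkQ _ (g x)) ∧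
      (∀ y, Ψ y = 0 → ∃ z, y.1 = dN z) ∧
      (∀ e, dE e = 0 → ∃ y, Ψ y = Submodule.mkQ _ e) := by
  -- Cycles of M map to the cokernels of both differentials, by φ and γ. As f is injective in
  -- homology γ factors through the image of φ, and as f is surjective in homology this image
  -- contains the classes of all cycles of N.
  let φ : LinearMap.ker dM →ₗ[R] N ⧸ LinearMap.range dN :=
    Submodule.mkQ _ ∘ₗ f ∘ₗ (LinearMap.ker dM).subtype
  let γ : LinearMap.ker dM →ₗ[R] E ⧸ LinearMap.range dE :=
    Submodule.mkQ _ ∘ₗ g ∘ₗ (LinearMap.ker dM).subtype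
  have hφγ : LinearMap.ker φ ≤ LinearMap.ker γ := fun x hx => by
    obtain ⟨z, hz⟩ := (Submodule.Quotient.mk_eq_zero _).1 (LinearMap.mem_ker.1 hx)
    obtain ⟨w, hw⟩ := hf.inj x.1 z x.2 hz.symm
    refine (Submodule.Quotient.mk_eq_zero _).2 ⟨g w, ?_⟩
    rw [← hg.comm, ← hw]
    rfl
  let t : LinearMap.ker dN →ₗ[R] LinearMap.range φ :=
    LinearMap.codRestrict _ (Submodule.mkQ _ ∘ₗ (LinearMap.ker dN).subtype) fun y => by
      obtain ⟨x, z, hx, hxz⟩ := hf.surj y.1 y.2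
      refine ⟨⟨x, hx⟩, ?_⟩
      refine (Submodule.Quotient.eq _).2 ⟨-z, ?_⟩
      change _ = f x - y.1
      rw [hxz, map_neg]
      abel
  let Ψ : LinearMap.ker dN →ₗ[R] E ⧸ LinearMap.range dE :=
    (LinearMap.ker φ).liftQ γ hφγ ∘ₗ φ.quotKerEquivRange.symm.toLinearMap ∘ₗ t
  have hΨ : ∀ x (y : LinearMap.ker dN) z, dM x = 0 → y.1 = f x + dN z →
      Ψ y = Submodule.mkQ _ (g x) := fun x y z hx hxy => by
    have h1 : t y = φ.quotKerEquivRange ((LinearMap.ker φ).mkQ ⟨x, hx⟩) := by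
      refine Subtype.ext ?_
      change Submodule.mkQ _ y.1 = Submodule.mkQ _ (f x)
      refine (Submodule.Quotient.eq _).2 ⟨z, ?_⟩
      rw [hxy]
      abel
    change (LinearMap.ker φ).liftQ γ hφγ (φ.quotKerEquivRange.symm (t y)) = _
    rw [h1, LinearEquiv.symm_apply_apply]
    rfl
  refine ⟨Ψ, fun x y hx hxy => hΨ x y 0 hx (by rw [map_zero, add_zero, hxy]), fun y hy => ?_,
    fun e he => ?_⟩
  · obtain ⟨x, z, hx, hxz⟩ := hf.surj y.1 y.2
    rw [hΨ x y z hx hxz] at hy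
    obtain ⟨v, hv⟩ := (Submodule.Quotient.mk_eq_zero _).1 hy
    obtain ⟨w, rfl⟩ := hg.inj x v hx hv.symm
    exact ⟨f w + z, by rw [hxz, hf.comm, map_add]⟩
  · obtain ⟨x, z, hx, hxz⟩ := hg.surj e he
    refine ⟨⟨f x, by rw [LinearMap.mem_ker, ← hf.comm, hx, map_zero]⟩, ?_⟩
    rw [hΨ x _ 0 hx (by simp)]
    refine (Submodule.Quotient.eq _).2 ⟨-z, ?_⟩
    rw [hxz, map_neg]
    abel

end HomologyMap

/-! ### Components of a sum of resolutions. -/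

section Components

variable {R : Type u} [CommRing R] {H P : ℤ → Type u} [∀ i, AddCommGroup (H i)]
  [∀ i, Module R (H i)] [∀ i, AddCommGroup (P i)] [∀ i, Module R (P i)]
  (π : ∀ i, P i →ₗ[R] H i)

/-- The component in `Pᵢ`. -/
noncomputable def resGenComp (i : ℤ) : Resolution π →ₗ[R] P i :=
  LinearMap.snd R _ _ ∘ₗ DirectSum.component R ℤ (fun i => LinearMap.ker (π i) × P i) i

/-- The component in `ker πᵢ`. -/
noncomputable def resRelComp (i : ℤ) : Resolution π →ₗ[R] LinearMap.ker (π i) :=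
  LinearMap.fst R _ _ ∘ₗ DirectSum.component R ℤ (fun i => LinearMap.ker (π i) × P i) i

theorem resGenComp_resGen (i : ℤ) (x : P i) : resGenComp π i (resGen π i x) = x := by
  simp [resGenComp, resGen, DirectSum.component.lof_self]

theorem resGenComp_resGen_of_ne {i j : ℤ} (h : i ≠ j) (x : P i) :
    resGenComp π j (resGen π i x) = 0 := by
  simp [resGenComp, resGen, DirectSum.component.of, h]

theorem resRelComp_resRel (i : ℤ) (x : LinearMap.ker (π i)) :
    resRelComp π i (resRel π i x) = x := by
  simp [resRelComp, resRel, DirectSum.component.lof_self]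

theorem resRelComp_resRel_of_ne {i j : ℤ} (h : i ≠ j) (x : LinearMap.ker (π i)) :
    resRelComp π j (resRel π i x) = 0 := by
  simp [resRelComp, resRel, DirectSum.component.of, h]

theorem resGenComp_resRel (i j : ℤ) (x : LinearMap.ker (π i)) :
    resGenComp π j (resRel π i x) = 0 := by
  by_cases h : i = j
  · subst h
    simp [resGenComp, resRel, DirectSum.component.lof_self]
  · simp [resGenComp, resRel, DirectSum.component.of, h]

theorem resRelComp_resGen (i j : ℤ) (x : P i) : resRelComp π j (resGen π i x) = 0 := by
  by_cases h : i = j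
  · subst h
    simp [resRelComp, resGen, DirectSum.component.lof_self]
  · simp [resRelComp, resGen, DirectSum.component.of, h]

end Components

/-! ### A graded module tensored with a sum of resolutions. -/

section Tensor

variable {R : Type u} [CommRing R] (H : ℤ → Type u) [∀ i, AddCommGroup (H i)]
  [∀ i, Module R (H i)] {K Q : ℤ → Type u} [∀ i, AddCommGroup (K i)]
  [∀ i, Module R (K i)] [∀ i, AddCommGroup (Q i)] [∀ i, Module R (Q i)]
  (ρ : ∀ i, Q i →ₗ[R] K i)

/-- The tensor product of `⨁ Hᵢ` with a resolution. -/
abbrev HomologyTensor : Type u := (⨁ i, H i) ⊗[R] Resolution ρ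

/-- The inclusion of `Hᵢ ⊗ Qⱼ`. -/
noncomputable def genTensor (i j : ℤ) : H i ⊗[R] Q j →ₗ[R] HomologyTensor H ρ :=
  TensorProduct.map (DirectSum.lof R ℤ H i) (resGen ρ j)

/-- The inclusion of `Hᵢ ⊗ ker ρⱼ`. -/
noncomputable def relTensor (i j : ℤ) :
    H i ⊗[R] LinearMap.ker (ρ j) →ₗ[R] HomologyTensor H ρ :=
  TensorProduct.map (DirectSum.lof R ℤ H i) (resRel ρ j)

/-- The component in `Hᵢ ⊗ Qⱼ`. -/
noncomputable def genComp (i j : ℤ) : HomologyTensor H ρ →ₗ[R] H i ⊗[R] Q j :=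
  TensorProduct.map (DirectSum.component R ℤ H i) (resGenComp ρ j)

/-- The component in `Hᵢ ⊗ ker ρⱼ`. -/
noncomputable def relComp (i j : ℤ) :
    HomologyTensor H ρ →ₗ[R] H i ⊗[R] LinearMap.ker (ρ j) :=
  TensorProduct.map (DirectSum.component R ℤ H i) (resRelComp ρ j)

theorem genComp_genTensor (i j : ℤ) (x : H i ⊗[R] Q j) :
    genComp H ρ i j (genTensor H ρ i j x) = x := by
  suffices h : genComp H ρ i j ∘ₗ genTensor H ρ i j = LinearMap.id from LinearMap.congr_fun h x
  refine TensorProduct.ext' fun h q => ?_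
  simp only [genComp, genTensor, LinearMap.comp_apply, TensorProduct.map_tmul,
    DirectSum.component.lof_self, resGenComp_resGen, LinearMap.id_apply]

theorem relComp_relTensor (i j : ℤ) (x : H i ⊗[R] LinearMap.ker (ρ j)) :
    relComp H ρ i j (relTensor H ρ i j x) = x := by
  suffices h : relComp H ρ i j ∘ₗ relTensor H ρ i j = LinearMap.id from LinearMap.congr_fun h x
  refine TensorProduct.ext' fun h q => ?_
  simp only [relComp, relTensor, LinearMap.comp_apply, TensorProduct.map_tmul,
    DirectSum.component.lof_self, resRelComp_resRel, LinearMap.id_apply]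

theorem genComp_genTensor_of_ne {i j i' j' : ℤ} (h : (i, j) ≠ (i', j')) (x : H i ⊗[R] Q j) :
    genComp H ρ i' j' (genTensor H ρ i j x) = 0 := by
  suffices h : genComp H ρ i' j' ∘ₗ genTensor H ρ i j = 0 from LinearMap.congr_fun h x
  refine TensorProduct.ext' fun y q => ?_
  simp only [genComp, genTensor, LinearMap.comp_apply, TensorProduct.map_tmul,
    LinearMap.zero_apply]
  by_cases hi : i = i'
  · rw [resGenComp_resGen_of_ne ρ (fun hj => h (by rw [hi, hj])), TensorProduct.tmul_zero]
  · rw [DirectSum.component.of, dif_neg hi, TensorProduct.zero_tmul]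

theorem relComp_relTensor_of_ne {i j i' j' : ℤ} (h : (i, j) ≠ (i', j'))
    (x : H i ⊗[R] LinearMap.ker (ρ j)) :
    relComp H ρ i' j' (relTensor H ρ i j x) = 0 := by
  suffices h : relComp H ρ i' j' ∘ₗ relTensor H ρ i j = 0 from LinearMap.congr_fun h x
  refine TensorProduct.ext' fun y q => ?_
  simp only [relComp, relTensor, LinearMap.comp_apply, TensorProduct.map_tmul,
    LinearMap.zero_apply]
  by_cases hi : i = i'
  · rw [resRelComp_resRel_of_ne ρ (fun hj => h (by rw [hi, hj])), TensorProduct.tmul_zero]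
  · rw [DirectSum.component.of, dif_neg hi, TensorProduct.zero_tmul]

theorem genComp_relTensor (i j i' j' : ℤ) (x : H i ⊗[R] LinearMap.ker (ρ j)) :
    genComp H ρ i' j' (relTensor H ρ i j x) = 0 := by
  suffices h : genComp H ρ i' j' ∘ₗ relTensor H ρ i j = 0 from LinearMap.congr_fun h x
  refine TensorProduct.ext' fun y q => ?_
  simp only [genComp, relTensor, LinearMap.comp_apply, TensorProduct.map_tmul,
    LinearMap.zero_apply, resGenComp_resRel, TensorProduct.tmul_zero]

theorem relComp_genTensor (i j i' j' : ℤ) (x : H i ⊗[R] Q j) :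
    relComp H ρ i' j' (genTensor H ρ i j x) = 0 := by
  suffices h : relComp H ρ i' j' ∘ₗ genTensor H ρ i j = 0 from LinearMap.congr_fun h x
  refine TensorProduct.ext' fun y q => ?_
  simp only [relComp, genTensor, LinearMap.comp_apply, TensorProduct.map_tmul,
    LinearMap.zero_apply, resRelComp_resGen, TensorProduct.tmul_zero]

theorem homologyTensor_hom_ext {M : Type*} [AddCommGroup M] [Module R M]
    {f g : HomologyTensor H ρ →ₗ[R] M}
    (h0 : ∀ i j x, f (genTensor H ρ i j x) = g (genTensor H ρ i j x))
    (h1 : ∀ i j x, f (relTensor H ρ i j x) = g (relTensor H ρ i j x)) : f = g := by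
  refine TensorProduct.ext (DirectSum.linearMap_ext _ fun i => LinearMap.ext fun h =>
    resolution_hom_ext ρ (fun j q => ?_) (fun j q => ?_))
  · exact h0 i j (h ⊗ₜ q)
  · exact h1 i j (h ⊗ₜ q)

/-- The differential of the tensor product of `⨁ Hᵢ` with a resolution. -/
noncomputable abbrev homologyTensorD : HomologyTensor H ρ →ₗ[R] HomologyTensor H ρ :=
  tensorD (0 : (⨁ i, H i) →ₗ[R] ⨁ i, H i) (homologySign (R := R) (H := H)) (resD ρ)

theorem homologyTensorD_genTensor (i j : ℤ) (x : H i ⊗[R] Q j) :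
    homologyTensorD H ρ (genTensor H ρ i j x) = 0 := by
  suffices h : homologyTensorD H ρ ∘ₗ genTensor H ρ i j = 0 from LinearMap.congr_fun h x
  refine TensorProduct.ext' fun y q => ?_
  simp [genTensor, resD_resGen]

/-- Up to sign the complex is a direct sum of two-term complexes, whose cokernels are the tensor
products and whose kernels are the torsion products. -/
theorem homologyTensorD_relTensor (i j : ℤ) (x : H i ⊗[R] LinearMap.ker (ρ j)) :
    homologyTensorD H ρ (relTensor H ρ i j x) =
      zsign R i • genTensor H ρ i j ((LinearMap.ker (ρ j)).subtype.lTensor (H i) x) := by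
  suffices h : homologyTensorD H ρ ∘ₗ relTensor H ρ i j =
    zsign R i • (genTensor H ρ i j ∘ₗ (LinearMap.ker (ρ j)).subtype.lTensor (H i)) from
    LinearMap.congr_fun h x
  refine TensorProduct.ext' fun y q => ?_
  simp [genTensor, relTensor, resD_resRel, homologySign_lof, TensorProduct.smul_tmul']

theorem relComp_homologyTensorD (i j : ℤ) (x : HomologyTensor H ρ) :
    relComp H ρ i j (homologyTensorD H ρ x) = 0 := by
  suffices h : relComp H ρ i j ∘ₗ homologyTensorD H ρ = 0 from LinearMap.congr_fun h x
  refine homologyTensor_hom_ext H ρ (fun i' j' x => ?_) (fun i' j' x => ?_)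
  · rw [LinearMap.comp_apply, homologyTensorD_genTensor, map_zero, LinearMap.zero_apply]
  · rw [LinearMap.comp_apply, homologyTensorD_relTensor, map_smul, relComp_genTensor, smul_zero,
      LinearMap.zero_apply]

theorem genComp_homologyTensorD (i j : ℤ) (x : HomologyTensor H ρ) :
    genComp H ρ i j (homologyTensorD H ρ x) =
      zsign R i • (LinearMap.ker (ρ j)).subtype.lTensor (H i) (relComp H ρ i j x) := by
  suffices h : genComp H ρ i j ∘ₗ homologyTensorD H ρ =
    zsign R i • ((LinearMap.ker (ρ j)).subtype.lTensor (H i) ∘ₗ relComp H ρ i j) from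
    LinearMap.congr_fun h x
  refine homologyTensor_hom_ext H ρ (fun i' j' x => ?_) (fun i' j' x => ?_)
  · rw [LinearMap.comp_apply, homologyTensorD_genTensor, map_zero, LinearMap.smul_apply,
      LinearMap.comp_apply, relComp_genTensor, map_zero, smul_zero]
  · rw [LinearMap.comp_apply, homologyTensorD_relTensor, map_smul, LinearMap.smul_apply,
      LinearMap.comp_apply]
    by_cases h : (i', j') = (i, j)
    · obtain ⟨rfl, rfl⟩ := Prod.mk.inj h
      rw [genComp_genTensor, relComp_relTensor]
    · rw [genComp_genTensor_of_ne H ρ h, relComp_relTensor_of_ne H ρ h, map_zero, smul_zero,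
        smul_zero]

/-- An element of the tensor product is the sum of its components. -/
theorem exists_eq_sum_components (x : HomologyTensor H ρ) : ∃ F : Finset (ℤ × ℤ), ∀ F', F ⊆ F' →
    x = ∑ p ∈ F', (genTensor H ρ p.1 p.2 (genComp H ρ p.1 p.2 x) +
      relTensor H ρ p.1 p.2 (relComp H ρ p.1 p.2 x)) := by
  classical
  have zero : ∃ F : Finset (ℤ × ℤ), ∀ F', F ⊆ F' →
    (0 : HomologyTensor H ρ) = ∑ p ∈ F', (genTensor H ρ p.1 p.2 (genComp H ρ p.1 p.2 0) +
      relTensor H ρ p.1 p.2 (relComp H ρ p.1 p.2 0)) := ⟨∅, fun F' _ => by simp⟩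
  have add : ∀ x y : HomologyTensor H ρ, (∃ F : Finset (ℤ × ℤ), ∀ F', F ⊆ F' →
      x = ∑ p ∈ F', (genTensor H ρ p.1 p.2 (genComp H ρ p.1 p.2 x) +
        relTensor H ρ p.1 p.2 (relComp H ρ p.1 p.2 x))) → (∃ F : Finset (ℤ × ℤ), ∀ F', F ⊆ F' →
      y = ∑ p ∈ F', (genTensor H ρ p.1 p.2 (genComp H ρ p.1 p.2 y) +
        relTensor H ρ p.1 p.2 (relComp H ρ p.1 p.2 y))) → (∃ F : Finset (ℤ × ℤ), ∀ F', F ⊆ F' →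
      x + y = ∑ p ∈ F', (genTensor H ρ p.1 p.2 (genComp H ρ p.1 p.2 (x + y)) +
        relTensor H ρ p.1 p.2 (relComp H ρ p.1 p.2 (x + y)))) := by
    rintro x y ⟨F, hF⟩ ⟨F', hF'⟩
    refine ⟨F ∪ F', fun F'' h => ?_⟩
    conv_lhs => rw [hF F'' (Finset.union_subset_left h), hF' F'' (Finset.union_subset_right h)]
    rw [← Finset.sum_add_distrib]
    refine Finset.sum_congr rfl fun p _ => ?_
    simp only [map_add]
    abel
  have single : ∀ (i j : ℤ) (h : H i) (y : LinearMap.ker (ρ j) × Q j), ∃ F : Finset (ℤ × ℤ),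
      ∀ F', F ⊆ F' → (DirectSum.lof R ℤ H i h ⊗ₜ[R]
        DirectSum.lof R ℤ (fun i => LinearMap.ker (ρ i) × Q i) j y) =
        ∑ p ∈ F', (genTensor H ρ p.1 p.2 (genComp H ρ p.1 p.2 (DirectSum.lof R ℤ H i h ⊗ₜ[R]
          DirectSum.lof R ℤ (fun i => LinearMap.ker (ρ i) × Q i) j y)) +
        relTensor H ρ p.1 p.2 (relComp H ρ p.1 p.2 (DirectSum.lof R ℤ H i h ⊗ₜ[R]
          DirectSum.lof R ℤ (fun i => LinearMap.ker (ρ i) × Q i) j y))) := by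
    intro i j h y
    have e : DirectSum.lof R ℤ H i h ⊗ₜ[R]
        DirectSum.lof R ℤ (fun i => LinearMap.ker (ρ i) × Q i) j y =
        genTensor H ρ i j (h ⊗ₜ y.2) + relTensor H ρ i j (h ⊗ₜ y.1) := by
      rw [genTensor, relTensor, TensorProduct.map_tmul, TensorProduct.map_tmul,
        ← TensorProduct.tmul_add, resGen, resRel, LinearMap.comp_apply, LinearMap.comp_apply,
        ← map_add]
      congr 2
      ext <;> simp
    refine ⟨{(i, j)}, fun F' hF' => ?_⟩
    rw [e, Finset.sum_eq_single (i, j)]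
    · simp only [map_add, genComp_genTensor, genComp_relTensor, relComp_genTensor,
        relComp_relTensor, add_zero, zero_add]
    · rintro ⟨i', j'⟩ _ hne
      simp only [map_add, genComp_genTensor_of_ne H ρ (Ne.symm hne), genComp_relTensor,
        relComp_genTensor, relComp_relTensor_of_ne H ρ (Ne.symm hne), add_zero, map_zero]
    · exact fun hn => absurd (hF' (Finset.mem_singleton_self _)) hn
  induction x using TensorProduct.induction_on with
  | zero => exact zero
  | add x y hx hy => exact add x y hx hy
  | tmul a b =>
    induction a using DirectSum.induction_on with
    | zero => rw [TensorProduct.zero_tmul]; exact zero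
    | add x y hx hy => rw [TensorProduct.add_tmul]; exact add _ _ hx hy
    | of i h =>
      induction b using DirectSum.induction_on with
      | zero => rw [TensorProduct.tmul_zero]; exact zero
      | add x y hx hy => rw [TensorProduct.tmul_add]; exact add _ _ hx hy
      | of j y => exact single i j h y

end Tensor

/-! ### The algebraic Künneth sequence. -/

section Kunneth

variable {R : Type u} [CommRing R]
  {C D E : Type u} [AddCommGroup C] [Module R C] [AddCommGroup D] [Module R D] [AddCommGroup E]
  [Module R E] {dC σC : C →ₗ[R] C} {dD σD : D →ₗ[R] D} {dE σE : E →ₗ[R] E}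
  {pC : ℤ → C →ₗ[R] C} {pD : ℤ → D →ₗ[R] D} {pE : ℤ → E →ₗ[R] E}
  {H K L : ℤ → Type u} [∀ i, AddCommGroup (H i)] [∀ i, Module R (H i)]
  [∀ i, AddCommGroup (K i)] [∀ i, Module R (K i)] [∀ i, AddCommGroup (L i)] [∀ i, Module R (L i)]
  {θC : ∀ i, H i →ₗ[R] C ⧸ LinearMap.range dC} {θD : ∀ i, K i →ₗ[R] D ⧸ LinearMap.range dD}
  {θE : ∀ i, L i →ₗ[R] E ⧸ LinearMap.range dE}
  {Q : ℤ → Type u} [∀ i, AddCommGroup (Q i)] [∀ i, Module R (Q i)]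
  {P : ℤ → Type u} [∀ i, AddCommGroup (P i)] [∀ i, Module R (P i)] (π : ∀ i, P i →ₗ[R] H i)
  (ρ : ∀ i, Q i →ₗ[R] K i)

/-- The class of `κ(z ⊗ w)` depends only on the classes of the cycles `z` and `w`. -/
theorem mkQ_tensor_eq {κ : C ⊗[R] D →ₗ[R] E} (hκ : ∀ x, κ (tensorD dC σC dD x) = dE (κ x))
    (hC : IsSigned dC σC) {z z' : C} {w w' : D} (hz : dC z = 0) (hw' : dD w' = 0)
    (hzz : (LinearMap.range dC).mkQ z = (LinearMap.range dC).mkQ z')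
    (hww : (LinearMap.range dD).mkQ w = (LinearMap.range dD).mkQ w') :
    (LinearMap.range dE).mkQ (κ (z ⊗ₜ w)) = (LinearMap.range dE).mkQ (κ (z' ⊗ₜ w')) := by
  obtain ⟨a, ha⟩ := (Submodule.Quotient.eq _).1 hzz
  obtain ⟨b, hb⟩ := (Submodule.Quotient.eq _).1 hww
  -- Write z ⊗ w - z' ⊗ w' as (z - z') ⊗ w' + z ⊗ (w - w'). The sign on z cancels the one in the
  -- tensor differential.
  refine (Submodule.Quotient.eq _).2 ⟨κ (a ⊗ₜ w' + σC z ⊗ₜ b), ?_⟩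
  have hσ : dC (σC z) = 0 := by rw [← neg_eq_zero, ← hC.sd, hz, map_zero]
  rw [← hκ, ← map_sub]
  congr 1
  simp only [map_add, LinearMap.add_apply, TensorProduct.map_tmul, LinearMap.id_apply, hw',
    TensorProduct.tmul_zero, hσ, TensorProduct.zero_tmul, hC.ss, ha, hb, TensorProduct.sub_tmul,
    TensorProduct.tmul_sub]
  abel

theorem genTensor_mem_ker (i j : ℤ) (y : H i ⊗[R] Q j) :
    genTensor H ρ i j y ∈ LinearMap.ker (homologyTensorD H ρ) :=
  homologyTensorD_genTensor H ρ i j y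

theorem relTensor_mem_ker (i j : ℤ) (t : H i ⊗[R] LinearMap.ker (ρ j))
    (ht : (LinearMap.ker (ρ j)).subtype.lTensor (H i) t = 0) :
    relTensor H ρ i j t ∈ LinearMap.ker (homologyTensorD H ρ) := by
  rw [LinearMap.mem_ker, homologyTensorD_relTensor, ht, map_zero, smul_zero]

/-- The homology of `⨁ Hᵢ ⊗ (⨁ ker ρⱼ → ⨁ Qⱼ)` is that of `E`. -/
theorem exists_homologyTensor_map [IsDomain R] [IsPrincipalIdealRing R]
    [∀ i, Module.Projective R (P i)] [∀ i, Module.Projective R (Q i)] (hC : IsGradedDM dC σC pC) (hθC : IsHomologyOf dC pC θC)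
    (hD : IsGradedDM dD σD pD) (hθD : IsHomologyOf dD pD θD)
    (hθE : IsHomologyOf dE pE θE) {κ : C ⊗[R] D →ₗ[R] E}
    (hκ : DQuasiIso (tensorD dC σC dD) dE κ)
    (hκp : ∀ i j x y, pE (i + j) (κ (pC i x ⊗ₜ pD j y)) = κ (pC i x ⊗ₜ pD j y))
    (cross : ∀ i j q, i + j = q → H i →ₗ[R] K j →ₗ[R] L q)
    (hcross : ∀ i j q (hq : i + j = q) x y, ∃ z w,
      pC i z = z ∧ dC z = 0 ∧ θC i x = Submodule.mkQ _ z ∧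
      pD j w = w ∧ dD w = 0 ∧ θD j y = Submodule.mkQ _ w ∧
      θE q (cross i j q hq x y) = Submodule.mkQ _ (κ (z ⊗ₜ w)))
    (hloc : ∀ (I : Ideal R) [I.IsMaximal], Module.Flat R (Localization.AtPrime I ⊗[R] C) ∨
      Module.Flat R (Localization.AtPrime I ⊗[R] D))
    (hπ : ∀ i, Function.Surjective (π i)) (hρ : ∀ i, Function.Surjective (ρ i)) :
    ∃ Ψ : LinearMap.ker (homologyTensorD H ρ) →ₗ[R] E ⧸ LinearMap.range dE,
      (∀ i j y, Ψ ⟨genTensor H ρ i j y, genTensor_mem_ker ρ i j y⟩ =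
        θE (i + j) (TensorProduct.lift (cross i j (i + j) rfl) ((ρ j).lTensor (H i) y))) ∧
      (∀ i j t ht, ∃ l, Ψ ⟨relTensor H ρ i j t, relTensor_mem_ker ρ i j t ht⟩ =
        θE (i + j - 1) l) ∧
      (∀ y, Ψ y = 0 → ∃ z, y.1 = homologyTensorD H ρ z) ∧
      (∀ e, dE e = 0 → ∃ y, Ψ y = Submodule.mkQ _ e) := by
  have flatρ : Module.Flat R (Resolution ρ) := flat_resolution ρ
  have flatπ : Module.Flat R (Resolution π) := flat_resolution π
  obtain ⟨α, hα, hασ, hα0, hαd, hαθ, hα1⟩ := hC.exists_resolution_quasiIso π hθC hπ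
  obtain ⟨β, hβ, -, hβ0, hβd, hβθ, hβ1⟩ := hD.exists_resolution_quasiIso ρ hθD hρ
  -- The tensor product of the two resolutions maps to E through C ⊗ D, and to the homology on the
  -- left tensored with the resolution on the right; both maps are quasi-isomorphisms.
  have q1 := hκ.comp (hα.map hβ hC.signed hD.signed (isSigned_resD π) (isSigned_resD ρ) hασ hloc)
  have q2 := (quasiIso_resAug π hπ).rTensor (K := Resolution ρ) (isSigned_resD π)
    isSigned_homologySign (resAug_resSign π) (isSigned_resD ρ).dd
  obtain ⟨Ψ, h1, h2, h3⟩ := q2.exists_homology_map q1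
  refine ⟨Ψ, fun i j y => ?_, fun i j t ht => ?_, h2, h3⟩
  · suffices h : Ψ ∘ₗ LinearMap.codRestrict _ (genTensor H ρ i j) (genTensor_mem_ker ρ i j) =
        θE (i + j) ∘ₗ TensorProduct.lift (cross i j (i + j) rfl) ∘ₗ (ρ j).lTensor (H i) from
      LinearMap.congr_fun h y
    refine TensorProduct.ext' fun h x => ?_
    obtain ⟨v, rfl⟩ := hπ i h
    have e := h1 (resGen π i v ⊗ₜ resGen ρ j x)
      ⟨genTensor H ρ i j (π i v ⊗ₜ x), genTensor_mem_ker ρ i j _⟩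
      (by simp [resD_resGen]) (by simp [genTensor, resAug_resGen])
    refine e.trans ?_
    simp only [LinearMap.comp_apply, TensorProduct.map_tmul, LinearMap.lTensor_tmul,
      TensorProduct.lift.tmul]
    obtain ⟨z, w, -, -, hz3, -, hw2, hw3, hzw⟩ :=
      hcross i j (i + j) rfl (π i v) (ρ j x)
    rw [hzw]
    exact mkQ_tensor_eq hκ.comm hC.signed (hαd i v) hw2 ((hαθ i v).symm.trans hz3)
      ((hβθ j x).symm.trans hw3)
  -- Lift t to x in P i ⊗ ker ρⱼ. Its image in P i ⊗ Q j vanishes in H i ⊗ Q j, hence comes from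
  -- some x' in ker πᵢ ⊗ Q j. With the correct sign, x and x' form a cycle over t whose image in E
  -- is homogeneous of degree i + j - 1.
  · obtain ⟨x, hx⟩ := LinearMap.rTensor_surjective (LinearMap.ker (ρ j)) (hπ i) t
    have hx0 : (π i).rTensor (Q j) ((LinearMap.ker (ρ j)).subtype.lTensor _ x) = 0 := by
      rw [← LinearMap.comp_apply, LinearMap.rTensor_comp_lTensor, ← LinearMap.lTensor_comp_rTensor,
        LinearMap.comp_apply, hx, ht]
    obtain ⟨x', hx'⟩ := (rTensor_exact (Q j) (LinearMap.exact_subtype_ker_map (π i)) (hπ i) _).1 hx0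
    let A : LinearMap.ker (π i) ⊗[R] Q j →ₗ[R] Resolution π ⊗[R] Resolution ρ :=
      TensorProduct.map (resRel π i) (resGen ρ j)
    let B : P i ⊗[R] LinearMap.ker (ρ j) →ₗ[R] Resolution π ⊗[R] Resolution ρ :=
      TensorProduct.map (resGen π i) (resRel ρ j)
    let G : P i ⊗[R] Q j →ₗ[R] Resolution π ⊗[R] Resolution ρ :=
      TensorProduct.map (resGen π i) (resGen ρ j)
    have hA : ∀ x, tensorD (resD π) (resSign π) (resD ρ) (A x) =
        G ((LinearMap.ker (π i)).subtype.rTensor _ x) := fun x => by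
      suffices h : tensorD (resD π) (resSign π) (resD ρ) ∘ₗ A =
        G ∘ₗ (LinearMap.ker (π i)).subtype.rTensor _ from LinearMap.congr_fun h x
      exact TensorProduct.ext' fun a b => by simp [A, G, resD_resRel, resD_resGen]
    have hB : ∀ x, tensorD (resD π) (resSign π) (resD ρ) (B x) =
        zsign R i • G ((LinearMap.ker (ρ j)).subtype.lTensor _ x) := fun x => by
      suffices h : tensorD (resD π) (resSign π) (resD ρ) ∘ₗ B =
        zsign R i • (G ∘ₗ (LinearMap.ker (ρ j)).subtype.lTensor _) from LinearMap.congr_fun h x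
      exact TensorProduct.ext' fun a b => by
        simp [B, G, resD_resRel, resD_resGen, resSign_resGen, TensorProduct.smul_tmul']
    have hAaug : ∀ x, (resAug π).rTensor (Resolution ρ) (A x) = 0 := fun x => by
      suffices h : (resAug π).rTensor (Resolution ρ) ∘ₗ A = 0 from LinearMap.congr_fun h x
      exact TensorProduct.ext' fun a b => by simp [A, resAug_resRel]
    have hBaug : ∀ x, (resAug π).rTensor (Resolution ρ) (B x) =
        relTensor H ρ i j ((π i).rTensor _ x) := fun x => by
      suffices h : (resAug π).rTensor (Resolution ρ) ∘ₗ B =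
        relTensor H ρ i j ∘ₗ (π i).rTensor _ from LinearMap.congr_fun h x
      exact TensorProduct.ext' fun a b => by simp [B, relTensor, resAug_resGen]
    have hAp : ∀ x, pE (i + j - 1) (κ (TensorProduct.map α β (A x))) =
        κ (TensorProduct.map α β (A x)) := fun x => by
      suffices h : pE (i + j - 1) ∘ₗ κ ∘ₗ TensorProduct.map α β ∘ₗ A =
        κ ∘ₗ TensorProduct.map α β ∘ₗ A from LinearMap.congr_fun h x
      refine TensorProduct.ext' fun a b => ?_
      have := hκp (i - 1) j (α (resRel π i a)) (β (resGen ρ j b))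
      rw [hα1, hβ0, show i - 1 + j = i + j - 1 by ring] at this
      exact this
    have hBp : ∀ x, pE (i + j - 1) (κ (TensorProduct.map α β (B x))) =
        κ (TensorProduct.map α β (B x)) := fun x => by
      suffices h : pE (i + j - 1) ∘ₗ κ ∘ₗ TensorProduct.map α β ∘ₗ B =
        κ ∘ₗ TensorProduct.map α β ∘ₗ B from LinearMap.congr_fun h x
      refine TensorProduct.ext' fun a b => ?_
      have := hκp i (j - 1) (α (resGen π i a)) (β (resRel ρ j b))
      rw [hα0, hβ1, show i + (j - 1) = i + j - 1 by ring] at this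
      exact this
    have hcyc : tensorD (resD π) (resSign π) (resD ρ) (B x - zsign R i • A x') = 0 := by
      rw [map_sub, map_smul, hA, hB, hx', sub_self]
    have e := h1 (B x - zsign R i • A x') ⟨relTensor H ρ i j t, relTensor_mem_ker ρ i j t ht⟩ hcyc
      (by rw [map_sub, map_smul, hAaug, hBaug, smul_zero, sub_zero, hx])
    rw [e]
    obtain ⟨l, hl⟩ := hθE.exists_class (i + j - 1)
      ((κ ∘ₗ TensorProduct.map α β) (B x - zsign R i • A x'))
      (by simp only [LinearMap.comp_apply, map_sub, map_smul, hAp, hBp])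
      (by rw [← q1.comm, hcyc, map_zero])
    exact ⟨l, hl.symm⟩

section Splitting

variable {A B M : Type*} [AddCommGroup A] [Module R A] [AddCommGroup B] [Module R B]
  [AddCommGroup M] [Module R M]

/-- A direct sum decomposition gives a split exact sequence. -/
theorem exists_split_exact_of_bijective (f : A →ₗ[R] M) (s : B →ₗ[R] M)
    (h : Function.Bijective (LinearMap.coprod f s)) :
    Function.Injective f ∧ ∃ β : M →ₗ[R] B, Function.Exact f β ∧ Function.Surjective β ∧
      ∃ s : B →ₗ[R] M, β ∘ₗ s = LinearMap.id := by
  let e := LinearEquiv.ofBijective _ h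
  have hf : ∀ a, e.symm (f a) = (a, 0) := fun a => by
    rw [LinearEquiv.symm_apply_eq]
    simp [e]
  have hs : ∀ b, e.symm (s b) = (0, b) := fun b => by
    rw [LinearEquiv.symm_apply_eq]
    simp [e]
  refine ⟨fun a b hab => ?_, LinearMap.snd R A B ∘ₗ e.symm.toLinearMap, fun m => ⟨fun hm => ?_, ?_⟩,
    fun b => ⟨s b, ?_⟩, s, LinearMap.ext fun b => ?_⟩
  · have := congrArg e.symm hab
    rw [hf, hf] at this
    exact (Prod.mk.inj this).1
  · refine ⟨(e.symm m).1, e.symm.injective ?_⟩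
    rw [hf]
    exact Prod.ext rfl hm.symm
  · rintro ⟨a, rfl⟩
    simp [hf]
  · simp [hs]
  · simp [hs]

end Splitting

/-- The homology of `E` is the direct sum of the tensor products and the torsion products. -/
theorem exists_bijective_coprod (hE : IsGradedDM dE σE pE) (hθE : IsHomologyOf dE pE θE)
    (cross : ∀ i j q, i + j = q → H i →ₗ[R] K j →ₗ[R] L q)
    (Ψ : LinearMap.ker (homologyTensorD H ρ) →ₗ[R] E ⧸ LinearMap.range dE)
    (hgen : ∀ i j y, Ψ ⟨genTensor H ρ i j y, genTensor_mem_ker ρ i j y⟩ =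
        θE (i + j) (TensorProduct.lift (cross i j (i + j) rfl) ((ρ j).lTensor (H i) y)))
    (hrel : ∀ i j t ht, ∃ l, Ψ ⟨relTensor H ρ i j t, relTensor_mem_ker ρ i j t ht⟩ =
        θE (i + j - 1) l)
    (hinj : ∀ y, Ψ y = 0 → ∃ z, y.1 = homologyTensorD H ρ z)
    (hsurj : ∀ e, dE e = 0 → ∃ y, Ψ y = Submodule.mkQ _ e)
    (hρ : ∀ i, Function.Surjective (ρ i))
    {T : ℤ → ℤ → Type u} [∀ i j, AddCommGroup (T i j)] [∀ i j, Module R (T i j)]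
    (τ : ∀ i j, T i j →ₗ[R] H i ⊗[R] LinearMap.ker (ρ j))
    (hτ : ∀ i j, Function.Injective (τ i j))
    (hτ' : ∀ i j, Function.Exact (τ i j) ((LinearMap.ker (ρ j)).subtype.lTensor (H i))) (q : ℤ) :
    ∃ s : (⨁ p : {p : ℤ × ℤ // p.1 + p.2 = q + 1}, T p.1.1 p.1.2) →ₗ[R] L q,
      Function.Bijective (LinearMap.coprod
        (DirectSum.toModule R {p : ℤ × ℤ // p.1 + p.2 = q} (L q) fun p =>
          TensorProduct.lift (cross p.1.1 p.1.2 q p.2)) s) := by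
  have hτ0 : ∀ i j t, (LinearMap.ker (ρ j)).subtype.lTensor (H i) (τ i j t) = 0 := fun i j t =>
    (hτ' i j _).2 ⟨t, rfl⟩
  -- the maps from the torsion products
  let tor : ∀ i j, T i j →ₗ[R] LinearMap.ker (homologyTensorD H ρ) := fun i j =>
    LinearMap.codRestrict _ (relTensor H ρ i j ∘ₗ τ i j)
      fun t => relTensor_mem_ker ρ i j _ (hτ0 i j t)
  let gen : ∀ i j, H i ⊗[R] Q j →ₗ[R] LinearMap.ker (homologyTensorD H ρ) := fun i j =>
    LinearMap.codRestrict _ (genTensor H ρ i j) (genTensor_mem_ker ρ i j)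
  let e := LinearEquiv.ofInjective (θE q) (hθE.inj q)
  have hmem : ∀ (p : {p : ℤ × ℤ // p.1 + p.2 = q + 1}) (t : T p.1.1 p.1.2),
      (Ψ ∘ₗ tor p.1.1 p.1.2) t ∈ LinearMap.range (θE q) := by
    rintro ⟨⟨i, j⟩, hp⟩ t
    obtain ⟨l, hl⟩ := hrel i j (τ i j t) (hτ0 i j t)
    have hij : i + j - 1 = q := by simp only at hp; omega
    subst hij
    exact ⟨l, hl.symm⟩
  let s : (⨁ p : {p : ℤ × ℤ // p.1 + p.2 = q + 1}, T p.1.1 p.1.2) →ₗ[R] L q :=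
    DirectSum.toModule R _ _ fun p =>
      e.symm.toLinearMap ∘ₗ LinearMap.codRestrict _ (Ψ ∘ₗ tor p.1.1 p.1.2) (hmem p)
  let f : (⨁ p : {p : ℤ × ℤ // p.1 + p.2 = q}, H p.1.1 ⊗[R] K p.1.2) →ₗ[R] L q :=
    DirectSum.toModule R {p : ℤ × ℤ // p.1 + p.2 = q} (L q) fun p =>
      TensorProduct.lift (cross p.1.1 p.1.2 q p.2)
  let torq : (⨁ p : {p : ℤ × ℤ // p.1 + p.2 = q + 1}, T p.1.1 p.1.2) →ₗ[R]
      LinearMap.ker (homologyTensorD H ρ) := DirectSum.toModule R _ _ fun p => tor p.1.1 p.1.2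
  let genq : (⨁ p : {p : ℤ × ℤ // p.1 + p.2 = q}, H p.1.1 ⊗[R] Q p.1.2) →ₗ[R]
      LinearMap.ker (homologyTensorD H ρ) := DirectSum.toModule R _ _ fun p => gen p.1.1 p.1.2
  let ρq : (⨁ p : {p : ℤ × ℤ // p.1 + p.2 = q}, H p.1.1 ⊗[R] Q p.1.2) →ₗ[R]
      ⨁ p : {p : ℤ × ℤ // p.1 + p.2 = q}, H p.1.1 ⊗[R] K p.1.2 :=
    DirectSum.lmap fun p => (ρ p.1.2).lTensor (H p.1.1)
  have hρq : Function.Surjective ρq := (DirectSum.lmap_surjective _).2 fun p =>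
    LinearMap.lTensor_surjective _ (hρ p.1.2)
  have hs1 : ∀ p t, θE q (s (DirectSum.lof R _ _ p t)) = Ψ (tor p.1.1 p.1.2 t) := fun p t => by
    simp only [s, DirectSum.toModule_lof, LinearMap.comp_apply, LinearEquiv.coe_coe]
    exact congrArg Subtype.val (e.apply_symm_apply _)
  have hs : ∀ t, θE q (s t) = Ψ (torq t) := fun t => by
    suffices h : θE q ∘ₗ s = Ψ ∘ₗ torq from LinearMap.congr_fun h t
    refine DirectSum.linearMap_ext _ fun p => LinearMap.ext fun t => ?_
    refine (hs1 p t).trans ?_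
    simp only [torq, LinearMap.comp_apply, DirectSum.toModule_lof]
  have hf1 : ∀ p y, θE q (f (DirectSum.lof R _ _ p ((ρ p.1.2).lTensor (H p.1.1) y))) =
      Ψ (gen p.1.1 p.1.2 y) := by
    rintro ⟨⟨i, j⟩, rfl⟩ y
    simp only [f, DirectSum.toModule_lof]
    exact (hgen i j y).symm
  have hf : ∀ y, θE q (f (ρq y)) = Ψ (genq y) := fun y => by
    suffices h : θE q ∘ₗ f ∘ₗ ρq = Ψ ∘ₗ genq from LinearMap.congr_fun h y
    refine DirectSum.linearMap_ext _ fun p => LinearMap.ext fun y => ?_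
    simp only [LinearMap.comp_apply, ρq, DirectSum.lmap_lof, hf1, genq, DirectSum.toModule_lof]
  refine ⟨s, ?_, ?_⟩
  -- An element of the kernel yields a boundary in the tensor complex. Boundaries have no components
  -- in the relations, which gives t = 0, and their components in the generators come from the
  -- kernels of ρ, which gives c = 0.
  · rw [injective_iff_map_eq_zero]
    rintro ⟨c, t⟩ hct
    obtain ⟨y, rfl⟩ := hρq c
    have h0 : Ψ (genq y + torq t) = 0 := by
      rw [map_add, ← hf, ← hs, ← map_add]
      exact (congrArg (θE q) hct).trans (map_zero _)
    obtain ⟨W, hW⟩ := hinj _ h0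
    have hgt : ∀ i j, genComp H ρ i j (torq t).1 = 0 := fun i j => by
      suffices h : genComp H ρ i j ∘ₗ Submodule.subtype _ ∘ₗ torq = 0 from LinearMap.congr_fun h t
      refine DirectSum.linearMap_ext _ fun p => LinearMap.ext fun t => ?_
      simp only [LinearMap.comp_apply, torq, DirectSum.toModule_lof]
      exact genComp_relTensor H ρ _ _ _ _ _
    have hrg : ∀ i j, relComp H ρ i j (genq y).1 = 0 := fun i j => by
      suffices h : relComp H ρ i j ∘ₗ Submodule.subtype _ ∘ₗ genq = 0 from LinearMap.congr_fun h y
      refine DirectSum.linearMap_ext _ fun p => LinearMap.ext fun t => ?_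
      simp only [LinearMap.comp_apply, genq, DirectSum.toModule_lof]
      exact relComp_genTensor H ρ _ _ _ _ _
    have hgg : ∀ p : {p : ℤ × ℤ // p.1 + p.2 = q}, genComp H ρ p.1.1 p.1.2 (genq y).1 = y p :=
        fun p => by
      suffices h : genComp H ρ p.1.1 p.1.2 ∘ₗ Submodule.subtype _ ∘ₗ genq =
        DirectSum.component R _ _ p from LinearMap.congr_fun h y
      refine DirectSum.linearMap_ext _ fun p' => LinearMap.ext fun t => ?_
      simp only [LinearMap.comp_apply, genq, DirectSum.toModule_lof]
      by_cases hp : p' = p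
      · subst hp
        rw [DirectSum.component.lof_self]
        exact genComp_genTensor H ρ _ _ _
      · rw [DirectSum.component.of, dif_neg hp]
        exact genComp_genTensor_of_ne H ρ (fun h => hp (Subtype.ext h)) _
    have hrr : ∀ p : {p : ℤ × ℤ // p.1 + p.2 = q + 1},
        relComp H ρ p.1.1 p.1.2 (torq t).1 = τ p.1.1 p.1.2 (t p) := fun p => by
      suffices h : relComp H ρ p.1.1 p.1.2 ∘ₗ Submodule.subtype _ ∘ₗ torq =
        τ p.1.1 p.1.2 ∘ₗ DirectSum.component R _ _ p from LinearMap.congr_fun h t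
      refine DirectSum.linearMap_ext _ fun p' => LinearMap.ext fun t => ?_
      simp only [LinearMap.comp_apply, torq, DirectSum.toModule_lof]
      by_cases hp : p' = p
      · subst hp
        rw [DirectSum.component.lof_self]
        exact relComp_relTensor H ρ _ _ _
      · rw [DirectSum.component.of, dif_neg hp, map_zero]
        exact relComp_relTensor_of_ne H ρ (fun h => hp (Subtype.ext h)) _
    have ht0 : t = 0 := DFinsupp.ext fun p => hτ _ _ (by
      rw [← hrr]
      have := congrArg (relComp H ρ p.1.1 p.1.2) hW
      rw [relComp_homologyTensorD, Submodule.coe_add, map_add, hrg, zero_add] at this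
      rw [this, DirectSum.zero_apply, map_zero])
    have hc0 : ρq y = 0 := DFinsupp.ext fun p => by
      have := congrArg (genComp H ρ p.1.1 p.1.2) hW
      rw [genComp_homologyTensorD, Submodule.coe_add, map_add, hgt, add_zero, hgg] at this
      have hρy : ρq y p = (ρ p.1.2).lTensor (H p.1.1) (y p) := DirectSum.lmap_apply _ _ _
      rw [hρy, DirectSum.zero_apply, this, map_smul, ← LinearMap.comp_apply, ← LinearMap.lTensor_comp]
      have : ρ p.1.2 ∘ₗ (LinearMap.ker (ρ p.1.2)).subtype = 0 := LinearMap.ext fun x => x.2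
      rw [this, LinearMap.lTensor_zero, LinearMap.zero_apply, smul_zero]
    rw [ht0, hc0]
    rfl
  · intro l
    obtain ⟨z, hz1, hz2, hz3⟩ := hθE.exists_rep q l
    obtain ⟨v, hv⟩ := hsurj z hz2
    -- Only the part of degree q of the cycle v over z matters; the projection discards the summands
    -- of other degrees.
    let pq : (E ⧸ LinearMap.range dE) →ₗ[R] E ⧸ LinearMap.range dE :=
      Submodule.mapQ _ _ (pE q) (by
        rintro _ ⟨x, rfl⟩
        refine ⟨pE (q - 1) x, ?_⟩
        rw [hE.d_proj, sub_add_cancel])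
    have hpq : ∀ i l, pq (θE i l) = if q = i then θE i l else 0 := fun i l => by
      obtain ⟨z, hz1, hz2, hz3⟩ := hθE.exists_rep i l
      rw [hz3]
      change Submodule.mkQ _ (pE q z) = _
      rw [hE.proj_of_eq hz1]
      split_ifs
      · rfl
      · exact map_zero _
    let S : Submodule R (E ⧸ LinearMap.range dE) :=
      ((LinearMap.range (LinearMap.coprod f s)).map (θE q)).comap pq
    obtain ⟨F, hF⟩ := exists_eq_sum_components H ρ v.1
    -- For a cycle, the differential kills each component in the relations separately, so these
    -- components belong to the torsion products.
    have hrv : ∀ i j, ∃ t, relComp H ρ i j v.1 = τ i j t := fun i j => by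
      have h1 := congrArg (genComp H ρ i j) (LinearMap.mem_ker.1 v.2)
      rw [genComp_homologyTensorD, map_zero] at h1
      have h2 := congrArg (zsign R i • ·) h1
      simp only [smul_smul, zsign_mul_self, one_smul, smul_zero] at h2
      obtain ⟨t, ht⟩ := (hτ' i j _).1 h2
      exact ⟨t, ht.symm⟩
    choose t ht using hrv
    have hvsum : v = ∑ p ∈ F, (gen p.1 p.2 (genComp H ρ p.1 p.2 v.1) + tor p.1 p.2 (t p.1 p.2)) := by
      refine Subtype.ext ?_
      rw [Submodule.coe_sum]
      conv_lhs => rw [hF F subset_rfl]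
      refine Finset.sum_congr rfl fun p _ => ?_
      rw [ht]
      rfl
    have hgenS : ∀ i j y, Ψ (gen i j y) ∈ S := fun i j y => by
      by_cases hij : i + j = q
      · refine ⟨f (DirectSum.lof R _ _ ⟨(i, j), hij⟩ ((ρ j).lTensor (H i) y)),
          ⟨(DirectSum.lof R _ _ ⟨(i, j), hij⟩ ((ρ j).lTensor (H i) y), 0), by simp⟩, ?_⟩
        have e1 := hf1 ⟨(i, j), hij⟩ y
        rw [← e1, hpq, if_pos rfl]
      · have e1 : Ψ (gen i j y) = θE (i + j) _ := hgen i j y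
        rw [e1, Submodule.mem_comap, hpq, if_neg (Ne.symm hij)]
        exact Submodule.zero_mem _
    have htorS : ∀ i j y, Ψ (tor i j y) ∈ S := fun i j y => by
      by_cases hij : i + j = q + 1
      · refine ⟨s (DirectSum.lof R _ _ ⟨(i, j), hij⟩ y),
          ⟨(0, DirectSum.lof R _ _ ⟨(i, j), hij⟩ y), by simp⟩, ?_⟩
        have e1 := hs1 ⟨(i, j), hij⟩ y
        rw [← e1, hpq, if_pos rfl]
      · obtain ⟨l, hl⟩ := hrel i j (τ i j y) (hτ0 i j y)
        have e1 : Ψ (tor i j y) = θE (i + j - 1) l := hl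
        rw [e1, Submodule.mem_comap, hpq, if_neg (by omega)]
        exact Submodule.zero_mem _
    have hvS : Ψ v ∈ S := by
      rw [hvsum, map_sum]
      refine Submodule.sum_mem _ fun p _ => ?_
      rw [map_add]
      exact Submodule.add_mem _ (hgenS _ _ _) (htorS _ _ _)
    rw [hv, ← hz3] at hvS
    obtain ⟨m, ⟨x, rfl⟩, hx⟩ := hvS
    rw [hpq, if_pos rfl] at hx
    exact ⟨x, hθE.inj q hx⟩

end Kunneth

namespace VR

/-! ### The Künneth sequence for semi-uniform spaces. -/

section KunnethLimit

variable (R : Type u) [CommRing R] [IsDomain R] [IsPrincipalIdealRing R] {X Y : Type u}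
  (G : Type u) [AddCommGroup G] [Module R G] (G' : Type u) [AddCommGroup G'] [Module R G']
  {𝒰 : SemiUniformity X} {𝒱 : SemiUniformity Y} {𝒲 : SemiUniformity (X × Y)}
  (hW : ∀ U ∈ 𝒰.filter, ∀ V ∈ 𝒱.filter, prodRel U V ∈ 𝒲.filter)

/-- By `exists_tor_exact` vanishing of Tor is injectivity of G ⊗ ker π → G ⊗ Q for a presentation π
of G'. -/
theorem smul_eq_zero_or_of_isZero_tor
    (h : CategoryTheory.Limits.IsZero (Tor₁ R (ModuleCat.of R G) (ModuleCat.of R G')))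
    (p : R) (hp : Prime p) : (∀ x : G, p • x = 0 → x = 0) ∨ (∀ y : G', p • y = 0 → y = 0) := by
  obtain ⟨Q, _, _, _, π, hπ, hτ⟩ := exists_tor_exact (ModuleCat.of R G')
  obtain ⟨τ, -, hex⟩ := hτ (ModuleCat.of R G)
  refine smul_eq_zero_or_of_injective (M := G) (N' := G') π hπ ?_ p hp
  rw [injective_iff_map_eq_zero]
  intro x hx
  obtain ⟨y, hy⟩ := (hex x).1 hx
  have := ModuleCat.subsingleton_of_isZero h
  rw [← hy, Subsingleton.elim y 0, map_zero]

/-- If G' has torsion at a prime generating I, then G has none there. The cochains with values in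
the module without such torsion become flat at I. -/
theorem flat_localized_limTot_or
    (h : CategoryTheory.Limits.IsZero (Tor₁ R (ModuleCat.of R G) (ModuleCat.of R G')))
    (I : Ideal R) [I.IsMaximal] :
    Module.Flat R (Localization.AtPrime I ⊗[R] LimTot R G 𝒰) ∨
      Module.Flat R (Localization.AtPrime I ⊗[R] LimTot R G' 𝒱) := by
  by_cases hI : ∃ p : R, Prime p ∧ Ideal.span {p} = I ∧ ∃ y : G', p • y = 0 ∧ y ≠ 0
  · obtain ⟨p, hp, hpI, y, hy, hy0⟩ := hI
    refine Or.inl (flat_localized_of_prime_smul I fun p' hp' hpI' m hm =>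
      limTot_smul_eq_zero R G ?_ m hm)
    -- Generators of I differ by units and have the same torsion.
    have hass : Associated p' p := Ideal.span_singleton_eq_span_singleton.1 (hpI'.trans hpI.symm)
    obtain ⟨c, hc⟩ := hass
    refine (smul_eq_zero_or_of_isZero_tor R G G' h p' hp').resolve_right fun h' => hy0 (h' y ?_)
    have : c • (p' • y) = 0 := by
      rw [Units.smul_def, smul_smul, mul_comm, hc, hy]
    exact (smul_eq_zero_iff_eq c).1 this
  · push Not at hI
    exact Or.inr (flat_localized_of_prime_smul I fun p hp hpI m hm =>
      limTot_smul_eq_zero R G' (fun y hy => hI p hp hpI y hy) m hm)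

/-- The split Künneth sequence of a product of semi-uniform spaces. -/
theorem exists_bijective_coprod_crossMap
    (hgood : ∀ (U : Entourage 𝒰) (V : Entourage 𝒱) (W : Entourage 𝒲),
      ∃ (U' : Entourage 𝒰) (V' : Entourage 𝒱), U ≤ U' ∧ V ≤ V' ∧ W ≤ prodEntourage hW U' V' ∧
        IsCrossQuasiIso R G G' U'.rel V'.rel)
    (h : CategoryTheory.Limits.IsZero (Tor₁ R (ModuleCat.of R G) (ModuleCat.of R G'))) (q : ℤ) :
    ∃ s : TorTerm R G G' 𝒰 𝒱 q →ₗ[R] cohomology R (G ⊗[R] G') 𝒲 q,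
      Function.Bijective (LinearMap.coprod (crossMap R G G' 𝒰 𝒱 𝒲 hW q) s) := by
  -- On the right the presentations must be those that compute Tor; on the left any projective
  -- presentation serves, and the free module on all elements is used.
  choose Q i1 i2 i3 ρ hρ hτ using fun j => exists_tor_exact (cohomology R G' 𝒱 j)
  choose τ hτ hτ' using fun i j => hτ j (cohomology R G 𝒰 i)
  obtain ⟨Ψ, h1, h2, h3, h4⟩ := exists_homologyTensor_map
    (H := fun i => cohomology R G 𝒰 i) (K := fun i => cohomology R G' 𝒱 i)
    (L := fun i => cohomology R (G ⊗[R] G') 𝒲 i) (P := fun i => cohomology R G 𝒰 i →₀ R)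
    (fun i => Finsupp.linearCombination R id) ρ (isGradedDM_limD R G 𝒰)
    (isHomologyOf_limClass R G 𝒰) (isGradedDM_limD R G' 𝒱) (isHomologyOf_limClass R G' 𝒱)
    (isHomologyOf_limClass R (G ⊗[R] G') 𝒲) (quasiIso_limCross hW hgood)
    (limCross_proj R G G' hW) (cohomologyCross R G G' 𝒰 𝒱 𝒲 hW) (limClass_cross R G G' hW)
    (fun I _ => flat_localized_limTot_or R G G' h I)
    (fun i => Finsupp.linearCombination_id_surjective R _) hρ
  exact exists_bijective_coprod ρ (isGradedDM_limD R (G ⊗[R] G') 𝒲)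
    (isHomologyOf_limClass R (G ⊗[R] G') 𝒲) (cohomologyCross R G G' 𝒰 𝒱 𝒲 hW) Ψ h1 h2 h3 h4 hρ τ hτ
    hτ' q

end KunnethLimit

/-! ### Metric spaces. -/

section KunnethMetric

variable (R : Type u) [CommRing R] [IsDomain R] [IsPrincipalIdealRing R] (G : Type u)
  [AddCommGroup G] [Module R G] (G' : Type u) [AddCommGroup G'] [Module R G'] {r : ℝ} (hr : 0 < r)

/-- In the maximum metric, relations contained in U_{r+ε} have their product contained in U_{r+ε}.
The bases of finite type refine these relations further; if G' is finitely generated no refinement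
on X is needed. -/
theorem exists_isCrossQuasiIso (X Y : Type u) [MetricSpace X] [MetricSpace Y]
    (hY : HasFiniteTypeBase R (metricSemiUniformity Y r hr))
    (hX : HasFiniteTypeBase R (metricSemiUniformity X r hr) ∨ Module.Finite R G')
    (U : Entourage (metricSemiUniformity X r hr)) (V : Entourage (metricSemiUniformity Y r hr))
    (W : Entourage (metricSemiUniformity (X × Y) r hr)) :
    ∃ (U' : Entourage (metricSemiUniformity X r hr))
      (V' : Entourage (metricSemiUniformity Y r hr)), U ≤ U' ∧ V ≤ V' ∧
        W ≤ prodEntourage (prodRel_mem r hr) U' V' ∧ IsCrossQuasiIso R G G' U'.rel V'.rel := by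
  obtain ⟨ε, hε, hW⟩ := W.mem
  have hU0 : U.rel ∩ metricRel X (r + ε) ∈ (metricSemiUniformity X r hr).filter :=
    Filter.inter_mem U.mem ⟨ε, hε, subset_rfl⟩
  have hV0 : V.rel ∩ metricRel Y (r + ε) ∈ (metricSemiUniformity Y r hr).filter :=
    Filter.inter_mem V.mem ⟨ε, hε, subset_rfl⟩
  obtain ⟨V', hV', hVV, hfV⟩ := hY _ hV0
  obtain ⟨U', hU', hUU, hfU⟩ : ∃ U' ∈ (metricSemiUniformity X r hr).filter,
      U' ⊆ U.rel ∩ metricRel X (r + ε) ∧ (FiniteType R U' ∨ Module.Finite R G') := by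
    rcases hX with hX | hX
    · obtain ⟨U', h1, h2, h3⟩ := hX _ hU0
      exact ⟨U', h1, h2, Or.inl h3⟩
    · exact ⟨_, hU0, subset_rfl, Or.inr hX⟩
  refine ⟨⟨U', hU'⟩, ⟨V', hV'⟩, hUU.trans Set.inter_subset_left, hVV.trans Set.inter_subset_left,
    fun p hp => hW ?_, ?_⟩
  · exact (max_lt (hUU hp.1).2 (hVV hp.2).2 :
      max (dist p.1.1 p.2.1) (dist p.1.2 p.2.2) < r + ε)
  · exact quasiIso_totCross ((metricSemiUniformity X r hr).diag U' hU')
      ((metricSemiUniformity Y r hr).diag V' hV') hfV hfU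

/-- The split Künneth sequence of a product of metric spaces. -/
theorem kunneth_metric (X Y : Type u) [MetricSpace X] [MetricSpace Y]
    (h : CategoryTheory.Limits.IsZero (Tor₁ R (ModuleCat.of R G) (ModuleCat.of R G')))
    (hY : HasFiniteTypeBase R (metricSemiUniformity Y r hr))
    (hX : HasFiniteTypeBase R (metricSemiUniformity X r hr) ∨ Module.Finite R G') (q : ℤ) :
    Function.Injective (kunnethCross R G G' r hr X Y q) ∧
      ∃ β : H R (G ⊗[R] G') r hr (X × Y) q →ₗ[R] KunnethTor R G G' r hr X Y q,
        Function.Exact (kunnethCross R G G' r hr X Y q) β ∧ Function.Surjective β ∧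
          ∃ s : KunnethTor R G G' r hr X Y q →ₗ[R] H R (G ⊗[R] G') r hr (X × Y) q,
            β ∘ₗ s = LinearMap.id := by
  obtain ⟨s, hs⟩ := exists_bijective_coprod_crossMap R G G' (prodRel_mem r hr)
    (exists_isCrossQuasiIso R G G' hr X Y hY hX) h q
  exact exists_split_exact_of_bijective _ s hs

end KunnethMetric

end VR

namespace VR

/-! ### Cohomology in the presence of a least entourage. -/

section Minimal

variable (R : Type*) [CommRing R] {X Y : Type*} (G : Type*) [AddCommGroup G] [Module R G]

/-- A relation contained in all the others determines the semi-uniform structure. -/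
structure IsLeastEntourage (𝒰 : SemiUniformity X) (U : Set (X × X)) : Prop where
  mem : U ∈ 𝒰.filter
  le : ∀ V ∈ 𝒰.filter, U ⊆ V

variable {𝒰 : SemiUniformity X} {U : Set (X × X)}

/-- The class of a cocycle in the limit. -/
noncomputable abbrev limCohMk (𝒰 : SemiUniformity X) (U : Entourage 𝒰) (n : ℕ)
    (f : cocycles R G U.rel n) : LimCoh R G 𝒰 n :=
  Module.DirectLimit.of R (Entourage 𝒰) (fun U => Coh R G U.rel n) (restr R G 𝒰 n) U
    (Coh.mk R G U.rel n f)

/-- The restriction of a cocycle to a smaller relation. -/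
def restrCocycle {U V : Entourage 𝒰} (h : U ≤ V) (n : ℕ) (f : cocycles R G U.rel n) :
    cocycles R G V.rel n :=
  ⟨cochainMap R G (fun x => x) (fun _ hp => h hp) n f.1, cochainMap_mem_cocycles R G _ _ n f.1 f.2⟩

theorem limCohMk_restrCocycle {U V : Entourage 𝒰} (h : U ≤ V) (n : ℕ) (f : cocycles R G U.rel n) :
    limCohMk R G 𝒰 V n (restrCocycle R G h n f) = limCohMk R G 𝒰 U n f :=
  Module.DirectLimit.of_f (f := restr R G 𝒰 n) (hij := h) (x := Coh.mk R G U.rel n f)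

theorem exists_limCohMk (n : ℕ) (x : LimCoh R G 𝒰 n) :
    ∃ U f, x = limCohMk R G 𝒰 U n f := by
  obtain ⟨U, y, rfl⟩ := Module.DirectLimit.exists_of x
  obtain ⟨f, rfl⟩ := Coh.mk_surjective R G U.rel n y
  exact ⟨U, f, rfl⟩

theorem IsLeastEntourage.exists_rep (hU : IsLeastEntourage 𝒰 U) (n : ℕ) (x : LimCoh R G 𝒰 n) :
    ∃ f, x = limCohMk R G 𝒰 ⟨U, hU.mem⟩ n f := by
  obtain ⟨V, f, rfl⟩ := exists_limCohMk R G n x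
  exact ⟨restrCocycle R G (V := ⟨U, hU.mem⟩) (hU.le V.rel V.mem) n f,
    (limCohMk_restrCocycle R G _ n f).symm⟩

/-- A functional on the cohomology of the least entourage. -/
noncomputable def IsLeastEntourage.lift (hU : IsLeastEntourage 𝒰 U) {M : Type*} [AddCommGroup M] [Module R M] (n : ℕ)
    (F : Cochain G U n →ₗ[R] M) (hF : ∀ f ∈ coboundaries R G U n, F f = 0) :
    LimCoh R G 𝒰 n →ₗ[R] M :=
  Module.DirectLimit.lift R _ _ _
    (fun V => Coh.lift R G V.rel n
      (F ∘ₗ cochainMap R G (fun x => x) (fun _ hp => hU.le V.rel V.mem hp) n ∘ₗ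
        Submodule.subtype _)
      (fun f hf => hF _ (cochainMap_mem_coboundaries R G _ _ n f.1 hf)))
    (fun V W h x => by
      obtain ⟨f, rfl⟩ := Coh.mk_surjective R G V.rel n x
      rfl)

theorem IsLeastEntourage.lift_mk (hU : IsLeastEntourage 𝒰 U) {M : Type*} [AddCommGroup M] [Module R M] (n : ℕ)
    (F : Cochain G U n →ₗ[R] M) (hF : ∀ f ∈ coboundaries R G U n, F f = 0) (V : Entourage 𝒰)
    (f : cocycles R G V.rel n) :
    hU.lift R G n F hF (limCohMk R G 𝒰 V n f) =
      F (cochainMap R G (fun x => x) (fun _ hp => hU.le V.rel V.mem hp) n f.1) := by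
  rw [IsLeastEntourage.lift, Module.DirectLimit.lift_of]
  rfl

theorem limCohMap_mk {𝒱 : SemiUniformity Y} (φ : Y → X)
    (hφ : ∀ U ∈ 𝒰.filter, {p : Y × Y | (φ p.1, φ p.2) ∈ U} ∈ 𝒱.filter) (n : ℕ) (U : Entourage 𝒰)
    (V : Entourage 𝒱) (h : ∀ p ∈ V.rel, (φ p.1, φ p.2) ∈ U.rel) (f : cocycles R G U.rel n) :
    limCohMap R G 𝒰 𝒱 φ hφ n (limCohMk R G 𝒰 U n f) =
      limCohMk R G 𝒱 V n ⟨cochainMap R G φ h n f.1, cochainMap_mem_cocycles R G φ h n f.1 f.2⟩ := by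
  rw [limCohMap, Module.DirectLimit.lift_of]
  exact (limCohMk_restrCocycle R G (U := ⟨_, hφ U.rel U.mem⟩) (V := V) (fun p hp => h p hp) n _).symm

end Minimal

/-! ### Finite spaces. -/

section Finite

variable (R : Type*) [CommRing R] [IsNoetherianRing R] {X : Type*} [Finite X]

theorem finiteType_of_finite (U : Set (X × X)) : FiniteType R U := fun n => by
  have : Finite (Simplex U n) := inferInstanceAs (Finite (Subtype _))
  have : Module.Finite R (Chain R U n) := inferInstanceAs (Module.Finite R (Simplex U n →₀ R))
  infer_instance

theorem hasFiniteTypeBase_of_finite (𝒰 : SemiUniformity X) : HasFiniteTypeBase R 𝒰 :=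
  fun U hU => ⟨U, hU, subset_rfl, finiteType_of_finite R U⟩

end Finite

/-! ### A criterion against natural splittings. -/

section Naturality

theorem exists_mul_functional {R : Type*} [CommRing R] {k : Type*} [CommRing k] [Algebra R k]
    {M N : Type*} [AddCommGroup M] [Module R M] [AddCommGroup N] [Module R N] (Λ : M →ₗ[R] k)
    (Λ' : N →ₗ[R] k) : ∃ f : M ⊗[R] N →ₗ[R] k, ∀ x y, f (x ⊗ₜ y) = Λ x * Λ' y :=
  ⟨TensorProduct.lift ((LinearMap.mul R k).compl₁₂ Λ Λ'), fun x y => by simp⟩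

theorem exists_component_functional {R : Type*} [CommRing R] {ι : Type*} [DecidableEq ι]
    (M : ι → Type*) [∀ i, AddCommGroup (M i)] [∀ i, Module R (M i)] {k : Type*} [AddCommGroup k]
    [Module R k] (i : ι) (f : M i →ₗ[R] k) :
    ∃ ev : (⨁ i, M i) →ₗ[R] k, (∀ x, ev (DirectSum.lof R ι M i x) = f x) ∧
      ∀ j x, j ≠ i → ev (DirectSum.lof R ι M j x) = 0 :=
  ⟨f ∘ₗ DirectSum.component R ι M i, fun x => by simp [DirectSum.component.lof_self],
    fun j x h => by simp [DirectSum.component.of, h]⟩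

/-- If the pullback of a class `w` of `X × Y` to `X' × Y` is the cross product of `a` and `b`,
where a functional which vanishes on the image of the cohomology of `X` does not vanish on `a`,
there is no natural splitting. -/
theorem not_hasNaturalSplitting_of (R : Type) [CommRing R] [IsNoetherianRing R] (k : Type)
    [CommRing k] [Nontrivial k] [Algebra R k] {r : ℝ} (hr : 0 < r) {X X' Y : Type} [MetricSpace X]
    [MetricSpace X'] [MetricSpace Y] [Finite X] [Finite X'] [Finite Y] (φ : X' → X)
    (hφ : LipschitzWith 1 φ)
    (w : LimCoh R (R ⊗[R] R) (metricSemiUniformity (X × Y) r hr) 3)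
    (a : LimCoh R R (metricSemiUniformity X' r hr) 1)
    (b : LimCoh R R (metricSemiUniformity Y r hr) 2)
    (hw : limCohMap R (R ⊗[R] R) _ _ (Prod.map φ id)
      (preimage_mem r hr (lipschitz_prodMap hφ LipschitzWith.id)) 3 w =
        crossLim R R R _ _ _ (prodRel_mem r hr) (show 1 + 2 = 3 from rfl) a b)
    (Λ : LimCoh R R (metricSemiUniformity X' r hr) 1 →ₗ[R] k)
    (Λ' : LimCoh R R (metricSemiUniformity Y r hr) 2 →ₗ[R] k)
    (hΛ : ∀ x, Λ (limCohMap R R _ _ φ (preimage_mem r hr hφ) 1 x) = 0) (ha : Λ a = 1)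
    (hb : Λ' b = 1) : ¬ HasNaturalSplitting R R R r hr := by
  rintro ⟨ρ, h1, h2⟩
  have fX := hasFiniteTypeBase_of_finite R (metricSemiUniformity X r hr)
  have fX' := hasFiniteTypeBase_of_finite R (metricSemiUniformity X' r hr)
  have fY := hasFiniteTypeBase_of_finite R (metricSemiUniformity Y r hr)
  let p : {p : ℤ × ℤ // p.1 + p.2 = Int.ofNat 3} := ⟨(Int.ofNat 1, Int.ofNat 2), rfl⟩
  obtain ⟨f, hf⟩ := exists_mul_functional (M := H R R r hr X' (Int.ofNat 1))
    (N := H R R r hr Y (Int.ofNat 2)) Λ Λ'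
  obtain ⟨ev, hev, hev0⟩ := exists_component_functional
    (fun p : {p : ℤ × ℤ // p.1 + p.2 = Int.ofNat 3} =>
      (H R R r hr X' p.1.1 ⊗[R] H R R r hr Y p.1.2)) p f
  let ab : KunnethTensor R R R r hr X' Y (Int.ofNat 3) :=
    DirectSum.lof R _ (fun p : {p : ℤ × ℤ // p.1 + p.2 = Int.ofNat 3} =>
      (H R R r hr X' p.1.1 ⊗[R] H R R r hr Y p.1.2)) p (a ⊗ₜ[R] b)
  have e1 : kunnethCross R R R r hr X' Y (Int.ofNat 3) ab =
      pullback R (R ⊗[R] R) r hr (lipschitz_prodMap hφ LipschitzWith.id) (Int.ofNat 3) w := by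
    refine Eq.trans ?_ hw.symm
    refine (DirectSum.toModule_lof R p _).trans ?_
    exact TensorProduct.lift.tmul _ _
  have e2 : ρ X' Y fX' fY (Int.ofNat 3) (kunnethCross R R R r hr X' Y (Int.ofNat 3) ab) = ab :=
    LinearMap.congr_fun (h1 X' Y fX' fY (Int.ofNat 3)) ab
  have e3 := LinearMap.congr_fun (h2 X X' Y Y fX fX' fY fY φ hφ id LipschitzWith.id (Int.ofNat 3)) w
  -- Apply the retraction to the pullback of w: it returns a ⊗ b, and naturality makes this a
  -- pullback.
  have e4 : ab = pullbackTensor R R R r hr hφ LipschitzWith.id (Int.ofNat 3)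
      (ρ X Y fX fY (Int.ofNat 3) w) := by
    rw [← e2, e1]
    exact e3
  have e5 : ev ab = 1 := by
    refine (hev _).trans ((hf a b).trans ?_)
    exact (congrArg₂ (· * ·) ha hb).trans (one_mul _)
  -- The functional sees only the summand of bidegree (1, 2), where Λ annihilates everything that
  -- comes from X.
  have e6 : ev ∘ₗ pullbackTensor R R R r hr hφ (LipschitzWith.id (α := Y)) (Int.ofNat 3) = 0 := by
    refine DirectSum.linearMap_ext _ fun p' => TensorProduct.ext' fun x y => ?_
    rw [LinearMap.comp_apply, LinearMap.comp_apply, pullbackTensor, tensorTermMap,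
      DirectSum.lmap_lof, TensorProduct.map_tmul]
    refine Eq.trans ?_ (LinearMap.zero_apply _).symm
    by_cases hp : p' = p
    · subst hp
      refine (hev _).trans ((hf _ _).trans ?_)
      exact (congrArg (· * _) (hΛ x)).trans (zero_mul _)
    · exact hev0 p' _ hp
  rw [e4, ← LinearMap.comp_apply, e6] at e5
  exact zero_ne_one e5

end Naturality

/-! ### Graphs as metric spaces. -/

section Graph

variable {A B : Type} [DecidableEq A] [DecidableEq B]

/-- The metric with distance `r` between adjacent points and `2r` between other points. -/
@[reducible] noncomputable def graphMetric (adj : A → A → Bool) (hs : ∀ x y, adj x y = adj y x) {r : ℝ}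
    (hr : 0 < r) : MetricSpace A where
  dist x y := if x = y then 0 else if adj x y then r else 2 * r
  dist_self x := if_pos rfl
  dist_comm x y := by simp only [eq_comm, hs]
  dist_triangle x y z := by
    split_ifs <;> first | linarith | (exfalso; simp_all)
  eq_of_dist_eq_zero {x y} h := by
    by_contra hxy
    simp only [hxy, if_false] at h
    split_ifs at h <;> linarith

/-- Equal or adjacent points. -/
def graphRel (adj : A → A → Bool) : Set (A × A) := {p | p.1 = p.2 ∨ adj p.1 p.2}

/-- Distances are 0, r or 2r, so U_{r+ε} is the graph relation as soon as ε ≤ r. -/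
theorem isLeastEntourage_graphRel (adj : A → A → Bool) (hs : ∀ x y, adj x y = adj y x) {r : ℝ}
    (hr : 0 < r) :
    IsLeastEntourage (@metricSemiUniformity A (graphMetric adj hs hr) r hr) (graphRel adj) where
  mem := by
    refine ⟨r, hr, fun p hp => ?_⟩
    have hp' : (if p.1 = p.2 then 0 else if adj p.1 p.2 then r else 2 * r) < r + r := hp
    split_ifs at hp' with h1 h2
    · exact Or.inl h1
    · exact Or.inr h2
    · linarith
  le := by
    rintro V ⟨ε, hε, hV⟩ p hp
    refine hV ?_
    change (if p.1 = p.2 then 0 else if adj p.1 p.2 then r else 2 * r) < r + ε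
    rcases hp with hp | hp
    · rw [if_pos hp]
      linarith
    · simp only [hp, if_true]
      split_ifs <;> linarith

theorem lipschitz_graphMetric (adj : A → A → Bool) (hs : ∀ x y, adj x y = adj y x)
    (adj' : B → B → Bool) (hs' : ∀ x y, adj' x y = adj' y x) {r : ℝ} (hr : 0 < r) (φ : A → B)
    (hφ : ∀ x y, adj x y → φ x = φ y ∨ adj' (φ x) (φ y)) :
    @LipschitzWith A B (graphMetric adj hs hr).toPseudoMetricSpace.toPseudoEMetricSpace
      (graphMetric adj' hs' hr).toPseudoMetricSpace.toPseudoEMetricSpace 1 φ := by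
  let _ := graphMetric adj hs hr
  let _ := graphMetric adj' hs' hr
  refine LipschitzWith.of_dist_le_mul fun x y => ?_
  rw [NNReal.coe_one, one_mul]
  change (if φ x = φ y then 0 else if adj' (φ x) (φ y) then r else 2 * r) ≤
    (if x = y then 0 else if adj x y then r else 2 * r)
  have := hφ x y
  split_ifs <;> first | linarith | (exfalso; simp_all)

end Graph

end VR

namespace VR

/-! ### Cochains of low degree. -/

section Cochains

variable (R : Type*) [CommRing R] {X Y : Type*} {G G' : Type*} [AddCommGroup G] [Module R G]
  [AddCommGroup G'] [Module R G'] {U : Set (X × X)}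

/-- The edge `(x, y)`. -/
def edge {x y : X} (h : (x, y) ∈ U) : Simplex U 1 :=
  ⟨![x, y], fun i j hij => by
    fin_cases i <;> fin_cases j
    · exact absurd hij (by decide)
    · exact h
    · exact absurd hij (by decide)
    · exact absurd hij (by decide)⟩

open Classical in
/-- The extension of a function on the edges to all pairs of points. -/
noncomputable def edgeExtend (g : Cochain G U 1) (x y : X) : G :=
  if h : (x, y) ∈ U then g (edge h) else 0

theorem edgeExtend_apply (g : Cochain G U 1) (σ : Simplex U 1) :
    edgeExtend g (σ.1 0) (σ.1 1) = g σ := by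
  rw [edgeExtend, dif_pos (σ.2 (by decide))]
  congr 1
  refine Subtype.ext (funext fun i => ?_)
  fin_cases i <;> rfl

theorem edgeExtend_edge (g : Cochain G U 1) {x y : X} (h : (x, y) ∈ U) :
    edgeExtend g x y = g (edge h) := dif_pos h

theorem coboundary_zero_apply (g : Cochain G U 0) (σ : Simplex U 1) :
    coboundary R G U 0 g σ = g (face 0 σ) - g (face 1 σ) := by
  change ∑ k : Fin 2, (-1 : R) ^ (k : ℕ) • g (face k σ) = _
  rw [Fin.sum_univ_two]
  simp [sub_eq_add_neg]

theorem coboundary_one_apply (g : Cochain G U 1) (σ : Simplex U 2) :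
    coboundary R G U 1 g σ = edgeExtend g (σ.1 1) (σ.1 2) - edgeExtend g (σ.1 0) (σ.1 2) +
      edgeExtend g (σ.1 0) (σ.1 1) := by
  have h0 := edgeExtend_apply g (face 0 σ)
  have h1 := edgeExtend_apply g (face 1 σ)
  have h2 := edgeExtend_apply g (face 2 σ)
  change ∑ k : Fin 3, (-1 : R) ^ (k : ℕ) • g (face k σ) = _
  rw [Fin.sum_univ_three, ← h0, ← h1, ← h2]
  simp only [Fin.val_zero, Fin.val_one, Fin.val_two, pow_zero, pow_one, neg_one_sq, one_smul,
    neg_one_smul, sub_eq_add_neg]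
  rfl

theorem coboundary_two_apply (g : Cochain G U 2) (σ : Simplex U 3) :
    coboundary R G U 2 g σ = g (face 0 σ) - g (face 1 σ) + g (face 2 σ) - g (face 3 σ) := by
  change ∑ k : Fin 4, (-1 : R) ^ (k : ℕ) • g (face k σ) = _
  rw [Fin.sum_univ_four]
  have h3 : (((3 : Fin 4) : ℕ)) = 2 + 1 := rfl
  rw [h3]
  simp only [Fin.val_zero, Fin.val_one, Fin.val_two, pow_zero, pow_succ, one_smul,
    neg_one_smul, sub_eq_add_neg, mul_neg, mul_one, neg_neg]

theorem crossLim_mk (𝒰 : SemiUniformity X) (𝒱 : SemiUniformity Y) (𝒲 : SemiUniformity (X × Y))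
    (hW : ∀ U ∈ 𝒰.filter, ∀ V ∈ 𝒱.filter, prodRel U V ∈ 𝒲.filter) {i j n : ℕ} (h : i + j = n)
    (U : Entourage 𝒰) (V : Entourage 𝒱) (f : cocycles R G U.rel i) (g : cocycles R G' V.rel j) :
    crossLim R G G' 𝒰 𝒱 𝒲 hW h (limCohMk R G 𝒰 U i f) (limCohMk R G' 𝒱 V j g) =
      limCohMk R (G ⊗[R] G') 𝒲 (prodEntourage hW U V) n
        ⟨crossCochain R G G' U.rel V.rel h f.1 g.1,
          crossCochain_mem_cocycles R G G' U.rel V.rel h f.1 g.1 f.2 g.2⟩ := by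
  rw [crossLim, Module.DirectLimit.lift_of, LinearMap.flip_apply, Module.DirectLimit.lift_of]
  rfl

end Cochains

/-! ### A triangulated projective plane and an essential loop. -/

section ProjectivePlane

/-- The triangles of a flag triangulation of the projective plane. -/
def rp2Triangle : Fin 20 → Fin 3 → Fin 11 :=
  ![![0, 1, 5], ![0, 1, 6], ![0, 3, 4], ![0, 3, 9], ![0, 4, 5], ![0, 6, 9], ![1, 2, 6],
    ![1, 2, 10], ![1, 5, 10], ![2, 3, 7], ![2, 3, 10], ![2, 6, 7], ![3, 4, 7], ![3, 9, 10],
    ![4, 5, 7], ![5, 7, 8], ![5, 8, 10], ![6, 7, 8], ![6, 8, 9], ![8, 9, 10]]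

/-- The edges of the triangulation. -/
def rp2Edges : List (Fin 11 × Fin 11) :=
  [(0, 1), (0, 3), (0, 4), (0, 5), (0, 6), (0, 9), (1, 2), (1, 5), (1, 6), (1, 10), (2, 3), (2, 6),
    (2, 7), (2, 10), (3, 4), (3, 7), (3, 9), (3, 10), (4, 5), (4, 7), (5, 7), (5, 8), (5, 10),
    (6, 7), (6, 8), (6, 9), (7, 8), (8, 9), (8, 10), (9, 10)]

/-- The graph of the triangulation. -/
def rp2Adj (x y : Fin 11) : Bool := (x, y) ∈ rp2Edges || (y, x) ∈ rp2Edges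

/-- The edges on which a cocycle modulo `2` which is not a coboundary does not vanish. -/
def rp2Cut : List (Fin 11 × Fin 11) := [(0, 6), (0, 9), (1, 2), (1, 6), (2, 10), (3, 9), (3, 10)]

/-- An integral lift of that cocycle. -/
def rp2Lift (x y : Fin 11) : ℤ :=
  (if (x, y) ∈ rp2Cut then 1 else 0) - (if (y, x) ∈ rp2Cut then 1 else 0)

/-- The half of the coboundary of the lift. -/
def rp2Bockstein (x y z : Fin 11) : ℤ := (rp2Lift y z - rp2Lift x z + rp2Lift x y) / 2

/-- The graph of the square. -/
def squareAdj (x y : Fin 4) : Bool := y = x + 1 || x = y + 1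

/-- A loop which is not contractible in the projective plane. -/
def squareLoop : Fin 4 → Fin 11 := Fin.castLE (by decide)

theorem rp2Adj_symm (x y : Fin 11) : rp2Adj x y = rp2Adj y x := Bool.or_comm _ _

theorem squareAdj_symm (x y : Fin 4) : squareAdj x y = squareAdj y x := Bool.or_comm _ _

theorem squareLoop_adj (x y : Fin 4) (h : squareAdj x y) :
    squareLoop x = squareLoop y ∨ rp2Adj (squareLoop x) (squareLoop y) := by
  revert x y
  decide

-- The lift is a cocycle modulo 2, so the division by 2 in `rp2Bockstein` is exact. Equal vertices
-- are admitted because simplices may be degenerate.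
set_option maxRecDepth 10000 in
theorem two_mul_rp2Bockstein : ∀ x y z : Fin 11, (x = y ∨ rp2Adj x y) → (x = z ∨ rp2Adj x z) →
    (y = z ∨ rp2Adj y z) →
    2 * rp2Bockstein x y z = rp2Lift y z - rp2Lift x z + rp2Lift x y := by
  decide +kernel

theorem rp2Bockstein_squareLoop : ∀ x y z : Fin 4, (x = y ∨ squareAdj x y) →
    (x = z ∨ squareAdj x z) → (y = z ∨ squareAdj y z) →
    rp2Bockstein (squareLoop x) (squareLoop y) (squareLoop z) = 0 := by
  decide +kernel

theorem rp2Triangle_adj : ∀ (t : Fin 20) (i j : Fin 3), i < j →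
    (rp2Triangle t i = rp2Triangle t j ∨ rp2Adj (rp2Triangle t i) (rp2Triangle t j)) := by
  decide +kernel

/-- The Bockstein takes the value 1 on the fundamental class modulo 2, hence it is not a coboundary.
-/
theorem sum_rp2Bockstein :
    ∑ t, rp2Bockstein (rp2Triangle t 0) (rp2Triangle t 1) (rp2Triangle t 2) = 1 := by
  decide +kernel

theorem sum_rp2Lift_squareLoop : ∑ i, rp2Lift (squareLoop i) (squareLoop (i + 1)) = 1 := by
  decide +kernel

/-- The projective plane has no fundamental class: each edge belongs to two triangles. -/
theorem two_dvd_sum_rp2Triangle (g : Fin 11 → Fin 11 → ℤ) :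
    2 ∣ ∑ t, (g (rp2Triangle t 1) (rp2Triangle t 2) - g (rp2Triangle t 0) (rp2Triangle t 2) +
      g (rp2Triangle t 0) (rp2Triangle t 1)) := by
  simp only [Fin.sum_univ_succ, rp2Triangle, Fin.sum_univ_zero]
  simp
  omega

/-- An integral cocycle vanishes on the loop, as twice the loop is a boundary. -/
theorem sum_squareLoop_eq_zero (g : Fin 11 → Fin 11 → ℤ)
    (hg : ∀ x y z : Fin 11, (x = y ∨ rp2Adj x y) → (x = z ∨ rp2Adj x z) → (y = z ∨ rp2Adj y z) →
      g y z - g x z + g x y = 0) : ∑ i, g (squareLoop i) (squareLoop (i + 1)) = 0 := by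
  have ht : ∀ t, g (rp2Triangle t 1) (rp2Triangle t 2) - g (rp2Triangle t 0) (rp2Triangle t 2) +
      g (rp2Triangle t 0) (rp2Triangle t 1) = 0 := fun t =>
    hg _ _ _ (rp2Triangle_adj t 0 1 (by decide)) (rp2Triangle_adj t 0 2 (by decide))
      (rp2Triangle_adj t 1 2 (by decide))
  -- The triangles use only edges with increasing ends, whereas the loop closes with the edge from 3
  -- to 0. These degenerate triangles show that reversing the edge changes the sign.
  have h0 := hg 0 0 0 (Or.inl rfl) (Or.inl rfl) (Or.inl rfl)
  have h3 := hg 0 3 0 (by decide) (Or.inl rfl) (by decide)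
  simp only [Fin.forall_fin_succ, rp2Triangle] at ht
  simp at ht
  change ∑ i : Fin 4, _ = _
  rw [Fin.sum_univ_four]
  change g 0 1 + g 1 2 + g 2 3 + g 3 0 = 0
  omega

end ProjectivePlane

end VR

namespace VR

/-! ### The obstruction given by a Bockstein class. -/

section Bockstein

variable (R : Type*) [CommRing R] {X X' : Type*} {U : Set (X × X)} {V : Set (X' × X')}

/-- If `δh = 2k`, then `h × k - k × h` is a cocycle. -/
theorem crossCochain_sub_mem_cocycles (h : Cochain R U 1) (k : Cochain R U 2)
    (hk : coboundary R R U 1 h = (2 : R) • k) (hk0 : k ∈ cocycles R R U 2) :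
    crossCochain R R R U U (show 1 + 2 = 3 from rfl) h k -
      crossCochain R R R U U (show 2 + 1 = 3 from rfl) k h ∈
        cocycles R (R ⊗[R] R) (prodRel U U) 3 := by
  rw [LinearMap.mem_ker] at hk0 ⊢
  -- Both δ(h × k) and δ(k × h) equal 2 k × k, since k is a cocycle of even degree.
  rw [map_sub, coboundary_crossCochain, coboundary_crossCochain, hk, hk0]
  simp

theorem cochainMap_mem_cocycles_of_eq_zero (φ : X' → X) (hφ : ∀ p ∈ V, (φ p.1, φ p.2) ∈ U)
    (h : Cochain R U 1) (k : Cochain R U 2) (hk : coboundary R R U 1 h = (2 : R) • k)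
    (hφk : cochainMap R R φ hφ 2 k = 0) : cochainMap R R φ hφ 1 h ∈ cocycles R R V 1 := by
  rw [LinearMap.mem_ker, coboundary_cochainMap, hk, map_smul, hφk, smul_zero]

/-- The cochain k vanishes after pullback along φ, so the second product disappears and the first
becomes a product of cocycles. -/
theorem cochainMap_crossCochain_sub {Y : Type*} {W : Set (Y × Y)} (φ : X' → X)
    (hφ : ∀ p ∈ V, (φ p.1, φ p.2) ∈ U)
    (hφ' : ∀ p ∈ prodRel V W, (Prod.map φ id p.1, Prod.map φ id p.2) ∈ prodRel U W)
    (h : Cochain R U 1) (k : Cochain R U 2) (h' : Cochain R W 1) (k' : Cochain R W 2)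
    (hφk : cochainMap R R φ hφ 2 k = 0) :
    cochainMap R (R ⊗[R] R) (Prod.map φ id) hφ' 3
      (crossCochain R R R U W (show 1 + 2 = 3 from rfl) h k' -
        crossCochain R R R U W (show 2 + 1 = 3 from rfl) k h') =
      crossCochain R R R V W (show 1 + 2 = 3 from rfl) (cochainMap R R φ hφ 1 h) k' := by
  have e : crossCochain R R R V W (show 2 + 1 = 3 from rfl) (cochainMap R R φ hφ 2 k) h' = 0 := by
    rw [hφk, LinearMap.map_zero₂]
  rw [map_sub]
  exact (congrArg _ e).trans (sub_zero _)

/-- A class `b` which is the Bockstein of a class modulo `2`, and which vanishes on `X'`, obstructs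
the natural splitting if it is detected by a functional. -/
theorem not_hasNaturalSplitting_of_bockstein (R : Type) [CommRing R] [IsNoetherianRing R]
    (k : Type) [CommRing k] [Nontrivial k] [Algebra R k] {r : ℝ} (hr : 0 < r) {X X' : Type}
    [MetricSpace X] [MetricSpace X'] [Finite X] [Finite X'] {U : Set (X × X)} {V : Set (X' × X')}
    (hU : IsLeastEntourage (metricSemiUniformity X r hr) U)
    (hV : IsLeastEntourage (metricSemiUniformity X' r hr) V) (φ : X' → X)
    (hφ : LipschitzWith 1 φ) (hφ' : ∀ p ∈ V, (φ p.1, φ p.2) ∈ U) (f : Cochain R U 1)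
    (b : Cochain R U 2) (hf : coboundary R R U 1 f = (2 : R) • b) (hb : b ∈ cocycles R R U 2)
    (hφb : cochainMap R R φ hφ' 2 b = 0) (Λ : Cochain R V 1 →ₗ[R] k)
    (Λ' : Cochain R U 2 →ₗ[R] k) (hΛ : ∀ g ∈ coboundaries R R V 1, Λ g = 0)
    (hΛ' : ∀ g ∈ coboundaries R R U 2, Λ' g = 0)
    (hΛφ : ∀ g ∈ cocycles R R U 1, Λ (cochainMap R R φ hφ' 1 g) = 0)
    (hΛf : Λ (cochainMap R R φ hφ' 1 f) = 1) (hΛb : Λ' b = 1) :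
    ¬ HasNaturalSplitting R R R r hr := by
  refine not_hasNaturalSplitting_of R k hr φ hφ
    (limCohMk R (R ⊗[R] R) _ (prodEntourage (prodRel_mem r hr) ⟨U, hU.mem⟩ ⟨U, hU.mem⟩) 3
      ⟨_, crossCochain_sub_mem_cocycles R f b hf hb⟩)
    (limCohMk R R _ ⟨V, hV.mem⟩ 1 ⟨_, cochainMap_mem_cocycles_of_eq_zero R φ hφ' f b hf hφb⟩)
    (limCohMk R R _ ⟨U, hU.mem⟩ 2 ⟨b, hb⟩) ?_ (hV.lift R R 1 Λ hΛ) (hU.lift R R 2 Λ' hΛ') ?_ ?_ ?_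
  · have h : ∀ p ∈ prodRel V U, (Prod.map φ id p.1, Prod.map φ id p.2) ∈ prodRel U U :=
      fun p hp => ⟨hφ' (p.1.1, p.2.1) hp.1, hp.2⟩
    rw [crossLim_mk, limCohMap_mk R (R ⊗[R] R) (Prod.map φ id) _ 3 _
      (prodEntourage (prodRel_mem r hr) ⟨V, hV.mem⟩ ⟨U, hU.mem⟩) h]
    exact congrArg _ (Subtype.ext (cochainMap_crossCochain_sub R φ hφ' h f b f b hφb))
  · intro x
    obtain ⟨g, rfl⟩ := hU.exists_rep R R 1 x
    rw [limCohMap_mk R R φ _ 1 _ ⟨V, hV.mem⟩ hφ', IsLeastEntourage.lift_mk]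
    exact hΛφ g.1 g.2
  · rw [IsLeastEntourage.lift_mk]
    exact hΛf
  · rw [IsLeastEntourage.lift_mk]
    exact hΛb

end Bockstein

/-! ### The projective plane against natural splittings. -/

section Obstruction

/-- The cochain defined by `rp2Lift`. -/
def rp2LiftCochain : Cochain ℤ (graphRel rp2Adj) 1 := fun σ => rp2Lift (σ.1 0) (σ.1 1)

/-- The cochain defined by `rp2Bockstein`. -/
def rp2BocksteinCochain : Cochain ℤ (graphRel rp2Adj) 2 :=
  fun σ => rp2Bockstein (σ.1 0) (σ.1 1) (σ.1 2)

theorem coboundary_rp2LiftCochain :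
    coboundary ℤ ℤ _ 1 rp2LiftCochain = (2 : ℤ) • rp2BocksteinCochain := by
  funext σ
  have h01 := σ.2 (show (0 : Fin 3) < 1 by decide)
  have h02 := σ.2 (show (0 : Fin 3) < 2 by decide)
  have h12 := σ.2 (show (1 : Fin 3) < 2 by decide)
  rw [coboundary_one_apply, edgeExtend_edge _ h01, edgeExtend_edge _ h02, edgeExtend_edge _ h12]
  exact (two_mul_rp2Bockstein _ _ _ h01 h02 h12).symm

/-- Twice the cochain is a coboundary, and the integers have no 2-torsion. -/
theorem rp2BocksteinCochain_mem_cocycles :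
    rp2BocksteinCochain ∈ cocycles ℤ ℤ (graphRel rp2Adj) 2 := by
  refine LinearMap.mem_ker.2 (funext fun σ => ?_)
  have h : ∀ τ : Simplex (graphRel rp2Adj) 2, 2 * rp2BocksteinCochain τ =
      rp2Lift (τ.1 1) (τ.1 2) - rp2Lift (τ.1 0) (τ.1 2) + rp2Lift (τ.1 0) (τ.1 1) := fun τ =>
    two_mul_rp2Bockstein _ _ _ (τ.2 (show (0 : Fin 3) < 1 by decide))
      (τ.2 (show (0 : Fin 3) < 2 by decide)) (τ.2 (show (1 : Fin 3) < 2 by decide))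
  have h0 : _ = rp2Lift (σ.1 2) (σ.1 3) - rp2Lift (σ.1 1) (σ.1 3) + rp2Lift (σ.1 1) (σ.1 2) :=
    h (face 0 σ)
  have h1 : _ = rp2Lift (σ.1 2) (σ.1 3) - rp2Lift (σ.1 0) (σ.1 3) + rp2Lift (σ.1 0) (σ.1 2) :=
    h (face 1 σ)
  have h2 : _ = rp2Lift (σ.1 1) (σ.1 3) - rp2Lift (σ.1 0) (σ.1 3) + rp2Lift (σ.1 0) (σ.1 1) :=
    h (face 2 σ)
  have h3 : _ = rp2Lift (σ.1 1) (σ.1 2) - rp2Lift (σ.1 0) (σ.1 2) + rp2Lift (σ.1 0) (σ.1 1) :=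
    h (face 3 σ)
  rw [coboundary_two_apply, Pi.zero_apply]
  omega

theorem squareLoop_mem_graphRel (p : Fin 4 × Fin 4) (hp : p ∈ graphRel squareAdj) :
    (squareLoop p.1, squareLoop p.2) ∈ graphRel rp2Adj :=
  hp.elim (fun h => Or.inl (congrArg squareLoop h)) (squareLoop_adj _ _)

theorem cochainMap_rp2BocksteinCochain :
    cochainMap ℤ ℤ squareLoop squareLoop_mem_graphRel 2 rp2BocksteinCochain = 0 :=
  funext fun σ => rp2Bockstein_squareLoop _ _ _ (σ.2 (show (0 : Fin 3) < 1 by decide))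
    (σ.2 (show (0 : Fin 3) < 2 by decide)) (σ.2 (show (1 : Fin 3) < 2 by decide))

theorem square_edge_mem (i : Fin 4) : (i, i + 1) ∈ graphRel squareAdj :=
  Or.inr (by revert i; decide)

/-- The value of a cochain on the square, modulo `2`. -/
noncomputable def squareValue : Cochain ℤ (graphRel squareAdj) 1 →ₗ[ℤ] ZMod 2 :=
  Algebra.linearMap ℤ (ZMod 2) ∘ₗ ∑ i, LinearMap.proj (edge (square_edge_mem i))

theorem squareValue_apply (f : Cochain ℤ (graphRel squareAdj) 1) :
    squareValue f = ((∑ i, f (edge (square_edge_mem i)) : ℤ) : ZMod 2) := by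
  simp [squareValue]

/-- The differences of a function on the vertices cancel around the square. -/
theorem squareValue_eq_zero (f : Cochain ℤ (graphRel squareAdj) 1)
    (hf : f ∈ coboundaries ℤ ℤ (graphRel squareAdj) 1) : squareValue f = 0 := by
  obtain ⟨g, rfl⟩ := hf
  let v : Fin 4 → Simplex (graphRel squareAdj) 0 := fun x => ⟨fun _ => x, fun i j h => by omega⟩
  have h : ∀ i, coboundary ℤ ℤ _ 0 g (edge (square_edge_mem i)) = g (v (i + 1)) - g (v i) := by
    intro i
    rw [coboundary_zero_apply]
    congr 2 <;> refine Subtype.ext (funext fun j => ?_) <;> fin_cases j <;> rfl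
  rw [squareValue_apply, Finset.sum_congr rfl fun i _ => h i, Finset.sum_sub_distrib]
  exact (congrArg _ (sub_eq_zero.2 (Equiv.sum_comp (Equiv.addRight (1 : Fin 4))
    fun i => g (v i)))).trans Int.cast_zero

/-- A triangle of the projective plane as a simplex. -/
def rp2Simplex (t : Fin 20) : Simplex (graphRel rp2Adj) 2 :=
  ⟨rp2Triangle t, fun i j h => rp2Triangle_adj t i j h⟩

/-- The value of a cochain on the projective plane, modulo `2`. -/
noncomputable def rp2Value : Cochain ℤ (graphRel rp2Adj) 2 →ₗ[ℤ] ZMod 2 :=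
  Algebra.linearMap ℤ (ZMod 2) ∘ₗ ∑ t, LinearMap.proj (rp2Simplex t)

theorem rp2Value_apply (f : Cochain ℤ (graphRel rp2Adj) 2) :
    rp2Value f = ((∑ t, f (rp2Simplex t) : ℤ) : ZMod 2) := by
  simp [rp2Value]

theorem rp2Value_eq_zero (f : Cochain ℤ (graphRel rp2Adj) 2)
    (hf : f ∈ coboundaries ℤ ℤ (graphRel rp2Adj) 2) : rp2Value f = 0 := by
  obtain ⟨g, rfl⟩ := hf
  rw [rp2Value_apply, ZMod.intCast_zmod_eq_zero_iff_dvd,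
    Finset.sum_congr rfl fun t _ => coboundary_one_apply ℤ g (rp2Simplex t)]
  exact two_dvd_sum_rp2Triangle (edgeExtend g)

theorem squareValue_rp2LiftCochain :
    squareValue (cochainMap ℤ ℤ squareLoop squareLoop_mem_graphRel 1 rp2LiftCochain) = 1 := by
  rw [squareValue_apply]
  exact (congrArg _ sum_rp2Lift_squareLoop).trans Int.cast_one

theorem rp2Value_rp2BocksteinCochain : rp2Value rp2BocksteinCochain = 1 := by
  rw [rp2Value_apply]
  exact (congrArg _ sum_rp2Bockstein).trans Int.cast_one

theorem squareValue_cochainMap (f : Cochain ℤ (graphRel rp2Adj) 1)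
    (hf : f ∈ cocycles ℤ ℤ (graphRel rp2Adj) 1) :
    squareValue (cochainMap ℤ ℤ squareLoop squareLoop_mem_graphRel 1 f) = 0 := by
  rw [squareValue_apply]
  refine (congrArg _ ?_).trans Int.cast_zero
  refine Eq.trans (Finset.sum_congr rfl fun i _ => ?_)
    (sum_squareLoop_eq_zero (edgeExtend f) fun x y z hxy hxz hyz => ?_)
  · exact (edgeExtend_apply f (simplexMap squareLoop squareLoop_mem_graphRel
      (edge (square_edge_mem i)))).symm
  · let σ : Simplex (graphRel rp2Adj) 2 := ⟨![x, y, z], fun i j h => by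
      fin_cases i <;> fin_cases j <;> first | exact absurd h (by decide) | assumption⟩
    exact (coboundary_one_apply ℤ f σ).symm.trans (congrFun (LinearMap.mem_ker.1 hf) σ)

/-- The projective plane serves as both factors X and Y, and the square is mapped to it along the
essential loop. Functionals modulo 2 on the loop and on the plane detect the two classes. -/
theorem not_hasNaturalSplitting {r : ℝ} (hr : 0 < r) : ¬ HasNaturalSplitting ℤ ℤ ℤ r hr := by
  let mX : MetricSpace (Fin 11) := graphMetric rp2Adj rp2Adj_symm hr
  let mX' : MetricSpace (Fin 4) := graphMetric squareAdj squareAdj_symm hr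
  exact not_hasNaturalSplitting_of_bockstein ℤ (ZMod 2) hr
    (isLeastEntourage_graphRel rp2Adj rp2Adj_symm hr)
    (isLeastEntourage_graphRel squareAdj squareAdj_symm hr) squareLoop
    (lipschitz_graphMetric squareAdj squareAdj_symm rp2Adj rp2Adj_symm hr squareLoop squareLoop_adj)
    squareLoop_mem_graphRel rp2LiftCochain rp2BocksteinCochain coboundary_rp2LiftCochain
    rp2BocksteinCochain_mem_cocycles cochainMap_rp2BocksteinCochain squareValue rp2Value
    squareValue_eq_zero rp2Value_eq_zero squareValue_cochainMap squareValue_rp2LiftCochain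
    rp2Value_rp2BocksteinCochain

end Obstruction

end VR

theorem mainTheorem6 (r : ℝ) (hr : 0 < r) :
    (∀ (R : Type u) [CommRing R] [IsDomain R] [IsPrincipalIdealRing R]
      (G : Type u) [AddCommGroup G] [Module R G] (G' : Type u) [AddCommGroup G'] [Module R G']
      (X Y : Type u) [MetricSpace X] [MetricSpace Y],
      CategoryTheory.Limits.IsZero (VR.Tor₁ R (ModuleCat.of R G) (ModuleCat.of R G')) →
      VR.HasFiniteTypeBase R (metricSemiUniformity Y r hr) →
      (VR.HasFiniteTypeBase R (metricSemiUniformity X r hr) ∨ Module.Finite R G') →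
      ∀ q : ℤ,
        Function.Injective (VR.kunnethCross R G G' r hr X Y q) ∧
        ∃ β : VR.H R (G ⊗[R] G') r hr (X × Y) q →ₗ[R] VR.KunnethTor R G G' r hr X Y q,
          Function.Exact (VR.kunnethCross R G G' r hr X Y q) β ∧
          Function.Surjective β ∧
          ∃ s : VR.KunnethTor R G G' r hr X Y q →ₗ[R] VR.H R (G ⊗[R] G') r hr (X × Y) q,
            β ∘ₗ s = LinearMap.id) ∧
    ¬ VR.HasNaturalSplitting ℤ ℤ ℤ r hr :=
  ⟨fun R _ _ _ G _ _ G' _ _ X Y _ _ h hY hX q =>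
    VR.kunneth_metric R G G' hr X Y h hY hX q, VR.not_hasNaturalSplitting hr⟩
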